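/- Let $\Gamma$ be a finite two-player extensive-form game, possibly with chance moves, with perfect recall. For $i\in\{1,2\}$ let $\mathcal I_i$ be the set of information sets of Player $i$, $A_I\neq\emptyset$ the set of actions at an information set $I$, $\Sigma_i=\{(I,a): I\in\mathcal I_i,\ a\in A_I\}\cup\{\varnothing\}$ the set of sequences, and $\sigma(I)\in\Sigma_i$ the parent sequence of $I\in\mathcal I_i$: the last pair $(I',a')$ of Player $i$ on the path from the root to any node of $I$, or $\varnothing$ if there is none. Information sets $I\in\mathcal I_1$, $J\in\mathcal I_2$ are connected, $I\rightleftharpoons J$, if there are $u\in I$, $v\in J$ such that one of $u,v$ lies on the path from the root to the other. A pair $(\sigma_1,\sigma_2)\in\Sigma_1\times\Sigma_2$ is relevant if $\sigma_1=\varnothing$ or $\sigma_2=\varnothing$ or $\sigma_1=(I,a)$, $\sigma_2=(J,b)$ with $I\rightleftharpoons J$; a sequence of one player is relevant for an information set $I$ of the other if it is $\varnothing$ or of the form $(J,b)$ with $J$ and $I$ connected. Let $R$ be the set of relevant pairs. The von Stengel-Forges polytope $\mathcal V\subseteq\mathbb R_{\ge0}^{R}$ is the set of all $v\ge 0$ with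 $v[\varnothing,\varnothing]=1$, $\sum_{a\in A_I}v[(I,a),\sigma_2]=v[\sigma(I),\sigma_2]$ for all $I\in\mathcal I_1$ and all $\sigma_2\in\Sigma_2$ relevant for $I$, and $\sum_{a\in A_J}v[\sigma_1,(J,a)]=v[\sigma_1,\sigma(J)]$ for all $J\in\mathcal I_2$ and all $\sigma_1\in\Sigma_1$ relevant for $J$. By the dimensionality of $\mathcal V$ we mean the number $|R|$ of its coordinates, and by the size $N$ of $\Gamma$ the number of nodes of its tree. Assume that $\Gamma$ is triangle-free: there are no distinct $I_1,I_2\in\mathcal I_1$ with $\sigma(I_1)=\sigma(I_2)$ and distinct $J_1,J_2\in\mathcal I_2$ with $\sigma(J_1)=\sigma(J_2)$ such that $I_1\rightleftharpoons J_1$, $I_2\rightleftharpoons J_2$ and $I_1\rightleftharpoons J_2$. For nonempty sets $\mathcal X\subseteq\mathbb R^m$, $\mathcal Y\subseteq\mathbb R^k$ and $h:\mathbb R^m\to\mathbb R$ nonnegative on $\mathcal X$, let $\mathcal X\rhd^h\mathcal Y=\{(x,h(x)y):x\in\mathcal X,\ y\in\mathcal Y\}\subseteq\mathbb R^{m+k}$.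 **Theorem.** 1. After a suitable ordering of its coordinates, $$\mathcal V=\{1\}\rhd^{h_1}\mathcal X_1\rhd^{h_2}\mathcal X_2\rhd^{h_3}\cdots\rhd^{h_n}\mathcal X_n,$$ where each $\mathcal X_i$ is a simplex $\Delta^{s_i}=\{x\in\mathbb R_{\ge0}^{s_i}:\sum_j x_j=1\}$ or the singleton $\{1\}$, and each $h_i$ is a linear function that is nonnegative on the set being extended. 2. Such an expression can be computed exactly in time linear in the dimensionality of $\mathcal V$: there are a program for a random access machine and a constant $C$ such that, for every perfect-recall triangle-free game, given the information structure (for each information set the number of its actions and its parent sequence, and the list of all connected pairs, under an arbitrary numbering), the program outputs such an expression (the blocks $\mathcal X_i$, the $h_i$ as lists of coordinates with natural number coefficients, and the relevant pair that each coordinate stands for) after at most $C\,|R|$ steps. 3. This is at most quadratic in the size of the game: $|R|\le N^2$. Moreover, if the game tree itself is given (for each node its parent, the action leading to it, and its player and information set), some program of this kind outputs such an expression after at most $C' N^2$ steps, for a constant $C'$. The random access machine has registers and two-dimensional arrays of natural numbers, initially $0$; in one step it sets a register to a constant, copies, increments or decrements a register, accesses an array cell, reads an input number, writes an output number, or tests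 $x<y$ for two registers. -/

import Mathlib

open scoped BigOperators

universe u

/-! ## Two-player extensive-form games -/

/-- A finite two-player extensive-form game, possibly with chance moves.  Nodes of the game tree are
identified with the lists of actions leading to them from the root `[]`, so `u` lies on the path
from the root to `v` iff `u` is a prefix of `v`.  Players are `0, 1 : Fin 2`. -/
structure EFG : Type (u + 1) where
  /-- labels of the edges of the tree -/
  Act : Type u
  [decEq : DecidableEq Act]
  /-- the nodes of the tree -/
  nodes : Finset (List Act)
  /-- the actions (outgoing edges) at a node; a node without actions is terminal -/
  acts : List Act → Finset Act
  root_mem : [] ∈ nodes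
  mem_append : ∀ h a, h ++ [a] ∈ nodes ↔ h ∈ nodes ∧ a ∈ acts h
  /-- the player who moves at a nonterminal node; `none` is the chance player -/
  owner : List Act → Option (Fin 2)
  /-- chance probabilities -/
  prob : List Act → Act → ℝ
  prob_nonneg : ∀ h ∈ nodes, owner h = none → ∀ a ∈ acts h, 0 ≤ prob h a
  prob_sum : ∀ h ∈ nodes, owner h = none → (acts h).Nonempty → ∑ a ∈ acts h, prob h a = 1
  /-- payoffs at terminal nodes -/
  payoff : Fin 2 → List Act → ℝ
  /-- the information partition of each player's decision nodes -/
  info : (i : Fin 2) →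
    Finpartition (nodes.filter fun h => owner h = some i ∧ (acts h).Nonempty)
  acts_eq : ∀ i, ∀ I ∈ (info i).parts, ∀ h ∈ I, ∀ h' ∈ I, acts h = acts h'

attribute [instance] EFG.decEq

namespace EFG

variable (G : EFG.{u})

/-- Information sets are finite sets of nodes; those of Player `i` are `(G.info i).parts`. -/
abbrev Infoset : Type u := Finset (List G.Act)

/-- Sequences: `none` is the empty sequence, `some (I, a)` is the information set-action pair. -/
abbrev Seq : Type u := Option (G.Infoset × G.Act)

/-- The size of the game: the number of nodes of its tree. -/
def size : ℕ := G.nodes.card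

/-- The set `A_I` of actions available at the information set `I`. -/
def actions (I : G.Infoset) : Finset G.Act := I.biUnion G.acts

/-- The information set-action pairs of Player `i` encountered when the actions in the second
argument are played one after the other from the node in the first argument. -/
def playedFrom (i : Fin 2) : List G.Act → List G.Act → List (G.Infoset × G.Act)
  | _, [] => []
  | p, a :: t =>
    if G.owner p = some i then ((G.info i).part p, a) :: playedFrom i (p ++ [a]) t
    else playedFrom i (p ++ [a]) t

/-- The information set-action pairs of Player `i` on the path from the root to `h`, in order. -/
def played (i : Fin 2) (h : List G.Act) : List (G.Infoset × G.Act) := G.playedFrom i [] h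

/-- Perfect recall: nodes that a player cannot distinguish have the same record of what that player
knew and did before. -/
def PerfectRecall : Prop :=
  ∀ i, ∀ I ∈ (G.info i).parts, ∀ h ∈ I, ∀ h' ∈ I, G.played i h = G.played i h'

open Classical in
/-- The parent sequence `σ(I)` of an information set `I` of Player `i`: the last pair of Player `i`
on the path to a node of `I` (to any of them, under perfect recall). -/
noncomputable def parentSeq (i : Fin 2) (I : G.Infoset) : G.Seq :=
  if h : I.Nonempty then (G.played i h.choose).getLast? else none

/-- The set `Σ_i` of sequences of Player `i`. -/
def seqs (i : Fin 2) : Finset G.Seq :=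
  Finset.insertNone ((G.info i).parts.biUnion fun I => (G.actions I).image fun a => (I, a))

variable {G}

/-- Connected information sets, `I ⇌ J`. -/
def Connected (I J : G.Infoset) : Prop := ∃ u ∈ I, ∃ v ∈ J, u <+: v ∨ v <+: u

/-- Relevance of a sequence of one player for an information set of the other player. -/
def RelInfo (I : G.Infoset) : G.Seq → Prop
  | none => True
  | some (J, _) => Connected I J

/-- Relevance of a pair of sequences. -/
def Relevant : G.Seq → G.Seq → Prop
  | none, _ => True
  | some _, none => True
  | some (I, _), some (J, _) => Connected I J

variable (G)

open Classical in
/-- The set of relevant pairs of sequences. -/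
noncomputable def relPairs : Finset (G.Seq × G.Seq) :=
  (G.seqs 0 ×ˢ G.seqs 1).filter fun p => Relevant p.1 p.2

/-- The dimensionality of the von Stengel-Forges polytope: the number of its coordinates, that is,
of relevant pairs of sequences. -/
noncomputable def dim : ℕ := G.relPairs.card

/-- Triangle-freeness. -/
def TriangleFree : Prop :=
  ∀ I₁ ∈ (G.info 0).parts, ∀ I₂ ∈ (G.info 0).parts, I₁ ≠ I₂ →
    G.parentSeq 0 I₁ = G.parentSeq 0 I₂ →
  ∀ J₁ ∈ (G.info 1).parts, ∀ J₂ ∈ (G.info 1).parts, J₁ ≠ J₂ →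
    G.parentSeq 1 J₁ = G.parentSeq 1 J₂ →
  ¬ (Connected I₁ J₁ ∧ Connected I₂ J₂ ∧ Connected I₁ J₂)

variable {G}

open Classical in
/-- The entry `v[σ, τ]` of a vector indexed by the relevant pairs.  (The value `0` at a pair that is
not relevant is a convention; the constraints below only mention relevant pairs.) -/
noncomputable def entry (v : G.relPairs → ℝ) (σ τ : G.Seq) : ℝ :=
  if h : (σ, τ) ∈ G.relPairs then v ⟨(σ, τ), h⟩ else 0

variable (G)

/-- The von Stengel-Forges polytope. -/
def vsf : Set (G.relPairs → ℝ) :=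
  {v | (∀ p, 0 ≤ v p) ∧
    entry v none none = 1 ∧
    (∀ I ∈ (G.info 0).parts, ∀ τ ∈ G.seqs 1, RelInfo I τ →
      ∑ a ∈ G.actions I, entry v (some (I, a)) τ = entry v (G.parentSeq 0 I) τ) ∧
    (∀ J ∈ (G.info 1).parts, ∀ σ ∈ G.seqs 0, RelInfo J σ →
      ∑ a ∈ G.actions J, entry v σ (some (J, a)) = entry v σ (G.parentSeq 1 J))}

end EFG

/-! ## Scaled extensions -/

/-- The scaled extension of `X` with `Y` via `h`. -/
def scaledExt {m k : ℕ} (X : Set (Fin m → ℝ)) (h : (Fin m → ℝ) → ℝ) (Y : Set (Fin k → ℝ)) :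
    Set (Fin (m + k) → ℝ) :=
  {z | ∃ x ∈ X, ∃ y ∈ Y, z = Fin.append x (h x • y)}

/-- The sets that may be used in a decomposition: the singleton `{1}` and the simplexes `Δ^s`. -/
inductive Block : Type
  | point : Block
  | simplex (s : ℕ) : Block

namespace Block

/-- Dimension of the ambient space. -/
def dim : Block → ℕ
  | point => 1
  | simplex s => s

/-- The subset of `ℝ^dim` denoted by a block. -/
def toSet : (X : Block) → Set (Fin X.dim → ℝ)
  | point => {fun _ => 1}
  | simplex s => stdSimplex ℝ (Fin s)

/-- A number for each block (no two blocks that denote nonempty sets share it). -/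
def code : Block → ℕ
  | point => 0
  | simplex s => s

end Block

/-- Expressions `{1} ⊳^{h₁} X₁ ⊳^{h₂} ⋯ ⊳^{hₙ} Xₙ` with linear `hᵢ`, denoting subsets of `ℝ^d`. -/
inductive Chain : ℕ → Type
  | one : Chain 1
  | ext {d : ℕ} (D : Chain d) (h : (Fin d → ℝ) →ₗ[ℝ] ℝ) (X : Block) : Chain (d + X.dim)

namespace Chain

/-- The number `n` of scaled extensions. -/
def length : {d : ℕ} → Chain d → ℕ
  | _, one => 0
  | _, ext D _ _ => D.length + 1

/-- The set denoted by an expression. -/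
def toSet : {d : ℕ} → Chain d → Set (Fin d → ℝ)
  | _, one => {fun _ => 1}
  | _, ext D h X => scaledExt D.toSet h X.toSet

/-- All scaled extensions in the expression are legitimate: each `hᵢ` is nonnegative on the set that
is extended and each `Xᵢ` is nonempty. -/
def Proper : {d : ℕ} → Chain d → Prop
  | _, one => True
  | _, ext D h X => D.Proper ∧ (∀ x ∈ D.toSet, 0 ≤ h x) ∧ X.toSet.Nonempty

/-- The linear form `x ↦ ∑ c * x k`, the sum being over the listed pairs `(k, c)`. -/
noncomputable def sparseForm {d : ℕ} (ts : List (Fin d × ℕ)) : (Fin d → ℝ) →ₗ[ℝ] ℝ :=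
  (ts.map fun t => (t.2 : ℝ) • LinearMap.proj (R := ℝ) (φ := fun _ : Fin d => ℝ) t.1).sum

/-- `D.HasCode l`: the list `l` of numbers writes out the expression `D`, one scaled extension after
the other; each is written as the number of its block, the number of terms of its linear form, and
the terms of that form. -/
inductive HasCode : {d : ℕ} → Chain d → List ℕ → Prop
  | one : HasCode Chain.one []
  | ext {d : ℕ} {D : Chain d} {l : List ℕ} (hD : HasCode D l) (ts : List (Fin d × ℕ)) (X : Block) :
      HasCode (Chain.ext D (sparseForm ts) X)
        (l ++ X.code :: ts.length :: ts.flatMap fun t => [(t.1 : ℕ), t.2])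

end Chain

/-- `D` is a scaled-extension decomposition of the von Stengel-Forges polytope of `G`, the `k`-th
coordinate of `D` being the entry at the relevant pair `e k`. -/
def EFG.IsDecomposition (G : EFG.{u}) {d : ℕ} (D : Chain d) (e : Fin d ≃ G.relPairs) : Prop :=
  D.Proper ∧ D.toSet = (fun v : G.relPairs → ℝ => v ∘ e) '' G.vsf

/-! ## Random access machines -/

namespace Ram

/-- Memory state: registers, two-dimensional arrays, the unread input, and the output so far.  A
program mentions only finitely many registers and arrays by name. -/
structure State : Type where
  reg : ℕ → ℕ
  arr : ℕ → ℕ → ℕ → ℕ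
  inp : List ℕ
  out : List ℕ

/-- Elementary instructions.  There is no arithmetic besides counting up and down, so a number in
the memory never exceeds the largest number in the input or program by more than the time spent. -/
inductive Op : Type
  | const (x n : ℕ) : Op
  | copy (x y : ℕ) : Op
  | inc (x : ℕ) : Op
  | dec (x : ℕ) : Op
  | load (x A y z : ℕ) : Op
  | store (A y z x : ℕ) : Op
  | read (x : ℕ) : Op
  | write (x : ℕ) : Op

/-- Assign a register. -/
def State.setReg (s : State) (x n : ℕ) : State := { s with reg := Function.update s.reg x n }

/-- Assign an array cell. -/
def State.setArr (s : State) (A i j n : ℕ) : State :=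
  { s with arr := fun B k l => if B = A ∧ k = i ∧ l = j then n else s.arr B k l }

/-- Effect of an elementary instruction. -/
def Op.run : Op → State → State
  | const x n, s => s.setReg x n
  | copy x y, s => s.setReg x (s.reg y)
  | inc x, s => s.setReg x (s.reg x + 1)
  | dec x, s => s.setReg x (s.reg x - 1)
  | load x A y z, s => s.setReg x (s.arr A (s.reg y) (s.reg z))
  | store A y z x, s => s.setArr A (s.reg y) (s.reg z) (s.reg x)
  | read x, s => { s.setReg x (s.inp.headD 0) with inp := s.inp.tail }
  | write x, s => { s with out := s.out ++ [s.reg x] }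

/-- Programs; the tests of `ite` and `loop` compare two registers, `x < y`. -/
inductive Prog : Type
  | skip : Prog
  | op (o : Op) : Prog
  | seq (p q : Prog) : Prog
  | ite (x y : ℕ) (p q : Prog) : Prog
  | loop (x y : ℕ) (p : Prog) : Prog

/-- `Exec p s s' t`: started in `s`, the program `p` halts in `s'` after `t` steps.  Every
elementary instruction and every evaluation of a test is one step. -/
inductive Exec : Prog → State → State → ℕ → Prop
  | skip (s : State) : Exec Prog.skip s s 1
  | op (o : Op) (s : State) : Exec (Prog.op o) s (o.run s) 1
  | seq {p q : Prog} {s s' s'' : State} {t t' : ℕ} :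
      Exec p s s' t → Exec q s' s'' t' → Exec (Prog.seq p q) s s'' (t + t')
  | ite_true {x y : ℕ} {p q : Prog} {s s' : State} {t : ℕ} :
      s.reg x < s.reg y → Exec p s s' t → Exec (Prog.ite x y p q) s s' (t + 1)
  | ite_false {x y : ℕ} {p q : Prog} {s s' : State} {t : ℕ} :
      ¬ s.reg x < s.reg y → Exec q s s' t → Exec (Prog.ite x y p q) s s' (t + 1)
  | loop_true {x y : ℕ} {p : Prog} {s s' s'' : State} {t t' : ℕ} :
      s.reg x < s.reg y → Exec p s s' t → Exec (Prog.loop x y p) s' s'' t' →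
        Exec (Prog.loop x y p) s s'' (t + t' + 1)
  | loop_false {x y : ℕ} {p : Prog} {s : State} :
      ¬ s.reg x < s.reg y → Exec (Prog.loop x y p) s s 1

/-- The initial state: the input is given, and the memory is filled with zeros. -/
def State.start (input : List ℕ) : State :=
  { reg := fun _ => 0, arr := fun _ _ _ => 0, inp := input, out := [] }

/-- On the given input, the program halts after `t` steps with the given output. -/
def Prog.Outputs (p : Prog) (input output : List ℕ) (t : ℕ) : Prop :=
  ∃ s : State, Exec p (State.start input) s t ∧ s.out = output

end Ram

/-! ## Games and decompositions as inputs and outputs of programs -/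

namespace EFG

variable (G : EFG.{u})

/-- An arbitrary numbering of the information sets and of the actions at each of them. -/
structure Numbering where
  infos : Fin 2 → List G.Infoset
  infos_nodup : ∀ i, (infos i).Nodup
  mem_infos : ∀ i I, I ∈ infos i ↔ I ∈ (G.info i).parts
  acts : G.Infoset → List G.Act
  acts_nodup : ∀ I, (acts I).Nodup
  mem_acts : ∀ I a, a ∈ acts I ↔ a ∈ G.actions I

variable {G}

/-- A sequence as two numbers: `0, 0` for the empty sequence; the number of the information set
plus one, and the number of the action, otherwise. -/
def Numbering.seqCode (ν : G.Numbering) (i : Fin 2) : G.Seq → List ℕ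
  | none => [0, 0]
  | some (I, a) => [(ν.infos i).idxOf I + 1, (ν.acts I).idxOf a]

/-- The records of the information sets of Player `i`: number of actions and parent sequence. -/
noncomputable def Numbering.infoCode (ν : G.Numbering) (i : Fin 2) : List ℕ :=
  (ν.infos i).flatMap fun I => (G.actions I).card :: ν.seqCode i (G.parentSeq i I)

/-- `edges` lists the connected pairs of information sets, each of them once, in any order. -/
def ListsConnected (edges : List (G.Infoset × G.Infoset)) : Prop :=
  edges.Nodup ∧ ∀ I J, (I, J) ∈ edges ↔
    I ∈ (G.info 0).parts ∧ J ∈ (G.info 1).parts ∧ Connected I J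

/-- The information structure of the game as a list of numbers: the numbers of information sets and
of connected pairs, the records of the information sets, and the connected pairs. -/
noncomputable def Numbering.infoInput (ν : G.Numbering) (edges : List (G.Infoset × G.Infoset)) :
    List ℕ :=
  [(ν.infos 0).length, (ν.infos 1).length, edges.length] ++ ν.infoCode 0 ++ ν.infoCode 1 ++
    edges.flatMap fun p => [(ν.infos 0).idxOf p.1, (ν.infos 1).idxOf p.2]

/-- `nodes` lists the nodes of the tree, each of them once, in any order. -/
def ListsNodes (nodes : List (List G.Act)) : Prop :=
  nodes.Nodup ∧ ∀ h, h ∈ nodes ↔ h ∈ G.nodes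

/-- The edge into the node `h`: the number of the parent node plus one and the number of the action
(`0` for chance moves); `0, 0` for the root. -/
def Numbering.edgeCode (ν : G.Numbering) (nodes : List (List G.Act)) (h : List G.Act) : List ℕ :=
  match h.getLast? with
  | none => [0, 0]
  | some a =>
    [nodes.idxOf h.dropLast + 1,
      match G.owner h.dropLast with
      | none => 0
      | some i => (ν.acts ((G.info i).part h.dropLast)).idxOf a]

/-- The place of the node `h` in the information structure: the player (`1` or `2`) and the number of
the information set; `0, 0` for chance nodes and terminal nodes. -/
def Numbering.nodeCode (ν : G.Numbering) (h : List G.Act) : List ℕ :=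
  if (G.acts h).Nonempty then
    match G.owner h with
    | none => [0, 0]
    | some i => [(i : ℕ) + 1, (ν.infos i).idxOf ((G.info i).part h)]
  else [0, 0]

/-- The game tree with its information sets as a list of numbers. -/
def Numbering.treeInput (ν : G.Numbering) (nodes : List (List G.Act)) : List ℕ :=
  [nodes.length, (ν.infos 0).length, (ν.infos 1).length] ++
    nodes.flatMap fun h => ν.edgeCode nodes h ++ ν.nodeCode h

/-- The list `l` writes out a scaled-extension decomposition of the von Stengel-Forges polytope:
the number of scaled extensions, the scaled extensions, and for each coordinate the pair of
sequences that it stands for. -/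
def Numbering.WritesDecomposition (ν : G.Numbering) (l : List ℕ) : Prop :=
  ∃ (d : ℕ) (D : Chain d) (e : Fin d ≃ G.relPairs) (c : List ℕ),
    G.IsDecomposition D e ∧ D.HasCode c ∧
    l = D.length :: c ++ (List.finRange d).flatMap fun k =>
      ν.seqCode 0 (e k).1.1 ++ ν.seqCode 1 (e k).1.2

end EFG

/-! Number the information sets of both players `1, …, n` and add a fictitious set `0` with a single
action, so that the empty sequence becomes the pair `(0, 0)` and pairs of sequences all look alike.
Connectedness passes from an information set to its parent, because prefixes of one path are
comparable; set `0` is connected with everything. The decomposition rests on deciding, for any two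
connected sets of opposite players, which of them precedes the other (`Bef`). A set `J` of the
second player precedes `I` if somewhere on the path to `I` (at `I` included) a set connected with
`J` has a sibling, that is, a set with the same parent sequence, that is connected with `J` as well;
otherwise `I` precedes `J`. Set `0` precedes all others.

Two properties make this work. The order is inherited: if `Y` precedes the parent of `X` and is
connected with `X`, then it precedes `X` (`bef_child`), and then the parent of `Y` precedes `X` too
(`bef_pi`). And a set connected with two siblings precedes both (`bef_siblings`); this is where
triangle-freeness is used. Consequently at most one child `Z` of a sequence `t` precedes a given `X`
(`chd_eq`), a child of `t` being an information set with parent sequence `t`.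

Whenever the information set of `t` precedes `X`, the coordinates `v[(X, a), t]`, `a ∈ A_X`, form
the block `(X, t)`. Apart from `v[∅, ∅]`, each coordinate lies in exactly one block. If no child of
`t` precedes `X`, the block is a simplex scaled by `v[σ(X), t]`. If `Z` is such a child, then each
`v[(X, a), t]` is the sum of `v[(X, a), (Z, c)]` over `c`, an extension by the singleton `{1}`. So
the equations in use are those of `X` at `t` in the first case, and those of `Z` at `(X, a)` for all
`Z` preceding `X`. The remaining ones, of `X` at a `t` with preceding child `Z`, follow by
exchanging sums: `∑ₐ v[(X,a),t] = ∑ₐ ∑_c v[(X,a),(Z,c)] = ∑_c v[σ(X),(Z,c)] = v[σ(X),t]`, by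
induction from the leaves of the tree of information sets towards its root (`WF.constraint`, applied
in `blkEq_iff`).

The blocks can be added one after the other because the dependencies among them are well-founded
(`acc_parent`, `WF.acc`). Any order that respects them gives a chain of extensions whose set is cut
out by the equations above (`Realizes.point`, `Realizes.simplex`, `WF.realizes`), and hence the
polytope (`mem_vsf_iff`, `writesDecomposition`).

For the running time, the number of coordinates equals the weight `∑ |A_X| |A_Y|` over the pairs
where `Y` precedes `X`, including those with `Y = 0`, plus one. Information sets, actions, edges and
blocks are all bounded by it. Branching is propagated along edges in topological order, a second
topological sorting (`runs_kahn`) orders the blocks, and all sums together have at most weight many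
terms because `X` and `Z` determine the block (`blkCost_le`). If the tree is given, the information
structure is found by climbing from each node to the root, which is quadratic in the number of nodes
(`runs_readTree`); the bound on `|R|` holds because different sequences of a player end at different
nodes (`card_seqs_le`). -/

namespace Chain

/-! ### Scaled extensions of sets of vectors with labelled coordinates -/

variable {P : Type*} [DecidableEq P]

/-- The value at `p` of the vector `x` whose coordinates are labelled by `lab`. -/
noncomputable def valAt (lab : List P) {d : ℕ} (x : Fin d → ℝ) (p : P) : ℝ :=
  if h : lab.idxOf p < d then x ⟨lab.idxOf p, h⟩ else 0

/-- The expression with `m` scaled extensions written out as `c` denotes the set of nonnegative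
vectors, with coordinates labelled by `lab`, that satisfy `φ`. -/
def Realizes (lab : List P) (φ : (P → ℝ) → Prop) (m : ℕ) (c : List ℕ) : Prop :=
  -- The middle condition says that `φ` only looks at the labelled entries. This keeps the old
  -- equations intact when coordinates are appended, and makes the default value of `valAt`
  -- harmless.
  lab.Nodup ∧ (∀ w w' : P → ℝ, (∀ p ∈ lab, w p = w' p) → φ w → φ w') ∧
  ∃ (d : ℕ) (D : Chain d), lab.length = d ∧ D.Proper ∧ D.HasCode c ∧ D.length = m ∧
    D.toSet = {x | (∀ i, 0 ≤ x i) ∧ φ (valAt lab x)}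

theorem valAt_append_left {lab new : List P} {d k : ℕ} (hd : lab.length = d)
    (x : Fin d → ℝ) (y : Fin k → ℝ) {p : P} (hp : p ∈ lab) :
    valAt (lab ++ new) (Fin.append x y) p = valAt lab x p := by
  have h1 : lab.idxOf p < d := hd ▸ List.idxOf_lt_length_iff.2 hp
  unfold valAt
  rw [List.idxOf_append_of_mem hp, dif_pos h1, dif_pos (by omega)]
  exact Fin.append_left x y ⟨lab.idxOf p, h1⟩

theorem valAt_append_right {lab new : List P} {d k : ℕ} (hd : lab.length = d)
    (x : Fin d → ℝ) (y : Fin k → ℝ) {p : P} (hp : p ∉ lab) :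
    valAt (lab ++ new) (Fin.append x y) p = valAt new y p := by
  unfold valAt
  rw [List.idxOf_append_of_notMem hp]
  by_cases h : new.idxOf p < k
  · rw [dif_pos (by omega), dif_pos h, ← Fin.append_right x y ⟨new.idxOf p, h⟩]
    congr 1
    ext
    simp [hd]
  · rw [dif_neg (by omega), dif_neg h]

theorem sum_map_valAt {new : List P} {k : ℕ} (hk : new.length = k) (hn : new.Nodup)
    (y : Fin k → ℝ) : (new.map (valAt new y)).sum = ∑ i, y i := by
  subst hk
  have : new.map (valAt new y) = List.ofFn y := by
    apply List.ext_getElem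
    · simp
    · intro i h1 h2
      simp only [List.length_map] at h1
      simp [valAt, hn.idxOf_getElem i h1, h1]
  rw [this, List.sum_ofFn]

/-- The terms of the linear form that sums the entries at `ps`. -/
def termsOf (lab : List P) {d : ℕ} (hd : lab.length = d) (ps : List P) (hps : ∀ p ∈ ps, p ∈ lab) :
    List (Fin d × ℕ) :=
  ps.attach.map fun p => (⟨lab.idxOf p.1, hd ▸ List.idxOf_lt_length_iff.2 (hps _ p.2)⟩, 1)

theorem sparseForm_termsOf (lab : List P) {d : ℕ} (hd : lab.length = d) (ps : List P)
    (hps : ∀ p ∈ ps, p ∈ lab) (x : Fin d → ℝ) :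
    sparseForm (termsOf lab hd ps hps) x = (ps.map (valAt lab x)).sum := by
  have key : ∀ ts : List (Fin d × ℕ),
      sparseForm ts x = (ts.map fun t => (t.2 : ℝ) * x t.1).sum := by
    intro ts
    induction ts with
    | nil => simp [sparseForm]
    | cons t ts ih =>
      have : sparseForm (t :: ts) x = (t.2 : ℝ) * x t.1 + sparseForm ts x := by
        simp [sparseForm]
      simp [this, ih]
  have : ps.map (valAt lab x) = ps.attach.map fun p => valAt lab x p.1 := by
    conv_lhs => rw [← List.attach_map_subtype_val ps, List.map_map]
    rfl
  rw [key, termsOf, List.map_map, this]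
  congr 1
  apply List.map_congr_left
  intro p _
  have h : lab.idxOf p.1 < d := hd ▸ List.idxOf_lt_length_iff.2 (hps _ p.2)
  simp [valAt, h]

theorem code_termsOf (lab : List P) {d : ℕ} (hd : lab.length = d) (ps : List P)
    (hps : ∀ p ∈ ps, p ∈ lab) :
    (termsOf lab hd ps hps).length :: (termsOf lab hd ps hps).flatMap
      (fun t => [(t.1 : ℕ), t.2]) = ps.length :: ps.flatMap fun p => [lab.idxOf p, 1] := by
  have : ps.flatMap (fun p => [lab.idxOf p, 1])
      = ps.attach.flatMap fun p => [lab.idxOf p.1, 1] := by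
    conv_lhs => rw [← List.attach_map_subtype_val ps]
    rw [List.flatMap_map]
  rw [this]
  simp [termsOf, List.flatMap_map]

omit [DecidableEq P] in
theorem sum_map_congr {l : List P} {f g : P → ℝ} (h : ∀ p ∈ l, f p = g p) :
    (l.map f).sum = (l.map g).sum := by
  rw [List.map_congr_left h]

theorem mem_toSet_ext_point {d : ℕ} (D : Chain d) (h : (Fin d → ℝ) →ₗ[ℝ] ℝ) (z : Fin (d + 1) → ℝ) :
    z ∈ (D.ext h Block.point).toSet ↔
      ∃ x ∈ D.toSet, z = Fin.append x (fun _ : Fin 1 => h x) := by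
  constructor
  · rintro ⟨x, hx, y, hy, rfl⟩
    change y = fun _ => 1 at hy
    subst hy
    refine ⟨x, hx, ?_⟩
    congr 1
    funext i
    exact mul_one _
  · rintro ⟨x, hx, rfl⟩
    refine ⟨x, hx, fun _ => 1, rfl, ?_⟩
    congr 1
    funext i
    exact (mul_one _).symm

theorem mem_toSet_ext_simplex {d s : ℕ} (D : Chain d) (h : (Fin d → ℝ) →ₗ[ℝ] ℝ)
    (z : Fin (d + s) → ℝ) :
    z ∈ (D.ext h (Block.simplex s)).toSet ↔
      ∃ x ∈ D.toSet, ∃ y ∈ stdSimplex ℝ (Fin s),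
        z = Fin.append x (fun i : Fin s => h x * y i) :=
  Iff.rfl

/-- Extension by one coordinate that is a sum of earlier ones. -/
theorem Realizes.point {lab : List P} {φ : (P → ℝ) → Prop} {m : ℕ} {c : List ℕ}
    (H : Realizes lab φ m c) {q : P} (hq : q ∉ lab) {ps : List P} (hps : ∀ p ∈ ps, p ∈ lab) :
    Realizes (lab ++ [q]) (fun w => φ w ∧ w q = (ps.map w).sum) (m + 1)
      (c ++ 0 :: ps.length :: ps.flatMap fun p => [lab.idxOf p, 1]) := by
  obtain ⟨hnd, hloc, d, D, hd, hP, hC, hL, hS⟩ := H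
  refine ⟨?_, ?_, d + 1, D.ext (sparseForm (termsOf lab hd ps hps)) Block.point, by simp [hd],
    ⟨hP, ?_, ⟨_, rfl⟩⟩, ?_, by simp [Chain.length, hL], ?_⟩
  · exact List.nodup_append.2 ⟨hnd, by simp, by
      intro a ha b hb; simp only [List.mem_singleton] at hb; rintro rfl; exact hq (hb ▸ ha)⟩
  · rintro w w' h ⟨h1, h2⟩
    refine ⟨hloc w w' (fun p hp => h p (by simp [hp])) h1, ?_⟩
    rw [← h q (by simp), h2, sum_map_congr fun p hp => h p (by simp [hps p hp])]
  · intro x hx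
    rw [hS] at hx
    rw [sparseForm_termsOf]
    apply List.sum_nonneg
    intro a ha
    obtain ⟨p, _, rfl⟩ := List.mem_map.1 ha
    unfold valAt
    split_ifs
    · exact hx.1 _
    · exact le_rfl
  · have := HasCode.ext hC (termsOf lab hd ps hps) Block.point
    rwa [code_termsOf] at this
  -- Everything required of an extended vector is expressed through its old part `x` and its new
  -- part `y`.
  · have hv : ∀ (x : Fin d → ℝ) (y : Fin 1 → ℝ),
        (φ (valAt (lab ++ [q]) (Fin.append x y)) ↔ φ (valAt lab x)) ∧
        valAt (lab ++ [q]) (Fin.append x y) q = y 0 ∧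
        (ps.map (valAt (lab ++ [q]) (Fin.append x y))).sum = (ps.map (valAt lab x)).sum := by
      intro x y
      refine ⟨⟨hloc _ _ fun p hp => valAt_append_left hd x y hp,
        hloc _ _ fun p hp => (valAt_append_left hd x y hp).symm⟩, ?_,
        sum_map_congr fun p hp => valAt_append_left hd x y (hps p hp)⟩
      rw [valAt_append_right hd x y hq]
      simp [valAt]
    ext z
    refine (mem_toSet_ext_point D _ z).trans ⟨?_, ?_⟩
    · rintro ⟨x, hx, rfl⟩
      rw [hS] at hx
      have hn : 0 ≤ (ps.map (valAt lab x)).sum := by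
        apply List.sum_nonneg
        intro a ha
        obtain ⟨p, _, rfl⟩ := List.mem_map.1 ha
        unfold valAt
        split_ifs
        · exact hx.1 _
        · exact le_rfl
      have hv' := hv x fun _ => sparseForm (termsOf lab hd ps hps) x
      refine ⟨?_, hv'.1.2 hx.2, hv'.2.1.trans (Eq.trans ?_ hv'.2.2.symm)⟩
      · intro i
        change Fin (d + 1) at i
        refine Fin.addCases (fun i => ?_) (fun i => ?_) i
        · rw [Fin.append_left]; exact hx.1 i
        · rw [Fin.append_right, sparseForm_termsOf]
          exact hn
      · rw [sparseForm_termsOf]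
    · rintro ⟨h0, h1, h2⟩
      change Fin (d + 1) → ℝ at z
      obtain ⟨x, y, rfl⟩ : ∃ (x : Fin d → ℝ) (y : Fin 1 → ℝ), z = Fin.append x y :=
        ⟨fun i => z (Fin.castAdd 1 i), fun i => z (Fin.natAdd d i), (Fin.append_castAdd_natAdd).symm⟩
      refine ⟨x, ?_, ?_⟩
      · rw [hS]
        refine ⟨fun i => ?_, (hv x y).1.1 h1⟩
        have : 0 ≤ Fin.append x y (Fin.castAdd 1 i) := h0 (Fin.castAdd 1 i)
        rwa [Fin.append_left] at this
      · rw [(hv x y).2.1, (hv x y).2.2] at h2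
        congr 1
        funext i
        have : i = 0 := Subsingleton.elim _ _
        subst this
        rw [h2, sparseForm_termsOf]

/-- Extension by a simplex scaled by an earlier coordinate. -/
theorem Realizes.simplex {lab : List P} {φ : (P → ℝ) → Prop} {m : ℕ} {c : List ℕ}
    (H : Realizes lab φ m c) {p : P} (hp : p ∈ lab) {new : List P} (hne : new ≠ [])
    (hnew : new.Nodup) (hdis : ∀ q ∈ new, q ∉ lab) :
    Realizes (lab ++ new) (fun w => φ w ∧ (new.map w).sum = w p) (m + 1)
      (c ++ [new.length, 1, lab.idxOf p, 1]) := by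
  obtain ⟨hnd, hloc, d, D, hd, hP, hC, hL, hS⟩ := H
  have hps : ∀ q ∈ [p], q ∈ lab := by simpa using hp
  have hform : ∀ x, sparseForm (termsOf lab hd [p] hps) x = valAt lab x p := by
    intro x; rw [sparseForm_termsOf]; simp
  have hvn : ∀ x : Fin d → ℝ, (∀ i, 0 ≤ x i) → 0 ≤ valAt lab x p := by
    intro x hx
    unfold valAt
    split_ifs
    · exact hx _
    · exact le_rfl
  have hpos : 0 < new.length := List.length_pos_iff.2 hne
  refine ⟨?_, ?_, d + new.length,
    D.ext (sparseForm (termsOf lab hd [p] hps)) (Block.simplex new.length), by simp [hd],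
    ⟨hP, ?_, ?_⟩, ?_, by simp [Chain.length, hL], ?_⟩
  · exact List.nodup_append.2 ⟨hnd, hnew, fun a ha b hb hab => hdis b hb (hab ▸ ha)⟩
  · rintro w w' h ⟨h1, h2⟩
    refine ⟨hloc w w' (fun p hp => h p (by simp [hp])) h1, ?_⟩
    rw [← h p (by simp [hp]), ← h2, sum_map_congr fun q hq => h q (by simp [hq])]
  · intro x hx
    rw [hS] at hx
    rw [hform]
    exact hvn x hx.1
  · exact ⟨_, single_mem_stdSimplex ℝ (⟨0, hpos⟩ : Fin new.length)⟩
  · have := HasCode.ext hC (termsOf lab hd [p] hps) (Block.simplex new.length)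
    rw [code_termsOf] at this
    simp only [List.length_singleton, List.flatMap_singleton, Block.code] at this
    exact this
  · have hv : ∀ (x : Fin d → ℝ) (y : Fin new.length → ℝ),
        (φ (valAt (lab ++ new) (Fin.append x y)) ↔ φ (valAt lab x)) ∧
        valAt (lab ++ new) (Fin.append x y) p = valAt lab x p ∧
        (new.map (valAt (lab ++ new) (Fin.append x y))).sum = ∑ i, y i := by
      intro x y
      refine ⟨⟨hloc _ _ fun p hp => valAt_append_left hd x y hp,
        hloc _ _ fun p hp => (valAt_append_left hd x y hp).symm⟩,
        valAt_append_left hd x y hp, ?_⟩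
      rw [sum_map_congr fun q hq => valAt_append_right hd x y (hdis q hq),
        sum_map_valAt rfl hnew]
    ext z
    refine (mem_toSet_ext_simplex D _ z).trans ⟨?_, ?_⟩
    · rintro ⟨x, hx, y, hy, rfl⟩
      rw [hS] at hx
      have hv' := hv x fun i => sparseForm (termsOf lab hd [p] hps) x * y i
      refine ⟨?_, hv'.1.2 hx.2, hv'.2.2.trans (Eq.trans ?_ hv'.2.1.symm)⟩
      · intro i
        change Fin (d + new.length) at i
        refine Fin.addCases (fun i => ?_) (fun i => ?_) i
        · rw [Fin.append_left]; exact hx.1 i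
        · rw [Fin.append_right]
          exact mul_nonneg (by rw [hform]; exact hvn x hx.1) (hy.1 i)
      · rw [← Finset.mul_sum, hy.2, hform, mul_one]
    · rintro ⟨h0, h1, h2⟩
      change Fin (d + new.length) → ℝ at z
      obtain ⟨x, y, rfl⟩ : ∃ (x : Fin d → ℝ) (y : Fin new.length → ℝ), z = Fin.append x y :=
        ⟨fun i => z (Fin.castAdd _ i), fun i => z (Fin.natAdd d i),
          (Fin.append_castAdd_natAdd).symm⟩
      have hx0 : ∀ i, 0 ≤ x i := fun i => by
        have : 0 ≤ Fin.append x y (Fin.castAdd _ i) := h0 (Fin.castAdd _ i)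
        rwa [Fin.append_left] at this
      have hy0 : ∀ i, 0 ≤ y i := fun i => by
        have : 0 ≤ Fin.append x y (Fin.natAdd d i) := h0 (Fin.natAdd d i)
        rwa [Fin.append_right] at this
      rw [(hv x y).2.1, (hv x y).2.2] at h2
      have hxD : x ∈ D.toSet := by
        rw [hS]
        exact ⟨hx0, (hv x y).1.1 h1⟩
      -- If the scaling entry is zero, nonnegativity makes all new entries vanish and any point of
      -- the simplex will do, here a vertex. Otherwise the new entries are divided by the scaling
      -- entry.
      rcases (hvn x hx0).eq_or_lt with h | h
      · have hyz : ∀ i, y i = 0 := by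
          rw [← h] at h2
          intro i
          exact (Finset.sum_eq_zero_iff_of_nonneg fun i _ => hy0 i).1 h2 i (Finset.mem_univ i)
        refine ⟨x, hxD, Pi.single (⟨0, hpos⟩ : Fin new.length) 1, single_mem_stdSimplex ℝ _, ?_⟩
        congr 1
        funext i
        rw [hform, ← h, hyz i, zero_mul]
      · refine ⟨x, hxD, fun i => y i / valAt lab x p, ⟨fun i => div_nonneg (hy0 i) h.le, ?_⟩, ?_⟩
        · rw [← Finset.sum_div, h2, div_self h.ne']
        · congr 1
          funext i
          rw [hform, mul_div_cancel₀ _ h.ne']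

theorem Realizes.start (p : P) : Realizes [p] (fun w => w p = 1) 0 [] := by
  refine ⟨by simp, fun w w' h h1 => (h p (by simp)).symm.trans h1, 1, Chain.one, rfl, trivial,
    HasCode.one, rfl, ?_⟩
  ext x
  constructor
  · rintro rfl
    exact ⟨fun _ => zero_le_one, by simp [valAt]⟩
  · rintro ⟨-, h⟩
    funext i
    have : i = 0 := Subsingleton.elim _ _
    subst this
    simpa [valAt] using h

end Chain

/-! ### Information structures in numbers -/

/-- The information structure of a two-player game in numbers.  The information sets of the first
player are `1, …, n0`, those of the second are `n0 + 1, …, n`, and `0` is a fictitious information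
set with one action, so that the pair `(0, 0)` is the empty sequence of either player.  `pi X` and
`pa X` make up the parent sequence of `X`, and `edges` lists the connected pairs. -/
structure Skel where
  n0 : ℕ
  n : ℕ
  na : ℕ → ℕ
  pi : ℕ → ℕ
  pa : ℕ → ℕ
  dep : ℕ → ℕ
  edges : List (ℕ × ℕ)

namespace Skel

/-- The parent sequence. -/
def sg (S : Skel) (X : ℕ) : ℕ × ℕ := (S.pi X, S.pa X)

/-- The properties of the information structure of a triangle-free game with perfect recall. -/
structure WF (S : Skel) : Prop where
  n0_le : S.n0 ≤ S.n
  na_zero : S.na 0 = 1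
  na_pos : ∀ X, X ≤ S.n → 1 ≤ S.na X
  pi_zero : S.pi 0 = 0
  pi_left : ∀ X, X ≤ S.n0 → S.pi X ≤ S.n0
  pi_right : ∀ X, S.n0 < X → X ≤ S.n → S.pi X = 0 ∨ S.n0 < S.pi X ∧ S.pi X ≤ S.n
  pa_lt : ∀ X, X ≤ S.n → S.pa X < S.na (S.pi X)
  dep_lt : ∀ X, 1 ≤ X → X ≤ S.n → S.dep (S.pi X) < S.dep X
  edges_nodup : S.edges.Nodup
  edges_mem : ∀ I J, (I, J) ∈ S.edges → 1 ≤ I ∧ I ≤ S.n0 ∧ S.n0 < J ∧ J ≤ S.n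
  edges_left : ∀ I J, (I, J) ∈ S.edges → S.pi I ≠ 0 → (S.pi I, J) ∈ S.edges
  edges_right : ∀ I J, (I, J) ∈ S.edges → S.pi J ≠ 0 → (I, S.pi J) ∈ S.edges
  triangleFree : ∀ I I' J J', I ≠ I' → J ≠ J' → S.sg I = S.sg I' → S.sg J = S.sg J' →
    (I, J) ∈ S.edges → (I', J) ∈ S.edges → (I, J') ∉ S.edges

/-- Connectedness, in either order; the fictitious information set is connected with all. -/
def Con (S : Skel) (X Y : ℕ) : Prop :=
  (X = 0 ∧ Y ≤ S.n) ∨ (Y = 0 ∧ X ≤ S.n) ∨ (X, Y) ∈ S.edges ∨ (Y, X) ∈ S.edges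

/-- On the path to `I` the information sets connected with `J` branch. -/
inductive Branch (S : Skel) : ℕ → ℕ → Prop
  | here {I I' J : ℕ} : (I, J) ∈ S.edges → (I', J) ∈ S.edges → I ≠ I' → S.sg I = S.sg I' →
      Branch S I J
  | up {I J : ℕ} : (I, J) ∈ S.edges → Branch S (S.pi I) J → Branch S I J

/-- Precedence among connected information sets. -/
def Bef (S : Skel) (Y X : ℕ) : Prop :=
  (Y = 0 ∧ 1 ≤ X ∧ X ≤ S.n) ∨ ((X, Y) ∈ S.edges ∧ S.Branch X Y) ∨
    ((Y, X) ∈ S.edges ∧ ¬ S.Branch Y X)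

variable {S : Skel}

theorem Branch.edge {I J : ℕ} (h : S.Branch I J) : (I, J) ∈ S.edges := by
  cases h <;> assumption

theorem Con.symm {X Y : ℕ} (h : S.Con X Y) : S.Con Y X := by
  unfold Con at *; tauto

/-! ### The precedence relation between connected information sets -/

namespace WF

variable (H : S.WF)
include H

theorem pi_le {X : ℕ} (hX : X ≤ S.n) : S.pi X ≤ S.n := by
  rcases le_or_gt X S.n0 with h | h
  · exact (H.pi_left X h).trans H.n0_le
  · rcases H.pi_right X h hX with h | h <;> omega

theorem con_le {X Y : ℕ} (h : S.Con X Y) : X ≤ S.n ∧ Y ≤ S.n := by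
  have := H.n0_le
  rcases h with h | h | h | h
  · omega
  · omega
  · have := H.edges_mem _ _ h; omega
  · have := H.edges_mem _ _ h; omega

theorem con_pi {X Y : ℕ} (h : S.Con X Y) : S.Con (S.pi X) Y := by
  obtain ⟨hX, hY⟩ := H.con_le h
  by_cases h0 : S.pi X = 0
  · exact Or.inl ⟨h0, hY⟩
  rcases h with h | h | h | h
  · exact absurd (h.1 ▸ H.pi_zero) h0
  · exact Or.inr (Or.inl ⟨h.1, H.pi_le hX⟩)
  · exact Or.inr (Or.inr (Or.inl (H.edges_left _ _ h h0)))
  · exact Or.inr (Or.inr (Or.inr (H.edges_right _ _ h h0)))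

omit H in
theorem bef_con {X Y : ℕ} (h : S.Bef Y X) : S.Con X Y := by
  rcases h with h | h | h
  · exact Or.inr (Or.inl ⟨h.1, h.2.2⟩)
  · exact Or.inr (Or.inr (Or.inl h.1))
  · exact Or.inr (Or.inr (Or.inr h.1))

theorem bef_pos {X Y : ℕ} (h : S.Bef Y X) : 1 ≤ X ∧ X ≤ S.n ∧ Y ≤ S.n := by
  have h1 := H.con_le (WF.bef_con h)
  have := H.n0_le
  rcases h with h | h | h
  · omega
  · have := H.edges_mem _ _ h.1; omega
  · have := H.edges_mem _ _ h.1; omega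

/-- Each edge is directed one way or the other according to `Branch`; only the pair `(0, 0)` has to
be excluded, as `0` does not precede itself. -/
theorem bef_total {X Y : ℕ} (h : S.Con X Y) (h0 : X ≠ 0 ∨ Y ≠ 0) : S.Bef X Y ∨ S.Bef Y X := by
  obtain ⟨hX, hY⟩ := H.con_le h
  unfold Bef
  rcases h with h | h | h | h
  · exact Or.inl (Or.inl ⟨h.1, by omega, h.2⟩)
  · exact Or.inr (Or.inl ⟨h.1, by omega, h.2⟩)
  · by_cases hb : S.Branch X Y <;> simp [h, hb]
  · by_cases hb : S.Branch Y X <;> simp [h, hb]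

theorem bef_asymm {X Y : ℕ} (h : S.Bef X Y) : ¬ S.Bef Y X := by
  have hX := H.bef_pos h
  intro h'
  have hY := H.bef_pos h'
  have hmem := H.edges_mem
  rcases h with h | h | h <;> rcases h' with h' | h' | h'
  · omega
  · omega
  · omega
  · omega
  · have := hmem _ _ h.1; have := hmem _ _ h'.1; omega
  · exact h'.2 h.2
  · omega
  · exact h.2 h'.2
  · have := hmem _ _ h.1; have := hmem _ _ h'.1; omega

/-- The siblings that witness branching are both connected with `J`, hence also with its parent. -/
theorem branch_pi {I J : ℕ} (h : S.Branch I J) (hJ : S.pi J ≠ 0) : S.Branch I (S.pi J) := by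
  induction h with
  | here h1 h2 h3 h4 =>
    exact Branch.here (H.edges_right _ _ h1 hJ) (H.edges_right _ _ h2 hJ) h3 h4
  | up h1 _ ih => exact Branch.up (H.edges_right _ _ h1 hJ) (ih hJ)

/-- Precedence is inherited downwards. If `X` belongs to the first player, branching at the parent
is branching on the path to `X`. If it belongs to the second, branching of `Y` against `X` would by
`branch_pi` be branching against the parent of `X`. -/
theorem bef_child {X Y : ℕ} (hc : S.Con X Y) (h : S.Bef Y (S.pi X)) : S.Bef Y X := by
  obtain ⟨hX, hY⟩ := H.con_le hc
  have hp := H.bef_pos h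
  have hX0 : X ≠ 0 := by
    rintro rfl
    have := H.pi_zero
    omega
  rcases h with h | h | h
  · exact Or.inl ⟨h.1, by omega, hX⟩
  · have hm := H.edges_mem _ _ h.1
    rcases hc with hc | hc | hc | hc
    · omega
    · omega
    · exact Or.inr (Or.inl ⟨hc, Branch.up hc h.2⟩)
    · have := H.edges_mem _ _ hc; omega
  · have hm := H.edges_mem _ _ h.1
    rcases hc with hc | hc | hc | hc
    · omega
    · omega
    · have := H.edges_mem _ _ hc; omega
    · exact Or.inr (Or.inr ⟨hc, fun hb => h.2 (H.branch_pi hb (by omega))⟩)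

/-- Otherwise `X` would precede the parent of `Y`, thus also `Y` by `bef_child`. -/
theorem bef_pi {X Y : ℕ} (h : S.Bef Y X) : S.Bef (S.pi Y) X := by
  have hX := H.bef_pos h
  have hc := WF.bef_con h
  rcases H.bef_total (H.con_pi hc.symm) (Or.inr (by omega)) with h1 | h1
  · exact h1
  · exact absurd h (H.bef_asymm (H.bef_child hc.symm h1))

/-- Where triangle-freeness enters. At the branching set itself a connection with `J'` would close
the forbidden triangle; further down such a connection would pass to the parent, where it is
excluded by induction. -/
theorem not_branch {I J J' : ℕ} (h : S.Branch I J) (hne : J ≠ J') (hs : S.sg J = S.sg J') :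
    (I, J') ∉ S.edges := by
  induction h with
  | here h1 h2 h3 h4 => exact H.triangleFree _ _ _ _ h3 hne h4 hs h1 h2
  | up h1 h2 ih =>
    intro h
    refine ih hne hs (H.edges_left _ _ h ?_)
    have := H.edges_mem _ _ h2.edge
    omega

/-- The property that `Bef` is designed for. If `X` belongs to the first player, branching of `X`
against `Y` is ruled out by `not_branch`, since `X` is connected with `Y'`. If `X` belongs to the
second player, `Y` and `Y'` themselves are the branching that puts `Y` after `X`. -/
theorem bef_siblings {X Y Y' : ℕ} (hY : Y ≠ 0) (hY' : Y' ≠ 0) (hne : Y ≠ Y')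
    (hs : S.sg Y = S.sg Y') (hc : S.Con X Y) (hc' : S.Con X Y') : S.Bef X Y := by
  obtain ⟨-, hYn⟩ := H.con_le hc
  rcases hc with hc | hc | hc | hc
  · exact Or.inl ⟨hc.1, by omega, hYn⟩
  · exact absurd hc.1 hY
  · have hm := H.edges_mem _ _ hc
    rcases hc' with h | h | h | h
    · omega
    · omega
    · exact Or.inr (Or.inr ⟨hc, fun hb => H.not_branch hb hne hs h⟩)
    · have := H.edges_mem _ _ h; omega
  · have hm := H.edges_mem _ _ hc
    rcases hc' with h | h | h | h
    · omega
    · omega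
    · have := H.edges_mem _ _ h; omega
    · exact Or.inr (Or.inl ⟨hc, Branch.here hc h hne hs⟩)

end WF

/-! ### Preceding children, and the constraints implied by the block equations -/

/-- `Y` is a child of the sequence `t` that precedes `X`. -/
def IsChd (S : Skel) (X : ℕ) (t : ℕ × ℕ) (Y : ℕ) : Prop :=
  Y ≠ 0 ∧ S.sg Y = t ∧ S.Bef Y X

open Classical in
/-- The child of `t` that precedes `X`, or `0` if there is none. -/
noncomputable def chd (S : Skel) (X : ℕ) (t : ℕ × ℕ) : ℕ :=
  if h : ∃ Y, S.IsChd X t Y then h.choose else 0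

theorem isChd_chd {X : ℕ} {t : ℕ × ℕ} (h : S.chd X t ≠ 0) : S.IsChd X t (S.chd X t) := by
  unfold chd at h ⊢
  split_ifs at h ⊢ with h1
  · exact h1.choose_spec
  · exact absurd rfl h

/-- Two different children of `t` that both precede `X` would be siblings connected with `X`, so `X`
would precede them. -/
theorem WF.chd_eq (H : S.WF) {X : ℕ} {t : ℕ × ℕ} {Y : ℕ} (h : S.IsChd X t Y) :
    S.chd X t = Y := by
  have h1 : ∃ Y, S.IsChd X t Y := ⟨Y, h⟩
  have h2 : S.IsChd X t (S.chd X t) := by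
    unfold chd
    rw [dif_pos h1]
    exact h1.choose_spec
  by_contra hne
  exact H.bef_asymm h.2.2 (H.bef_siblings h.1 h2.1 (Ne.symm hne) (h.2.1.trans h2.2.1.symm)
    (WF.bef_con h.2.2) (WF.bef_con h2.2.2))

/-- Inductions from the leaves towards the root run on the difference to this bound. -/
theorem WF.exists_dep_bound (H : S.WF) : ∃ M, ∀ X ≤ S.n, S.dep X ≤ M := by
  have := H.n0_le
  exact ⟨(Finset.range (S.n + 1)).sup S.dep, fun X hX =>
    Finset.le_sup (f := S.dep) (Finset.mem_range.2 (by omega))⟩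

/-- The constraint at the information set `X` and the sequence `t` of the other player. -/
def Constraint (S : Skel) (V : ℕ × ℕ → ℕ × ℕ → ℝ) (X : ℕ) (t : ℕ × ℕ) : Prop :=
  ∑ a ∈ Finset.range (S.na X), V (X, a) t = V (S.sg X) t

/-- The equations of a decomposition imply all constraints. -/
theorem WF.constraint (H : S.WF) {V : ℕ × ℕ → ℕ × ℕ → ℝ}
    (hV : ∀ s t, S.Con s.1 t.1 → V s t = V t s)
    (h1 : ∀ X Y b, S.Bef Y X → b < S.na Y → S.chd X (Y, b) = 0 → S.Constraint V X (Y, b))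
    (h2 : ∀ X Y a, Y ≠ 0 → S.Bef Y X → a < S.na X → S.Constraint V Y (X, a))
    {X Y b : ℕ} (hX : X ≠ 0) (hc : S.Con X Y) (hb : b < S.na Y) : S.Constraint V X (Y, b) := by
  obtain ⟨M, hM⟩ := H.exists_dep_bound
  -- The constraint at `(Y, b)` is reduced to those at the sequences of a child of `(Y, b)`, which
  -- is deeper than `Y`.
  induction hm : M - S.dep Y using Nat.strong_induction_on generalizing Y b with
  | _ m ih =>
    rcases H.bef_total hc (Or.inl hX) with h | h
    · exact h2 _ _ _ hX h hb
    by_cases h0 : S.chd X (Y, b) = 0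
    · exact h1 _ _ _ h hb h0
    obtain ⟨hZ0, hZs, hZX⟩ := isChd_chd h0
    set Z := S.chd X (Y, b)
    have hZn := H.bef_pos hZX
    have hZc := WF.bef_con hZX
    have hpi : S.pi Z = Y := congrArg Prod.fst hZs
    have hdep := H.dep_lt Z (by omega) hZn.2.2
    have hMZ := hM Z hZn.2.2
    have hbef : ∀ a < S.na X, V (X, a) (Y, b) = ∑ c ∈ Finset.range (S.na Z), V (X, a) (Z, c) := by
      intro a ha
      have := h2 X Z a hZ0 hZX ha
      unfold Constraint at this
      rw [hZs] at this
      rw [hV (X, a) (Y, b) hc, ← this]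
      exact Finset.sum_congr rfl fun c _ => hV (Z, c) (X, a) hZc.symm
    have hin : ∀ c < S.na Z, S.Constraint V X (Z, c) := fun c hc' =>
      ih (M - S.dep Z) (by rw [← hm]; rw [hpi] at hdep; omega) hZc hc' rfl
    have hpX : S.pa X < S.na (S.pi X) := H.pa_lt X hZn.2.1
    have hpc : S.Con (S.pi X) Z := H.con_pi hZc
    -- The constraint of `Z` at the parent sequence of `X` is among the given ones in either
    -- direction. If `Z` follows the parent of `X`, it must be checked that no child `W` of `S.sg X`
    -- precedes `Z`. Since `Z` precedes `X`, such a `W` would be a sibling of `X`, and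
    -- `bef_siblings` would make `Z` precede `W`.
    have hpar : S.Constraint V Z (S.sg X) := by
      rcases H.bef_total hpc (Or.inr hZ0) with h3 | h3
      · refine h1 _ _ _ h3 hpX ?_
        by_contra h4
        obtain ⟨hW0, hWs, hWZ⟩ := isChd_chd h4
        set W := S.chd Z (S.pi X, S.pa X)
        have hWX : X ≠ W := fun h => H.bef_asymm hZX (h ▸ hWZ)
        exact H.bef_asymm (H.bef_siblings hW0 hX hWX.symm hWs (WF.bef_con hWZ) hZc.symm) hWZ
      · exact h2 _ _ _ hZ0 h3 hpX
    -- Each `V (X, a) (Y, b)` is expanded along `Z`, the sums are exchanged, the induction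
    -- hypothesis is applied at every `(Z, c)`, and the sum over `c` is collected with `hpar`.
    unfold Constraint at hpar ⊢
    rw [hZs] at hpar
    rw [Finset.sum_congr rfl fun a ha => hbef a (Finset.mem_range.1 ha), Finset.sum_comm,
      Finset.sum_congr rfl fun c hc' => hin c (Finset.mem_range.1 hc'),
      hV _ _ (H.con_pi hc), ← hpar]
    exact Finset.sum_congr rfl fun c _ => hV _ _ hpc

/-! ### Blocks and the well-foundedness of their dependencies -/

/-- A block `(X, t)` consists of the pairs `(X, a), t`. -/
abbrev Blk := ℕ × ℕ × ℕ

/-- The blocks of a decomposition. -/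
def IsBlk (S : Skel) (k : Blk) : Prop := S.Bef k.2.1 k.1 ∧ k.2.2 < S.na k.2.1

/-- The dependencies among blocks; `(0, 0, 0)` stands for the pair of empty sequences. -/
inductive Pre (S : Skel) : Blk → Blk → Prop
  | sum {X Y b : ℕ} : Y ≠ 0 → S.Bef Y X → b < S.na Y → Pre S (X, Y, b) (X, S.sg Y)
  | own {X Y b : ℕ} : S.Bef Y X → b < S.na Y → S.Bef Y (S.pi X) → Pre S (S.pi X, Y, b) (X, Y, b)
  | opp {X Y b : ℕ} : S.Bef Y X → b < S.na Y → S.Bef (S.pi X) Y → Pre S (Y, S.sg X) (X, Y, b)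
  | root {X : ℕ} : 1 ≤ X → X ≤ S.n → S.pi X = 0 → Pre S (0, 0, 0) (X, 0, 0)

theorem WF.acc_root (H : S.WF) : Acc S.Pre (0, 0, 0) := by
  constructor
  intro k hk
  generalize hz : ((0, 0, 0) : Blk) = z at hk
  cases hk with
  | sum _ h _ => have := H.bef_pos h; simp only [Prod.mk.injEq] at hz; omega
  | own h _ _ => have := H.bef_pos h; simp only [Prod.mk.injEq] at hz; omega
  | opp h _ _ => have := H.bef_pos h; simp only [Prod.mk.injEq] at hz; omega
  | root h _ _ => simp only [Prod.mk.injEq] at hz; omega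

/-- With `X` fixed, a dependency of kind `sum` leads from a sequence to those of one of its
children, so chains of them are bounded by the depth of the other player's information sets. The
kinds that leave `X` are taken care of by the two hypotheses. -/
theorem WF.acc_of_parent (H : S.WF) {X : ℕ}
    (h1 : ∀ Y b, S.Bef Y X → b < S.na Y → S.Bef Y (S.pi X) → Acc S.Pre (S.pi X, Y, b))
    (h2 : ∀ Y b, S.Bef Y X → b < S.na Y → S.Bef (S.pi X) Y → Acc S.Pre (Y, S.sg X))
    {Y b : ℕ} (h : S.Bef Y X) (hb : b < S.na Y) : Acc S.Pre (X, Y, b) := by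
  obtain ⟨M, hM⟩ := H.exists_dep_bound
  induction hm : M - S.dep Y using Nat.strong_induction_on generalizing Y b with
  | _ m ih =>
    constructor
    intro k hk
    generalize hz : ((X, Y, b) : Blk) = z at hk
    cases hk with
    | @sum X' Z c hZ hZX hc =>
      simp only [Prod.mk.injEq, sg] at hz
      obtain ⟨rfl, rfl, rfl⟩ := hz
      have hn := H.bef_pos hZX
      have := H.dep_lt Z (by omega) hn.2.2
      have := hM Z hn.2.2
      exact ih (M - S.dep Z) (by omega) hZX hc rfl
    | own _ _ h5 =>
      simp only [Prod.mk.injEq] at hz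
      obtain ⟨rfl, rfl, rfl⟩ := hz
      exact h1 _ _ h hb h5
    | opp _ _ h5 =>
      simp only [Prod.mk.injEq] at hz
      obtain ⟨rfl, rfl, rfl⟩ := hz
      exact h2 _ _ h hb h5
    | root => exact H.acc_root

/-- Induction on the depth of `X` and, for equal `X`, on the depth of `Y`. The first kind of block
has the parent of `X` in place of `X`, so `acc_of_parent` applies to it. The second kind, `(Y, S.sg
X)`, exchanges the roles of the players and threatens to start a cycle; it does not, because it has
no dependency of kind `sum`. -/
theorem WF.acc_parent (H : S.WF) {X Y b : ℕ} (h : S.Bef Y X) (hb : b < S.na Y) :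
    (S.Bef Y (S.pi X) → Acc S.Pre (S.pi X, Y, b)) ∧
    (S.Bef (S.pi X) Y → Acc S.Pre (Y, S.sg X)) := by
  induction hm : S.dep X using Nat.strong_induction_on generalizing X Y b with
  | _ m ihX =>
  induction hl : S.dep Y using Nat.strong_induction_on generalizing Y b with
  | _ l ihY =>
    have hX := H.bef_pos h
    constructor
    · intro h1
      have hd := H.dep_lt X hX.1 hX.2.1
      exact H.acc_of_parent (fun Y b h2 hb2 h3 => (ihX _ (hm ▸ hd) h2 hb2 rfl).1 h3)
        (fun Y b h2 hb2 h3 => (ihX _ (hm ▸ hd) h2 hb2 rfl).2 h3) h1 hb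
    · intro h1
      have hY := H.bef_pos h1
      have hd := H.dep_lt Y hY.1 hY.2.1
      have hpY : S.Bef (S.pi Y) X := H.bef_pi h
      have hpa := H.pa_lt Y hY.2.1
      -- Both remaining kinds of dependency of `(Y, S.sg X)` lead to the block that contains the
      -- pair of `S.sg X` and `S.sg Y`. Whichever side it lies on, the induction hypothesis for
      -- `S.sg Y` in place of `(Y, b)` covers it.
      have hih := ihY _ (hl ▸ hd) hpY hpa rfl
      constructor
      intro k hk
      generalize hz : ((Y, S.sg X) : Blk) = z at hk
      cases hk with
      -- A child `Z` of `S.sg X` that precedes `Y` would differ from `X`, hence be a sibling of it,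
      -- and then `Y` would precede `Z`.
      | @sum Y' Z c hZ hZY hc =>
        simp only [Prod.mk.injEq] at hz
        obtain ⟨rfl, hz⟩ := hz
        have hne : Z ≠ X := by
          rintro rfl
          exact H.bef_asymm h hZY
        exact absurd hZY (H.bef_asymm (H.bef_siblings hZ (by omega) hne hz.symm (WF.bef_con hZY)
          (WF.bef_con h).symm))
      | own _ _ h5 =>
        simp only [Prod.mk.injEq, sg] at hz
        obtain ⟨rfl, rfl, rfl⟩ := hz
        exact hih.2 h5
      | opp _ _ h5 =>
        simp only [Prod.mk.injEq, sg] at hz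
        obtain ⟨rfl, rfl, rfl⟩ := hz
        exact hih.1 h5
      | root => exact H.acc_root

theorem WF.acc (H : S.WF) {k : Blk} (h : S.IsBlk k) : Acc S.Pre k := by
  obtain ⟨X, Y, b⟩ := k
  exact H.acc_of_parent (fun Y b h1 h2 h3 => (H.acc_parent h1 h2).1 h3)
    (fun Y b h1 h2 h3 => (H.acc_parent h1 h2).2 h3) h.1 h.2

/-- Any nonempty set of blocks has an element that depends on none of the others. -/
theorem WF.exists_min (H : S.WF) {T : Set Blk} (hT : ∀ k ∈ T, k = (0, 0, 0) ∨ S.IsBlk k)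
    (hne : T.Nonempty) : ∃ k ∈ T, ∀ k', S.Pre k' k → k' ∉ T := by
  obtain ⟨k, hk⟩ := hne
  have hacc : Acc S.Pre k := by
    rcases hT k hk with rfl | h
    · exact H.acc_root
    · exact H.acc h
  induction hacc with
  | intro k _ ih =>
    by_cases h : ∃ k', S.Pre k' k ∧ k' ∈ T
    · obtain ⟨k', h1, h2⟩ := h
      exact ih k' h1 h2
    · push Not at h
      exact ⟨k, hk, h⟩

/-! ### Writing out a decomposition -/

/-- A pair of sequences, that of the owner of `X` first, rearranged with that of the first player
first. -/
def ord (S : Skel) (X : ℕ) (s t : ℕ × ℕ) : (ℕ × ℕ) × (ℕ × ℕ) :=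
  if X ≤ S.n0 then (s, t) else (t, s)

/-- The pairs of a block. -/
def labels (S : Skel) (k : Blk) : List ((ℕ × ℕ) × (ℕ × ℕ)) :=
  (List.range (S.na k.1)).map fun a => S.ord k.1 (k.1, a) k.2

/-- The labels of the coordinates when the blocks are added in the listed order. -/
def labelsOf (S : Skel) (Q : List Blk) : List ((ℕ × ℕ) × (ℕ × ℕ)) :=
  ((0, 0), (0, 0)) :: Q.flatMap S.labels

/-- The position of a label. -/
def pos (lab : List ((ℕ × ℕ) × (ℕ × ℕ))) (p : (ℕ × ℕ) × (ℕ × ℕ)) : ℕ :=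
  -- The instance is named so that this is the `idxOf` of `Chain.Realizes`, which comes from
  -- decidable equality and not from the product instance of `BEq`.
  @List.idxOf _ instBEqOfDecidableEq p lab

theorem pos_append_of_mem {lab lab' : List ((ℕ × ℕ) × (ℕ × ℕ))} {p : (ℕ × ℕ) × (ℕ × ℕ)}
    (h : p ∈ lab) : pos (lab ++ lab') p = pos lab p :=
  @List.idxOf_append_of_mem _ lab lab' instBEqOfDecidableEq _ p h

/-- What is written for the pair `(X, a), t` of a block that is determined by the child `Y` of `t`. -/
def sumCode (S : Skel) (lab : List ((ℕ × ℕ) × (ℕ × ℕ))) (X Y a : ℕ) : List ℕ :=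
  0 :: S.na Y :: (List.range (S.na Y)).flatMap fun b => [pos lab (S.ord X (X, a) (Y, b)), 1]

/-- What is written for a block, `lab` being the labels of the earlier coordinates. -/
noncomputable def blkCode (S : Skel) (lab : List ((ℕ × ℕ) × (ℕ × ℕ))) (k : Blk) : List ℕ :=
  if S.chd k.1 k.2 = 0 then [S.na k.1, 1, pos lab (S.ord k.1 (S.sg k.1) k.2), 1]
  else (List.range (S.na k.1)).flatMap (S.sumCode lab k.1 (S.chd k.1 k.2))

/-- The number of scaled extensions for a block. -/
noncomputable def blkLen (S : Skel) (k : Blk) : ℕ := if S.chd k.1 k.2 = 0 then 1 else S.na k.1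

/-- What is written for a list of blocks. -/
noncomputable def codeOf (S : Skel) (Q : List Blk) : List ℕ :=
  (Q.foldl (fun p k => (p.1 ++ S.blkCode (S.labelsOf p.2) k, p.2 ++ [k])) ([], [])).1

/-- The number of a sequence's information set among those of its player, plus one. -/
def loc (S : Skel) (X : ℕ) : ℕ := if X ≤ S.n0 then X else X - S.n0

/-- What is written for the label of a coordinate. -/
def labelCode (S : Skel) (p : (ℕ × ℕ) × (ℕ × ℕ)) : List ℕ :=
  [S.loc p.1.1, p.1.2, S.loc p.2.1, p.2.2]

/-- The text of the decomposition for an ordering of the blocks. -/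
noncomputable def output (S : Skel) (Q : List Blk) : List ℕ :=
  (Q.map S.blkLen).sum :: S.codeOf Q ++ (S.labelsOf Q).flatMap S.labelCode

/-- All coordinates that determine a block are among `lab`. -/
def Ready (S : Skel) (lab : List ((ℕ × ℕ) × (ℕ × ℕ))) (k : Blk) : Prop :=
  if S.chd k.1 k.2 = 0 then S.ord k.1 (S.sg k.1) k.2 ∈ lab
  else ∀ a < S.na k.1, ∀ b < S.na (S.chd k.1 k.2),
    S.ord k.1 (k.1, a) (S.chd k.1 k.2, b) ∈ lab

/-- An ordering of the blocks that respects the dependencies. -/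
structure IsOrder (S : Skel) (Q : List Blk) : Prop where
  nodup : Q.Nodup
  mem : ∀ k, k ∈ Q ↔ S.IsBlk k
  ready : ∀ Q₁ k Q₂, Q = Q₁ ++ k :: Q₂ → S.Ready (S.labelsOf Q₁) k

theorem labelsOf_append (Q Q' : List Blk) :
    S.labelsOf (Q ++ Q') = S.labelsOf Q ++ Q'.flatMap S.labels := by
  simp [labelsOf]

theorem codeOf_nil : S.codeOf [] = [] := rfl

theorem codeOf_concat (Q : List Blk) (k : Blk) :
    S.codeOf (Q ++ [k]) = S.codeOf Q ++ S.blkCode (S.labelsOf Q) k := by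
  have : ∀ (Q : List Blk) (p : List ℕ × List Blk), (Q.foldl
      (fun p k => (p.1 ++ S.blkCode (S.labelsOf p.2) k, p.2 ++ [k])) p).2 = p.2 ++ Q := by
    intro Q
    induction Q with
    | nil => simp
    | cons k Q ih => intro p; simp [ih]
  unfold codeOf
  rw [List.foldl_append]
  simp [this]

end Skel

/-! ### An ordered list of blocks writes out a chain of scaled extensions -/

namespace Skel

variable {S : Skel}

/-- The equations of a block. -/
def BlkEq (S : Skel) (w : (ℕ × ℕ) × (ℕ × ℕ) → ℝ) (k : Blk) : Prop :=
  if S.chd k.1 k.2 = 0 then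
    ((S.labels k).map w).sum = w (S.ord k.1 (S.sg k.1) k.2)
  else ∀ a < S.na k.1, w (S.ord k.1 (k.1, a) k.2) =
    (((List.range (S.na (S.chd k.1 k.2))).map fun b =>
      S.ord k.1 (k.1, a) (S.chd k.1 k.2, b)).map w).sum

theorem labels_nodup (k : Blk) : (S.labels k).Nodup := by
  refine List.Nodup.map ?_ List.nodup_range
  intro a b h
  unfold ord at h
  split_ifs at h <;> simpa using h

/-- A label names its two information sets. Asymmetry of precedence tells which of them is the later
one, and the later one determines how the label splits into a block and an action. -/
theorem WF.labels_disjoint (H : S.WF) {k k' : Blk} (hk : S.IsBlk k) (hk' : S.IsBlk k')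
    {p : (ℕ × ℕ) × (ℕ × ℕ)} (h : p ∈ S.labels k) (h' : p ∈ S.labels k') : k = k' := by
  obtain ⟨X, Y, b⟩ := k
  obtain ⟨X', Y', b'⟩ := k'
  obtain ⟨a, -, rfl⟩ := List.mem_map.1 h
  obtain ⟨a', -, he⟩ := List.mem_map.1 h'
  have h1 : S.Bef Y X := hk.1
  have h2 : S.Bef Y' X' := hk'.1
  simp only [ord] at he
  split_ifs at he <;> simp only [Prod.mk.injEq] at he ⊢
  · exact ⟨he.1.1.symm, he.2.1.symm, he.2.2.symm⟩
  · obtain ⟨⟨rfl, rfl⟩, rfl, rfl⟩ := he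
    exact absurd h2 (H.bef_asymm h1)
  · obtain ⟨⟨rfl, rfl⟩, rfl, rfl⟩ := he
    exact absurd h2 (H.bef_asymm h1)
  · exact ⟨he.2.1.symm, he.1.1.symm, he.1.2.symm⟩

theorem WF.root_notMem_labels (H : S.WF) {k : Blk} (hk : S.IsBlk k) :
    ((0, 0), (0, 0)) ∉ S.labels k := by
  intro h
  obtain ⟨a, -, he⟩ := List.mem_map.1 h
  have := H.bef_pos hk.1
  unfold ord at he
  split_ifs at he <;> simp only [Prod.mk.injEq] at he <;> omega

/-- One point extension for each of the first `l` actions. The summands are all among the labels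
before the block, so their positions do not move while the coordinates of the block are appended. -/
theorem realizes_sum {lab : List ((ℕ × ℕ) × (ℕ × ℕ))}
    {φ : ((ℕ × ℕ) × (ℕ × ℕ) → ℝ) → Prop} {m : ℕ} {c : List ℕ}
    (h : Chain.Realizes lab φ m c) {X Y : ℕ} {t : ℕ × ℕ} {l : ℕ}
    (hmem : ∀ a < l, ∀ b < S.na Y, S.ord X (X, a) (Y, b) ∈ lab)
    (hdis : ∀ a < l, S.ord X (X, a) t ∉ lab) :
    Chain.Realizes (lab ++ (List.range l).map fun a => S.ord X (X, a) t)
      (fun w => φ w ∧ ∀ a < l, w (S.ord X (X, a) t) =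
        (((List.range (S.na Y)).map fun b => S.ord X (X, a) (Y, b)).map w).sum)
      (m + l) (c ++ (List.range l).flatMap (S.sumCode lab X Y)) := by
  induction l with
  | zero => simpa using h
  | succ l ih =>
    have h1 := ih (fun a ha => hmem a (by omega)) (fun a ha => hdis a (by omega))
    have hq : S.ord X (X, l) t ∉ lab ++ (List.range l).map fun a => S.ord X (X, a) t := by
      rw [List.mem_append, not_or]
      refine ⟨hdis l (by omega), fun h2 => ?_⟩
      obtain ⟨a, ha, he⟩ := List.mem_map.1 h2
      have ha := List.mem_range.1 ha
      unfold ord at he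
      split_ifs at he <;> simp only [Prod.mk.injEq] at he <;> omega
    have hps : ∀ p ∈ (List.range (S.na Y)).map (fun b => S.ord X (X, l) (Y, b)), p ∈ lab := by
      intro p hp
      obtain ⟨b, hb, rfl⟩ := List.mem_map.1 hp
      exact hmem l (by omega) b (List.mem_range.1 hb)
    have h2 := h1.point hq (fun p hp => List.mem_append_left _ (hps p hp))
    refine cast ?_ h2
    congr 1
    · simp [List.range_succ]
    · funext w
      rw [eq_iff_iff, and_assoc]
      refine and_congr_right fun _ => ⟨fun h3 a ha => ?_, fun h3 => ⟨fun a ha => h3 a (by omega),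
        h3 l (by omega)⟩⟩
      rcases Nat.lt_succ_iff_lt_or_eq.1 ha with h4 | rfl
      · exact h3.1 a h4
      · exact h3.2
    · rw [List.range_succ, List.flatMap_append, ← List.append_assoc]
      congr 1
      rw [List.flatMap_singleton, sumCode, List.length_map, List.length_range, List.flatMap_map]
      congr 2
      apply List.flatMap_congr
      intro b hb
      rw [← pos_append_of_mem (hps _ (List.mem_map_of_mem hb))]
      rfl

/-- Blocks are appended one at a time. Readiness puts the scaling entry or the summands among the
earlier labels, and disjointness of blocks makes the new labels fresh; these are the hypotheses of
the two extension lemmas. -/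
theorem WF.realizes (H : S.WF) (Q : List Blk) (hnd : Q.Nodup) (hblk : ∀ k ∈ Q, S.IsBlk k)
    (hready : ∀ Q₁ k Q₂, Q = Q₁ ++ k :: Q₂ → S.Ready (S.labelsOf Q₁) k) :
    Chain.Realizes (S.labelsOf Q) (fun w => w ((0, 0), (0, 0)) = 1 ∧ ∀ k ∈ Q, S.BlkEq w k)
      (Q.map S.blkLen).sum (S.codeOf Q) := by
  induction Q using List.reverseRecOn with
  | nil =>
    have := Chain.Realizes.start (((0, 0), (0, 0)) : (ℕ × ℕ) × (ℕ × ℕ))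
    simpa [labelsOf, codeOf_nil] using this
  | append_singleton Q k ih =>
    have hQ : Q.Nodup ∧ k ∉ Q := by
      rw [List.nodup_append] at hnd
      exact ⟨hnd.1, fun h => hnd.2.2 k h k (by simp) rfl⟩
    have h := ih hQ.1 (fun k hk => hblk k (by simp [hk])) fun Q₁ k' Q₂ h' =>
      hready Q₁ k' (Q₂ ++ [k]) (by simp [h'])
    have hr := hready Q k [] rfl
    have hk := hblk k (by simp)
    have hdis : ∀ p ∈ S.labels k, p ∉ S.labelsOf Q := by
      intro p hp hpQ
      rcases List.mem_cons.1 hpQ with rfl | hpQ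
      · exact H.root_notMem_labels hk hp
      · obtain ⟨k', hk', hp'⟩ := List.mem_flatMap.1 hpQ
        exact hQ.2 (H.labels_disjoint hk (hblk k' (by simp [hk'])) hp hp' ▸ hk')
    have hkn := (H.bef_pos hk.1).2.1
    have hpos := H.na_pos _ hkn
    have hφ : (fun w : (ℕ × ℕ) × (ℕ × ℕ) → ℝ =>
        w ((0, 0), (0, 0)) = 1 ∧ ∀ k' ∈ Q ++ [k], S.BlkEq w k') =
        fun w => (w ((0, 0), (0, 0)) = 1 ∧ ∀ k' ∈ Q, S.BlkEq w k') ∧ S.BlkEq w k := by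
      funext w
      simp [or_imp, forall_and, and_assoc]
    rw [codeOf_concat, labelsOf_append, List.flatMap_singleton, List.map_append, List.sum_append,
      List.map_singleton, List.sum_singleton, hφ]
    unfold Ready at hr
    by_cases h0 : S.chd k.1 k.2 = 0
    · rw [if_pos h0] at hr
      have := h.simplex hr (new := S.labels k) (by
        rw [Ne, labels, List.map_eq_nil_iff, List.range_eq_nil]
        omega) (labels_nodup k) hdis
      have hlen : (S.labels k).length = S.na k.1 := by simp [labels]
      rw [hlen] at this
      have h1 : S.blkCode (S.labelsOf Q) k =
          [S.na k.1, 1, pos (S.labelsOf Q) (S.ord k.1 (S.sg k.1) k.2), 1] := if_pos h0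
      have h2 : S.blkLen k = 1 := if_pos h0
      have h3 : ∀ w, S.BlkEq w k =
          (((S.labels k).map w).sum = w (S.ord k.1 (S.sg k.1) k.2)) := fun w => if_pos h0
      simp only [h1, h2, h3]
      exact this
    · rw [if_neg h0] at hr
      have h1 : S.blkCode (S.labelsOf Q) k = (List.range (S.na k.1)).flatMap
          (S.sumCode (S.labelsOf Q) k.1 (S.chd k.1 k.2)) := if_neg h0
      have h2 : S.blkLen k = S.na k.1 := if_neg h0
      have h3 : ∀ w, S.BlkEq w k = ∀ a < S.na k.1, w (S.ord k.1 (k.1, a) k.2) =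
          (((List.range (S.na (S.chd k.1 k.2))).map fun b =>
            S.ord k.1 (k.1, a) (S.chd k.1 k.2, b)).map w).sum := fun w => if_neg h0
      simp only [h1, h2, h3]
      exact realizes_sum h hr fun a ha => hdis _
        (List.mem_map.2 ⟨a, List.mem_range.2 ha, rfl⟩)

end Skel

/-! ### A calculus of programs with running times -/

namespace Ram

/-- Started in `s` at time `T`, the program halts in a state and at a time related by `Q`. -/
def Runs (p : Prog) (s : State) (T : ℕ) (Q : State → ℕ → Prop) : Prop :=
  ∃ s' t, Exec p s s' t ∧ Q s' (T + t)

/-- This and the following equivalences compute the weakest precondition of a program without loops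
by rewriting. The clock `T` is passed along, so that postconditions and loop invariants can bound
the time. -/
theorem runs_skip {s : State} {T : ℕ} {Q : State → ℕ → Prop} :
    Runs Prog.skip s T Q ↔ Q s (T + 1) := by
  constructor
  · rintro ⟨s', t, h, hQ⟩
    cases h
    exact hQ
  · exact fun h => ⟨_, _, Exec.skip s, h⟩

theorem runs_op {o : Op} {s : State} {T : ℕ} {Q : State → ℕ → Prop} :
    Runs (Prog.op o) s T Q ↔ Q (o.run s) (T + 1) := by
  constructor
  · rintro ⟨s', t, h, hQ⟩
    cases h
    exact hQ
  · exact fun h => ⟨_, _, Exec.op o s, h⟩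

theorem runs_seq {p q : Prog} {s : State} {T : ℕ} {Q : State → ℕ → Prop} :
    Runs (Prog.seq p q) s T Q ↔ Runs p s T fun s' T' => Runs q s' T' Q := by
  constructor
  · rintro ⟨s', t, h, hQ⟩
    cases h with
    | seq h1 h2 => exact ⟨_, _, h1, _, _, h2, by rwa [Nat.add_assoc]⟩
  · rintro ⟨s1, t1, h1, s2, t2, h2, hQ⟩
    exact ⟨_, _, Exec.seq h1 h2, by rwa [← Nat.add_assoc]⟩

theorem runs_ite {x y : ℕ} {p q : Prog} {s : State} {T : ℕ} {Q : State → ℕ → Prop} :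
    Runs (Prog.ite x y p q) s T Q ↔
      if s.reg x < s.reg y then Runs p s (T + 1) Q else Runs q s (T + 1) Q := by
  split_ifs with hxy
  · constructor
    · rintro ⟨s', t, h, hQ⟩
      cases h with
      | ite_true _ h1 => exact ⟨_, _, h1, by rwa [Nat.add_assoc, Nat.add_comm 1]⟩
      | ite_false h0 _ => exact absurd hxy h0
    · rintro ⟨s', t, h, hQ⟩
      exact ⟨_, _, Exec.ite_true hxy h, by rwa [Nat.add_comm t 1, ← Nat.add_assoc]⟩
  · constructor
    · rintro ⟨s', t, h, hQ⟩
      cases h with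
      | ite_true h0 _ => exact absurd h0 hxy
      | ite_false _ h1 => exact ⟨_, _, h1, by rwa [Nat.add_assoc, Nat.add_comm 1]⟩
    · rintro ⟨s', t, h, hQ⟩
      exact ⟨_, _, Exec.ite_false hxy h, by rwa [Nat.add_comm t 1, ← Nat.add_assoc]⟩

theorem Runs.mono {p : Prog} {s : State} {T : ℕ} {Q Q' : State → ℕ → Prop} (h : Runs p s T Q)
    (hQ : ∀ s' T', Q s' T' → Q' s' T') : Runs p s T Q' :=
  let ⟨s', t, h1, h2⟩ := h
  ⟨s', t, h1, hQ _ _ h2⟩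

/-! ### What a program does not change -/

/-- The operation assigns the register. -/
def Op.setsReg : Op → ℕ → Bool
  | Op.const x _, r => Nat.beq x r
  | Op.copy x _, r => Nat.beq x r
  | Op.inc x, r => Nat.beq x r
  | Op.dec x, r => Nat.beq x r
  | Op.load x _ _ _, r => Nat.beq x r
  | Op.store _ _ _ _, _ => false
  | Op.read x, r => Nat.beq x r
  | Op.write _, _ => false

/-- The program may assign the register. -/
def Prog.setsReg : Prog → ℕ → Bool
  | Prog.skip, _ => false
  | Prog.op o, r => o.setsReg r
  | Prog.seq p q, r => p.setsReg r || q.setsReg r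
  | Prog.ite _ _ p q, r => p.setsReg r || q.setsReg r
  | Prog.loop _ _ p, r => p.setsReg r

/-- The program may assign the array. -/
def Prog.setsArr : Prog → ℕ → Bool
  | Prog.skip, _ => false
  | Prog.op (Op.store B _ _ _), A => Nat.beq B A
  | Prog.op _, _ => false
  | Prog.seq p q, A => p.setsArr A || q.setsArr A
  | Prog.ite _ _ p q, A => p.setsArr A || q.setsArr A
  | Prog.loop _ _ p, A => p.setsArr A

/-- The program may read input. -/
def Prog.reads : Prog → Bool
  | Prog.op (Op.read _) => true
  | Prog.seq p q => p.reads || q.reads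
  | Prog.ite _ _ p q => p.reads || q.reads
  | Prog.loop _ _ p => p.reads
  | _ => false

/-- The program may write output. -/
def Prog.writes : Prog → Bool
  | Prog.op (Op.write _) => true
  | Prog.seq p q => p.writes || q.writes
  | Prog.ite _ _ p q => p.writes || q.writes
  | Prog.loop _ _ p => p.writes
  | _ => false

/-- The states agree on everything that the program cannot change. -/
structure Frame (p : Prog) (s s' : State) : Prop where
  reg : ∀ r, p.setsReg r = false → s'.reg r = s.reg r
  arr : ∀ A, p.setsArr A = false → s'.arr A = s.arr A
  inp : p.reads = false → s'.inp = s.inp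
  out : p.writes = false → s'.out = s.out

theorem Frame.refl (p : Prog) (s : State) : Frame p s s :=
  ⟨fun _ _ => rfl, fun _ _ => rfl, fun _ => rfl, fun _ => rfl⟩

theorem Frame.trans {p : Prog} {s s' s'' : State} (h : Frame p s s') (h' : Frame p s' s'') :
    Frame p s s'' :=
  ⟨fun r hr => (h'.reg r hr).trans (h.reg r hr), fun A hA => (h'.arr A hA).trans (h.arr A hA),
    fun hi => (h'.inp hi).trans (h.inp hi), fun ho => (h'.out ho).trans (h.out ho)⟩

theorem Frame.of_le {p q : Prog} {s s' : State} (h : Frame q s s')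
    (h1 : ∀ r, p.setsReg r = false → q.setsReg r = false)
    (h2 : ∀ r, p.setsArr r = false → q.setsArr r = false)
    (h3 : p.reads = false → q.reads = false) (h4 : p.writes = false → q.writes = false) :
    Frame p s s' :=
  ⟨fun r hr => h.reg r (h1 r hr), fun A hA => h.arr A (h2 A hA), fun hi => h.inp (h3 hi),
    fun ho => h.out (h4 ho)⟩

theorem beq_ne {x r : ℕ} (h : Nat.beq x r = false) : r ≠ x := by
  rintro rfl
  simp at h

theorem Op.frame (o : Op) (s : State) : Frame (Prog.op o) s (o.run s) := by
  cases o with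
  | store B y z x =>
    refine ⟨fun _ _ => rfl, fun A hA => ?_, fun _ => rfl, fun _ => rfl⟩
    funext k l
    exact if_neg fun h => beq_ne hA h.1
  | write x => exact ⟨fun _ _ => rfl, fun _ _ => rfl, fun _ => rfl, fun h => (by cases h)⟩
  | read x =>
    exact ⟨fun r hr => Function.update_of_ne (beq_ne hr) _ _, fun _ _ => rfl,
      fun h => (by cases h), fun _ => rfl⟩
  | _ =>
    exact ⟨fun r hr => Function.update_of_ne (beq_ne hr) _ _, fun _ _ => rfl, fun _ => rfl,
      fun _ => rfl⟩

theorem or_false_left {a b : Bool} (h : (a || b) = false) : a = false := by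
  cases a <;> simp_all

theorem or_false_right {a b : Bool} (h : (a || b) = false) : b = false := by
  cases b <;> simp_all

/-- The footprint of a program is computed from its text. For concrete programs the side conditions
of frame arguments therefore hold by `rfl`. -/
theorem Exec.frame {p : Prog} {s s' : State} {t : ℕ} (h : Exec p s s' t) : Frame p s s' := by
  induction h with
  | skip s => exact Frame.refl _ _
  | op o s => exact o.frame s
  | @seq p q _ _ _ _ _ _ _ ih1 ih2 =>
    exact (ih1.of_le (p := Prog.seq p q) (fun _ => or_false_left) (fun _ => or_false_left)
      or_false_left or_false_left).trans (ih2.of_le (fun _ => or_false_right)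
      (fun _ => or_false_right) or_false_right or_false_right)
  | @ite_true x y p q _ _ _ _ _ ih =>
    exact ih.of_le (p := Prog.ite x y p q) (fun _ => or_false_left) (fun _ => or_false_left)
      or_false_left or_false_left
  | @ite_false x y p q _ _ _ _ _ ih =>
    exact ih.of_le (p := Prog.ite x y p q) (fun _ => or_false_right) (fun _ => or_false_right)
      or_false_right or_false_right
  | @loop_true x y p _ _ _ _ _ _ _ _ ih1 ih2 =>
    exact (ih1.of_le (p := Prog.loop x y p) (fun _ h => h) (fun _ h => h) (fun h => h)
      (fun h => h)).trans ih2
  | loop_false _ => exact Frame.refl _ _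

theorem Runs.frame {p : Prog} {s : State} {T : ℕ} {Q : State → ℕ → Prop} (h : Runs p s T Q) :
    Runs p s T fun s' T' => Frame p s s' ∧ Q s' T' :=
  let ⟨s', t, h1, h2⟩ := h
  ⟨s', t, h1, h1.frame, h2⟩

/-! ### Reading off states -/

@[simp] theorem State.setReg_reg (s : State) (x n y : ℕ) :
    (s.setReg x n).reg y = if y = x then n else s.reg y := Function.update_apply ..
@[simp] theorem State.setReg_arr (s : State) (x n : ℕ) : (s.setReg x n).arr = s.arr := rfl
@[simp] theorem State.setReg_inp (s : State) (x n : ℕ) : (s.setReg x n).inp = s.inp := rfl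
@[simp] theorem State.setReg_out (s : State) (x n : ℕ) : (s.setReg x n).out = s.out := rfl
@[simp] theorem State.setArr_reg (s : State) (A i j n : ℕ) : (s.setArr A i j n).reg = s.reg := rfl
@[simp] theorem State.setArr_inp (s : State) (A i j n : ℕ) : (s.setArr A i j n).inp = s.inp := rfl
@[simp] theorem State.setArr_out (s : State) (A i j n : ℕ) : (s.setArr A i j n).out = s.out := rfl
theorem State.setArr_arr (s : State) (A i j n B k l : ℕ) :
    (s.setArr A i j n).arr B k l = if B = A ∧ k = i ∧ l = j then n else s.arr B k l := rfl
@[simp] theorem State.setArr_arr_same (s : State) (A i j n k l : ℕ) :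
    (s.setArr A i j n).arr A k l = if k = i ∧ l = j then n else s.arr A k l := by
  simp [State.setArr_arr]
theorem State.setArr_arr_ne (s : State) (A i j n B : ℕ) (h : B ≠ A) :
    (s.setArr A i j n).arr B = s.arr B := by
  funext k l
  exact if_neg fun h' => h h'.1

/-! ### Counting loops -/

/-- `for i in [0, n)`, the bound being the content of a register. -/
def Prog.for (i n : ℕ) (p : Prog) : Prog :=
  Prog.seq (Prog.op (Op.const i 0)) (Prog.loop i n (Prog.seq p (Prog.op (Op.inc i))))

/-- Invariant rule for counting loops. -/
theorem runs_for {i n : ℕ} {p : Prog} {s : State} {T : ℕ} {Q : State → ℕ → Prop}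
    (Inv : ℕ → State → ℕ → Prop) (hi : p.setsReg i = false) (hn : p.setsReg n = false)
    (hin : n ≠ i) (h0 : Inv 0 (s.setReg i 0) (T + 1))
    (hstep : ∀ k s' T', k < s.reg n → s'.reg i = k → Frame (Prog.for i n p) s s' → Inv k s' T' →
      Runs p s' (T' + 1) fun s'' T'' => Inv (k + 1) (s''.setReg i (k + 1)) (T'' + 1))
    (hQ : ∀ s' T', Frame (Prog.for i n p) s s' → Inv (s.reg n) s' T' → Q s' (T' + 1)) :
    Runs (Prog.for i n p) s T Q := by
  have hreg : ∀ r, r ≠ i → p.setsReg r = false → (Prog.for i n p).setsReg r = false := by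
    intro r hr hp
    have h1 : Nat.beq i r = false := by
      cases h : Nat.beq i r
      · rfl
      · exact absurd (Nat.eq_of_beq_eq_true h).symm hr
    simp [Prog.for, Prog.setsReg, Op.setsReg, hp, h1]
  have hfr : ∀ s s' : State, Frame p s s' →
      ∀ k, Frame (Prog.for i n p) s (s'.setReg i k) := by
    intro s s' h k
    refine ⟨fun r hr => ?_, fun A hA => ?_, fun h1 => ?_, fun h1 => ?_⟩
    · simp only [Prog.for, Prog.setsReg, Bool.or_eq_false_iff, Op.setsReg] at hr
      rw [State.setReg_reg, if_neg (beq_ne hr.1), h.reg r hr.2.1]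
    · simp only [Prog.for, Prog.setsArr, Bool.or_eq_false_iff] at hA
      rw [State.setReg_arr, h.arr A hA.2.1]
    · simp only [Prog.for, Prog.reads, Bool.or_eq_false_iff] at h1
      rw [State.setReg_inp, h.inp h1.2.1]
    · simp only [Prog.for, Prog.writes, Bool.or_eq_false_iff] at h1
      rw [State.setReg_out, h.out h1.2.1]
  -- Induction on the number `m` of iterations still to come; the bound register and, inside the
  -- body, the counter are unchanged by the footprint conditions.
  have key : ∀ m k s' T', k + m = s.reg n → s'.reg i = k → Frame (Prog.for i n p) s s' →
      Inv k s' T' → Runs (Prog.loop i n (Prog.seq p (Prog.op (Op.inc i)))) s' T' Q := by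
    intro m
    induction m with
    | zero =>
      intro k s' T' hk hki hf hI
      refine ⟨s', 1, Exec.loop_false ?_, ?_⟩
      · rw [hf.reg n (hreg n hin hn), hki]
        omega
      · exact hQ s' T' hf (by rwa [← hk])
    | succ m ih =>
      intro k s' T' hk hki hf hI
      obtain ⟨s1, t1, h1, hI1⟩ := hstep k s' T' (by omega) hki hf hI
      have hk1 : s1.reg i = k := by rw [h1.frame.reg i hi, hki]
      obtain ⟨s2, t2, h2, hQ2⟩ := ih (k + 1) (s1.setReg i (k + 1)) (T' + 1 + t1 + 1) (by omega)
        (by simp) (hf.trans (hfr _ _ h1.frame _)) hI1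
      refine ⟨s2, t1 + 1 + t2 + 1, Exec.loop_true ?_ (Exec.seq h1 (Exec.op _ _)) ?_, ?_⟩
      · rw [hf.reg n (hreg n hin hn), hki]
        omega
      · rw [Op.run, hk1]
        exact h2
      · rwa [show T' + (t1 + 1 + t2 + 1) = T' + 1 + t1 + 1 + t2 by omega]
  unfold Prog.for
  rw [runs_seq, runs_op]
  exact key (s.reg n) 0 _ _ (by omega) (by simp [Op.run]) (hfr s s (Frame.refl _ _) 0) h0

end Ram

/-! ### Topological sorting in linear time on the machine -/

namespace Ram

attribute [simp] runs_skip runs_op runs_seq runs_ite Op.run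

infixr:60 " ;; " => Prog.seq

/-- The targets of the arcs out of `u`. -/
def targets (arcs : List (ℕ × ℕ)) (u : ℕ) : List ℕ :=
  (arcs.filter fun a => a.1 = u).map Prod.snd

/-- The arrays `K`, `K + 1`, `K + 2` hold the lists of targets, their lengths, and the in-degrees of
a directed graph. -/
structure HasGraph (K : ℕ) (arcs : List (ℕ × ℕ)) (s : State) : Prop where
  adj : ∀ u i (h : i < (targets arcs u).length), s.arr K u i = (targets arcs u)[i]
  deg : ∀ u, s.arr (K + 1) u 0 = (targets arcs u).length
  ind : ∀ v, s.arr (K + 2) v 0 = arcs.countP fun a => a.2 = v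

/-- Adds an arc from register 40 to register 41. -/
def addArc (K : ℕ) : Prog :=
  .op (.load 42 (K + 1) 40 0) ;; .op (.store K 40 42 41) ;; .op (.inc 42) ;;
  .op (.store (K + 1) 40 0 42) ;; .op (.load 42 (K + 2) 41 0) ;; .op (.inc 42) ;;
  .op (.store (K + 2) 41 0 42)

theorem targets_concat (arcs : List (ℕ × ℕ)) (u v w : ℕ) :
    targets (arcs ++ [(u, v)]) w = targets arcs w ++ if w = u then [v] else [] := by
  unfold targets
  rw [List.filter_append, List.map_append]
  congr 1
  by_cases h : w = u
  · simp [h]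
  · simp [h, Ne.symm h]

theorem runs_addArc {K : ℕ} {arcs : List (ℕ × ℕ)} {s : State} {T : ℕ} (h : HasGraph K arcs s)
    (h0 : s.reg 0 = 0) :
    Runs (addArc K) s T fun s' T' =>
      HasGraph K (arcs ++ [(s.reg 40, s.reg 41)]) s' ∧ T' = T + 7 := by
  unfold addArc
  simp only [runs_seq, runs_op, Op.run]
  refine ⟨⟨?_, ?_, ?_⟩, trivial⟩
  · intro u i hi
    simp only [targets_concat] at hi ⊢
    simp only [State.setArr_arr, State.setReg_arr, State.setReg_reg, State.setArr_reg]
    have h1 := h.deg (s.reg 40)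
    by_cases hu : u = s.reg 40
    · subst hu
      simp only [if_true, List.length_append, List.length_singleton] at hi
      simp only [h0, h1]
      rcases Nat.lt_succ_iff_lt_or_eq.1 hi with h2 | h2
      · have := h.adj _ i h2
        simp [this, h2.ne, List.getElem_append_left h2]
      · subst h2
        simp
    · simp only [hu, if_false, List.append_nil] at hi
      have := h.adj _ i hi
      simp [this, hu]
  · intro u
    simp only [targets_concat, State.setArr_arr, State.setReg_arr, State.setReg_reg,
      State.setArr_reg]
    have h1 := h.deg (s.reg 40)
    by_cases hu : u = s.reg 40
    · subst hu
      simp [h0, h1]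
    · have := h.deg u
      simp [this, hu]
  · intro v
    have h1 := h.ind (s.reg 41)
    simp only [State.setArr_arr, State.setReg_arr, State.setReg_reg, State.setArr_reg,
      List.countP_append]
    by_cases hv : v = s.reg 41
    · subst hv
      simp [h0, h1]
    · have := h.ind v
      simp [this, hv, Ne.symm hv]

/-- Kahn's algorithm on the graph with as many nodes as register 43 says; the nodes are listed in a
topological order in array `K + 3`. -/
def kahn (K : ℕ) : Prog :=
  .op (.const 44 0) ;; .op (.const 51 1) ;;
  .for 45 43 (.op (.load 50 (K + 2) 45 0) ;;
    .ite 50 51 (.op (.store (K + 3) 44 0 45) ;; .op (.inc 44)) .skip) ;;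
  .for 45 43 (.op (.load 47 (K + 3) 45 0) ;; .op (.load 49 (K + 1) 47 0) ;;
    .for 46 49 (.op (.load 48 K 47 46) ;; .op (.load 50 (K + 2) 48 0) ;; .op (.dec 50) ;;
      .op (.store (K + 2) 48 0 50) ;;
      .ite 50 51 (.op (.store (K + 3) 44 0 48) ;; .op (.inc 44)) .skip))

/-- The state of Kahn's algorithm: `q` has been listed, the arcs out of the first `h` nodes of it
have been removed except those to the nodes in `rest`. -/
structure KahnInv (K : ℕ) (arcs : List (ℕ × ℕ)) (n : ℕ) (q : List ℕ) (h : ℕ) (rest : List ℕ)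
    (s : State) : Prop where
  nodup : q.Nodup
  lt : ∀ x ∈ q, x < n
  le : h ≤ q.length
  list : ∀ i (hi : i < q.length), s.arr (K + 3) i 0 = q[i]
  len : s.reg 44 = q.length
  ind : ∀ v, s.arr (K + 2) v 0 =
    arcs.countP (fun a => a.2 = v ∧ a.1 ∉ q.take h) + rest.count v
  mem : ∀ v, v < n → (v ∈ q ↔ s.arr (K + 2) v 0 = 0)
  order : ∀ i (hi : i < q.length), ∀ u, (u, q[i]) ∈ arcs → u ∈ q.take i

/-- Removing one arc into `v`. As that arc was still counted, the in-degree of `v` was positive and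
`v` had not been listed. If the in-degree drops to zero, `v` is appended, which leaves the processed
prefix of length `h` untouched. -/
theorem KahnInv.step {K : ℕ} {arcs : List (ℕ × ℕ)} {n : ℕ} {q : List ℕ} {h v : ℕ}
    {rest : List ℕ} {s s' : State} (I : KahnInv K arcs n q h (v :: rest) s) (hv : v < n)
    (hind : ∀ w, s'.arr (K + 2) w 0 = if w = v then s.arr (K + 2) w 0 - 1
      else s.arr (K + 2) w 0)
    (hlist : ∀ i, s'.arr (K + 3) i 0 = if s.arr (K + 2) v 0 - 1 < 1 ∧ i = s.reg 44 then v
      else s.arr (K + 3) i 0)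
    (hlen : s'.reg 44 = if s.arr (K + 2) v 0 - 1 < 1 then s.reg 44 + 1 else s.reg 44) :
    ∃ q', KahnInv K arcs n q' h rest s' ∧ q'.take h = q.take h := by
  have hiv := I.ind v
  rw [List.count_cons_self] at hiv
  have hvq : v ∉ q := by
    rw [I.mem v hv]
    omega
  have hind' : ∀ (q' : List ℕ), q'.take h = q.take h → ∀ w, s'.arr (K + 2) w 0 =
      arcs.countP (fun a => a.2 = w ∧ a.1 ∉ q'.take h) + rest.count w := by
    intro q' hq' w
    rw [hind, hq']
    have := I.ind w
    split_ifs with hw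
    · subst hw
      rw [List.count_cons_self] at this
      omega
    · rw [List.count_cons_of_ne (Ne.symm hw)] at this
      exact this
  by_cases h1 : s.arr (K + 2) v 0 - 1 < 1
  · have htake : (q ++ [v]).take h = q.take h := List.take_append_of_le_length I.le
    refine ⟨q ++ [v], ⟨?_, ?_, ?_, ?_, ?_, hind' _ htake, ?_, ?_⟩, htake⟩
    · exact List.nodup_append.2 ⟨I.nodup, by simp, fun a ha b hb hab => hvq (by
        rw [List.mem_singleton] at hb; rwa [← hb, ← hab])⟩
    · intro x hx
      rcases List.mem_append.1 hx with hx | hx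
      · exact I.lt x hx
      · rw [List.mem_singleton] at hx; omega
    · have := I.le
      simp only [List.length_append, List.length_singleton]; omega
    · intro i hi
      rw [hlist, I.len]
      rw [List.length_append, List.length_singleton] at hi
      by_cases hi' : i = q.length
      · subst hi'
        simp [h1]
      · rw [if_neg fun h => hi' h.2, List.getElem_append_left (by omega)]
        exact I.list i (by omega)
    · rw [hlen, if_pos h1, I.len]
      simp
    · intro w hw
      rw [List.mem_append, List.mem_singleton, hind]
      split_ifs with hwv
      · subst hwv
        simp; omega
      · rw [← I.mem w hw]
        simp [hwv]
    · intro i hi u hu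
      rw [List.length_append, List.length_singleton] at hi
      by_cases hi' : i = q.length
      · subst hi'
        rw [List.getElem_append_right le_rfl] at hu
        simp only [Nat.sub_self, List.getElem_cons_zero] at hu
        rw [List.take_append_of_le_length le_rfl, List.take_length]
        by_contra hnu
        -- An arc from an unlisted node would still be counted in the in-degree of `v`, which is
        -- zero after this step.
        have h3 : 0 < arcs.countP (fun a => a.2 = v ∧ a.1 ∉ q.take h) :=
          List.countP_pos_iff.2 ⟨_, hu, by simpa using fun h' => hnu (List.mem_of_mem_take h')⟩
        omega
      · rw [List.take_append_of_le_length (by omega)]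
        rw [List.getElem_append_left (by omega)] at hu
        exact I.order i (by omega) u hu
  · refine ⟨q, ⟨I.nodup, I.lt, I.le, ?_, ?_, hind' q rfl, ?_, I.order⟩, rfl⟩
    · intro i hi
      rw [hlist, if_neg fun h => h1 h.1]
      exact I.list i hi
    · rw [hlen, if_neg h1, I.len]
    · intro w hw
      rw [I.mem w hw, hind]
      split_ifs with hwv
      · subst hwv; omega
      · rfl

/-- When `u` joins the processed nodes, the arcs out of `u` move from the counted in-degrees to the
list of arcs yet to be removed, and the stored in-degrees remain correct. -/
theorem targets_count (arcs : List (ℕ × ℕ)) (u v : ℕ) (l : List ℕ) (hu : u ∉ l) :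
    arcs.countP (fun a => a.2 = v ∧ a.1 ∉ l) =
      arcs.countP (fun a => a.2 = v ∧ a.1 ∉ l ++ [u]) + (targets arcs u).count v := by
  induction arcs with
  | nil => rfl
  | cons a arcs ih =>
    have : targets (a :: arcs) u = (if a.1 = u then [a.2] else []) ++ targets arcs u := by
      unfold targets
      by_cases h : a.1 = u <;> simp [h]
    rw [List.countP_cons, List.countP_cons, ih, this, List.count_append]
    by_cases h1 : a.1 = u <;> by_cases h2 : a.2 = v <;> by_cases h3 : a.1 ∈ l <;>
      simp_all <;> omega

/-- The amortisation: the out-degrees of the processed nodes add up to a number of arcs, so that all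
runs of the inner loop together are linear. -/
theorem targets_length (arcs : List (ℕ × ℕ)) (u : ℕ) (l : List ℕ) (hu : u ∉ l) :
    arcs.countP (fun a => a.1 ∈ l ++ [u]) =
      arcs.countP (fun a => a.1 ∈ l) + (targets arcs u).length := by
  induction arcs with
  | nil => rfl
  | cons a arcs ih =>
    have : targets (a :: arcs) u = (if a.1 = u then [a.2] else []) ++ targets arcs u := by
      unfold targets
      by_cases h : a.1 = u <;> simp [h]
    rw [List.countP_cons, List.countP_cons, ih, this, List.length_append]
    by_cases h1 : a.1 = u <;> by_cases h3 : a.1 ∈ l <;> simp_all <;> omega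

theorem mem_targets {arcs : List (ℕ × ℕ)} {u v : ℕ} : v ∈ targets arcs u ↔ (u, v) ∈ arcs := by
  simp only [targets, List.mem_map, List.mem_filter, decide_eq_true_eq]
  constructor
  · rintro ⟨⟨a, b⟩, ⟨h1, rfl⟩, rfl⟩
    exact h1
  · exact fun h => ⟨(u, v), ⟨h, rfl⟩, rfl⟩

/-- Kahn's algorithm sorts an acyclic graph topologically in linear time. -/
theorem runs_kahn {K n : ℕ} {arcs : List (ℕ × ℕ)} {s : State} {T : ℕ} (hg : HasGraph K arcs s)
    (h0 : s.reg 0 = 0) (hn : s.reg 43 = n) (harcs : ∀ a ∈ arcs, a.1 < n ∧ a.2 < n)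
    (hacyc : ∀ A : Set ℕ, (∀ x ∈ A, x < n) → A.Nonempty →
      ∃ x ∈ A, ∀ y, (y, x) ∈ arcs → y ∉ A) :
    Runs (kahn K) s T fun s' T' => ∃ q : List ℕ, q.Nodup ∧ (∀ x, x ∈ q ↔ x < n) ∧
      (∀ i (hi : i < q.length), s'.arr (K + 3) i 0 = q[i]) ∧
      (∀ i (hi : i < q.length), ∀ u, (u, q[i]) ∈ arcs → u ∈ q.take i) ∧
      T' ≤ T + 20 * (n + arcs.length + 1) := by
  unfold kahn
  simp only [runs_seq, runs_op, Op.run]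
  -- The scan for sources: among the nodes seen so far, exactly those without incoming arcs are
  -- listed.
  refine runs_for (fun k s' T' => T' ≤ T + 3 + 6 * k ∧ ∃ q : List ℕ,
      q = (List.range k).filter (fun v => arcs.countP (fun a => a.2 = v) = 0) ∧
      (∀ i (hi : i < q.length), s'.arr (K + 3) i 0 = q[i]) ∧ s'.reg 44 = q.length ∧
      s'.arr (K + 2) = s.arr (K + 2) ∧ s'.arr (K + 1) = s.arr (K + 1) ∧ s'.arr K = s.arr K)
    rfl rfl (by decide) ?_ ?_ ?_
  · refine ⟨by omega, [], by simp, by simp, by simp, ?_⟩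
    simp
  · rintro k s1 T1 hk hi hf ⟨hT, q, hq, hl, hlen, e2, e1, e0⟩
    have r0 : s1.reg 0 = 0 := (hf.reg 0 rfl).trans (by simpa using h0)
    have r51 : s1.reg 51 = 1 := (hf.reg 51 rfl).trans (by simp)
    have hdeg := hg.ind k
    simp only [runs_seq, runs_op, Op.run, runs_ite, runs_skip, State.setReg_reg, r0, r51, hi, e2,
      hdeg, ↓reduceIte, Nat.reduceEqDiff, OfNat.zero_ne_ofNat]
    have hfil : (List.range (k + 1)).filter (fun v => arcs.countP (fun a => a.2 = v) = 0) =
        q ++ if arcs.countP (fun a => a.2 = k) = 0 then [k] else [] := by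
      rw [List.range_succ, List.filter_append, hq]
      congr 1
      by_cases h : arcs.countP (fun a => a.2 = k) = 0 <;> simp [h]
    by_cases h1 : arcs.countP (fun a => a.2 = k) = 0
    · rw [if_pos h1] at hfil
      rw [if_pos (by omega)]
      refine ⟨by simp; omega, _, hfil.symm, ?_, ?_, ?_, ?_, ?_⟩
      · intro i hi'
        rw [List.length_append, List.length_singleton] at hi'
        by_cases h2 : i = q.length
        · subst h2
          simp [hlen]
        · rw [List.getElem_append_left (by omega)]
          simp [hlen, h2, hl i (by omega)]
      · simp [hlen]
      · simpa [State.setArr_arr_ne] using e2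
      · simpa [State.setArr_arr_ne] using e1
      · simpa [State.setArr_arr_ne] using e0
    · rw [if_neg h1, List.append_nil] at hfil
      rw [if_neg (by omega)]
      exact ⟨by simp; omega, _, hfil.symm, by simpa using hl, by simpa using hlen,
        by simpa using e2, by simpa using e1, by simpa using e0⟩
  · rintro s1 T1 hf ⟨hT, q, hq, hl, hlen, e2, e1, e0⟩
    have r0 : s1.reg 0 = 0 := (hf.reg 0 rfl).trans (by simpa using h0)
    have r43 : s1.reg 43 = n := (hf.reg 43 rfl).trans (by simpa using hn)
    have r51 : s1.reg 51 = 1 := (hf.reg 51 rfl).trans (by simp)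
    have hn' : ((s.setReg 44 0).setReg 51 1).reg 43 = n := by simpa using hn
    rw [hn'] at hT hq
    -- Besides a constant per node, the time is charged to the arcs that leave the first `k` nodes
    -- of the list.
    refine runs_for (fun k s' T' => ∃ q : List ℕ, KahnInv K arcs n q k [] s' ∧
      s'.arr (K + 1) = s.arr (K + 1) ∧ s'.arr K = s.arr K ∧
      T' ≤ T + 5 + 6 * n + 6 * k + 10 * arcs.countP (fun a => a.1 ∈ q.take k))
      rfl rfl (by decide) ?_ ?_ ?_
    · refine ⟨q, ⟨?_, ?_, Nat.zero_le _, ?_, ?_, ?_, ?_, ?_⟩, ?_, ?_, ?_⟩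
      · rw [hq]; exact List.nodup_range.filter _
      · intro x hx
        rw [hq, List.mem_filter, List.mem_range] at hx
        exact hx.1
      · simpa using hl
      · simpa using hlen
      · intro v
        simp [e2, hg.ind v]
      · intro v hv
        rw [hq, List.mem_filter, List.mem_range, State.setReg_arr, e2, hg.ind v]
        simp [hv]
      · intro i hi u hu
        have h3 : ∀ x ∈ q, _ := fun x hx => (List.mem_filter.1 (hq ▸ hx)).2
        replace h3 := h3 _ (List.getElem_mem hi)
        simp only [decide_eq_true_eq] at h3
        rw [List.countP_eq_zero] at h3
        exact absurd (h3 _ hu) (by simp)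
      · simpa using e1
      · simpa using e0
      · simp
        omega
    · rintro k s2 T2 hk hi hf2 ⟨q, I, d1, d0, hT2⟩
      rw [r43] at hk
      have z0 : s2.reg 0 = 0 := (hf2.reg 0 rfl).trans r0
      have z51 : s2.reg 51 = 1 := (hf2.reg 51 rfl).trans r51
      -- The list is not exhausted before all nodes are on it. Otherwise acyclicity gives an
      -- unlisted node whose incoming arcs all come from listed nodes. All of those arcs have been
      -- removed, so its in-degree is zero and it would be listed.
      have hkq : k < q.length := by
        by_contra hkq
        have htq : q.take k = q := List.take_of_length_le (by omega)
        have hne : ({x | x < n ∧ x ∉ q} : Set ℕ).Nonempty := by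
          by_contra hne
          rw [Set.not_nonempty_iff_eq_empty] at hne
          have hsub : List.range n ⊆ q := by
            intro x hx
            by_contra hxq
            exact (Set.ext_iff.1 hne x).1 ⟨List.mem_range.1 hx, hxq⟩
          have := (List.nodup_range.subperm hsub).length_le
          rw [List.length_range] at this
          omega
        obtain ⟨x, ⟨hx, hxq⟩, hx2⟩ := hacyc _ (fun x hx => hx.1) hne
        apply hxq
        rw [I.mem x hx, I.ind x, htq, List.count_nil, Nat.add_zero, List.countP_eq_zero]
        rintro ⟨y, x'⟩ hy
        simp only [decide_eq_true_eq, not_and, not_not]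
        rintro rfl
        by_contra hyq
        exact hx2 y hy ⟨(harcs _ hy).1, hyq⟩
      have hnotin : q[k] ∉ q.take k := by
        intro h
        obtain ⟨j, hj, he⟩ := List.mem_iff_getElem.1 h
        rw [List.length_take] at hj
        rw [List.getElem_take] at he
        have := (I.nodup.getElem_inj_iff).1 he
        omega
      have htk : q.take (k + 1) = q.take k ++ [q[k]] := by
        rw [List.take_add_one, List.getElem?_eq_getElem hkq]; rfl
      simp only [runs_seq, runs_op, Op.run]
      -- While the arcs out of `q[k]` are removed the list may grow, but its first `k + 1` entries
      -- stay.
      refine runs_for (fun j s' T' => ∃ q' : List ℕ, q'.take (k + 1) = q.take (k + 1) ∧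
        KahnInv K arcs n q' (k + 1) ((targets arcs q[k]).drop j) s' ∧
        s'.arr (K + 1) = s.arr (K + 1) ∧ s'.arr K = s.arr K ∧ T' ≤ T2 + 4 + 10 * j)
        rfl rfl (by decide) ?_ ?_ ?_
      · refine ⟨q, rfl, ⟨I.nodup, I.lt, hkq, ?_, ?_, ?_, ?_, I.order⟩, ?_, ?_, ?_⟩
        · simpa using I.list
        · simpa using I.len
        · intro v
          rw [List.drop_zero, htk, ← targets_count arcs _ v _ hnotin]
          simpa using I.ind v
        · simpa using I.mem
        · simpa using d1
        · simpa using d0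
        · omega
      · rintro j s3 T3 hj hji hf3 ⟨q', hq', I', c1, c0, hT3⟩
        have y0 : s3.reg 0 = 0 := (hf3.reg 0 rfl).trans (by simpa using z0)
        have y51 : s3.reg 51 = 1 := (hf3.reg 51 rfl).trans (by simpa using z51)
        have y47 : s3.reg 47 = q[k] := (hf3.reg 47 rfl).trans (by
          simpa [z0, hi] using I.list k hkq)
        have hdeg := hg.deg q[k]
        rw [← d1] at hdeg
        have hlk := I.list k hkq
        have hj' : j < (targets arcs q[k]).length := by
          simpa [z0, hi, hlk, hdeg] using hj
        have hv : s3.arr K q[k] j = (targets arcs q[k])[j] := by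
          rw [c0]
          exact hg.adj _ _ hj'
        rw [List.drop_eq_getElem_cons hj'] at I'
        set v := (targets arcs q[k])[j] with hvdef
        have hvn : v < n := (harcs _ (mem_targets.1 (List.getElem_mem hj'))).2
        simp only [runs_seq, runs_op, runs_ite, runs_skip, Op.run, State.setReg_reg,
          State.setReg_arr, State.setArr_reg, y0, y47, y51, hji, hv, ↓reduceIte, Nat.reduceEqDiff,
          OfNat.zero_ne_ofNat]
        have hfin : ∀ s' : State, (∀ w, s'.arr (K + 2) w 0 = if w = v then s3.arr (K + 2) w 0 - 1
            else s3.arr (K + 2) w 0) → (∀ i, s'.arr (K + 3) i 0 =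
            if s3.arr (K + 2) v 0 - 1 < 1 ∧ i = s3.reg 44 then v else s3.arr (K + 3) i 0) →
            (s'.reg 44 = if s3.arr (K + 2) v 0 - 1 < 1 then s3.reg 44 + 1 else s3.reg 44) →
            s'.arr (K + 1) = s.arr (K + 1) → s'.arr K = s.arr K →
            ∀ T', T' ≤ T2 + 4 + 10 * (j + 1) →
            ∃ q' : List ℕ, q'.take (k + 1) = q.take (k + 1) ∧
              KahnInv K arcs n q' (k + 1) ((targets arcs q[k]).drop (j + 1)) s' ∧
              s'.arr (K + 1) = s.arr (K + 1) ∧ s'.arr K = s.arr K ∧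
              T' ≤ T2 + 4 + 10 * (j + 1) := by
          intro s' a1 a2 a3 a4 a5 T' hT'
          obtain ⟨q'', I'', hq''⟩ := I'.step hvn a1 a2 a3
          exact ⟨q'', hq''.trans hq', I'', a4, a5, hT'⟩
        by_cases h1 : s3.arr (K + 2) v 0 - 1 < 1
        · rw [if_pos (by omega)]
          apply hfin
          · intro w
            simp [State.setArr_arr]
            split_ifs with hw
            · rw [hw]
            · rfl
          · intro i
            simp [State.setArr_arr, h1]
          · simp [h1]
          · simpa [State.setArr_arr_ne] using c1
          · simpa [State.setArr_arr_ne] using c0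
          · simp; omega
        · rw [if_neg (by omega)]
          apply hfin
          · intro w
            simp [State.setArr_arr]
            split_ifs with hw
            · rw [hw]
            · rfl
          · intro i
            simp [State.setArr_arr, h1]
          · simp [h1]
          · simpa [State.setArr_arr_ne] using c1
          · simpa [State.setArr_arr_ne] using c0
          · simp; omega
      · rintro s3 T3 hf3 ⟨q', hq', I', c1, c0, hT3⟩
        have hdeg := hg.deg q[k]
        rw [← d1] at hdeg
        have hlk := I.list k hkq
        have he : ((s2.setReg 47 (s2.arr (K + 3) (s2.reg 45) (s2.reg 0))).setReg 49
          ((s2.setReg 47 (s2.arr (K + 3) (s2.reg 45) (s2.reg 0))).arr (K + 1)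
          ((s2.setReg 47 (s2.arr (K + 3) (s2.reg 45) (s2.reg 0))).reg 47)
          ((s2.setReg 47 (s2.arr (K + 3) (s2.reg 45) (s2.reg 0))).reg 0))).reg 49 =
            (targets arcs q[k]).length := by
          simp [z0, hi, hlk, hdeg]
        rw [he] at I' hT3
        rw [List.drop_length] at I'
        refine ⟨q', ⟨I'.nodup, I'.lt, I'.le, ?_, ?_, ?_, ?_, I'.order⟩, ?_, ?_, ?_⟩
        · simpa using I'.list
        · simpa using I'.len
        · simpa using I'.ind
        · simpa using I'.mem
        · simpa using c1
        · simpa using c0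
        · rw [hq', htk, targets_length arcs _ _ hnotin]
          omega
    · rintro s2 T2 hf2 ⟨q, I, d1, d0, hT2⟩
      rw [r43] at I hT2
      have hlen : q.length = n := by
        refine le_antisymm ?_ I.le
        have := (I.nodup.subperm fun x hx => List.mem_range.2 (I.lt x hx)).length_le
        rwa [List.length_range] at this
      refine ⟨q, I.nodup, fun x => ⟨I.lt x, fun hx => ?_⟩, I.list, I.order, ?_⟩
      · by_contra hxq
        have := (List.nodup_cons.2 ⟨hxq, I.nodup⟩).subperm (l₂ := List.range n) (by
          intro y hy
          rcases List.mem_cons.1 hy with rfl | hy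
          · exact List.mem_range.2 hx
          · exact List.mem_range.2 (I.lt y hy))
        have := this.length_le
        rw [List.length_range, List.length_cons] at this
        omega
      · have := List.countP_le_length (p := fun a : ℕ × ℕ => decide (a.1 ∈ q.take n)) (l := arcs)
        omega

end Ram

set_option linter.unusedSectionVars false

/-! ### Numbers of sequences, the list of blocks, and the number of coordinates -/

namespace Skel

variable {S : Skel}

/-- The number of a sequence. -/
def sid (S : Skel) (s : ℕ × ℕ) : ℕ := (∑ Z ∈ Finset.range s.1, S.na Z) + s.2

/-- The second number of the pair is that of an action at the information set of the first. -/
def IsSeq (S : Skel) (s : ℕ × ℕ) : Prop := s.2 < S.na s.1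

/-- The sequences at one information set occupy an interval that ends before that of the next
information set. For pairs that are not sequences the numbers may clash, hence the hypothesis. -/
theorem sid_lt {s t : ℕ × ℕ} (hs : S.IsSeq s) (h : s.1 < t.1) : S.sid s < S.sid t := by
  have h1 : ∑ Z ∈ Finset.range (s.1 + 1), S.na Z ≤ ∑ Z ∈ Finset.range t.1, S.na Z :=
    Finset.sum_le_sum_of_subset (Finset.range_subset_range.2 h)
  rw [Finset.sum_range_succ] at h1
  unfold IsSeq at hs
  unfold sid
  omega

theorem sid_inj {s t : ℕ × ℕ} (hs : S.IsSeq s) (ht : S.IsSeq t) (h : S.sid s = S.sid t) :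
    s = t := by
  rcases lt_trichotomy s.1 t.1 with h1 | h1 | h1
  · exact absurd h (sid_lt hs h1).ne
  · unfold sid at h
    rw [h1] at h
    exact Prod.ext h1 (by omega)
  · exact absurd h (sid_lt ht h1).ne'

open Classical in
/-- The later and the earlier one of two connected information sets. -/
noncomputable def orient (S : Skel) (e : ℕ × ℕ) : ℕ × ℕ :=
  if S.Branch e.1 e.2 then e else e.swap

/-- The pairs `(X, Y)` of connected information sets such that `Y` precedes `X`. -/
noncomputable def pairs (S : Skel) : List (ℕ × ℕ) :=
  ((List.range (S.n + 1)).map fun X => (X, 0)) ++ S.edges.map S.orient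

/-- The blocks for a pair of information sets. -/
def blks (S : Skel) (p : ℕ × ℕ) : List Blk := (List.range (S.na p.2)).map fun b => (p.1, p.2, b)

/-- All blocks, after `(0, 0, 0)`. -/
noncomputable def blkList (S : Skel) : List Blk := S.pairs.flatMap S.blks

namespace WF

variable (H : S.WF)
include H

theorem isSeq_sg {X : ℕ} (hX : X ≤ S.n) : S.IsSeq (S.sg X) := H.pa_lt X hX

theorem mem_pairs {X Y : ℕ} : (X, Y) ∈ S.pairs ↔ (X = 0 ∧ Y = 0) ∨ S.Bef Y X := by
  simp only [pairs, List.mem_append, List.mem_map, List.mem_range, Prod.mk.injEq, orient]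
  constructor
  · rintro (⟨X', hX', rfl, rfl⟩ | ⟨e, he, h⟩)
    · rcases Nat.eq_zero_or_pos X' with h | h
      · exact Or.inl ⟨h, rfl⟩
      · exact Or.inr (Or.inl ⟨rfl, h, by omega⟩)
    · obtain ⟨I, J⟩ := e
      right
      split_ifs at h with hb
      · simp only [Prod.mk.injEq] at h
        obtain ⟨rfl, rfl⟩ := h
        exact Or.inr (Or.inl ⟨he, hb⟩)
      · simp only [Prod.swap_prod_mk, Prod.mk.injEq] at h
        obtain ⟨rfl, rfl⟩ := h
        exact Or.inr (Or.inr ⟨he, hb⟩)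
  · rintro (⟨rfl, rfl⟩ | ⟨rfl, h1, h2⟩ | ⟨h1, h2⟩ | ⟨h1, h2⟩)
    · exact Or.inl ⟨0, by omega, rfl, rfl⟩
    · exact Or.inl ⟨X, by omega, rfl, rfl⟩
    · exact Or.inr ⟨_, h1, by rw [if_pos h2]⟩
    · exact Or.inr ⟨_, h1, by rw [if_neg h2]; rfl⟩

theorem pairs_nodup : S.pairs.Nodup := by
  refine List.nodup_append.2 ⟨List.nodup_range.map fun a b h => by simpa using h, ?_, ?_⟩
  · refine List.Nodup.map_on ?_ H.edges_nodup
    rintro ⟨I, J⟩ h ⟨I', J'⟩ h' he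
    have h1 := H.edges_mem _ _ h
    have h2 := H.edges_mem _ _ h'
    unfold orient at he
    split_ifs at he <;> simp only [Prod.swap_prod_mk, Prod.mk.injEq] at he ⊢ <;> omega
  · rintro p hp p' hp' rfl
    obtain ⟨X, -, rfl⟩ := List.mem_map.1 hp
    obtain ⟨⟨I, J⟩, h, he⟩ := List.mem_map.1 hp'
    have h1 := H.edges_mem _ _ h
    unfold orient at he
    split_ifs at he <;> simp only [Prod.swap_prod_mk, Prod.mk.injEq] at he <;> omega

omit H in
theorem mem_blks {p : ℕ × ℕ} {k : Blk} :
    k ∈ S.blks p ↔ k.1 = p.1 ∧ k.2.1 = p.2 ∧ k.2.2 < S.na p.2 := by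
  obtain ⟨X, Y, b⟩ := k
  simp only [blks, List.mem_map, List.mem_range, Prod.mk.injEq]
  constructor
  · rintro ⟨b', h, rfl, rfl, rfl⟩
    exact ⟨rfl, rfl, h⟩
  · rintro ⟨rfl, rfl, h⟩
    exact ⟨b, h, rfl, rfl, rfl⟩

theorem mem_blkList {k : Blk} : k ∈ S.blkList ↔ k = (0, 0, 0) ∨ S.IsBlk k := by
  obtain ⟨X, Y, b⟩ := k
  have hz := H.na_zero
  simp only [blkList, List.mem_flatMap, mem_blks, IsBlk, Prod.mk.injEq]
  constructor
  · rintro ⟨⟨X', Y'⟩, h, h1, h2, h3⟩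
    simp only at h1 h2 h3
    subst h1 h2
    rcases H.mem_pairs.1 h with ⟨rfl, rfl⟩ | h
    · left; omega
    · exact Or.inr ⟨h, h3⟩
  · rintro (⟨rfl, rfl, rfl⟩ | ⟨h1, h2⟩)
    · exact ⟨(0, 0), H.mem_pairs.2 (Or.inl ⟨rfl, rfl⟩), rfl, rfl, by simp [hz]⟩
    · exact ⟨(X, Y), H.mem_pairs.2 (Or.inr h1), rfl, rfl, h2⟩

omit H in
theorem flatMap_blks_nodup {P : List (ℕ × ℕ)} (hP : P.Nodup) : (P.flatMap S.blks).Nodup := by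
  refine List.nodup_flatMap.2 ⟨fun p _ => List.nodup_range.map fun a b h => by simpa using h, ?_⟩
  refine hP.imp ?_
  intro p p' hne
  simp only [Function.onFun, List.disjoint_left]
  intro k hk hk'
  rw [mem_blks] at hk hk'
  exact hne (Prod.ext (hk.1.symm.trans hk'.1) (hk.2.1.symm.trans hk'.2.1))

theorem blkList_nodup : S.blkList.Nodup := flatMap_blks_nodup H.pairs_nodup

/-- The dummy block `(0, 0, 0)` gets the number `0`. It is a node of the dependency graph, but
nothing is written for it, and it is recognised by its number. -/
theorem blkList_eq_cons : ∃ l, S.blkList = (0, 0, 0) :: l := by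
  have : S.pairs = (0, 0) :: ((List.range S.n).map (fun X => (X + 1, 0)) ++
      S.edges.map S.orient) := by
    simp [pairs, List.range_succ_eq_map, Function.comp_def]
  rw [blkList, this, List.flatMap_cons, blks, H.na_zero]
  exact ⟨_, rfl⟩

end WF

/-- The number of coordinates. -/
noncomputable def weight (S : Skel) : ℕ := (S.pairs.map fun p => S.na p.1 * S.na p.2).sum

theorem sum_map_flatMap_blks (f : ℕ → ℕ) (P : List (ℕ × ℕ)) :
    ((P.flatMap S.blks).map fun k => f k.1).sum = (P.map fun p => f p.1 * S.na p.2).sum := by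
  induction P with
  | nil => rfl
  | cons p P ih =>
    rw [List.flatMap_cons, List.map_append, List.sum_append, ih, List.map_cons, List.sum_cons]
    congr 1
    simp [blks, Function.comp_def, Nat.mul_comm]

theorem length_labelsOf (Q : List Blk) :
    (S.labelsOf Q).length = 1 + (Q.map fun k => S.na k.1).sum := by
  simp only [labelsOf, List.length_cons, List.length_flatMap, labels, List.length_map,
    List.length_range]
  omega

namespace WF

variable (H : S.WF)
include H

theorem length_le_weight {P : List (ℕ × ℕ)} (hP : ∀ p ∈ P, p.1 ≤ S.n ∧ p.2 ≤ S.n) :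
    P.length ≤ (P.map fun p => S.na p.1 * S.na p.2).sum := by
  have := List.sum_le_sum (l := P) (f := fun _ => 1) (g := fun p => S.na p.1 * S.na p.2)
    fun p hp => Nat.mul_pos (H.na_pos _ (hP p hp).1) (H.na_pos _ (hP p hp).2)
  simpa using this

theorem pairs_le {p : ℕ × ℕ} (h : p ∈ S.pairs) : p.1 ≤ S.n ∧ p.2 ≤ S.n := by
  obtain ⟨X, Y⟩ := p
  rcases H.mem_pairs.1 h with ⟨rfl, rfl⟩ | h
  · exact ⟨Nat.zero_le _, Nat.zero_le _⟩
  · have := H.bef_pos h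
    exact ⟨this.2.1, this.2.2⟩

/-- Every summand of the weight is at least one, so loops over information sets and edges are
affordable. -/
theorem card_add_edges_le_weight : S.n + 1 + S.edges.length ≤ S.weight := by
  have := H.length_le_weight fun p hp => H.pairs_le hp
  simpa [pairs, weight] using this

/-- The pairs `(X, 0)` alone contribute the number of actions, because set `0` has one action. -/
theorem sum_na_le_weight : ∑ X ∈ Finset.range (S.n + 1), S.na X ≤ S.weight := by
  have h : ∑ X ∈ Finset.range (S.n + 1), S.na X =
      (((List.range (S.n + 1)).map fun X => (X, 0)).map fun p => S.na p.1 * S.na p.2).sum := by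
    have h1 : ∀ m, ∑ X ∈ Finset.range m, S.na X = ((List.range m).map S.na).sum := by
      intro m
      induction m with
      | zero => rfl
      | succ m ih => simp [List.range_succ, Finset.sum_range_succ, ih]
    simp [h1, Function.comp_def, H.na_zero]
  rw [h, weight, pairs, List.map_append, List.sum_append]
  omega

theorem weight_eq : S.weight = (S.blkList.map fun k => S.na k.1).sum :=
  (sum_map_flatMap_blks S.na S.pairs).symm

theorem length_blkList_le : S.blkList.length ≤ S.weight := by
  rw [H.weight_eq]
  have := List.sum_le_sum (l := S.blkList) (f := fun _ => 1) (g := fun k => S.na k.1)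
    fun k hk => by
      rcases H.mem_blkList.1 hk with rfl | h
      · exact H.na_pos _ (Nat.zero_le _)
      · exact H.na_pos _ (H.bef_pos h.1).2.1
  simpa using this

end WF

/-! ### The dependency graph of the blocks -/

open Classical in
/-- The block of the pair of the parent sequence of `X` and a sequence `t`. -/
noncomputable def ownBlk (S : Skel) (X : ℕ) (t : ℕ × ℕ) : Blk :=
  if S.Bef t.1 (S.pi X) then (S.pi X, t)
  else if S.Bef (S.pi X) t.1 then (t.1, S.sg X) else (0, 0, 0)

/-- The arcs of the dependency graph that are due to a block. -/
noncomputable def blkArcs (S : Skel) (k : Blk) : List (Blk × Blk) :=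
  if k.1 = 0 then [] else
    (if k.2.1 = 0 then [] else [(k, k.1, S.sg k.2.1)]) ++ [(S.ownBlk k.1 k.2, k)]

/-- The number of a block. -/
noncomputable def bid (S : Skel) (k : Blk) : ℕ := @List.idxOf _ instBEqOfDecidableEq k S.blkList

/-- The dependency graph of the numbers of blocks. -/
noncomputable def arcs (S : Skel) (L : List Blk) : List (ℕ × ℕ) :=
  L.flatMap fun k => (S.blkArcs k).map (Prod.map S.bid S.bid)

theorem bid_lt {k : Blk} (h : k ∈ S.blkList) : S.bid k < S.blkList.length :=
  (@List.idxOf_lt_length_iff _ instBEqOfDecidableEq _ _ _).2 h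

theorem getElem_bid {k : Blk} (h : S.bid k < S.blkList.length) : S.blkList[S.bid k] = k :=
  @List.getElem_idxOf _ instBEqOfDecidableEq _ k S.blkList h

theorem WF.bid_getElem (H : S.WF) {i : ℕ} (h : i < S.blkList.length) :
    S.bid S.blkList[i] = i :=
  @List.Nodup.idxOf_getElem _ instBEqOfDecidableEq _ S.blkList H.blkList_nodup i h

namespace WF

variable (H : S.WF)
include H

theorem bid_root : S.bid (0, 0, 0) = 0 := by
  obtain ⟨l, hl⟩ := H.blkList_eq_cons
  simp [bid, hl]

theorem isBlk_of_fst {k : Blk} (hk : k ∈ S.blkList) (h0 : k.1 ≠ 0) : S.IsBlk k := by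
  rcases H.mem_blkList.1 hk with rfl | h
  · exact absurd rfl h0
  · exact h

/-- `S.ownBlk X t` is the block in which the pair of the parent sequence of `X` and `t` is a
coordinate; which side it is on depends on the direction of precedence. If neither set precedes the
other, both sequences are empty. -/
theorem ownBlk_cases {X : ℕ} {t : ℕ × ℕ} (h : S.Bef t.1 X) :
    (S.Bef t.1 (S.pi X) ∧ S.ownBlk X t = (S.pi X, t)) ∨
    (S.Bef (S.pi X) t.1 ∧ S.ownBlk X t = (t.1, S.sg X)) ∨
    (S.pi X = 0 ∧ t.1 = 0 ∧ S.ownBlk X t = (0, 0, 0)) := by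
  unfold ownBlk
  split_ifs with h1 h2
  · exact Or.inl ⟨h1, rfl⟩
  · exact Or.inr (Or.inl ⟨h2, rfl⟩)
  · refine Or.inr (Or.inr ?_)
    by_contra h3
    rcases H.bef_total (H.con_pi (bef_con h)) (by
      by_contra h4; push Not at h4; exact h3 ⟨h4.1, h4.2, rfl⟩) with h5 | h5
    · exact h2 h5
    · exact h1 h5

theorem mem_blkArcs {k u v : Blk} (hk : k ∈ S.blkList) (h : (u, v) ∈ S.blkArcs k) :
    S.Pre u v ∧ u ∈ S.blkList ∧ v ∈ S.blkList := by
  unfold blkArcs at h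
  split_ifs at h with h0 h1
  · simp at h
  all_goals
    have hb := H.isBlk_of_fst hk h0
    obtain ⟨X, Y, b⟩ := k
    have hbef : S.Bef Y X := hb.1
    have hbn : b < S.na Y := hb.2
    have hX := H.bef_pos hbef
    have hown : S.Pre (S.ownBlk X (Y, b)) (X, Y, b) ∧ S.ownBlk X (Y, b) ∈ S.blkList := by
      rw [H.mem_blkList]
      rcases H.ownBlk_cases (X := X) (t := (Y, b)) hbef with ⟨h2, h3⟩ | ⟨h2, h3⟩ | ⟨h2, h3, h4⟩
      · rw [h3]
        exact ⟨Pre.own hbef hbn h2, Or.inr ⟨h2, hbn⟩⟩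
      · rw [h3]
        exact ⟨Pre.opp hbef hbn h2, Or.inr ⟨h2, H.pa_lt X hX.2.1⟩⟩
      · simp only at h3
        subst h3
        rw [h4]
        have : b = 0 := by have := H.na_zero; omega
        subst this
        exact ⟨Pre.root hX.1 hX.2.1 h2, Or.inl rfl⟩
  · simp only [List.nil_append, List.mem_singleton, Prod.mk.injEq] at h
    rw [h.1, h.2]
    exact ⟨hown.1, hown.2, hk⟩
  · simp only [List.cons_append, List.nil_append, List.mem_cons, Prod.mk.injEq,
      List.not_mem_nil, or_false] at h
    rcases h with ⟨rfl, rfl⟩ | ⟨rfl, rfl⟩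
    · exact ⟨Pre.sum h1 hbef hbn, hk, H.mem_blkList.2 (Or.inr ⟨H.bef_pi hbef, H.pa_lt Y hX.2.2⟩)⟩
    · exact ⟨hown.1, hown.2, hk⟩

theorem mem_arcs {u v : ℕ} (h : (u, v) ∈ S.arcs S.blkList) :
    ∃ (hu : u < S.blkList.length) (hv : v < S.blkList.length),
      S.Pre S.blkList[u] S.blkList[v] := by
  obtain ⟨k, hk, h1⟩ := List.mem_flatMap.1 h
  obtain ⟨⟨a, b⟩, h2, h3⟩ := List.mem_map.1 h1
  obtain ⟨h4, ha, hb⟩ := H.mem_blkArcs hk h2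
  simp only [Prod.map_apply, Prod.mk.injEq] at h3
  obtain ⟨rfl, rfl⟩ := h3
  refine ⟨bid_lt ha, bid_lt hb, ?_⟩
  rwa [getElem_bid, getElem_bid]

/-- Arcs are dependencies, so this is well-foundedness in the form of `WF.exists_min`, carried over
to numbers. -/
theorem arcs_acyclic (A : Set ℕ) (hA : ∀ x ∈ A, x < S.blkList.length) (hne : A.Nonempty) :
    ∃ x ∈ A, ∀ y, (y, x) ∈ S.arcs S.blkList → y ∉ A := by
  obtain ⟨x, hx⟩ := hne
  obtain ⟨k, hk, hmin⟩ := H.exists_min (T := {k | k ∈ S.blkList ∧ S.bid k ∈ A})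
    (fun k hk => H.mem_blkList.1 hk.1)
    ⟨S.blkList[x]'(hA x hx), List.getElem_mem _, by rwa [H.bid_getElem]⟩
  refine ⟨S.bid k, hk.2, fun y hy hyA => ?_⟩
  obtain ⟨hu, hv, hP⟩ := H.mem_arcs hy
  rw [getElem_bid] at hP
  exact hmin _ hP ⟨List.getElem_mem _, by rwa [H.bid_getElem]⟩

-- Linear size of the graph: the arcs of kind `sum` are stored with their source block, which has
-- only one of them, and each block has one arc from the pair of the parent sequence.
omit H in
theorem length_arcs_le (L : List Blk) : (S.arcs L).length ≤ 2 * L.length := by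
  induction L with
  | nil => simp [arcs]
  | cons k L ih =>
    have : (S.blkArcs k).length ≤ 2 := by
      unfold blkArcs
      split_ifs <;> simp
    unfold arcs at ih ⊢
    simp only [List.flatMap_cons, List.length_append, List.length_map, List.length_cons]
    omega

theorem side_of_bef {X Y : ℕ} (h : S.Bef Y X) (hY : Y ≠ 0) : X ≤ S.n0 ↔ ¬ Y ≤ S.n0 := by
  rcases h with h | h | h
  · exact absurd h.1 hY
  · have := H.edges_mem _ _ h.1; omega
  · have := H.edges_mem _ _ h.1; omega

theorem side_pi {X : ℕ} (hX : X ≤ S.n) (h0 : S.pi X ≠ 0) : S.pi X ≤ S.n0 ↔ X ≤ S.n0 := by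
  rcases le_or_gt X S.n0 with h | h
  · have := H.pi_left X h; omega
  · have := H.pi_right X h hX; omega

omit H in
theorem mem_labels {X a : ℕ} {t : ℕ × ℕ} (h : a < S.na X) :
    S.ord X (X, a) t ∈ S.labels (X, t) :=
  List.mem_map.2 ⟨a, List.mem_range.2 h, rfl⟩

/-- The nonzero entries of a topologically sorted list, as blocks. -/
noncomputable def _root_.Skel.blksOf (S : Skel) (q : List ℕ) : List Blk :=
  (q.filter (· ≠ 0)).map fun i => S.blkList.getD i (0, 0, 0)

omit H in
theorem _root_.Skel.blksOf_append (q q' : List ℕ) :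
    S.blksOf (q ++ q') = S.blksOf q ++ S.blksOf q' := by
  simp [blksOf]

theorem mem_blksOf {q : List ℕ} (hq : ∀ x ∈ q, x < S.blkList.length) {k : Blk}
    (hk : S.IsBlk k) : k ∈ S.blksOf q ↔ S.bid k ∈ q := by
  have hmem : k ∈ S.blkList := H.mem_blkList.2 (Or.inr hk)
  simp only [blksOf, List.mem_map, List.mem_filter, decide_eq_true_eq]
  constructor
  · rintro ⟨i, ⟨hi, -⟩, rfl⟩
    rwa [List.getD_eq_getElem _ _ (hq i hi), H.bid_getElem]
  · intro h
    refine ⟨S.bid k, ⟨h, fun h0 => ?_⟩, ?_⟩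
    · have h1 := getElem_bid (bid_lt hmem)
      obtain ⟨l, hl⟩ := H.blkList_eq_cons
      simp only [h0, hl, List.getElem_cons_zero] at h1
      have := H.bef_pos hk.1
      rw [← h1] at this
      simp at this
    · rw [List.getD_eq_getElem _ _ (bid_lt hmem), getElem_bid]

/-- A topological sorting of the numbers of blocks orders the blocks. -/
theorem ready_of_order {q : List ℕ} (hq : ∀ x ∈ q, x < S.blkList.length) {i : ℕ}
    (hi : i ∈ S.blkList.map S.bid) (h0 : i ≠ 0)
    (harc : ∀ u, (u, i) ∈ S.arcs S.blkList → u ∈ q) :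
    S.Ready (S.labelsOf (S.blksOf q)) (S.blkList.getD i (0, 0, 0)) := by
  obtain ⟨k, hk, rfl⟩ := List.mem_map.1 hi
  rw [List.getD_eq_getElem _ _ (bid_lt hk), getElem_bid]
  have hb : S.IsBlk k := by
    rcases H.mem_blkList.1 hk with rfl | h
    · exact absurd H.bid_root h0
    · exact h
  obtain ⟨X, Y, b⟩ := k
  have hbef : S.Bef Y X := hb.1
  have hX := H.bef_pos hbef
  have hlab : ∀ k' : Blk, S.IsBlk k' → S.bid k' ∈ q → ∀ p ∈ S.labels k',
      p ∈ S.labelsOf (S.blksOf q) := fun k' h1 h2 p hp =>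
    List.mem_cons_of_mem _ (List.mem_flatMap.2 ⟨k', (H.mem_blksOf hq h1).2 h2, hp⟩)
  unfold Ready
  by_cases hc : S.chd X (Y, b) = 0
  · rw [if_pos hc]
    -- Without a preceding child the block is scaled by the pair of the parent sequence of `X` and
    -- `(Y, b)`, which is a coordinate of `ownBlk`.
    have harc' : S.bid (S.ownBlk X (Y, b)) ∈ q := harc _ (by
      refine List.mem_flatMap.2 ⟨_, hk, List.mem_map.2 ⟨(S.ownBlk X (Y, b), X, Y, b), ?_, rfl⟩⟩
      unfold blkArcs
      rw [if_neg (by simp; omega)]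
      simp)
    rcases H.ownBlk_cases (X := X) (t := (Y, b)) hbef with ⟨h2, h3⟩ | ⟨h2, h3⟩ | ⟨h2, h3, h4⟩
    · rw [h3] at harc'
      refine hlab (S.pi X, Y, b) ⟨h2, hb.2⟩ harc' _ ?_
      have h5 := mem_labels (X := S.pi X) (t := (Y, b)) (H.pa_lt X hX.2.1)
      have h6 := H.side_pi hX.2.1 (by have := H.bef_pos h2; omega)
      unfold ord at h5 ⊢
      simp only [h6] at h5
      exact h5
    · rw [h3] at harc'
      refine hlab (Y, S.sg X) ⟨h2, H.pa_lt X hX.2.1⟩ harc' _ ?_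
      have h5 := mem_labels (X := Y) (a := b) (t := S.sg X) hb.2
      have h7 : Y ≠ 0 := by have := H.bef_pos h2; simp only at this; omega
      have h6 := H.side_of_bef hbef h7
      unfold ord at h5 ⊢
      by_cases h8 : Y ≤ S.n0
      · rw [if_pos h8] at h5
        rwa [if_neg (by rw [h6]; exact not_not.2 h8)]
      · rw [if_neg h8] at h5
        rwa [if_pos (h6.2 h8)]
    · simp only at h3
      subst h3
      have h5 : b = 0 := by have := H.na_zero; have := hb.2; simp only at this; omega
      have h6 : S.pa X = 0 := by
        have := H.pa_lt X hX.2.1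
        rw [h2, H.na_zero] at this
        omega
      simp only [h5, sg, h2, h6, ord, ite_self]
      exact List.mem_cons_self
  -- The summand for `(X, a)` and `(Z, c)` is a coordinate of the block `(X, Z, c)`, and that block
  -- contributed an arc to this one because `(Y, b)` is the parent sequence of `Z`.
  · rw [if_neg hc]
    obtain ⟨h1, h2, h3⟩ := isChd_chd hc
    intro a ha c hcn
    set Z := S.chd X (Y, b)
    have hblk : S.IsBlk (X, Z, c) := ⟨h3, hcn⟩
    refine hlab (X, Z, c) hblk (harc _ ?_) _ (mem_labels ha)
    refine List.mem_flatMap.2 ⟨(X, Z, c), H.mem_blkList.2 (Or.inr hblk),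
      List.mem_map.2 ⟨((X, Z, c), X, Y, b), ?_, rfl⟩⟩
    unfold blkArcs
    rw [if_neg (by simp; omega), if_neg h1]
    simp [h2]

theorem isOrder_of_order {q : List ℕ} (hnd : q.Nodup)
    (hq : ∀ x, x ∈ q ↔ x < S.blkList.length)
    (harc : ∀ i (hi : i < q.length), ∀ u, (u, q[i]) ∈ S.arcs S.blkList → u ∈ q.take i) :
    S.IsOrder (S.blksOf q) := by
  refine ⟨?_, ?_, ?_⟩
  · refine List.Nodup.map_on ?_ (hnd.filter _)
    intro x hx y hy he
    have hx := (hq x).1 (List.mem_of_mem_filter hx)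
    have hy := (hq y).1 (List.mem_of_mem_filter hy)
    rw [List.getD_eq_getElem _ _ hx, List.getD_eq_getElem _ _ hy] at he
    exact (H.blkList_nodup.getElem_inj_iff).1 he
  · intro k
    constructor
    · intro h
      obtain ⟨i, hi, rfl⟩ := List.mem_map.1 h
      obtain ⟨hi, h0⟩ := List.mem_filter.1 hi
      have hi := (hq i).1 hi
      rw [List.getD_eq_getElem _ _ hi]
      rcases H.mem_blkList.1 (List.getElem_mem hi) with h1 | h1
      · have := H.bid_getElem hi
        rw [h1, H.bid_root] at this
        simp [← this] at h0
      · exact h1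
    · intro h
      rw [H.mem_blksOf (fun x hx => (hq x).1 hx) h, hq]
      exact bid_lt (H.mem_blkList.2 (Or.inr h))
  -- A splitting of the list of blocks is lifted to a splitting of `q`. Entries equal to `0` that
  -- were filtered out just before `k`, collected in `r₂`, add no block, so `Q₁` belongs to the
  -- whole prefix `r₁ ++ r₂`.
  · intro Q₁ k Q₂ he
    obtain ⟨q₁, q', h1, h2, h3⟩ := List.map_eq_append_iff.1 he
    obtain ⟨i, q₂, rfl, rfl, rfl⟩ := List.map_eq_cons_iff.1 h3
    obtain ⟨r₁, r', h4, rfl, h5⟩ := List.filter_eq_append_iff.1 h1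
    obtain ⟨r₂, r₃, rfl, h6, h7, h8⟩ := List.filter_eq_cons_iff.1 h5
    have hr : r₂.filter (· ≠ 0) = [] := by
      rw [List.filter_eq_nil_iff]
      exact h6
    have hQ : (List.filter (fun x => decide (x ≠ 0)) r₁).map
        (fun i => S.blkList.getD i (0, 0, 0)) = S.blksOf (r₁ ++ r₂) := by
      rw [blksOf_append]
      have : S.blksOf r₂ = [] := by unfold blksOf; rw [hr]; rfl
      rw [this, List.append_nil]
      rfl
    have hlen : (r₁ ++ r₂).length < q.length := by rw [h4]; simp
    have hget : q[(r₁ ++ r₂).length] = i := by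
      have : q = (r₁ ++ r₂) ++ i :: r₃ := by rw [h4]; simp
      simp only [this]
      simp
    have htake : q.take (r₁ ++ r₂).length = r₁ ++ r₂ := by
      have : q = (r₁ ++ r₂) ++ i :: r₃ := by rw [h4]; simp
      rw [this, List.take_left']
      rfl
    have hin : i < S.blkList.length := (hq i).1 (by rw [h4]; simp)
    rw [← h2, hQ]
    refine H.ready_of_order (fun x hx => (hq x).1 ?_) ?_ (by simpa using h7) ?_
    · rw [h4]
      simp only [List.mem_append] at hx ⊢
      tauto
    · exact List.mem_map.2 ⟨_, List.getElem_mem hin, H.bid_getElem hin⟩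
    · intro u hu
      have := harc _ hlen u (by rwa [hget])
      rwa [htake] at this

end WF

end Skel

/-! ### Programs for numbering the sequences and for detecting branching -/

namespace Ram

open Skel

attribute [simp] State.setArr_arr State.setArr_arr_ne

/-- The information structure is in the memory: the numbers of information sets and edges in
registers 1, 2, 3, the numbers of actions, the parent sequences, the edges, and the numbers of the
information sets for the output in arrays 0, …, 5. -/
structure Loaded (S : Skel) (s : State) : Prop where
  zero : s.reg 0 = 0
  n0 : s.reg 1 = S.n0
  n : s.reg 2 = S.n + 1
  edges : s.reg 3 = S.edges.length
  na : ∀ X, X ≤ S.n → s.arr 0 X 0 = S.na X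
  pi : ∀ X, X ≤ S.n → s.arr 1 X 0 = S.pi X
  pa : ∀ X, X ≤ S.n → s.arr 2 X 0 = S.pa X
  left : ∀ k (h : k < S.edges.length), s.arr 3 k 0 = S.edges[k].1
  right : ∀ k (h : k < S.edges.length), s.arr 4 k 0 = S.edges[k].2
  loc : ∀ X, X ≤ S.n → s.arr 5 X 0 = S.loc X

theorem Loaded.frame {S : Skel} {s s' : State} {p : Prog} (h : Loaded S s) (hf : Frame p s s')
    (h0 : p.setsReg 0 = false := by rfl) (h1 : p.setsReg 1 = false := by rfl)
    (h2 : p.setsReg 2 = false := by rfl) (h3 : p.setsReg 3 = false := by rfl)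
    (a0 : p.setsArr 0 = false := by rfl) (a1 : p.setsArr 1 = false := by rfl)
    (a2 : p.setsArr 2 = false := by rfl) (a3 : p.setsArr 3 = false := by rfl)
    (a4 : p.setsArr 4 = false := by rfl) (a5 : p.setsArr 5 = false := by rfl) : Loaded S s' where
  zero := (hf.reg 0 h0).trans h.zero
  n0 := (hf.reg 1 h1).trans h.n0
  n := (hf.reg 2 h2).trans h.n
  edges := (hf.reg 3 h3).trans h.edges
  na := by rw [hf.arr 0 a0]; exact h.na
  pi := by rw [hf.arr 1 a1]; exact h.pi
  pa := by rw [hf.arr 2 a2]; exact h.pa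
  left := by rw [hf.arr 3 a3]; exact h.left
  right := by rw [hf.arr 4 a4]; exact h.right
  loc := by rw [hf.arr 5 a5]; exact h.loc

/-- Array 6 holds the numbers of the sequences. -/
def HasSid (S : Skel) (s : State) : Prop :=
  ∀ X, X ≤ S.n → ∀ a, a < S.na X → s.arr 6 X a = S.sid (X, a)

/-- Array 7 holds the numbers of the parent sequences. -/
def HasParent (S : Skel) (s : State) : Prop := ∀ X, X ≤ S.n → s.arr 7 X 0 = S.sid (S.sg X)

/-- Numbers the sequences. -/
def numberSeqs : Prog :=
  .op (.const 4 0) ;;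
  .for 11 2 (.op (.load 12 0 11 0) ;; .for 13 12 (.op (.store 6 11 13 4) ;; .op (.inc 4)))

theorem runs_numberSeqs {S : Skel} {s : State} {T : ℕ} (h : Loaded S s) :
    Runs numberSeqs s T fun s' T' => HasSid S s' ∧
      T' ≤ T + 3 + 6 * (S.n + 1) + 4 * ∑ X ∈ Finset.range (S.n + 1), S.na X := by
  unfold numberSeqs
  simp only [runs_seq, runs_op, Op.run]
  refine runs_for (fun k s' T' => s'.reg 4 = ∑ Z ∈ Finset.range k, S.na Z ∧
    (∀ X, X < k → ∀ a, a < S.na X → s'.arr 6 X a = S.sid (X, a)) ∧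
    T' ≤ T + 2 + 6 * k + 4 * ∑ X ∈ Finset.range k, S.na X) rfl rfl (by decide) ?_ ?_ ?_
  · simp
  · rintro k s1 T1 hk hi hf ⟨h4, h6, hT⟩
    have hk' : k ≤ S.n := by simp [h.n] at hk; omega
    have e0 : s1.reg 0 = 0 := (hf.reg 0 rfl).trans (by simpa using h.zero)
    have ea : s1.arr 0 k 0 = S.na k := by rw [hf.arr 0 rfl]; exact h.na k hk'
    simp only [runs_seq, runs_op, Op.run, hi, e0, ea]
    refine runs_for (fun j s' T' => s'.reg 4 = ∑ Z ∈ Finset.range k, S.na Z + j ∧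
      (∀ X, X < k → ∀ a, a < S.na X → s'.arr 6 X a = S.sid (X, a)) ∧
      (∀ a, a < j → s'.arr 6 k a = S.sid (k, a)) ∧ T' ≤ T1 + 3 + 4 * j)
      rfl rfl (by decide) ?_ ?_ ?_
    · refine ⟨by simpa using h4, by simpa using h6, by simp, by omega⟩
    · rintro j s2 T2 hj hji hf2 ⟨g4, g6, gk, gT⟩
      have e11 : s2.reg 11 = k := (hf2.reg 11 rfl).trans (by simpa using hi)
      simp only [runs_seq, runs_op, Op.run, hji, e11, g4]
      refine ⟨by simp [g4]; omega, fun X hX a ha => ?_, fun a ha => ?_, by omega⟩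
      · simp [hX.ne, g6 X hX a ha]
      · by_cases haj : a = j
        · subst haj; simp [sid]
        · simp [haj, gk a (by omega)]
    · rintro s2 T2 hf2 ⟨g4, g6, gk, gT⟩
      simp only [State.setReg_reg, ↓reduceIte] at g4 gk gT
      refine ⟨by simp [g4, Finset.sum_range_succ], fun X hX a ha => ?_, ?_⟩
      · rcases Nat.lt_succ_iff_lt_or_eq.1 hX with hX | rfl
        · exact g6 X hX a ha
        · exact gk a ha
      · rw [Finset.sum_range_succ]; omega
  · rintro s1 T1 hf ⟨h4, h6, hT⟩
    have : (s.setReg 4 0).reg 2 = S.n + 1 := by simp [h.n]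
    rw [this] at h6 hT
    exact ⟨fun X hX => h6 X (by omega), by omega⟩

/-- Looks up the numbers of the parent sequences. -/
def numberParents : Prog :=
  .for 11 2 (.op (.load 14 1 11 0) ;; .op (.load 15 2 11 0) ;; .op (.load 16 6 14 15) ;;
    .op (.store 7 11 0 16))

theorem runs_numberParents {S : Skel} (H : S.WF) {s : State} {T : ℕ} (h : Loaded S s)
    (hs : HasSid S s) :
    Runs numberParents s T fun s' T' => HasParent S s' ∧ T' ≤ T + 2 + 6 * (S.n + 1) := by
  unfold numberParents
  refine runs_for (fun k s' T' => (∀ X, X < k → s'.arr 7 X 0 = S.sid (S.sg X)) ∧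
    T' ≤ T + 1 + 6 * k) rfl rfl (by decide) ?_ ?_ ?_
  · simp
  · rintro k s1 T1 hk hi hf ⟨h7, hT⟩
    have hk' : k ≤ S.n := by rw [h.n] at hk; omega
    have L := h.frame hf
    have e6 : s1.arr 6 (S.pi k) (S.pa k) = S.sid (S.sg k) := by
      rw [hf.arr 6 rfl]
      exact hs _ (H.pi_le hk') _ (H.pa_lt k hk')
    simp only [runs_seq, runs_op, Op.run]
    refine ⟨fun X hX => ?_, by omega⟩
    by_cases hXk : X = k
    · subst hXk
      simp [hi, L.zero, L.pi X hk', L.pa X hk', e6]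
    · simp [hi, hXk, h7 X (by omega)]
  · rintro s1 T1 hf ⟨h7, hT⟩
    rw [h.n] at h7 hT
    exact ⟨fun X hX => h7 X (by omega), by omega⟩

/-- The number of an edge. -/
def eid (S : Skel) (e : ℕ × ℕ) : ℕ := @List.idxOf _ instBEqOfDecidableEq e S.edges

theorem eid_lt {S : Skel} {e : ℕ × ℕ} (h : e ∈ S.edges) : eid S e < S.edges.length :=
  (@List.idxOf_lt_length_iff _ instBEqOfDecidableEq _ _ _).2 h

theorem getElem_eid {S : Skel} {e : ℕ × ℕ} (h : eid S e < S.edges.length) :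
    S.edges[eid S e] = e :=
  @List.getElem_idxOf _ instBEqOfDecidableEq _ e S.edges h

theorem eid_getElem {S : Skel} (H : S.WF) {i : ℕ} (h : i < S.edges.length) :
    eid S S.edges[i] = i :=
  @List.Nodup.idxOf_getElem _ instBEqOfDecidableEq _ S.edges H.edges_nodup i h

/-- Array 8 holds the numbers of the edges; array 9 counts the edges from the children of a sequence
of the first player to an information set of the second. -/
structure HasEdges (S : Skel) (s : State) : Prop where
  eid : ∀ e ∈ S.edges, s.arr 8 e.1 e.2 = eid S e
  cnt : ∀ t J, s.arr 9 t J = S.edges.countP fun e => S.sid (S.sg e.1) = t ∧ e.2 = J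

/-- Numbers and counts the edges. -/
def countEdges : Prog :=
  .for 11 3 (.op (.load 12 3 11 0) ;; .op (.load 13 4 11 0) ;; .op (.store 8 12 13 11) ;;
    .op (.load 14 7 12 0) ;; .op (.load 15 9 14 13) ;; .op (.inc 15) ;; .op (.store 9 14 13 15))

theorem runs_countEdges {S : Skel} (H : S.WF) {s : State} {T : ℕ} (h : Loaded S s)
    (hp : HasParent S s) (h9 : ∀ t J, s.arr 9 t J = 0) :
    Runs countEdges s T fun s' T' => HasEdges S s' ∧ T' ≤ T + 2 + 9 * S.edges.length := by
  unfold countEdges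
  refine runs_for (fun k s' T' => (∀ i (hi : i < S.edges.length), i < k →
      s'.arr 8 S.edges[i].1 S.edges[i].2 = i) ∧
    (∀ t J, s'.arr 9 t J = (S.edges.take k).countP fun e => S.sid (S.sg e.1) = t ∧ e.2 = J) ∧
    T' ≤ T + 1 + 9 * k) rfl rfl (by decide) ?_ ?_ ?_
  · refine ⟨fun i hi h => absurd h (by omega), by simpa using h9, by omega⟩
  · rintro k s1 T1 hk hi hf ⟨h8, h9, hT⟩
    have hk' : k < S.edges.length := by rwa [h.edges] at hk
    have L := h.frame hf
    have hm := H.edges_mem S.edges[k].1 S.edges[k].2 (List.getElem_mem hk')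
    have hn := H.n0_le
    have e7 : s1.arr 7 S.edges[k].1 0 = S.sid (S.sg S.edges[k].1) := by
      rw [hf.arr 7 rfl]
      exact hp _ (by omega)
    simp only [runs_seq, runs_op, Op.run]
    refine ⟨fun i hi' hik => ?_, fun t J => ?_, by omega⟩
    · by_cases hik' : i = k
      · subst hik'
        simp [hi, L.zero, L.left i hk', L.right i hk']
      · have hne : ¬ (S.edges[i].1 = S.edges[k].1 ∧ S.edges[i].2 = S.edges[k].2) := fun h =>
          hik' ((H.edges_nodup.getElem_inj_iff).1 (Prod.ext h.1 h.2))
        simp [hi, L.zero, L.left k hk', L.right k hk', hne, h8 i hi' (by omega)]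
    · rw [List.take_add_one, List.getElem?_eq_getElem hk', List.countP_append, ← h9]
      by_cases hc : S.sid (S.sg S.edges[k].1) = t ∧ S.edges[k].2 = J
      · obtain ⟨rfl, rfl⟩ := hc
        simp [hi, L.zero, L.left k hk', L.right k hk', e7]
      · have hc' : ¬ (t = S.sid (S.sg S.edges[k].1) ∧ J = S.edges[k].2) := fun h =>
          hc ⟨h.1.symm, h.2.symm⟩
        simp [hi, L.zero, L.left k hk', L.right k hk', e7, hc, hc']
  · rintro s1 T1 hf ⟨h8, h9, hT⟩
    rw [h.edges] at h8 h9 hT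
    refine ⟨⟨fun e he => ?_, by simpa using h9⟩, by omega⟩
    have := h8 _ (eid_lt he) (eid_lt he)
    rwa [getElem_eid] at this

/-- The graph on the edges with arcs from `(pi I, J)` to `(I, J)`. -/
def edgeArcs (S : Skel) (L : List (ℕ × ℕ)) : List (ℕ × ℕ) :=
  (L.filter fun e => S.pi e.1 ≠ 0).map fun e => (eid S (S.pi e.1, e.2), eid S e)

theorem edgeArcs_append {S : Skel} (L L' : List (ℕ × ℕ)) :
    edgeArcs S (L ++ L') = edgeArcs S L ++ edgeArcs S L' := by
  simp [edgeArcs]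

/-- Sets up the graph on the edges. -/
def edgeGraph : Prog :=
  .for 11 3 (.op (.load 12 3 11 0) ;; .op (.load 13 4 11 0) ;; .op (.load 14 1 12 0) ;;
    .ite 0 14 (.op (.load 40 8 14 13) ;; .op (.copy 41 11) ;; addArc 20) .skip)

theorem HasGraph.congr {K : ℕ} {arcs : List (ℕ × ℕ)} {s s' : State} (h : HasGraph K arcs s)
    (h0 : s'.arr K = s.arr K) (h1 : s'.arr (K + 1) = s.arr (K + 1))
    (h2 : s'.arr (K + 2) = s.arr (K + 2)) : HasGraph K arcs s' :=
  ⟨by rw [h0]; exact h.adj, by rw [h1]; exact h.deg, by rw [h2]; exact h.ind⟩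

theorem HasGraph.nil {K : ℕ} {s : State} (h1 : ∀ i, s.arr (K + 1) i 0 = 0)
    (h2 : ∀ i, s.arr (K + 2) i 0 = 0) : HasGraph K [] s :=
  ⟨fun u i h => by simp [targets] at h, fun u => h1 u, fun v => h2 v⟩

theorem runs_edgeGraph {S : Skel} (H : S.WF) {s : State} {T : ℕ} (h : Loaded S s)
    (he : HasEdges S s) (hg : HasGraph 20 [] s) :
    Runs edgeGraph s T fun s' T' => HasGraph 20 (edgeArcs S S.edges) s' ∧
      T' ≤ T + 2 + 20 * S.edges.length := by
  unfold edgeGraph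
  refine runs_for (fun k s' T' => HasGraph 20 (edgeArcs S (S.edges.take k)) s' ∧
    T' ≤ T + 1 + 20 * k) rfl rfl (by decide) ?_ ?_ ?_
  · exact ⟨hg.congr rfl rfl rfl, by omega⟩
  · rintro k s1 T1 hk hi hf ⟨hg, hT⟩
    have hk' : k < S.edges.length := by rwa [h.edges] at hk
    have L := h.frame hf
    have hmem : (S.edges[k].1, S.edges[k].2) ∈ S.edges := List.getElem_mem hk'
    have hm := H.edges_mem S.edges[k].1 S.edges[k].2 hmem
    have hn := H.n0_le
    have htake : S.edges.take (k + 1) = S.edges.take k ++ [S.edges[k]] := by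
      rw [List.take_add_one, List.getElem?_eq_getElem hk']; rfl
    have e1 : s1.arr 1 S.edges[k].1 0 = S.pi S.edges[k].1 := L.pi _ (by omega)
    simp only [runs_seq, runs_op, Op.run, runs_ite, runs_skip, State.setReg_reg, State.setReg_arr,
      Nat.reduceEqDiff, OfNat.zero_ne_ofNat, ↓reduceIte, hi, L.zero, L.left k hk', L.right k hk',
      e1]
    split_ifs with hpi
    · have hpe := H.edges_left _ _ hmem (by omega)
      have h8 : s1.arr 8 (S.pi S.edges[k].1) S.edges[k].2 = eid S (S.pi S.edges[k].1, S.edges[k].2) := by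
        rw [hf.arr 8 rfl]; exact he.eid _ hpe
      refine Runs.mono (runs_addArc (K := 20) (arcs := edgeArcs S (S.edges.take k))
        (HasGraph.congr (s := s1) hg rfl rfl rfl) (by simp [L.zero])) ?_
      rintro s2 T2 ⟨hg2, rfl⟩
      refine ⟨HasGraph.congr (s := s2) ?_ rfl rfl rfl, by omega⟩
      rw [htake, edgeArcs_append]
      simpa [edgeArcs, hpi.ne', eid_getElem H hk', h8] using hg2
    · refine ⟨HasGraph.congr (s := s1) ?_ rfl rfl rfl, by omega⟩
      rw [htake, edgeArcs_append]
      simpa [edgeArcs, show S.pi S.edges[k].1 = 0 by omega] using hg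
  · rintro s1 T1 hf ⟨hg, hT⟩
    rw [h.edges] at hg hT
    exact ⟨by simpa using hg, by omega⟩

theorem mem_edgeArcs {S : Skel} {u v : ℕ} : (u, v) ∈ edgeArcs S S.edges ↔
    ∃ e ∈ S.edges, S.pi e.1 ≠ 0 ∧ u = eid S (S.pi e.1, e.2) ∧ v = eid S e := by
  simp only [edgeArcs, List.mem_map, List.mem_filter, decide_eq_true_eq, Prod.mk.injEq]
  constructor
  · rintro ⟨e, ⟨h1, h2⟩, h3, h4⟩
    exact ⟨e, h1, h2, h3.symm, h4.symm⟩
  · rintro ⟨e, h1, h2, h3, h4⟩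
    exact ⟨e, ⟨h1, h2⟩, h3.symm, h4.symm⟩

/-- Along an arc the depth of the first player's information set increases. -/
theorem edgeArcs_acyclic {S : Skel} (H : S.WF) (A : Set ℕ) (_hA : ∀ x ∈ A, x < S.edges.length)
    (hne : A.Nonempty) : ∃ x ∈ A, ∀ y, (y, x) ∈ edgeArcs S S.edges → y ∉ A := by
  let f : ℕ → ℕ := fun x => S.dep (S.edges.getD x (0, 0)).1
  obtain ⟨x, hx, hmin⟩ := (measure f).wf.has_min A hne
  refine ⟨x, hx, fun y hy hyA => hmin y hyA ?_⟩
  obtain ⟨e, he, h1, rfl, rfl⟩ := mem_edgeArcs.1 hy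
  have hl := eid_lt he
  have hl' := eid_lt (H.edges_left e.1 e.2 he h1)
  have hm := H.edges_mem e.1 e.2 he
  have hn := H.n0_le
  change S.dep (S.edges.getD _ (0, 0)).1 < S.dep (S.edges.getD _ (0, 0)).1
  rw [List.getD_eq_getElem _ _ hl, List.getD_eq_getElem _ _ hl', getElem_eid, getElem_eid]
  exact H.dep_lt _ (by omega) (by omega)

open Classical in
/-- Array 10 tells where the paths branch. -/
def HasBranch (S : Skel) (s : State) : Prop :=
  ∀ e ∈ S.edges, s.arr 10 e.1 e.2 = if S.Branch e.1 e.2 then 1 else 0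

/-- Finds out where the paths branch. -/
def findBranches : Prog :=
  .op (.const 10 1) ;;
  .for 11 3 (.op (.load 16 23 11 0) ;; .op (.load 12 3 16 0) ;; .op (.load 13 4 16 0) ;;
    .op (.load 14 7 12 0) ;; .op (.load 15 9 14 13) ;;
    .ite 10 15 (.op (.store 10 12 13 10))
      (.op (.load 14 1 12 0) ;; .op (.load 15 10 14 13) ;; .op (.store 10 12 13 15)))

/-- The edge `(I, J)` counts itself, so a sibling of `I` connected with `J` shows up as a count
above one. This decides in constant time whether branching happens at `I` itself. -/
theorem one_lt_countP_iff {S : Skel} (H : S.WF) {I J : ℕ} (h : (I, J) ∈ S.edges) :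
    1 < (S.edges.countP fun e => S.sid (S.sg e.1) = S.sid (S.sg I) ∧ e.2 = J) ↔
      ∃ I', I ≠ I' ∧ S.sg I = S.sg I' ∧ (I', J) ∈ S.edges := by
  have hn := H.n0_le
  rw [List.countP_eq_length_filter]
  set l := S.edges.filter fun e => S.sid (S.sg e.1) = S.sid (S.sg I) ∧ e.2 = J with hl
  have hnd : l.Nodup := H.edges_nodup.filter _
  have hmem : ∀ e, e ∈ l ↔ e ∈ S.edges ∧ S.sg e.1 = S.sg I ∧ e.2 = J := by
    intro e
    simp only [hl, List.mem_filter, decide_eq_true_eq]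
    refine and_congr_right fun he => and_congr_left fun _ => ⟨fun h1 => ?_, fun h1 => by rw [h1]⟩
    have h2 := H.edges_mem _ _ he
    have h3 := H.edges_mem _ _ h
    exact sid_inj (H.isSeq_sg (by omega)) (H.isSeq_sg (by omega)) h1
  have hI : (I, J) ∈ l := (hmem _).2 ⟨h, rfl, rfl⟩
  constructor
  · intro hlen
    by_contra hno
    push Not at hno
    have hsub : l ⊆ [(I, J)] := by
      intro e he
      obtain ⟨h1, h2, h3⟩ := (hmem e).1 he
      rw [List.mem_singleton]
      by_contra hne
      refine hno e.1 (fun h4 => hne (Prod.ext h4.symm h3)) h2.symm ?_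
      rwa [← h3]
    have := (hnd.subperm hsub).length_le
    simp at this
    omega
  · rintro ⟨I', h1, h2, h3⟩
    have hI' : (I', J) ∈ l := (hmem _).2 ⟨h3, h2.symm, rfl⟩
    have hnd2 : [(I, J), (I', J)].Nodup := by simp [h1]
    have := (hnd2.subperm (l₂ := l) (by
      intro e he
      simp only [List.mem_cons, List.not_mem_nil, or_false] at he
      rcases he with rfl | rfl <;> assumption)).length_le
    simp only [List.length_cons, List.length_nil] at this
    omega

theorem runs_findBranches {S : Skel} (H : S.WF) {s : State} {T : ℕ} (h : Loaded S s)
    (hp : HasParent S s) (he : HasEdges S s) (h10 : ∀ J, s.arr 10 0 J = 0) {q : List ℕ}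
    (hnd : q.Nodup) (hq : ∀ x, x ∈ q ↔ x < S.edges.length)
    (h23 : ∀ i (hi : i < q.length), s.arr 23 i 0 = q[i])
    (hord : ∀ i (hi : i < q.length), ∀ u, (u, q[i]) ∈ edgeArcs S S.edges → u ∈ q.take i) :
    Runs findBranches s T fun s' T' => HasBranch S s' ∧ T' ≤ T + 3 + 11 * S.edges.length := by
  classical
  have hlen : q.length = S.edges.length := by
    have : q.Perm (List.range S.edges.length) :=
      (List.perm_ext_iff_of_nodup hnd List.nodup_range).2 fun x => by rw [hq, List.mem_range]
    simpa using this.length_eq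
  unfold findBranches
  simp only [runs_seq, runs_op, Op.run]
  refine runs_for (fun k s' T' => (∀ J, s'.arr 10 0 J = 0) ∧ (∀ e ∈ S.edges, eid S e ∈ q.take k →
    s'.arr 10 e.1 e.2 = if S.Branch e.1 e.2 then 1 else 0) ∧ T' ≤ T + 2 + 11 * k)
    rfl rfl (by decide) ?_ ?_ ?_
  · exact ⟨by simpa using h10, by simp, by omega⟩
  · rintro k s1 T1 hk hi hf ⟨hz, hb, hT⟩
    have hk' : k < q.length := by simpa [hlen, h.edges] using hk
    have hqk : q[k] < S.edges.length := (hq _).1 (List.getElem_mem hk')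
    have L : Loaded S s1 := (show Loaded S (s.setReg 10 1) from
      h.frame ((Op.const 10 1).frame s)).frame hf
    have e10 : s1.reg 10 = 1 := (hf.reg 10 rfl).trans (by simp)
    have hmem : S.edges[q[k]] ∈ S.edges := List.getElem_mem hqk
    generalize hIJ : S.edges[q[k]] = e at hmem
    obtain ⟨I, J⟩ := e
    have hm := H.edges_mem I J hmem
    have hn := H.n0_le
    have heid : eid S (I, J) = q[k] := by rw [← hIJ, eid_getElem H]
    have e23 : s1.arr 23 k 0 = q[k] := by rw [hf.arr 23 rfl]; exact h23 k hk'
    have e7 : s1.arr 7 I 0 = S.sid (S.sg I) := by rw [hf.arr 7 rfl]; exact hp I (by omega)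
    have e9 := he.cnt (S.sid (S.sg I)) J
    have e9' : s1.arr 9 = s.arr 9 := hf.arr 9 rfl
    have e3 : s1.arr 3 q[k] 0 = I := by rw [L.left _ hqk, hIJ]
    have e4 : s1.arr 4 q[k] 0 = J := by rw [L.right _ hqk, hIJ]
    have e1 : s1.arr 1 I 0 = S.pi I := L.pi I (by omega)
    have htake : q.take (k + 1) = q.take k ++ [q[k]] := by
      rw [List.take_add_one, List.getElem?_eq_getElem hk']; rfl
    -- Both outcomes of the test write the truth value of `Branch` at the current edge and nothing
    -- else into array 10.
    have hfin : ∀ s' : State, (∀ X Z, s'.arr 10 X Z = if X = I ∧ Z = J then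
        (if S.Branch I J then 1 else 0) else s1.arr 10 X Z) → ∀ T', T' ≤ T + 2 + 11 * (k + 1) →
        (∀ J, s'.arr 10 0 J = 0) ∧ (∀ e ∈ S.edges, eid S e ∈ q.take (k + 1) →
          s'.arr 10 e.1 e.2 = if S.Branch e.1 e.2 then 1 else 0) ∧ T' ≤ T + 2 + 11 * (k + 1) := by
      intro s' h1 T' hT'
      refine ⟨fun Z => by rw [h1, if_neg (by omega), hz], fun e hes hek => ?_, hT'⟩
      rw [h1]
      by_cases heq : e = (I, J)
      · subst heq; simp
      · rw [if_neg fun h2 => heq (Prod.ext h2.1 h2.2)]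
        refine hb e hes ?_
        rw [htake, List.mem_append, List.mem_singleton, ← heid] at hek
        refine hek.resolve_right fun h2 => heq ?_
        have := congrArg (fun i => S.edges.getD i (0, 0)) h2
        simp only [List.getD_eq_getElem _ _ (eid_lt hes), List.getD_eq_getElem _ _ (eid_lt hmem),
          getElem_eid] at this
        exact this
    simp only [runs_seq, runs_op, Op.run, runs_ite, State.setReg_reg, State.setReg_arr,
      Nat.reduceEqDiff, OfNat.zero_ne_ofNat, ↓reduceIte, hi, L.zero, e23, e3, e4, e7, e9', e9, e10,
      one_lt_countP_iff H hmem]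
    split_ifs with hc
    · have hB : S.Branch I J := by
        obtain ⟨I', h1, h2, h3⟩ := hc
        exact Branch.here hmem h3 h1 h2
      refine hfin _ (fun X Z => ?_) _ (by omega)
      simp [hB]
    -- Without a sibling at `I`, branching is decided at the parent, whose edge to `J` comes earlier
    -- in the topological order. If `I` has no parent, row `0` of the array is read, which is never
    -- written and holds zeros.
    · have hB : s1.arr 10 (S.pi I) J = if S.Branch I J then 1 else 0 := by
        have hiff : S.Branch I J ↔ S.Branch (S.pi I) J := by
          constructor
          · intro h1
            cases h1 with
            | here h2 h3 h4 h5 => exact absurd ⟨_, h4, h5, h3⟩ hc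
            | up h2 h3 => exact h3
          · exact fun h1 => Branch.up hmem h1
        by_cases hpi : S.pi I = 0
        · rw [hpi, hz, hiff, hpi, if_neg]
          intro h1
          have := H.edges_mem _ _ h1.edge
          omega
        · simp only [hiff]
          exact hb (S.pi I, J) (H.edges_left _ _ hmem hpi)
            (hord k hk' _ (mem_edgeArcs.2 ⟨(I, J), hmem, hpi, rfl, heid.symm⟩))
      refine hfin _ (fun X Z => ?_) _ (by omega)
      simp [e1, hB]
  · rintro s1 T1 hf ⟨hz, hb, hT⟩
    have h3 : (s.setReg 10 1).reg 3 = S.edges.length := by simpa using h.edges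
    rw [h3] at hb hT
    refine ⟨fun e hes => hb e hes ?_, by omega⟩
    rw [List.take_of_length_le (by omega), hq]
    exact eid_lt hes

end Ram

/-! ### Programs for listing the blocks and their dependency graph -/

namespace Ram

open Skel

/-- The blocks `L` are listed in arrays 11, …, 14, and array 16 holds their numbers. -/
structure HasBlocks (S : Skel) (L : List Blk) (s : State) : Prop where
  len : s.reg 5 = L.length
  fst : ∀ i (h : i < L.length), s.arr 11 i 0 = L[i].1
  snd : ∀ i (h : i < L.length), s.arr 12 i 0 = L[i].2.1
  trd : ∀ i (h : i < L.length), s.arr 13 i 0 = L[i].2.2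
  seq : ∀ i (h : i < L.length), s.arr 14 i 0 = S.sid L[i].2
  idx : ∀ k ∈ L, ∀ a < S.na k.1,
    s.arr 16 (S.sid (k.1, a)) (S.sid k.2) = @List.idxOf _ instBEqOfDecidableEq k L ∧
    s.arr 16 (S.sid k.2) (S.sid (k.1, a)) = @List.idxOf _ instBEqOfDecidableEq k L

theorem HasBlocks.congr {S : Skel} {L : List Blk} {s s' : State} (h : HasBlocks S L s)
    (h5 : s'.reg 5 = s.reg 5) (h11 : s'.arr 11 = s.arr 11) (h12 : s'.arr 12 = s.arr 12)
    (h13 : s'.arr 13 = s.arr 13) (h14 : s'.arr 14 = s.arr 14) (h16 : s'.arr 16 = s.arr 16) :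
    HasBlocks S L s' :=
  ⟨by rw [h5]; exact h.len, by rw [h11]; exact h.fst, by rw [h12]; exact h.snd,
    by rw [h13]; exact h.trd, by rw [h14]; exact h.seq, by rw [h16]; exact h.idx⟩

/-- Appends the block that registers 12, 13, 16 hold. -/
def pushBlock : Prog :=
  .op (.load 17 6 13 16) ;; .op (.store 11 5 0 12) ;; .op (.store 12 5 0 13) ;;
  .op (.store 13 5 0 16) ;; .op (.store 14 5 0 17) ;;
  .for 18 15 (.op (.load 19 6 12 18) ;; .op (.store 16 19 17 5) ;; .op (.store 16 17 19 5)) ;;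
  .op (.inc 5)

/-- The number of the block is stored under both orders of each of its pairs of sequences. A later
lookup need not know which of the two information sets precedes the other. -/
theorem runs_pushBlock {S : Skel} (H : S.WF) {L : List Blk} {X Y b : ℕ} {s : State} {T : ℕ}
    (h : Loaded S s) (hs : HasSid S s) (hL : ∀ k ∈ L, k ∈ S.blkList)
    (hk : (X, Y, b) ∈ S.blkList) (hn : (X, Y, b) ∉ L) (h12 : s.reg 12 = X) (h13 : s.reg 13 = Y)
    (h16 : s.reg 16 = b) (h15 : s.reg 15 = S.na X) (hB : HasBlocks S L s) :
    Runs pushBlock s T fun s' T' => HasBlocks S (L ++ [(X, Y, b)]) s' ∧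
      T' ≤ T + 8 + 5 * S.na X := by
  have hX : X ≤ S.n ∧ Y ≤ S.n ∧ b < S.na Y := by
    rcases H.mem_blkList.1 hk with h1 | ⟨h1, h2⟩
    · simp only [Prod.mk.injEq] at h1
      have := H.na_zero
      rw [h1.1, h1.2.1, h1.2.2]
      omega
    · have := H.bef_pos h1
      exact ⟨this.2.1, this.2.2, h2⟩
  have hbound : ∀ k ∈ S.blkList, k.1 ≤ S.n ∧ S.IsSeq k.2 := by
    intro k hk
    rcases H.mem_blkList.1 hk with rfl | ⟨h1, h2⟩
    · exact ⟨Nat.zero_le _, by simp [IsSeq, H.na_zero]⟩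
    · exact ⟨(H.bef_pos h1).2.1, h2⟩
  have h17 : s.arr 6 Y b = S.sid (Y, b) := hs Y hX.2.1 b hX.2.2
  unfold pushBlock
  simp only [runs_seq, runs_op, Op.run, State.setReg_reg, State.setArr_reg,
    Nat.reduceEqDiff, OfNat.zero_ne_ofNat, ↓reduceIte, h.zero, h12, h13, h16, h17, hB.len]
  refine runs_for (fun j s' T' => T' ≤ T + 6 + 5 * j ∧ ∀ x y, s'.arr 16 x y =
    if ∃ a < j, (x = S.sid (X, a) ∧ y = S.sid (Y, b)) ∨ (x = S.sid (Y, b) ∧ y = S.sid (X, a))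
    then L.length else s.arr 16 x y) rfl rfl (by decide) ?_ ?_ ?_
  · exact ⟨by omega, by simp⟩
  · rintro j s1 T1 hj hi hf ⟨hT, h1⟩
    simp only [State.setReg_reg, State.setArr_reg, Nat.reduceEqDiff, ↓reduceIte, h15] at hj
    have e19 : s1.arr 6 X j = S.sid (X, j) := by
      rw [hf.arr 6 rfl]; exact hs X hX.1 j hj
    have e12 : s1.reg 12 = X := (hf.reg 12 rfl).trans (by simp [h12])
    have e17 : s1.reg 17 = S.sid (Y, b) := (hf.reg 17 rfl).trans (by simp)
    have e5 : s1.reg 5 = L.length := (hf.reg 5 rfl).trans (by simp [hB.len])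
    simp only [runs_seq, runs_op, Op.run, State.setReg_reg, State.setReg_arr, State.setArr_reg,
      Nat.reduceEqDiff, ↓reduceIte, hi, e12, e17, e5, e19]
    refine ⟨by omega, fun x y => ?_⟩
    simp only [State.setReg_arr, State.setArr_arr, true_and, h1]
    by_cases ha : (x = S.sid (X, j) ∧ y = S.sid (Y, b)) ∨ (x = S.sid (Y, b) ∧ y = S.sid (X, j))
    · have hj1 : ∃ a < j + 1, (x = S.sid (X, a) ∧ y = S.sid (Y, b)) ∨
          (x = S.sid (Y, b) ∧ y = S.sid (X, a)) := ⟨j, by omega, ha⟩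
      rw [if_pos hj1]
      rcases ha with ha | ha <;> simp [ha]
    · rw [not_or] at ha
      rw [if_neg ha.2, if_neg ha.1]
      refine if_congr ?_ rfl rfl
      constructor
      · rintro ⟨a, h2, h3⟩
        exact ⟨a, by omega, h3⟩
      · rintro ⟨a, h2, h3⟩
        refine ⟨a, ?_, h3⟩
        rcases Nat.lt_succ_iff_lt_or_eq.1 h2 with h4 | rfl
        · exact h4
        · exact absurd h3 (not_or.2 ha)
  · rintro s1 T1 hf ⟨hT, h1⟩
    simp only [State.setReg_reg, State.setArr_reg, Nat.reduceEqDiff, ↓reduceIte, h15] at hT h1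
    have e5 : s1.reg 5 = L.length := (hf.reg 5 rfl).trans (by simp [hB.len])
    refine ⟨⟨?_, ?_, ?_, ?_, ?_, ?_⟩, by omega⟩
    · simp [e5]
    · intro i hi
      rw [State.setReg_arr, hf.arr 11 rfl]
      rcases Nat.lt_or_ge i L.length with h2 | h2
      · simpa [List.getElem_append_left h2, h2.ne] using hB.fst i h2
      · obtain rfl : i = L.length := by simp at hi; omega
        simp
    · intro i hi
      rw [State.setReg_arr, hf.arr 12 rfl]
      rcases Nat.lt_or_ge i L.length with h2 | h2
      · simpa [List.getElem_append_left h2, h2.ne] using hB.snd i h2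
      · obtain rfl : i = L.length := by simp at hi; omega
        simp
    · intro i hi
      rw [State.setReg_arr, hf.arr 13 rfl]
      rcases Nat.lt_or_ge i L.length with h2 | h2
      · simpa [List.getElem_append_left h2, h2.ne] using hB.trd i h2
      · obtain rfl : i = L.length := by simp at hi; omega
        simp
    · intro i hi
      rw [State.setReg_arr, hf.arr 14 rfl]
      rcases Nat.lt_or_ge i L.length with h2 | h2
      · simpa [List.getElem_append_left h2, h2.ne] using hB.seq i h2
      · obtain rfl : i = L.length := by simp at hi; omega
        simp
    · intro k hkL a ha
      rw [State.setReg_arr, h1, h1]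
      rw [List.mem_append, List.mem_singleton] at hkL
      rcases hkL with hkL | rfl
      · rw [@List.idxOf_append_of_mem _ _ _ instBEqOfDecidableEq _ _ hkL]
        obtain ⟨hk1, hk2⟩ := hbound k (hL k hkL)
        -- The cells written now belong to no earlier block: the same pair in the same order would
        -- make the blocks equal, and in the opposite order it would contradict asymmetry, except
        -- for the dummy block, which again would be the same.
        have hd : ∀ a' < S.na X, ¬ ((X, a') = (k.1, a) ∧ (Y, b) = k.2) ∧
            ¬ ((Y, b) = (k.1, a) ∧ (X, a') = k.2) := by
          intro a' _
          constructor
          · rintro ⟨h2, h3⟩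
            simp only [Prod.mk.injEq] at h2
            exact hn (by rw [h2.1, h3]; exact hkL)
          · rintro ⟨h2, h3⟩
            simp only [Prod.mk.injEq] at h2
            have h4 : k.2.1 = X := by rw [← h3]
            rcases H.mem_blkList.1 (hL k hkL) with rfl | h5
            · simp only at h2 h4
              have h7 := H.na_zero
              have h8 := hX.2.2
              rw [h2.1, h7] at h8
              refine hn ?_
              rw [← h4, h2.1, show b = 0 by omega]
              exact hkL
            · have h6 := h5.1
              rw [h4, ← h2.1] at h6
              rcases H.mem_blkList.1 hk with h7 | h7
              · simp only [Prod.mk.injEq] at h7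
                have := H.bef_pos h6
                omega
              · exact H.bef_asymm h6 h7.1
        have hs1 : ∀ a' < S.na X, S.IsSeq (X, a') := fun a' h2 => h2
        have hs2 : S.IsSeq (Y, b) := hX.2.2
        have hs3 : S.IsSeq (k.1, a) := ha
        rw [if_neg, if_neg]
        · exact hB.idx k hkL a ha
        · rintro ⟨a', h2, ⟨h3, h4⟩ | ⟨h3, h4⟩⟩
          · exact (hd a' h2).2 ⟨(sid_inj hs3 hs2 h4).symm, (sid_inj hk2 (hs1 a' h2) h3).symm⟩
          · exact (hd a' h2).1 ⟨(sid_inj hs3 (hs1 a' h2) h4).symm, (sid_inj hk2 hs2 h3).symm⟩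
        · rintro ⟨a', h2, ⟨h3, h4⟩ | ⟨h3, h4⟩⟩
          · exact (hd a' h2).1 ⟨(sid_inj hs3 (hs1 a' h2) h3).symm, (sid_inj hk2 hs2 h4).symm⟩
          · exact (hd a' h2).2 ⟨(sid_inj hs3 hs2 h3).symm, (sid_inj hk2 (hs1 a' h2) h4).symm⟩
      · rw [@List.idxOf_append_of_notMem _ _ _ instBEqOfDecidableEq _ _ hn,
          if_pos ⟨a, ha, Or.inl ⟨rfl, rfl⟩⟩, if_pos ⟨a, ha, Or.inr ⟨rfl, rfl⟩⟩]
        simp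

/-- Array 15 holds the children of sequences that have been found. -/
structure HasChd (S : Skel) (P : List (ℕ × ℕ)) (s : State) : Prop where
  eq : ∀ X t, S.IsSeq t → s.arr 15 X (S.sid t) = 0 ∨ s.arr 15 X (S.sid t) = S.chd X t
  ne : ∀ X Y, (X, Y) ∈ P → Y ≠ 0 → s.arr 15 X (S.sid (S.sg Y)) ≠ 0

theorem HasChd.congr {S : Skel} {P : List (ℕ × ℕ)} {s s' : State} (h : HasChd S P s)
    (h15 : s'.arr 15 = s.arr 15) : HasChd S P s' :=
  ⟨by rw [h15]; exact h.eq, by rw [h15]; exact h.ne⟩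

/-- Once all pairs have been processed, a zero in array 15 really means that no child precedes. -/
theorem HasChd.chd {S : Skel} (H : S.WF) {s : State} (h : HasChd S S.pairs s) {X : ℕ} {t : ℕ × ℕ}
    (ht : S.IsSeq t) : s.arr 15 X (S.sid t) = S.chd X t := by
  by_cases h0 : S.chd X t = 0
  · have := h.eq X t ht
    omega
  · obtain ⟨h1, h2, h3⟩ := isChd_chd h0
    have h4 := h.ne X _ (H.mem_pairs.2 (Or.inr h3)) h1
    rw [h2] at h4
    exact (h.eq X t ht).resolve_left h4

/-- Appends the blocks for the pair of information sets in registers 12, 13. -/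
def addBlocks : Prog :=
  .op (.load 14 0 13 0) ;; .op (.load 15 0 12 0) ;; .op (.load 20 7 13 0) ;;
  .ite 0 13 (.op (.store 15 12 20 13)) .skip ;; .for 16 14 pushBlock

/-- The pair `(X, Y)` also reveals `Y` as the child of its parent sequence that precedes `X`; it is
recorded in passing. The cost is proportional to the number of coordinates in the new blocks. -/
theorem runs_addBlocks {S : Skel} (H : S.WF) {P : List (ℕ × ℕ)} {X Y : ℕ} {s : State} {T : ℕ}
    (h : Loaded S s) (hs : HasSid S s) (hp : HasParent S s) (hP : ∀ p ∈ P, p ∈ S.pairs)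
    (hp1 : (X, Y) ∈ S.pairs) (hn : (X, Y) ∉ P) (h12 : s.reg 12 = X) (h13 : s.reg 13 = Y)
    (hB : HasBlocks S (P.flatMap S.blks) s) (hC : HasChd S P s) :
    Runs addBlocks s T fun s' T' => HasBlocks S ((P ++ [(X, Y)]).flatMap S.blks) s' ∧
      HasChd S (P ++ [(X, Y)]) s' ∧ T' ≤ T + 22 * (S.na X * S.na Y) := by
  obtain ⟨hX, hY⟩ := H.pairs_le hp1
  have hb : ∀ b < S.na Y, (X, Y, b) ∈ S.blkList := fun b hb =>
    List.mem_flatMap.2 ⟨_, hp1, WF.mem_blks.2 ⟨rfl, rfl, hb⟩⟩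
  have hPL : ∀ k ∈ P.flatMap S.blks, k ∈ S.blkList := by
    intro k hk
    obtain ⟨p, h1, h2⟩ := List.mem_flatMap.1 hk
    exact List.mem_flatMap.2 ⟨p, hP p h1, h2⟩
  have hnP : ∀ b, (X, Y, b) ∉ P.flatMap S.blks := by
    intro b hk
    obtain ⟨p, h1, h2⟩ := List.mem_flatMap.1 hk
    have h3 := WF.mem_blks.1 h2
    exact hn (by rw [show (X, Y) = p from Prod.ext h3.1 h3.2.1]; exact h1)
  have hw : 1 ≤ S.na X * S.na Y := Nat.mul_pos (H.na_pos X hX) (H.na_pos Y hY)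
  have hw' : S.na Y ≤ S.na X * S.na Y := Nat.le_mul_of_pos_left _ (H.na_pos X hX)
  unfold addBlocks
  simp only [runs_seq, runs_op, Op.run, runs_ite, runs_skip, State.setReg_reg, State.setReg_arr,
    Nat.reduceEqDiff, OfNat.zero_ne_ofNat, ↓reduceIte, h.zero, h12, h13, h.na X hX, h.na Y hY,
    hp Y hY]
  have key : ∀ s0 : State, Frame addBlocks s s0 → s0.reg 12 = X → s0.reg 13 = Y →
      s0.reg 14 = S.na Y → s0.reg 15 = S.na X → HasBlocks S (P.flatMap S.blks) s0 →
      HasChd S (P ++ [(X, Y)]) s0 → Runs (.for 16 14 pushBlock) s0 (T + 1 + 1 + 1 + 1 + 1)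
      fun s' T' => HasBlocks S ((P ++ [(X, Y)]).flatMap S.blks) s' ∧
      HasChd S (P ++ [(X, Y)]) s' ∧ T' ≤ T + 22 * (S.na X * S.na Y) := by
    intro s0 hf0 k12 k13 k14 k15 kB kC
    have L0 := h.frame hf0
    have hs0 : HasSid S s0 := by unfold HasSid; rw [hf0.arr 6 rfl]; exact hs
    refine runs_for (fun j s' T' => HasBlocks S (P.flatMap S.blks ++
      (List.range j).map fun b => (X, Y, b)) s' ∧
      T' ≤ T + 6 + (10 + 5 * S.na X) * j) rfl rfl (by decide) ?_ ?_ ?_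
    · exact ⟨HasBlocks.congr (s := s0) (by simpa using kB) rfl rfl rfl rfl rfl rfl, by omega⟩
    · rintro j s1 T1 hj hi hf ⟨hB1, hT⟩
      rw [k14] at hj
      have L1 := L0.frame hf
      have hs1 : HasSid S s1 := by unfold HasSid; rw [hf.arr 6 rfl]; exact hs0
      refine Runs.mono (runs_pushBlock H L1 hs1 ?_ (hb j hj) ?_ ((hf.reg 12 rfl).trans k12)
        ((hf.reg 13 rfl).trans k13) hi ((hf.reg 15 rfl).trans k15) hB1) ?_
      · intro k hk
        rcases List.mem_append.1 hk with h1 | h1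
        · exact hPL k h1
        · obtain ⟨b, h2, rfl⟩ := List.mem_map.1 h1
          exact hb b (by have := List.mem_range.1 h2; omega)
      · rw [List.mem_append]
        rintro (h1 | h1)
        · exact hnP j h1
        · simp at h1
      · rintro s2 T2 ⟨hB2, hT2⟩
        refine ⟨?_, ?_⟩
        · rw [List.range_succ, List.map_append, ← List.append_assoc]
          exact hB2.congr rfl rfl rfl rfl rfl rfl
        · rw [Nat.mul_succ]; omega
    · rintro s1 T1 hf ⟨hB1, hT⟩
      rw [k14] at hB1 hT
      refine ⟨?_, kC.congr (hf.arr 15 rfl), ?_⟩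
      · simpa [blks] using hB1
      -- The constant is `22 = 7 + 10 + 5`, the terms `1` and `S.na Y` being at most `S.na X * S.na
      -- Y`.
      · have : (10 + 5 * S.na X) * S.na Y = 10 * S.na Y + 5 * (S.na X * S.na Y) := by ring
        omega
  split_ifs with h0
  · refine key _ ⟨?_, ?_, fun _ => rfl, fun _ => rfl⟩ (by simp [h12]) (by simp [h13]) (by simp)
      (by simp) (hB.congr (by simp) rfl rfl rfl rfl rfl) ?_
    · intro r hr
      have h1 : r ≠ 14 := by rintro rfl; cases hr
      have h2 : r ≠ 15 := by rintro rfl; cases hr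
      have h3 : r ≠ 20 := by rintro rfl; cases hr
      simp [h1, h2, h3]
    · intro A hA
      have h1 : A ≠ 15 := by rintro rfl; cases hA
      simp [h1]
    · have hbef : S.Bef Y X := (H.mem_pairs.1 hp1).resolve_left (by omega)
      have hc := H.chd_eq (X := X) (t := S.sg Y) ⟨by omega, rfl, hbef⟩
      constructor
      · intro X' t ht
        simp only [State.setArr_arr, true_and, State.setReg_arr]
        split_ifs with h1
        · right
          rw [h1.1, sid_inj ht (H.isSeq_sg hY) h1.2, hc]
        · exact hC.eq X' t ht
      · intro X' Y' hm hY'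
        simp only [State.setArr_arr, true_and, State.setReg_arr]
        split_ifs with h1
        · omega
        · rcases List.mem_append.1 hm with h2 | h2
          · exact hC.ne X' Y' h2 hY'
          · simp only [List.mem_singleton, Prod.mk.injEq] at h2
            exact absurd ⟨h2.1, by rw [h2.2]⟩ h1
  · refine key _ ⟨?_, fun _ _ => rfl, fun _ => rfl, fun _ => rfl⟩ (by simp [h12]) (by simp [h13])
      (by simp) (by simp) (hB.congr (by simp) rfl rfl rfl rfl rfl) ?_
    · intro r hr
      have h1 : r ≠ 14 := by rintro rfl; cases hr
      have h2 : r ≠ 15 := by rintro rfl; cases hr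
      have h3 : r ≠ 20 := by rintro rfl; cases hr
      simp [h1, h2, h3]
    · refine ⟨hC.eq, fun X' Y' hm hY' => ?_⟩
      rcases List.mem_append.1 hm with h2 | h2
      · exact hC.ne X' Y' h2 hY'
      · simp only [List.mem_singleton, Prod.mk.injEq] at h2
        omega

end Ram

namespace Ram

open Skel

theorem pairs_length (S : Skel) : S.pairs.length = S.n + 1 + S.edges.length := by
  simp [pairs]

theorem pairs_getElem_left (S : Skel) {k : ℕ} (hk : k < S.n + 1) (h : k < S.pairs.length) :
    S.pairs[k] = (k, 0) := by
  simp only [pairs]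
  rw [List.getElem_append_left (by simpa using hk)]
  simp

theorem pairs_getElem_right (S : Skel) {k : ℕ} (hk : k < S.edges.length)
    (h : S.n + 1 + k < S.pairs.length) : S.pairs[S.n + 1 + k] = S.orient S.edges[k] := by
  simp only [pairs]
  rw [List.getElem_append_right (by simp)]
  simp

/-- The number of coordinates for some pairs of information sets. -/
def weightOf (S : Skel) (P : List (ℕ × ℕ)) : ℕ := (P.map fun p => S.na p.1 * S.na p.2).sum

theorem runs_addBlocks_take {S : Skel} (H : S.WF) {m : ℕ} (hm : m < S.pairs.length) {s : State}
    {T : ℕ} (h : Loaded S s) (hs : HasSid S s) (hp : HasParent S s)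
    (h12 : s.reg 12 = S.pairs[m].1) (h13 : s.reg 13 = S.pairs[m].2)
    (hB : HasBlocks S ((S.pairs.take m).flatMap S.blks) s) (hC : HasChd S (S.pairs.take m) s) :
    Runs addBlocks s T fun s' T' => HasBlocks S ((S.pairs.take (m + 1)).flatMap S.blks) s' ∧
      HasChd S (S.pairs.take (m + 1)) s' ∧
      T' + 22 * weightOf S (S.pairs.take m) ≤ T + 22 * weightOf S (S.pairs.take (m + 1)) := by
  have ht : S.pairs.take (m + 1) = S.pairs.take m ++ [S.pairs[m]] := by
    rw [List.take_add_one, List.getElem?_eq_getElem hm]; rfl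
  have hmem : (S.pairs[m].1, S.pairs[m].2) ∈ S.pairs := List.getElem_mem hm
  refine Runs.mono (runs_addBlocks H h hs hp (P := S.pairs.take m) (fun p hp =>
    List.mem_of_mem_take hp) hmem ?_ h12 h13 hB hC) ?_
  · intro h1
    obtain ⟨i, hi, he⟩ := List.mem_take_iff_getElem.1 h1
    have := H.pairs_nodup.getElem_inj_iff.1 he
    omega
  · rintro s' T' ⟨h1, h2, h3⟩
    rw [ht]
    refine ⟨h1, h2, ?_⟩
    simp only [weightOf, List.map_append, List.map_cons, List.map_nil, List.sum_append,
      List.sum_cons, List.sum_nil]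
    omega

/-- Lists the blocks. -/
def listBlocks : Prog :=
  .op (.const 5 0) ;;
  .for 11 2 (.op (.copy 12 11) ;; .op (.const 13 0) ;; addBlocks) ;;
  .for 11 3 (.op (.load 21 3 11 0) ;; .op (.load 22 4 11 0) ;; .op (.load 23 10 21 22) ;;
    .ite 0 23 (.op (.copy 12 21) ;; .op (.copy 13 22)) (.op (.copy 12 22) ;; .op (.copy 13 21)) ;;
    addBlocks)

/-- The loops follow the list `S.pairs`: the pairs with set `0`, and after them the edges, directed
by the marks in array 10. -/
theorem runs_listBlocks {S : Skel} (H : S.WF) {s : State} {T : ℕ} (h : Loaded S s)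
    (hs : HasSid S s) (hp : HasParent S s) (hb : HasBranch S s) (h15 : ∀ X t, s.arr 15 X t = 0) :
    Runs listBlocks s T fun s' T' => HasBlocks S S.blkList s' ∧ HasChd S S.pairs s' ∧
      T' ≤ T + 5 + 36 * S.weight := by
  have hw := H.card_add_edges_le_weight
  have hlen := pairs_length S
  unfold listBlocks
  simp only [runs_seq, runs_op, Op.run]
  refine runs_for (fun k s' T' => HasBlocks S ((S.pairs.take k).flatMap S.blks) s' ∧
      HasChd S (S.pairs.take k) s' ∧ T' ≤ T + 2 + 4 * k + 22 * weightOf S (S.pairs.take k))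
    rfl rfl (by decide) ?_ ?_ ?_
  · refine ⟨⟨by simp, ?_, ?_, ?_, ?_, ?_⟩, ⟨fun X t _ => Or.inl (h15 _ _), ?_⟩, by omega⟩ <;> simp
  · rintro k s1 T1 hk hi hf ⟨hB, hC, hT⟩
    have hk' : k < S.n + 1 := by simpa [h.n] using hk
    have hkl : k < S.pairs.length := by omega
    have L : Loaded S s1 := (show Loaded S (s.setReg 5 0) from
      h.frame ((Op.const 5 0).frame s)).frame hf
    have hs1 : HasSid S s1 := by unfold HasSid; rw [hf.arr 6 rfl]; exact hs
    have hp1 : HasParent S s1 := by unfold HasParent; rw [hf.arr 7 rfl]; exact hp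
    have hg := pairs_getElem_left S hk' hkl
    simp only [runs_seq, runs_op]
    refine Runs.mono (runs_addBlocks_take H hkl (L.frame (p := .op (.copy 12 11) ;;
      .op (.const 13 0)) ((Exec.seq (Exec.op _ _) (Exec.op _ _)).frame)) hs1 hp1
      (by simp [hg, hi]) (by simp [hg]) (hB.congr rfl rfl rfl rfl rfl rfl) (hC.congr rfl)) ?_
    rintro s2 T2 ⟨h1, h2, h3⟩
    exact ⟨h1.congr rfl rfl rfl rfl rfl rfl, h2.congr rfl, by omega⟩
  · rintro s1 T1 hf ⟨hB, hC, hT⟩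
    have h2 : (s.setReg 5 0).reg 2 = S.n + 1 := by simp [h.n]
    rw [h2] at hB hC hT
    have L1 : Loaded S s1 := (show Loaded S (s.setReg 5 0) from
      h.frame ((Op.const 5 0).frame s)).frame hf
    have hs1 : HasSid S s1 := by unfold HasSid; rw [hf.arr 6 rfl]; exact hs
    have hp1 : HasParent S s1 := by unfold HasParent; rw [hf.arr 7 rfl]; exact hp
    have hb1 : HasBranch S s1 := by unfold HasBranch; rw [hf.arr 10 rfl]; exact hb
    refine runs_for (fun k s' T' => HasBlocks S ((S.pairs.take (S.n + 1 + k)).flatMap S.blks) s' ∧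
      HasChd S (S.pairs.take (S.n + 1 + k)) s' ∧
      T' ≤ T + 4 + 4 * (S.n + 1) + 8 * k + 22 * weightOf S (S.pairs.take (S.n + 1 + k)))
      rfl rfl (by decide) ?_ ?_ ?_
    · exact ⟨hB.congr rfl rfl rfl rfl rfl rfl, hC.congr rfl, by simp only [Nat.add_zero]; omega⟩
    · rintro k s2 T2 hk hi hf2 ⟨hB, hC, hT⟩
      have hk' : k < S.edges.length := by rwa [L1.edges] at hk
      have hkl : S.n + 1 + k < S.pairs.length := by omega
      have L2 := L1.frame hf2
      have hs2 : HasSid S s2 := by unfold HasSid; rw [hf2.arr 6 rfl]; exact hs1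
      have hp2 : HasParent S s2 := by unfold HasParent; rw [hf2.arr 7 rfl]; exact hp1
      have hb2 := hb1 _ (List.getElem_mem hk')
      rw [← hf2.arr 10 rfl] at hb2
      have hg := pairs_getElem_right S hk' hkl
      simp only [runs_seq, runs_op, Op.run, runs_ite, State.setReg_reg, State.setReg_arr,
        Nat.reduceEqDiff, OfNat.zero_ne_ofNat, ↓reduceIte, hi, L2.zero, L2.left k hk',
        L2.right k hk', hb2]
      have key : ∀ (s3 : State), Loaded S s3 → s3.arr = s2.arr → s3.reg 5 = s2.reg 5 →
          s3.reg 12 = S.pairs[S.n + 1 + k].1 → s3.reg 13 = S.pairs[S.n + 1 + k].2 →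
          Runs addBlocks s3 (T2 + 1 + 1 + 1 + 1 + 1 + 1 + 1) fun s'' T'' =>
            HasBlocks S ((S.pairs.take (S.n + 1 + (k + 1))).flatMap S.blks) (s''.setReg 11 (k + 1)) ∧
            HasChd S (S.pairs.take (S.n + 1 + (k + 1))) (s''.setReg 11 (k + 1)) ∧
            T'' + 1 ≤ T + 4 + 4 * (S.n + 1) + 8 * (k + 1) +
              22 * weightOf S (S.pairs.take (S.n + 1 + (k + 1))) := by
        intro s3 L3 ha h5 h12 h13
        refine Runs.mono (runs_addBlocks_take H hkl L3 (by unfold HasSid; rw [ha]; exact hs2)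
          (by unfold HasParent; rw [ha]; exact hp2) h12 h13
          (hB.congr h5 (by rw [ha]) (by rw [ha]) (by rw [ha]) (by rw [ha]) (by rw [ha]))
          (hC.congr (by rw [ha]))) ?_
        rintro s4 T4 ⟨h1, h2, h3⟩
        exact ⟨h1.congr rfl rfl rfl rfl rfl rfl, h2.congr rfl, by simp only [← Nat.add_assoc]; omega⟩
      have hL : ∀ a b c d e : ℕ, Loaded S (((((s2.setReg 21 a).setReg 22 b).setReg 23 c).setReg
          12 d).setReg 13 e) := fun a b c d e =>
        L2.frame (p := .op (.const 21 a) ;; .op (.const 22 b) ;; .op (.const 23 c) ;;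
          .op (.const 12 d) ;; .op (.const 13 e)) ((Exec.seq (Exec.op _ _) (Exec.seq (Exec.op _ _)
          (Exec.seq (Exec.op _ _) (Exec.seq (Exec.op _ _) (Exec.op _ _))))).frame)
      by_cases hbr : S.Branch S.edges[k].1 S.edges[k].2
      · simp only [hbr, ↓reduceIte, Nat.zero_lt_one]
        refine key _ (hL _ _ _ _ _) rfl (by simp) ?_ ?_ <;> simp [hg, orient, hbr]
      · simp only [hbr, ↓reduceIte, lt_self_iff_false]
        refine key _ (hL _ _ _ _ _) rfl (by simp) ?_ ?_ <;> simp [hg, orient, hbr]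
    · rintro s2 T2 hf2 ⟨hB, hC, hT⟩
      rw [L1.edges, ← hlen, List.take_length] at hB hC hT
      refine ⟨hB, hC, ?_⟩
      change _ ≤ _ + 22 * S.weight at hT
      omega

/-- Adds the arc to a block from the block of the pair of the parent sequence. -/
def ownArc : Prog :=
  .op (.load 15 7 12 0) ;; .op (.load 40 16 15 14) ;; .op (.copy 41 11) ;; addArc 30

/-- Sets up the dependency graph of the blocks. -/
def blockGraph : Prog :=
  .for 11 5 (.op (.load 12 11 11 0) ;; .op (.load 13 12 11 0) ;; .op (.load 14 14 11 0) ;;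
    .ite 0 12
      (.ite 0 13 (.op (.load 15 6 12 0) ;; .op (.load 16 7 13 0) ;; .op (.load 41 16 15 16) ;;
        .op (.copy 40 11) ;; addArc 30) .skip ;; ownArc) .skip)

/-- One lookup serves all three cases of `ownBlk` because array 16 is symmetric on the pairs of the
blocks. -/
theorem HasBlocks.ownBlk {S : Skel} (H : S.WF) {s : State} (hB : HasBlocks S S.blkList s) {X : ℕ}
    {t : ℕ × ℕ} (ht : S.IsSeq t) (h : S.Bef t.1 X) :
    s.arr 16 (S.sid (S.sg X)) (S.sid t) = S.bid (S.ownBlk X t) := by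
  have hX := H.bef_pos h
  rcases H.ownBlk_cases h with ⟨h2, h3⟩ | ⟨h2, h3⟩ | ⟨h2, h3, h4⟩
  · rw [h3]
    exact (hB.idx (S.pi X, t) (H.mem_blkList.2 (Or.inr ⟨h2, ht⟩)) (S.pa X) (H.pa_lt X hX.2.1)).1
  · rw [h3]
    exact (hB.idx (t.1, S.sg X) (H.mem_blkList.2 (Or.inr ⟨h2, H.pa_lt X hX.2.1⟩)) t.2 ht).2
  · have h5 : t = (0, 0) := by
      obtain ⟨Y, b⟩ := t
      simp only at h3
      subst h3
      have := H.na_zero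
      simp only [IsSeq] at ht
      simp only [Prod.mk.injEq, true_and]
      omega
    have h6 : S.sg X = (0, 0) := by
      have := H.pa_lt X hX.2.1
      rw [h2, H.na_zero] at this
      simp only [sg, h2, Prod.mk.injEq, true_and]
      omega
    rw [h4, h5, h6]
    exact (hB.idx (0, 0, 0) (H.mem_blkList.2 (Or.inl rfl)) 0 (by simp [H.na_zero])).1

theorem arcs_append {S : Skel} (L L' : List Blk) : S.arcs (L ++ L') = S.arcs L ++ S.arcs L' := by
  simp [arcs]

theorem runs_blockGraph {S : Skel} (H : S.WF) {s : State} {T : ℕ} (h : Loaded S s)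
    (hs : HasSid S s) (hp : HasParent S s) (hB : HasBlocks S S.blkList s) (hg : HasGraph 30 [] s) :
    Runs blockGraph s T fun s' T' => HasGraph 30 (S.arcs S.blkList) s' ∧
      T' ≤ T + 2 + 30 * S.blkList.length := by
  unfold blockGraph
  refine runs_for (fun k s' T' => HasGraph 30 (S.arcs (S.blkList.take k)) s' ∧
    T' ≤ T + 1 + 30 * k) rfl rfl (by decide) ?_ ?_ ?_
  · exact ⟨hg.congr rfl rfl rfl, by omega⟩
  · rintro k s1 T1 hk hi hf ⟨hg, hT⟩
    rw [hB.len] at hk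
    have L := h.frame hf
    have hs1 : HasSid S s1 := by unfold HasSid; rw [hf.arr 6 rfl]; exact hs
    have hp1 : HasParent S s1 := by unfold HasParent; rw [hf.arr 7 rfl]; exact hp
    have hB1 : HasBlocks S S.blkList s1 := hB.congr (hf.reg 5 rfl) (hf.arr 11 rfl) (hf.arr 12 rfl)
      (hf.arr 13 rfl) (hf.arr 14 rfl) (hf.arr 16 rfl)
    have htake : S.arcs (S.blkList.take (k + 1)) = S.arcs (S.blkList.take k) ++
        (S.blkArcs S.blkList[k]).map (Prod.map S.bid S.bid) := by
      rw [List.take_add_one, List.getElem?_eq_getElem hk, arcs_append]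
      simp [arcs]
    have hmem : S.blkList[k] ∈ S.blkList := List.getElem_mem hk
    have hbid := H.bid_getElem hk
    have e11 := hB1.fst k hk
    have e12 := hB1.snd k hk
    have e14 := hB1.seq k hk
    rw [htake]
    generalize S.blkList[k] = B at hmem hbid e11 e12 e14
    simp only [runs_seq, runs_op, Op.run, runs_ite, runs_skip, State.setReg_reg, State.setReg_arr,
      Nat.reduceEqDiff, OfNat.zero_ne_ofNat, ↓reduceIte, hi, L.zero, e11, e12, e14]
    by_cases h0 : B.1 = 0
    · simp only [h0, lt_self_iff_false, ↓reduceIte]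
      refine ⟨?_, by omega⟩
      simp only [blkArcs, h0, ↓reduceIte, List.map_nil, List.append_nil]
      exact hg.congr rfl rfl rfl
    have hblk := H.isBlk_of_fst hmem h0
    obtain ⟨X, Y, b⟩ := B
    have hbef : S.Bef Y X := hblk.1
    have hX := H.bef_pos hbef
    have e7 : s1.arr 7 X 0 = S.sid (S.sg X) := hp1 X hX.2.1
    have eown : s1.arr 16 (S.sid (S.sg X)) (S.sid (Y, b)) = S.bid (S.ownBlk X (Y, b)) :=
      hB1.ownBlk H hblk.2 hbef
    have key : ∀ (A : List (ℕ × ℕ)) (s3 : State) (T3 : ℕ), s3.reg 0 = 0 → s3.reg 11 = k →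
        s3.reg 12 = X → s3.reg 14 = S.sid (Y, b) → s3.arr 7 = s1.arr 7 → s3.arr 16 = s1.arr 16 →
        HasGraph 30 A s3 → Runs ownArc s3 T3 fun s' T' =>
          HasGraph 30 (A ++ [(S.bid (S.ownBlk X (Y, b)), k)]) (s'.setReg 11 (k + 1)) ∧
            T' = T3 + 10 := by
      intro A s3 T3 k0 k11 k12 k14 a7 a16 hA
      unfold ownArc
      simp only [runs_seq, runs_op, Op.run, State.setReg_reg, State.setReg_arr, Nat.reduceEqDiff,
        ↓reduceIte, k0, k11, k12, k14, a7, a16, e7, eown]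
      refine Runs.mono (runs_addArc (K := 30) (HasGraph.congr (s := s3) hA rfl rfl rfl)
        (by simp [k0])) ?_
      rintro s4 T4 ⟨h1, rfl⟩
      refine ⟨HasGraph.congr (s := s4) ?_ rfl rfl rfl, rfl⟩
      simpa using h1
    have h0' : 0 < X := Nat.pos_of_ne_zero h0
    simp only [h0', ↓reduceIte]
    by_cases hY : Y = 0
    · simp only [hY, lt_self_iff_false, ↓reduceIte]
      refine Runs.mono (key (S.arcs (S.blkList.take k)) _ _ ?_ ?_ ?_ ?_ rfl rfl
        (HasGraph.congr (s := s1) hg rfl rfl rfl)) ?_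
      · simp [L.zero]
      · simp [hi]
      · simp
      · simp [hY]
      · rintro s2 T2 ⟨h1, rfl⟩
        refine ⟨?_, by omega⟩
        simp only [blkArcs, h0, ↓reduceIte, List.nil_append, List.map_cons, List.map_nil,
          Prod.map_apply, hY ▸ hbid]
        exact hY ▸ h1
    · have hY' : 0 < Y := Nat.pos_of_ne_zero hY
      have e6 : s1.arr 6 X 0 = S.sid (X, 0) := hs1 X hX.2.1 0 (H.na_pos X hX.2.1)
      have e7' : s1.arr 7 Y 0 = S.sid (S.sg Y) := hp1 Y hX.2.2
      have e16 : s1.arr 16 (S.sid (X, 0)) (S.sid (S.sg Y)) = S.bid (X, S.sg Y) :=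
        (hB1.idx (X, S.sg Y) (H.mem_blkList.2 (Or.inr ⟨H.bef_pi hbef, H.pa_lt Y hX.2.2⟩)) 0
          (H.na_pos X hX.2.1)).1
      simp only [hY', ↓reduceIte, e6, e7', e16]
      refine Runs.mono (Runs.frame (runs_addArc (K := 30) (arcs := S.arcs (S.blkList.take k))
        ?_ ?_)) ?_
      · exact HasGraph.congr (s := s1) hg rfl rfl rfl
      · simp [L.zero]
      rintro s2 T2 ⟨hf2, h1, rfl⟩
      refine Runs.mono (key _ s2 _ ((hf2.reg 0 rfl).trans (by simp [L.zero]))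
        ((hf2.reg 11 rfl).trans (by simp [hi])) ((hf2.reg 12 rfl).trans (by simp))
        ((hf2.reg 14 rfl).trans (by simp)) (hf2.arr 7 rfl) (hf2.arr 16 rfl) h1) ?_
      rintro s3 T3 ⟨h2, rfl⟩
      refine ⟨?_, by omega⟩
      simpa [blkArcs, h0, hY, hbid] using h2
  · rintro s1 T1 hf ⟨hg, hT⟩
    rw [hB.len] at hg hT
    rw [List.take_length] at hg
    exact ⟨hg, by omega⟩

end Ram

/-! ### Buffers for the text and for the labels of the coordinates -/

namespace Ram

open Skel

/-- What has been written to the buffers: coordinates with labels `lab`, and the text `code` of `m`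
scaled extensions.  Array 17 holds the positions of the labels. -/
structure Emitted (S : Skel) (lab : List ((ℕ × ℕ) × (ℕ × ℕ))) (code : List ℕ) (m : ℕ)
    (s : State) : Prop where
  coords : s.reg 6 = lab.length
  codeLen : s.reg 7 = code.length
  ext : s.reg 8 = m
  labLen : s.reg 9 = (lab.flatMap S.labelCode).length
  one : s.reg 10 = 1
  text : ∀ i (h : i < code.length), s.arr 18 i 0 = code[i]
  labels : ∀ i (h : i < (lab.flatMap S.labelCode).length),
    s.arr 19 i 0 = (lab.flatMap S.labelCode)[i]
  pos : ∀ p ∈ lab, s.arr 17 (S.sid p.1) (S.sid p.2) = pos lab p ∧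
    s.arr 17 (S.sid p.2) (S.sid p.1) = pos lab p

theorem Emitted.frame {S : Skel} {lab : List ((ℕ × ℕ) × (ℕ × ℕ))} {code : List ℕ} {m : ℕ}
    {s s' : State} {p : Prog} (h : Emitted S lab code m s) (hf : Frame p s s')
    (h6 : p.setsReg 6 = false := by rfl) (h7 : p.setsReg 7 = false := by rfl)
    (h8 : p.setsReg 8 = false := by rfl) (h9 : p.setsReg 9 = false := by rfl)
    (h10 : p.setsReg 10 = false := by rfl) (a17 : p.setsArr 17 = false := by rfl)
    (a18 : p.setsArr 18 = false := by rfl) (a19 : p.setsArr 19 = false := by rfl) :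
    Emitted S lab code m s' where
  coords := (hf.reg 6 h6).trans h.coords
  codeLen := (hf.reg 7 h7).trans h.codeLen
  ext := (hf.reg 8 h8).trans h.ext
  labLen := (hf.reg 9 h9).trans h.labLen
  one := (hf.reg 10 h10).trans h.one
  text := by rw [hf.arr 18 a18]; exact h.text
  labels := by rw [hf.arr 19 a19]; exact h.labels
  pos := by rw [hf.arr 17 a17]; exact h.pos

theorem Emitted.setReg {S : Skel} {lab : List ((ℕ × ℕ) × (ℕ × ℕ))} {code : List ℕ} {m : ℕ}
    {s : State} (h : Emitted S lab code m s) (r v : ℕ) (hr : 10 < r := by decide) :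
    Emitted S lab code m (s.setReg r v) := by
  have h1 : ∀ x, x ≤ 10 → (s.setReg r v).reg x = s.reg x := fun x hx => by
    rw [State.setReg_reg, if_neg (by omega)]
  exact ⟨(h1 6 (by omega)).trans h.coords, (h1 7 (by omega)).trans h.codeLen,
    (h1 8 (by omega)).trans h.ext, (h1 9 (by omega)).trans h.labLen,
    (h1 10 (by omega)).trans h.one, h.text, h.labels, h.pos⟩

/-- Positions, too, are stored under both orders of a pair, so it does not matter to which player
`X` belongs. -/
theorem Emitted.position {S : Skel} {lab : List ((ℕ × ℕ) × (ℕ × ℕ))} {code : List ℕ} {m : ℕ}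
    {s : State} (h : Emitted S lab code m s) {X : ℕ} {u t : ℕ × ℕ} (hm : S.ord X u t ∈ lab) :
    s.arr 17 (S.sid u) (S.sid t) = Skel.pos lab (S.ord X u t) := by
  have h1 := h.pos _ hm
  unfold ord at h1 ⊢
  split_ifs at h1 ⊢
  · exact h1.1
  · exact h1.2

/-- Writes a register to the buffer for the text. -/
def emit (r : ℕ) : Prog := .op (.store 18 7 0 r) ;; .op (.inc 7)

theorem runs_emit {S : Skel} {lab : List ((ℕ × ℕ) × (ℕ × ℕ))} {code : List ℕ} {m : ℕ} {s : State}
    {r T : ℕ} {Q : State → ℕ → Prop} (h : Emitted S lab code m s) (h0 : s.reg 0 = 0)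
    (hQ : ∀ s', Frame (emit r) s s' → Emitted S lab (code ++ [s.reg r]) m s' → Q s' (T + 2)) :
    Runs (emit r) s T Q := by
  have h1 : Runs (emit r) s T fun s' T' => Emitted S lab (code ++ [s.reg r]) m s' ∧ T' = T + 2 := by
    unfold emit
    simp only [runs_seq, runs_op, Op.run]
    refine ⟨⟨?_, ?_, ?_, ?_, ?_, ?_, ?_, ?_⟩, trivial⟩
    · simpa using h.coords
    · simp [h.codeLen]
    · simpa using h.ext
    · simpa using h.labLen
    · simpa using h.one
    · intro i hi
      rcases Nat.lt_or_ge i code.length with h2 | h2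
      · simpa [List.getElem_append_left h2, h2.ne, h.codeLen] using h.text i h2
      · obtain rfl : i = code.length := by simp at hi; omega
        simp [h.codeLen, h0]
    · intro i hi
      simpa using h.labels i hi
    · intro p hp
      simpa using h.pos p hp
  obtain ⟨s', t, he, h2, h3⟩ := h1
  exact ⟨s', t, he, by rw [h3]; exact hQ s' he.frame h2⟩

/-- Writes a register to the buffer for the labels. -/
def emitLabel (r : ℕ) : Prog := .op (.store 19 9 0 r) ;; .op (.inc 9)

/-- Adds the coordinate for the sequences `(X, a)`, `(Y, b)`, where `X`, `Y`, `b` and `a` are in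
registers 12, 13, 14, 16, and the number of `(Y, b)` is in register 15. -/
def newCoord : Prog :=
  .op (.load 17 6 12 16) ;; .op (.store 17 17 15 6) ;; .op (.store 17 15 17 6) ;; .op (.inc 6) ;;
  .op (.load 18 5 12 0) ;; .op (.load 19 5 13 0) ;;
  .ite 1 12 (emitLabel 19 ;; emitLabel 14 ;; emitLabel 18 ;; emitLabel 16)
    (emitLabel 18 ;; emitLabel 16 ;; emitLabel 19 ;; emitLabel 14)

/-- The nested conditionals are the memory after four consecutive writes at the end of a buffer, as
simplification leaves them. -/
theorem buffer_append {f : ℕ → ℕ} {l : List ℕ} {a b c d : ℕ}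
    (h : ∀ i (h : i < l.length), f i = l[i]) (i : ℕ) (hi : i < (l ++ [a, b, c, d]).length) :
    (if i = l.length + 1 + 1 + 1 then d else if i = l.length + 1 + 1 then c else
      if i = l.length + 1 then b else if i = l.length then a else f i) =
      (l ++ [a, b, c, d])[i] := by
  rcases Nat.lt_or_ge i l.length with h2 | h2
  · rw [List.getElem_append_left h2, ← h i h2, if_neg (by omega), if_neg (by omega),
      if_neg (by omega), if_neg (by omega)]
  · rw [List.getElem_append_right h2]
    obtain ⟨j, rfl⟩ := Nat.exists_eq_add_of_le h2
    simp only [List.length_append, List.length_cons, List.length_nil] at hi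
    have hj : j < 4 := by omega
    interval_cases j
    · simp [show ¬ l.length = l.length + 1 + 1 + 1 by omega,
        show ¬ l.length = l.length + 1 + 1 by omega]
    all_goals simp

theorem runs_newCoord {S : Skel} {lab : List ((ℕ × ℕ) × (ℕ × ℕ))} {code : List ℕ} {m : ℕ}
    {s : State} {T X Y a b : ℕ} (h : Loaded S s) (hs : HasSid S s)
    (hlab : ∀ p ∈ lab, S.IsSeq p.1 ∧ S.IsSeq p.2) (hX : X ≤ S.n) (hY : Y ≤ S.n) (ha : a < S.na X)
    (hb : b < S.na Y) (hn : S.ord X (X, a) (Y, b) ∉ lab)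
    (hn' : (S.ord X (X, a) (Y, b)).swap ∉ lab) (h12 : s.reg 12 = X) (h13 : s.reg 13 = Y)
    (h14 : s.reg 14 = b) (h15 : s.reg 15 = S.sid (Y, b)) (h16 : s.reg 16 = a)
    (hE : Emitted S lab code m s) :
    Runs newCoord s T fun s' T' => Emitted S (lab ++ [S.ord X (X, a) (Y, b)]) code m s' ∧
      T' = T + 15 := by
  -- The writes do not destroy the positions of earlier labels, since neither the new label nor its
  -- swap is among them.
  have hpos : ∀ p ∈ lab ++ [S.ord X (X, a) (Y, b)],
      (if S.sid p.1 = S.sid (Y, b) ∧ S.sid p.2 = S.sid (X, a) then lab.length else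
        if S.sid p.1 = S.sid (X, a) ∧ S.sid p.2 = S.sid (Y, b) then lab.length else
          s.arr 17 (S.sid p.1) (S.sid p.2)) = Skel.pos (lab ++ [S.ord X (X, a) (Y, b)]) p ∧
      (if S.sid p.2 = S.sid (Y, b) ∧ S.sid p.1 = S.sid (X, a) then lab.length else
        if S.sid p.2 = S.sid (X, a) ∧ S.sid p.1 = S.sid (Y, b) then lab.length else
          s.arr 17 (S.sid p.2) (S.sid p.1)) = Skel.pos (lab ++ [S.ord X (X, a) (Y, b)]) p := by
    intro p hp
    rw [List.mem_append, List.mem_singleton] at hp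
    rcases hp with hp | rfl
    · rw [pos_append_of_mem hp]
      obtain ⟨hp1, hp2⟩ := hlab p hp
      have hx : S.IsSeq (X, a) := ha
      have hy : S.IsSeq (Y, b) := hb
      have h1 : ¬ (S.sid p.1 = S.sid (Y, b) ∧ S.sid p.2 = S.sid (X, a)) := by
        rintro ⟨h2, h3⟩
        have h4 : p = ((Y, b), (X, a)) := Prod.ext (sid_inj hp1 hy h2) (sid_inj hp2 hx h3)
        unfold ord at hn hn'
        split_ifs at hn hn'
        · exact hn' (by rw [h4] at hp; exact hp)
        · exact hn (by rw [h4] at hp; exact hp)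
      have h2 : ¬ (S.sid p.1 = S.sid (X, a) ∧ S.sid p.2 = S.sid (Y, b)) := by
        rintro ⟨h2, h3⟩
        have h4 : p = ((X, a), (Y, b)) := Prod.ext (sid_inj hp1 hx h2) (sid_inj hp2 hy h3)
        unfold ord at hn hn'
        split_ifs at hn hn'
        · exact hn (by rw [h4] at hp; exact hp)
        · exact hn' (by rw [h4] at hp; exact hp)
      rw [if_neg h1, if_neg h2, if_neg fun h => h2 h.symm, if_neg fun h => h1 h.symm]
      exact hE.pos p hp
    · have h1 : Skel.pos (lab ++ [S.ord X (X, a) (Y, b)]) (S.ord X (X, a) (Y, b)) = lab.length := by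
        unfold Skel.pos
        rw [@List.idxOf_append_of_notMem _ _ _ instBEqOfDecidableEq _ _ hn]
        simp
      rw [h1]
      unfold ord
      by_cases hx : X ≤ S.n0 <;> simp [hx]
  have hcode : S.labelCode (S.ord X (X, a) (Y, b)) =
      if X ≤ S.n0 then [S.loc X, a, S.loc Y, b] else [S.loc Y, b, S.loc X, a] := by
    unfold ord
    split_ifs <;> rfl
  have h17 : s.arr 6 X a = S.sid (X, a) := hs X hX a ha
  unfold newCoord emitLabel
  simp only [runs_seq, runs_op, Op.run, runs_ite, State.setReg_reg, State.setReg_arr,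
    State.setArr_reg, State.setArr_arr, Nat.reduceEqDiff, OfNat.zero_ne_ofNat,
    OfNat.one_ne_ofNat, false_and, ↓reduceIte, h.zero, h.n0, h12, h13, h14, h15, h16, h17,
    hE.coords, hE.labLen, h.loc X hX, h.loc Y hY]
  have hfl : (lab ++ [S.ord X (X, a) (Y, b)]).flatMap S.labelCode =
      lab.flatMap S.labelCode ++ S.labelCode (S.ord X (X, a) (Y, b)) := by
    simp
  split_ifs with hx
  · rw [if_neg (by omega)] at hcode
    refine ⟨⟨?_, ?_, ?_, ?_, ?_, ?_, ?_, ?_⟩, trivial⟩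
    · simp
    · simpa using hE.codeLen
    · simpa using hE.ext
    · rw [hfl, hcode]; simp
    · simpa using hE.one
    · intro i hi
      simpa using hE.text i hi
    · intro i hi
      simp only [hfl, hcode] at hi ⊢
      rw [← buffer_append hE.labels i hi]
      simp
    · intro p hp
      simpa using hpos p hp
  · rw [if_pos (by omega)] at hcode
    refine ⟨⟨?_, ?_, ?_, ?_, ?_, ?_, ?_, ?_⟩, trivial⟩
    · simp
    · simpa using hE.codeLen
    · simpa using hE.ext
    · rw [hfl, hcode]; simp
    · simpa using hE.one
    · intro i hi
      simpa using hE.text i hi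
    · intro i hi
      simp only [hfl, hcode] at hi ⊢
      rw [← buffer_append hE.labels i hi]
      simp
    · intro p hp
      simpa using hpos p hp

end Ram

/-! ### Labels in the middle of a block -/

namespace Skel

variable {S : Skel}

/-- The labels after those for `a` actions of the block `k` have been added to those for `Q`. -/
def partLabels (S : Skel) (Q : List Blk) (k : Blk) (a : ℕ) : List ((ℕ × ℕ) × (ℕ × ℕ)) :=
  S.labelsOf Q ++ (List.range a).map fun a => S.ord k.1 (k.1, a) k.2

theorem partLabels_zero (Q : List Blk) (k : Blk) : S.partLabels Q k 0 = S.labelsOf Q := by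
  simp [partLabels]

theorem partLabels_succ (Q : List Blk) (k : Blk) (a : ℕ) :
    S.partLabels Q k (a + 1) = S.partLabels Q k a ++ [S.ord k.1 (k.1, a) k.2] := by
  simp [partLabels, List.range_succ]

theorem partLabels_na (Q : List Blk) (k : Blk) :
    S.partLabels Q k (S.na k.1) = S.labelsOf (Q ++ [k]) := by
  simp [partLabels, labelsOf_append, labels]

namespace WF

variable (H : S.WF)
include H

theorem isSeq_labelsOf {Q : List Blk} (hQ : ∀ k ∈ Q, S.IsBlk k) {p : (ℕ × ℕ) × (ℕ × ℕ)}
    (hp : p ∈ S.labelsOf Q) : S.IsSeq p.1 ∧ S.IsSeq p.2 := by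
  rcases List.mem_cons.1 hp with rfl | hp
  · simp [IsSeq, H.na_zero]
  · obtain ⟨k, hk, hp⟩ := List.mem_flatMap.1 hp
    obtain ⟨a, ha, rfl⟩ := List.mem_map.1 hp
    have h1 : S.IsSeq (k.1, a) := List.mem_range.1 ha
    have h2 : S.IsSeq k.2 := (hQ k hk).2
    unfold ord
    split_ifs
    · exact ⟨h1, h2⟩
    · exact ⟨h2, h1⟩

theorem swap_notMem_labels {k k' : Blk} (hk : S.IsBlk k) (hk' : S.IsBlk k')
    {p : (ℕ × ℕ) × (ℕ × ℕ)} (h : p ∈ S.labels k) : p.swap ∉ S.labels k' := by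
  obtain ⟨X, Y, b⟩ := k
  obtain ⟨X', Y', b'⟩ := k'
  obtain ⟨a, -, rfl⟩ := List.mem_map.1 h
  intro h'
  obtain ⟨a', -, he⟩ := List.mem_map.1 h'
  have h1 : S.Bef Y X := hk.1
  have h2 : S.Bef Y' X' := hk'.1
  simp only [ord] at he
  split_ifs at he <;> simp only [Prod.swap_prod_mk, Prod.mk.injEq] at he
  · obtain ⟨⟨rfl, rfl⟩, rfl, rfl⟩ := he
    exact H.bef_asymm h1 h2
  · omega
  · omega
  · obtain ⟨⟨rfl, rfl⟩, rfl, rfl⟩ := he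
    exact H.bef_asymm h1 h2

/-- What is needed to write the next coordinate: its label and the swap of its label are new. Swaps
matter because array 17 is written symmetrically. -/
theorem partLabels_fresh {Q : List Blk} {k : Blk} {a : ℕ} (hQ : ∀ k ∈ Q, S.IsBlk k)
    (hk : S.IsBlk k) (hn : k ∉ Q) (ha : a < S.na k.1) :
    (∀ p ∈ S.partLabels Q k a, S.IsSeq p.1 ∧ S.IsSeq p.2) ∧
      S.ord k.1 (k.1, a) k.2 ∉ S.partLabels Q k a ∧
      (S.ord k.1 (k.1, a) k.2).swap ∉ S.partLabels Q k a := by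
  have hmem : ∀ a < S.na k.1, S.ord k.1 (k.1, a) k.2 ∈ S.labels k := fun a ha =>
    List.mem_map.2 ⟨a, List.mem_range.2 ha, rfl⟩
  have hsub : ∀ p ∈ S.partLabels Q k a, p ∈ S.labelsOf (Q ++ [k]) := by
    intro p hp
    rw [labelsOf_append]
    rcases List.mem_append.1 hp with h | h
    · exact List.mem_append_left _ h
    · obtain ⟨a', h1, rfl⟩ := List.mem_map.1 h
      refine List.mem_append_right _ ?_
      simpa using hmem a' (by have := List.mem_range.1 h1; omega)
  have hQk : ∀ k' ∈ Q ++ [k], S.IsBlk k' := by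
    intro k' hk'
    rcases List.mem_append.1 hk' with h | h
    · exact hQ _ h
    · rwa [List.mem_singleton.1 h]
  refine ⟨fun p hp => H.isSeq_labelsOf hQk (hsub p hp), fun hp => ?_, fun hp => ?_⟩
  · rcases List.mem_append.1 hp with h | h
    · rcases List.mem_cons.1 h with h | h
      · exact H.root_notMem_labels hk (h ▸ hmem a ha)
      · obtain ⟨k', hk', h⟩ := List.mem_flatMap.1 h
        exact hn (H.labels_disjoint hk (hQ k' hk') (hmem a ha) h ▸ hk')
    · obtain ⟨a', h1, h2⟩ := List.mem_map.1 h
      have := List.mem_range.1 h1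
      unfold ord at h2
      split_ifs at h2 <;> simp only [Prod.mk.injEq] at h2 <;> omega
  · rcases List.mem_cons.1 (hsub _ hp) with h | h
    · refine H.root_notMem_labels hk ?_
      have h1 : S.ord k.1 (k.1, a) k.2 = ((0, 0), (0, 0)) := by
        rw [← Prod.swap_swap (S.ord k.1 (k.1, a) k.2), h]; rfl
      exact h1 ▸ hmem a ha
    · obtain ⟨k', hk', h⟩ := List.mem_flatMap.1 h
      exact H.swap_notMem_labels hk (hQk k' hk') (hmem a ha) h

end WF

end Skel

/-! ### Programs for writing out one block -/

namespace Ram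

open Skel

theorem Frame.seq {p q : Prog} {s s' s'' : State} (h : Frame p s s') (h' : Frame q s' s'') :
    Frame (p ;; q) s s'' :=
  (h.of_le (p := p ;; q) (fun _ => or_false_left) (fun _ => or_false_left) or_false_left
    or_false_left).trans (h'.of_le (fun _ => or_false_right) (fun _ => or_false_right)
    or_false_right or_false_right)

/-- Registers 12, …, 15 hold a block. -/
structure AtBlock (S : Skel) (k : Blk) (s : State) : Prop where
  fst : s.reg 12 = k.1
  snd : s.reg 13 = k.2.1
  trd : s.reg 14 = k.2.2
  seq : s.reg 15 = S.sid k.2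

theorem AtBlock.frame {S : Skel} {k : Blk} {s s' : State} {p : Prog} (h : AtBlock S k s)
    (hf : Frame p s s') (h12 : p.setsReg 12 = false := by rfl)
    (h13 : p.setsReg 13 = false := by rfl) (h14 : p.setsReg 14 = false := by rfl)
    (h15 : p.setsReg 15 = false := by rfl) : AtBlock S k s' :=
  ⟨(hf.reg 12 h12).trans h.fst, (hf.reg 13 h13).trans h.snd, (hf.reg 14 h14).trans h.trd,
    (hf.reg 15 h15).trans h.seq⟩

theorem Emitted.incExt {S : Skel} {lab : List ((ℕ × ℕ) × (ℕ × ℕ))} {code : List ℕ} {m : ℕ}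
    {s : State} (h : Emitted S lab code m s) : Emitted S lab code (m + 1) ((Op.inc 8).run s) :=
  ⟨by simpa using h.coords, by simpa using h.codeLen, by simpa using h.ext, by simpa using h.labLen,
    by simpa using h.one, h.text, h.labels, h.pos⟩

theorem runs_coord {S : Skel} (H : S.WF) {Q : List Blk} {k : Blk} {a : ℕ} {code : List ℕ} {m : ℕ}
    {s : State} {T : ℕ} (h : Loaded S s) (hs : HasSid S s) (hQ : ∀ k ∈ Q, S.IsBlk k)
    (hk : S.IsBlk k) (hn : k ∉ Q) (ha : a < S.na k.1) (hA : AtBlock S k s) (h16 : s.reg 16 = a)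
    (hE : Emitted S (S.partLabels Q k a) code m s) :
    Runs newCoord s T fun s' T' => Emitted S (S.partLabels Q k (a + 1)) code m s' ∧
      T' = T + 15 := by
  obtain ⟨h1, h2, h3⟩ := H.partLabels_fresh hQ hk hn ha
  obtain ⟨X, Y, b⟩ := k
  have hX := H.bef_pos hk.1
  rw [partLabels_succ]
  exact runs_newCoord h hs h1 hX.2.1 hX.2.2 ha hk.2 h2 h3 hA.fst hA.snd hA.trd hA.seq h16 hE

/-- Writes out a block that is determined by the pair of the parent sequence. -/
def emitSplit : Prog :=
  .op (.load 20 0 12 0) ;; emit 20 ;; emit 10 ;; .op (.load 21 7 12 0) ;;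
  .op (.load 22 17 21 15) ;; emit 22 ;; emit 10 ;; .op (.inc 8) ;; .for 16 20 newCoord

/-- The four numbers of the simplex step: its dimension, one term, the position of the scaling
coordinate, and the coefficient one. -/
theorem runs_emitSplit {S : Skel} (H : S.WF) {Q : List Blk} {k : Blk} {m : ℕ} {s : State} {T : ℕ}
    (h : Loaded S s) (hs : HasSid S s) (hp : HasParent S s) (hQ : ∀ k ∈ Q, S.IsBlk k)
    (hk : S.IsBlk k) (hn : k ∉ Q) (hc : S.chd k.1 k.2 = 0)
    (hr : S.ord k.1 (S.sg k.1) k.2 ∈ S.labelsOf Q) (hA : AtBlock S k s)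
    (hE : Emitted S (S.labelsOf Q) (S.codeOf Q) m s) :
    Runs emitSplit s T fun s' T' =>
      Emitted S (S.labelsOf (Q ++ [k])) (S.codeOf (Q ++ [k])) (m + 1) s' ∧
      T' ≤ T + 14 + 17 * S.na k.1 := by
  have hX := H.bef_pos hk.1
  unfold emitSplit
  simp only [runs_seq, runs_op]
  have f1 := (Op.load 20 0 12 0).frame s
  have e20 : ((Op.load 20 0 12 0).run s).reg 20 = S.na k.1 := by
    simp [hA.fst, h.zero, h.na k.1 hX.2.1]
  refine runs_emit (hE.frame f1) (h.frame f1).zero fun s2 f2 hE2 => ?_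
  have F2 := f1.seq f2
  refine runs_emit hE2 (h.frame F2).zero fun s3 f3 hE3 => ?_
  have F3 := F2.seq f3
  have f4 := (Op.load 21 7 12 0).frame s3
  have F4 := F3.seq f4
  have e21 : ((Op.load 21 7 12 0).run s3).reg 21 = S.sid (S.sg k.1) := by
    simp [(hA.frame F3).fst, (h.frame F3).zero, F3.arr 7 rfl, hp k.1 hX.2.1]
  have f5 := (Op.load 22 17 21 15).frame ((Op.load 21 7 12 0).run s3)
  have F5 := F4.seq f5
  have hE5 := (hE3.frame f4).frame f5
  have e22 : ((Op.load 22 17 21 15).run ((Op.load 21 7 12 0).run s3)).reg 22 =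
      pos (S.labelsOf Q) (S.ord k.1 (S.sg k.1) k.2) := by
    rw [← (hE3.frame f4).position hr, ← e21, ← (hA.frame F4).seq]
    simp [Op.run]
  refine runs_emit hE5 (h.frame F5).zero fun s6 f6 hE6 => ?_
  have F6 := F5.seq f6
  refine runs_emit hE6 (h.frame F6).zero fun s7 f7 hE7 => ?_
  have F7 := F6.seq f7
  have F8 := F7.seq ((Op.inc 8).frame s7)
  have hE8 := hE7.incExt
  rw [e20, hE2.one, e22, hE6.one] at hE8
  have e20' : ((Op.inc 8).run s7).reg 20 = S.na k.1 := by
    rw [← e20, ← f2.reg 20 rfl, ← f3.reg 20 rfl, ← f4.reg 20 rfl, ← f5.reg 20 rfl, ← f6.reg 20 rfl,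
      ← f7.reg 20 rfl]
    rfl
  refine runs_for (fun j s' T' => Emitted S (S.partLabels Q k j) (S.codeOf (Q ++ [k])) (m + 1) s' ∧
    T' ≤ T + 13 + 17 * j) rfl rfl (by decide) ?_ ?_ ?_
  · refine ⟨?_, by omega⟩
    have := hE8.setReg 16 0
    rw [codeOf_concat, blkCode, if_pos hc, partLabels_zero]
    simpa using this
  · rintro j s1 T1 hj hi hf ⟨hE1, hT⟩
    rw [e20'] at hj
    have F := F8.seq hf
    have hs1 : HasSid S s1 := by unfold HasSid; rw [F.arr 6 rfl]; exact hs
    refine Runs.mono (runs_coord H (h.frame F) hs1 hQ hk hn hj (hA.frame F) hi hE1) ?_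
    rintro s2 T2 ⟨h1, rfl⟩
    exact ⟨h1.setReg 16 _, by omega⟩
  · rintro s1 T1 hf ⟨hE1, hT⟩
    rw [e20'] at hE1 hT
    rw [partLabels_na] at hE1
    exact ⟨hE1, by omega⟩

/-- Writes out the equation for one action of a block that is determined by the child in register
23, and adds a coordinate. -/
def emitSumAct : Prog :=
  emit 0 ;; emit 24 ;; .op (.load 21 6 12 16) ;;
  .for 25 24 (.op (.load 22 6 23 25) ;; .op (.load 22 17 21 22) ;; emit 22 ;; emit 10) ;;
  .op (.inc 8) ;; newCoord

theorem runs_emitSumAct {S : Skel} (H : S.WF) {Q : List Blk} {k : Blk} {a Z m : ℕ} {code : List ℕ}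
    {s : State} {T : ℕ} (h : Loaded S s) (hs : HasSid S s) (hQ : ∀ k ∈ Q, S.IsBlk k)
    (hk : S.IsBlk k) (hn : k ∉ Q) (ha : a < S.na k.1) (hZ : Z ≤ S.n)
    (hr : ∀ b < S.na Z, S.ord k.1 (k.1, a) (Z, b) ∈ S.labelsOf Q) (hA : AtBlock S k s)
    (h16 : s.reg 16 = a) (h23 : s.reg 23 = Z) (h24 : s.reg 24 = S.na Z)
    (hE : Emitted S (S.partLabels Q k a) code m s) :
    Runs emitSumAct s T fun s' T' =>
      Emitted S (S.partLabels Q k (a + 1)) (code ++ S.sumCode (S.labelsOf Q) k.1 Z a) (m + 1) s' ∧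
      T' ≤ T + 23 + 8 * S.na Z := by
  have hX := H.bef_pos hk.1
  unfold emitSumAct
  simp only [runs_seq, runs_op]
  refine runs_emit hE h.zero fun s1 f1 hE1 => ?_
  refine runs_emit hE1 (h.frame f1).zero fun s2 f2 hE2 => ?_
  have F2 := f1.seq f2
  have f3 := (Op.load 21 6 12 16).frame s2
  have F3 := F2.seq f3
  have e24 : s2.reg 24 = S.na Z := (F2.reg 24 rfl).trans h24
  have hE3 := hE2.frame f3
  rw [h.zero, f1.reg 24 rfl, h24] at hE3
  have e21 : ((Op.load 21 6 12 16).run s2).reg 21 = S.sid (k.1, a) := by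
    simp only [Op.run, State.setReg_reg, ↓reduceIte]
    rw [F2.reg 16 rfl, h16, (hA.frame F2).fst, F2.arr 6 rfl]
    exact hs k.1 hX.2.1 a ha
  refine runs_for (fun j s' T' => Emitted S (S.partLabels Q k a) (code ++ (0 :: S.na Z ::
    (List.range j).flatMap fun b => [pos (S.labelsOf Q) (S.ord k.1 (k.1, a) (Z, b)), 1])) m s' ∧
    T' ≤ T + 6 + 8 * j) rfl rfl (by decide) ?_ ?_ ?_
  · exact ⟨by simpa using hE3.setReg 25 0, by omega⟩
  · rintro j s4 T4 hj hi hf ⟨hE4, hT⟩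
    have hj' : j < S.na Z := by rwa [← e24]
    have F4 := F3.seq hf
    simp only [runs_seq, runs_op]
    have f5 := (Op.load 22 6 23 25).frame s4
    have e22 : ((Op.load 22 6 23 25).run s4).reg 22 = S.sid (Z, j) := by
      simp only [Op.run, State.setReg_reg, ↓reduceIte]
      rw [hi, F4.reg 23 rfl, h23, F4.arr 6 rfl]
      exact hs Z hZ j hj'
    have e21' : ((Op.load 22 6 23 25).run s4).reg 21 = S.sid (k.1, a) := by
      rw [f5.reg 21 rfl, hf.reg 21 rfl, e21]
    have hm := hr j hj'
    have hm' : S.ord k.1 (k.1, a) (Z, j) ∈ S.partLabels Q k a := List.mem_append_left _ hm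
    have hpos := (hE4.frame f5).position hm'
    have f6 := (Op.load 22 17 21 22).frame ((Op.load 22 6 23 25).run s4)
    have e22' : ((Op.load 22 17 21 22).run ((Op.load 22 6 23 25).run s4)).reg 22 =
        pos (S.labelsOf Q) (S.ord k.1 (k.1, a) (Z, j)) := by
      rw [← pos_append_of_mem hm, partLabels] at *
      rw [← hpos, ← e21', ← e22]
      simp [Op.run]
    have F6 := (F4.seq f5).seq f6
    refine runs_emit ((hE4.frame f5).frame f6) (h.frame F6).zero fun s7 f7 hE7 => ?_
    refine runs_emit hE7 (h.frame (F6.seq f7)).zero fun s8 f8 hE8 => ?_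
    rw [e22', hE7.one] at hE8
    refine ⟨?_, by omega⟩
    have := hE8.setReg 25 (j + 1)
    simpa [List.range_succ, List.flatMap_append] using this
  · rintro s4 T4 hf ⟨hE4, hT⟩
    rw [show ((Op.load 21 6 12 16).run s2).reg 24 = S.na Z from e24] at hE4 hT
    have F5 := (F3.seq hf).seq ((Op.inc 8).frame s4)
    have hs5 : HasSid S ((Op.inc 8).run s4) := by unfold HasSid; rw [F5.arr 6 rfl]; exact hs
    refine Runs.mono (runs_coord H (h.frame F5) hs5 hQ hk hn ha (hA.frame F5)
      ((F5.reg 16 rfl).trans h16) hE4.incExt) ?_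
    rintro s6 T6 ⟨h1, rfl⟩
    exact ⟨h1, by omega⟩

/-- Writes out a block that is determined by the child in register 23. -/
def emitSum : Prog := .op (.load 20 0 12 0) ;; .op (.load 24 0 23 0) ;; .for 16 20 emitSumAct

/-- The time is proportional to the number of summands, that is, of actions at `X` times actions at
the child; `blkCost_le` bounds the total. -/
theorem runs_emitSum {S : Skel} (H : S.WF) {Q : List Blk} {k : Blk} {m : ℕ} {s : State} {T : ℕ}
    (h : Loaded S s) (hs : HasSid S s) (hQ : ∀ k ∈ Q, S.IsBlk k) (hk : S.IsBlk k) (hn : k ∉ Q)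
    (hc : S.chd k.1 k.2 ≠ 0) (hr : ∀ a < S.na k.1, ∀ b < S.na (S.chd k.1 k.2),
      S.ord k.1 (k.1, a) (S.chd k.1 k.2, b) ∈ S.labelsOf Q) (hA : AtBlock S k s)
    (h23 : s.reg 23 = S.chd k.1 k.2) (hE : Emitted S (S.labelsOf Q) (S.codeOf Q) m s) :
    Runs emitSum s T fun s' T' =>
      Emitted S (S.labelsOf (Q ++ [k])) (S.codeOf (Q ++ [k])) (m + S.na k.1) s' ∧
      T' ≤ T + 4 + (25 + 8 * S.na (S.chd k.1 k.2)) * S.na k.1 := by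
  have hX := H.bef_pos hk.1
  have hZ : S.chd k.1 k.2 ≤ S.n := (H.bef_pos (isChd_chd hc).2.2).2.2
  unfold emitSum
  simp only [runs_seq, runs_op]
  have f1 := (Op.load 20 0 12 0).frame s
  have f2 := (Op.load 24 0 23 0).frame ((Op.load 20 0 12 0).run s)
  have F2 := f1.seq f2
  have e20 : ((Op.load 24 0 23 0).run ((Op.load 20 0 12 0).run s)).reg 20 = S.na k.1 := by
    simp [hA.fst, h.zero, h.na k.1 hX.2.1]
  have e24 : ((Op.load 24 0 23 0).run ((Op.load 20 0 12 0).run s)).reg 24 =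
      S.na (S.chd k.1 k.2) := by
    simp [h23, h.zero, h.na _ hZ]
  refine runs_for (fun j s' T' => Emitted S (S.partLabels Q k j) (S.codeOf Q ++
    (List.range j).flatMap (S.sumCode (S.labelsOf Q) k.1 (S.chd k.1 k.2))) (m + j) s' ∧
    T' ≤ T + 3 + (25 + 8 * S.na (S.chd k.1 k.2)) * j) rfl rfl (by decide) ?_ ?_ ?_
  · refine ⟨?_, by omega⟩
    rw [partLabels_zero]
    simpa using (hE.frame F2).setReg 16 0
  · rintro j s1 T1 hj hi hf ⟨hE1, hT⟩
    rw [e20] at hj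
    have F := F2.seq hf
    have hs1 : HasSid S s1 := by unfold HasSid; rw [F.arr 6 rfl]; exact hs
    refine Runs.mono (runs_emitSumAct H (h.frame F) hs1 hQ hk hn hj hZ (hr j hj) (hA.frame F) hi
      ((F.reg 23 rfl).trans h23) ((hf.reg 24 rfl).trans e24) hE1) ?_
    rintro s2 T2 ⟨h1, h2⟩
    refine ⟨?_, by rw [Nat.mul_succ]; omega⟩
    rw [List.range_succ, List.flatMap_append, ← List.append_assoc, ← Nat.add_assoc]
    simpa using h1.setReg 16 (j + 1)
  · rintro s1 T1 hf ⟨hE1, hT⟩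
    rw [e20] at hE1 hT
    rw [partLabels_na] at hE1
    rw [codeOf_concat, blkCode, if_neg hc]
    exact ⟨hE1, by omega⟩

end Ram

/-! ### The total length of the text -/

namespace Skel

variable {S : Skel}

/-- A bound for the cost of writing out a block. -/
noncomputable def blkCost (S : Skel) (k : Blk) : ℕ := S.na k.1 * S.na (S.chd k.1 k.2)

/-- Why the sums are affordable. Blocks without a preceding child cost as many steps as they have
coordinates, at most `S.weight` together. A block with child `Z` costs `|A_X| |A_Z|`, which is the
summand of the weight for the pair `(X, Z)`. -/
theorem WF.blkCost_le (H : S.WF) {Q : List Blk} (hnd : Q.Nodup) (hQ : ∀ k ∈ Q, S.IsBlk k) :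
    (Q.map S.blkCost).sum ≤ 2 * S.weight := by
  classical
  have h1 : (Q.map S.blkCost).sum = ∑ k ∈ Q.toFinset, S.blkCost k :=
    (List.sum_toFinset _ hnd).symm
  have hw1 : S.weight = ∑ k ∈ S.blkList.toFinset, S.na k.1 := by
    rw [H.weight_eq]; exact (List.sum_toFinset _ H.blkList_nodup).symm
  have hw2 : S.weight = ∑ p ∈ S.pairs.toFinset, S.na p.1 * S.na p.2 :=
    (List.sum_toFinset _ H.pairs_nodup).symm
  have hsplit := Finset.sum_filter_add_sum_filter_not Q.toFinset
    (fun k => S.chd k.1 k.2 = 0) S.blkCost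
  have ha : ∑ k ∈ Q.toFinset with S.chd k.1 k.2 = 0, S.blkCost k ≤ S.weight := by
    rw [hw1]
    refine le_trans (Finset.sum_le_sum (g := fun k => S.na k.1) fun k hk => ?_)
      (Finset.sum_le_sum_of_subset fun k hk => ?_)
    · rw [blkCost, (Finset.mem_filter.1 hk).2, H.na_zero, Nat.mul_one]
    · have := (Finset.mem_filter.1 hk).1
      rw [List.mem_toFinset] at this ⊢
      exact H.mem_blkList.2 (Or.inr (hQ k this))
  have hb : ∑ k ∈ Q.toFinset with ¬ S.chd k.1 k.2 = 0, S.blkCost k ≤ S.weight := by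
    rw [hw2]
    -- No pair `(X, Z)` is charged twice: the sequence of the block is the parent sequence of `Z`.
    have hinj : Set.InjOn (fun k : Blk => (k.1, S.chd k.1 k.2))
        (Q.toFinset.filter fun k => ¬ S.chd k.1 k.2 = 0) := by
      intro k hk k' hk' he
      simp only [Prod.mk.injEq] at he
      have h2 := isChd_chd (Finset.mem_filter.1 hk).2
      have h3 := isChd_chd (Finset.mem_filter.1 hk').2
      rw [← he.2] at h3
      exact Prod.ext he.1 (h2.2.1.symm.trans h3.2.1)
    have h4 := Finset.sum_image (f := fun p : ℕ × ℕ => S.na p.1 * S.na p.2) hinj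
    change _ = ∑ k ∈ Q.toFinset with ¬ S.chd k.1 k.2 = 0, S.blkCost k at h4
    rw [← h4]
    refine Finset.sum_le_sum_of_subset fun p hp => ?_
    obtain ⟨k, hk, rfl⟩ := Finset.mem_image.1 hp
    rw [List.mem_toFinset]
    exact H.mem_pairs.2 (Or.inr (isChd_chd (Finset.mem_filter.1 hk).2).2.2)
  omega

theorem WF.one_le_blkCost (H : S.WF) {k : Blk} (hk : S.IsBlk k) :
    S.na k.1 ≤ S.blkCost k ∧ S.na (S.chd k.1 k.2) ≤ S.blkCost k ∧ 1 ≤ S.na k.1 ∧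
      1 ≤ S.na (S.chd k.1 k.2) := by
  have h1 := H.na_pos _ (H.bef_pos hk.1).2.1
  have h2 : 1 ≤ S.na (S.chd k.1 k.2) := by
    by_cases hc : S.chd k.1 k.2 = 0
    · rw [hc, H.na_zero]
    · exact H.na_pos _ (H.bef_pos (isChd_chd hc).2.2).2.2
  exact ⟨Nat.le_mul_of_pos_right _ h2, Nat.le_mul_of_pos_left _ h1, h1, h2⟩

/-- A simplex takes four numbers, and a sum over `Z` takes `2 |A_Z| + 2 ≤ 4 |A_Z|` for each action.
-/
theorem WF.length_codeOf_le (H : S.WF) {Q : List Blk} (hQ : ∀ k ∈ Q, S.IsBlk k) :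
    (S.codeOf Q).length ≤ 4 * (Q.map S.blkCost).sum := by
  induction Q using List.reverseRecOn with
  | nil => simp [codeOf_nil]
  | append_singleton Q k ih =>
    have h1 := ih fun k hk => hQ k (List.mem_append_left _ hk)
    obtain ⟨h2, h3, h4, h5⟩ := H.one_le_blkCost (hQ k (by simp))
    have h6 : (S.blkCode (S.labelsOf Q) k).length ≤ 4 * S.blkCost k := by
      unfold blkCode
      split_ifs
      · simp only [List.length_cons, List.length_nil]; omega
      · have : ∀ Z a, (S.sumCode (S.labelsOf Q) k.1 Z a).length = 2 * S.na Z + 2 := by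
          intro Z a
          simp [sumCode, List.length_flatMap]
          omega
        simp only [List.length_flatMap, this, List.map_const', List.length_range,
          List.sum_replicate, smul_eq_mul]
        unfold blkCost
        nlinarith
    rw [codeOf_concat, List.length_append, List.map_append, List.sum_append]
    simp only [List.map_cons, List.map_nil, List.sum_cons, List.sum_nil]
    omega

/-- The label of the pair of empty sequences takes the place of the dummy block, which has exactly
one action. -/
theorem WF.length_labelsOf_eq (H : S.WF) {Q : List Blk} (hQ : S.IsOrder Q) :
    (S.labelsOf Q).length = S.weight := by
  obtain ⟨l, hl⟩ := H.blkList_eq_cons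
  have hnd := H.blkList_nodup
  have hmem : ∀ k, k ∈ l ↔ S.IsBlk k := by
    intro k
    have h1 := H.mem_blkList (k := k)
    rw [hl, List.mem_cons] at h1
    rw [hl, List.nodup_cons] at hnd
    constructor
    · intro h
      rcases h1.1 (Or.inr h) with rfl | h2
      · exact absurd h hnd.1
      · exact h2
    · intro h
      rcases h1.2 (Or.inr h) with rfl | h2
      · have := H.bef_pos h.1
        simp at this
      · exact h2
  rw [hl, List.nodup_cons] at hnd
  have hp : Q.Perm l := (List.perm_ext_iff_of_nodup hQ.nodup hnd.2).2 fun k => by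
    rw [hQ.mem, hmem]
  rw [length_labelsOf, H.weight_eq, hl, List.map_cons, List.sum_cons, H.na_zero,
    (hp.map _).sum_eq]

end Skel

/-! ### Programs for writing out all blocks -/

namespace Ram

open Skel

/-- Writes out the blocks in the order of array 33 to the buffers. -/
def emitBlocks : Prog :=
  .op (.const 10 1) ;; .op (.const 6 1) ;; .op (.const 7 0) ;; .op (.const 8 0) ;;
  .op (.const 9 4) ;;
  .for 11 5 (.op (.load 26 33 11 0) ;;
    .ite 0 26 (.op (.load 12 11 26 0) ;; .op (.load 13 12 26 0) ;; .op (.load 14 13 26 0) ;;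
      .op (.load 15 14 26 0) ;; .op (.load 23 15 12 15) ;; .ite 0 23 emitSum emitSplit) .skip)

theorem runs_emitBlocks {S : Skel} (H : S.WF) {q : List ℕ} {s : State} {T : ℕ} (h : Loaded S s)
    (hs : HasSid S s) (hp : HasParent S s) (hB : HasBlocks S S.blkList s)
    (hC : HasChd S S.pairs s) (hnd : q.Nodup) (hq : ∀ x, x ∈ q ↔ x < S.blkList.length)
    (h33 : ∀ i (hi : i < q.length), s.arr 33 i 0 = q[i])
    (harc : ∀ i (hi : i < q.length), ∀ u, (u, q[i]) ∈ S.arcs S.blkList → u ∈ q.take i)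
    (h17 : ∀ x y, s.arr 17 x y = 0) (h19 : ∀ x y, s.arr 19 x y = 0) :
    Runs emitBlocks s T fun s' T' => Emitted S (S.labelsOf (S.blksOf q)) (S.codeOf (S.blksOf q))
      ((S.blksOf q).map S.blkLen).sum s' ∧ T' ≤ T + 7 + 90 * S.weight := by
  have hlen : q.length = S.blkList.length := by
    have : q.Perm (List.range S.blkList.length) :=
      (List.perm_ext_iff_of_nodup hnd List.nodup_range).2 fun x => by rw [hq, List.mem_range]
    simpa using this.length_eq
  have hO := H.isOrder_of_order hnd hq harc
  have hcost := H.blkCost_le hO.nodup fun k hk => (hO.mem k).1 hk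
  have hbl := H.length_blkList_le
  unfold emitBlocks
  simp only [runs_seq, runs_op]
  have F0 := (((((Op.const 10 1).frame s).seq ((Op.const 6 1).frame _)).seq
    ((Op.const 7 0).frame _)).seq ((Op.const 8 0).frame _)).seq ((Op.const 9 4).frame _)
  -- Ten steps per entry of the order and forty per unit of `blkCost` give `10 + 40 * 2 = 90` times
  -- the weight.
  refine runs_for (fun j s' T' => Emitted S (S.labelsOf (S.blksOf (q.take j)))
    (S.codeOf (S.blksOf (q.take j))) ((S.blksOf (q.take j)).map S.blkLen).sum s' ∧
    T' ≤ T + 6 + 10 * j + 40 * ((S.blksOf (q.take j)).map S.blkCost).sum) rfl rfl (by decide)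
    ?_ ?_ ?_
  -- Initially there is the coordinate of the pair of empty sequences. Its position is `0` and its
  -- label consists of four zeros, which blank memory already shows, so only the lengths `1` and `4`
  -- have to be set.
  · refine ⟨⟨?_, ?_, ?_, ?_, ?_, ?_, ?_, ?_⟩, by omega⟩
    · simp [blksOf, labelsOf]
    · simp [blksOf, codeOf_nil]
    · simp [blksOf]
    · simp [blksOf, labelsOf, labelCode]
    · simp
    · simp [blksOf, codeOf_nil]
    · intro i hi
      simp only [blksOf, labelsOf, labelCode, List.take_zero, List.filter_nil, List.map_nil,
        List.flatMap_nil, List.flatMap_cons, List.append_nil, List.length_cons,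
        List.length_nil] at hi
      have : i < 4 := by omega
      have hl : S.loc 0 = 0 := by simp [loc]
      interval_cases i <;> simp [blksOf, labelsOf, labelCode, h19, hl]
    · intro p hp
      simp only [blksOf, labelsOf, List.take_zero, List.filter_nil, List.map_nil,
        List.flatMap_nil, List.mem_singleton] at hp ⊢
      subst hp
      simp [h17, Skel.pos]
  · rintro j s1 T1 hj hi hf ⟨hE, hT⟩
    have hj' : j < S.blkList.length := by
      have : (s.reg 5) = S.blkList.length := hB.len
      rwa [← this]
    have hjq : j < q.length := by omega
    have F := F0.seq hf
    have L := h.frame F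
    have hs1 : HasSid S s1 := by unfold HasSid; rw [F.arr 6 rfl]; exact hs
    have hp1 : HasParent S s1 := by unfold HasParent; rw [F.arr 7 rfl]; exact hp
    have hB1 : HasBlocks S S.blkList s1 := hB.congr (F.reg 5 rfl) (F.arr 11 rfl) (F.arr 12 rfl)
      (F.arr 13 rfl) (F.arr 14 rfl) (F.arr 16 rfl)
    have hC1 : HasChd S S.pairs s1 := hC.congr (F.arr 15 rfl)
    have e33 : s1.arr 33 j 0 = q[j] := by rw [F.arr 33 rfl]; exact h33 j hjq
    have hqj : q[j] < S.blkList.length := (hq _).1 (List.getElem_mem hjq)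
    have htake : q.take (j + 1) = q.take j ++ [q[j]] := by
      rw [List.take_add_one, List.getElem?_eq_getElem hjq]; rfl
    have e11 := hB1.fst _ hqj
    have e12 := hB1.snd _ hqj
    have e13 := hB1.trd _ hqj
    have e14 := hB1.seq _ hqj
    have hqt : ∀ x ∈ q.take j, x < S.blkList.length := fun x hx =>
      (hq x).1 (List.mem_of_mem_take hx)
    have hready := H.ready_of_order hqt (List.mem_map.2 ⟨_, List.getElem_mem hqj,
      H.bid_getElem hqj⟩)
    have hready' := fun h0 => hready h0 (harc j hjq)
    rw [List.getD_eq_getElem _ _ hqj] at hready'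
    rw [htake, blksOf_append]
    -- The number `0` belongs to the dummy block, which is passed over.
    by_cases h0 : q[j] = 0
    · simp only [runs_seq, runs_op, Op.run, runs_ite, runs_skip, State.setReg_reg,
        Nat.reduceEqDiff, OfNat.zero_ne_ofNat, ↓reduceIte, hi, L.zero, e33, h0, lt_self_iff_false]
      have : S.blksOf [0] = [] := by simp [blksOf]
      rw [this, List.append_nil]
      exact ⟨(hE.setReg 26 _).setReg 11 _, by omega⟩
    · have hsingle : S.blksOf [q[j]] = [S.blkList[q[j]]] := by
        simp [blksOf, h0, hqj]
      have hpos : 0 < q[j] := Nat.pos_of_ne_zero h0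
      have hQ : ∀ k ∈ S.blksOf (q.take j), S.IsBlk k := by
        intro k hk
        refine (hO.mem k).1 ?_
        rw [← List.take_append_drop j q, blksOf_append]
        exact List.mem_append_left _ hk
      have hk : S.IsBlk S.blkList[q[j]] := by
        rcases H.mem_blkList.1 (List.getElem_mem hqj) with h1 | h1
        · have h2 := H.bid_getElem hqj
          rw [h1, H.bid_root] at h2
          exact absurd h2.symm h0
        · exact h1
      have hn : S.blkList[q[j]] ∉ S.blksOf (q.take j) := by
        rw [H.mem_blksOf hqt hk, H.bid_getElem hqj]
        intro h1
        obtain ⟨i, hi, he⟩ := List.mem_take_iff_getElem.1 h1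
        have := hnd.getElem_inj_iff.1 he
        omega
      have hr := hready' h0
      rw [hsingle]
      generalize S.blkList[q[j]] = k at *
      have hchd : s1.arr 15 k.1 (S.sid k.2) = S.chd k.1 k.2 := hC1.chd H hk.2
      simp only [runs_seq, runs_op, Op.run, runs_ite, runs_skip, State.setReg_reg,
        State.setReg_arr, Nat.reduceEqDiff, OfNat.zero_ne_ofNat, ↓reduceIte, hi, L.zero, e33, hpos,
        e11, e12, e13, e14, hchd]
      set s2 := (((((s1.setReg 26 q[j]).setReg 12 k.1).setReg 13 k.2.1).setReg 14 k.2.2).setReg 15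
        (S.sid k.2)).setReg 23 (S.chd k.1 k.2) with hs2
      have F2 : Frame (.op (.const 26 q[j]) ;; .op (.const 12 k.1) ;; .op (.const 13 k.2.1) ;;
          .op (.const 14 k.2.2) ;; .op (.const 15 (S.sid k.2)) ;; .op (.const 23 (S.chd k.1 k.2)))
          s1 s2 := (Exec.seq (Exec.op _ _) (Exec.seq (Exec.op _ _)
            (Exec.seq (Exec.op _ _) (Exec.seq (Exec.op _ _) (Exec.seq (Exec.op _ _)
            (Exec.op _ _)))))).frame
      have L2 := L.frame F2
      have hs2' : HasSid S s2 := hs1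
      have hp2 : HasParent S s2 := hp1
      have hE2 := hE.frame F2
      have hA : AtBlock S k s2 := ⟨by simp [hs2], by simp [hs2], by simp [hs2], by simp [hs2]⟩
      obtain ⟨c1, c2, c3, c4⟩ := H.one_le_blkCost hk
      rw [List.map_append, List.sum_append, List.map_append, List.sum_append]
      simp only [List.map_cons, List.map_nil, List.sum_cons, List.sum_nil, Nat.add_zero]
      unfold Ready at hr
      by_cases hc : S.chd k.1 k.2 = 0
      · rw [if_pos hc] at hr
        rw [if_neg (by omega)]
        refine Runs.mono (runs_emitSplit H L2 hs2' hp2 hQ hk hn hc hr hA hE2) ?_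
        rintro s3 T3 ⟨h1, h2⟩
        refine ⟨?_, by omega⟩
        rw [blkLen, if_pos hc]
        exact h1.setReg 11 _
      · rw [if_neg hc] at hr
        rw [if_pos (by omega)]
        refine Runs.mono (runs_emitSum H L2 hs2' hQ hk hn hc hr hA (by simp [hs2]) hE2) ?_
        rintro s3 T3 ⟨h1, h2⟩
        refine ⟨?_, ?_⟩
        · rw [blkLen, if_neg hc]
          exact h1.setReg 11 _
        · have : (25 + 8 * S.na (S.chd k.1 k.2)) * S.na k.1 =
              25 * S.na k.1 + 8 * S.blkCost k := by unfold blkCost; ring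
          omega
  · rintro s1 T1 hf ⟨hE, hT⟩
    have h5 : ((Op.const 9 4).run ((Op.const 8 0).run ((Op.const 7 0).run ((Op.const 6 1).run
      ((Op.const 10 1).run s))))).reg 5 = S.blkList.length := hB.len
    rw [h5, ← hlen, List.take_length] at hE hT
    exact ⟨hE, by omega⟩

/-- Copies the buffers to the output. -/
def writeBuffers : Prog :=
  .op (.write 8) ;; .for 11 7 (.op (.load 12 18 11 0) ;; .op (.write 12)) ;;
  .for 11 9 (.op (.load 12 19 11 0) ;; .op (.write 12))

/-- Buffers are needed because the output begins with the number of extensions, which is known only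
at the end, and because the labels come after the whole text. -/
theorem runs_writeBuffers {S : Skel} {lab : List ((ℕ × ℕ) × (ℕ × ℕ))} {code : List ℕ} {m : ℕ}
    {s : State} {T : ℕ} (hE : Emitted S lab code m s) (h0 : s.reg 0 = 0) (ho : s.out = []) :
    Runs writeBuffers s T fun s' T' => s'.out = m :: code ++ lab.flatMap S.labelCode ∧
      T' ≤ T + 5 + 4 * code.length + 16 * lab.length := by
  have hll : (lab.flatMap S.labelCode).length = 4 * lab.length := by
    simp [List.length_flatMap, labelCode]
    omega
  unfold writeBuffers
  simp only [runs_seq, runs_op, Op.run, ho, hE.ext]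
  refine runs_for (fun j s' T' => s'.out = m :: code.take j ∧ T' ≤ T + 2 + 4 * j) rfl rfl
    (by decide) ?_ ?_ ?_
  · exact ⟨by simp, by omega⟩
  · rintro j s1 T1 hj hi hf ⟨ho, hT⟩
    have hj' : j < code.length := by rw [← hE.codeLen]; exact hj
    have e0 : s1.reg 0 = 0 := (hf.reg 0 rfl).trans h0
    have e18 : s1.arr 18 j 0 = code[j] := by rw [hf.arr 18 rfl]; exact hE.text j hj'
    simp only [runs_seq, runs_op, Op.run]
    refine ⟨?_, by omega⟩
    rw [List.take_add_one, List.getElem?_eq_getElem hj']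
    simp [hi, e0, e18, ho]
  · rintro s1 T1 hf ⟨ho, hT⟩
    have e7 : s.reg 7 = code.length := hE.codeLen
    rw [show ({ s with out := [] ++ [m] } : State).reg 7 = code.length from e7] at ho hT
    rw [List.take_length] at ho
    refine runs_for (fun j s' T' => s'.out = m :: code ++ (lab.flatMap S.labelCode).take j ∧
      T' ≤ T + 4 + 4 * code.length + 4 * j) rfl rfl (by decide) ?_ ?_ ?_
    · exact ⟨by simp [ho], by omega⟩
    · rintro j s2 T2 hj hi hf2 ⟨ho, hT⟩
      have e9 : s1.reg 9 = (lab.flatMap S.labelCode).length := (hf.reg 9 rfl).trans hE.labLen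
      have hj' : j < (lab.flatMap S.labelCode).length := by rwa [e9] at hj
      have e0 : s2.reg 0 = 0 := (hf2.reg 0 rfl).trans ((hf.reg 0 rfl).trans h0)
      have e19 : s2.arr 19 j 0 = (lab.flatMap S.labelCode)[j] := by
        rw [hf2.arr 19 rfl, hf.arr 19 rfl]; exact hE.labels j hj'
      simp only [runs_seq, runs_op, Op.run]
      refine ⟨?_, by omega⟩
      rw [List.take_add_one, List.getElem?_eq_getElem hj']
      simp [hi, e0, e19, ho]
    · rintro s2 T2 hf2 ⟨ho, hT⟩
      have e9 : s1.reg 9 = (lab.flatMap S.labelCode).length := (hf.reg 9 rfl).trans hE.labLen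
      rw [e9] at ho hT
      rw [List.take_length] at ho
      exact ⟨ho, by omega⟩

end Ram

/-! ### The program for the decomposition -/

namespace Ram

open Skel

/-- Writes out a decomposition, given the information structure. -/
def decompose : Prog :=
  numberSeqs ;; numberParents ;; countEdges ;; edgeGraph ;; .op (.copy 43 3) ;; kahn 20 ;;
  findBranches ;; listBlocks ;; blockGraph ;; .op (.copy 43 5) ;; kahn 30 ;; emitBlocks ;;
  writeBuffers

theorem HasSid.congr {S : Skel} {s s' : State} (h : HasSid S s) (h6 : s'.arr 6 = s.arr 6) :
    HasSid S s' := by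
  unfold HasSid
  rw [h6]
  exact h

theorem HasParent.congr {S : Skel} {s s' : State} (h : HasParent S s) (h7 : s'.arr 7 = s.arr 7) :
    HasParent S s' := by
  unfold HasParent
  rw [h7]
  exact h

/-- The phases use separate arrays between 6 and 39, all blank at the start. Each phase is linear in
the number of information sets, actions, edges or blocks, or in `blkCost`, hence in the weight; the
constant is generous. -/
theorem runs_decompose {S : Skel} (H : S.WF) {s : State} {T : ℕ} (h : Loaded S s)
    (ha : ∀ A, 6 ≤ A → A < 40 → ∀ i j, s.arr A i j = 0) (ho : s.out = []) :
    Runs decompose s T fun s' T' =>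
      (∃ Q, S.IsOrder Q ∧ s'.out = S.output Q) ∧ T' ≤ T + 1000 * S.weight := by
  have w1 := H.card_add_edges_le_weight
  have w2 := H.sum_na_le_weight
  have w3 := H.length_blkList_le
  unfold decompose
  simp only [runs_seq]
  refine Runs.mono (runs_numberSeqs h).frame ?_
  rintro s1 T1 ⟨f1, hs1, hT1⟩
  have L1 := h.frame f1
  refine Runs.mono (runs_numberParents H L1 hs1).frame ?_
  rintro s2 T2 ⟨f2, hp2, hT2⟩
  have F2 := f1.seq f2
  refine Runs.mono (runs_countEdges H (h.frame F2) hp2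
    (by rw [F2.arr 9 rfl]; exact ha 9 (by omega) (by omega))).frame ?_
  rintro s3 T3 ⟨f3, he3, hT3⟩
  have F3 := F2.seq f3
  refine Runs.mono (runs_edgeGraph H (h.frame F3) he3 (HasGraph.nil
    (fun i => by rw [F3.arr 21 rfl]; exact ha 21 (by omega) (by omega) _ _)
    (fun i => by rw [F3.arr 22 rfl]; exact ha 22 (by omega) (by omega) _ _))).frame ?_
  rintro s4 T4 ⟨f4, hg4, hT4⟩
  have F4 := F3.seq f4
  have F5 := F4.seq ((Op.copy 43 3).frame s4)
  have L4 := h.frame F4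
  simp only [runs_op]
  have hg5 : HasGraph 20 (edgeArcs S S.edges) ((Op.copy 43 3).run s4) :=
    HasGraph.congr (s := s4) hg4 rfl rfl rfl
  refine Runs.mono (runs_kahn (n := S.edges.length) hg5 (h.frame F5).zero (by simp [L4.edges]) ?_
    (edgeArcs_acyclic H)).frame ?_
  · rintro ⟨u, v⟩ hm
    obtain ⟨e, h1, h2, rfl, rfl⟩ := mem_edgeArcs.1 hm
    exact ⟨eid_lt (H.edges_left _ _ h1 h2), eid_lt h1⟩
  rintro s6 T6 ⟨f6, q, hnd, hq, hq23, hord, hT6⟩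
  have F6 := F5.seq f6
  have hlen1 : (edgeArcs S S.edges).length ≤ S.edges.length := by
    simp only [edgeArcs, List.length_map]
    exact List.length_filter_le _ _
  have he6 : HasEdges S s6 := by
    refine ⟨?_, ?_⟩
    · rw [f6.arr 8 rfl]
      change ∀ e ∈ S.edges, s4.arr 8 _ _ = _
      rw [f4.arr 8 rfl]
      exact he3.eid
    · rw [f6.arr 9 rfl]
      change ∀ t J, s4.arr 9 _ _ = _
      rw [f4.arr 9 rfl]
      exact he3.cnt
  have hp6 : HasParent S s6 := hp2.congr (by
    rw [f6.arr 7 rfl]; change s4.arr 7 = _; rw [f4.arr 7 rfl, f3.arr 7 rfl])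
  refine Runs.mono (runs_findBranches H (h.frame F6) hp6 he6
    (by rw [F6.arr 10 rfl]; exact ha 10 (by omega) (by omega) _) hnd hq hq23 hord).frame ?_
  rintro s7 T7 ⟨f7, hb7, hT7⟩
  have F7 := F6.seq f7
  have hs7 : HasSid S s7 := hs1.congr (by
    rw [f7.arr 6 rfl, f6.arr 6 rfl]; change s4.arr 6 = _
    rw [f4.arr 6 rfl, f3.arr 6 rfl, f2.arr 6 rfl])
  have hp7 : HasParent S s7 := hp6.congr (f7.arr 7 rfl)
  refine Runs.mono (runs_listBlocks H (h.frame F7) hs7 hp7 hb7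
    (by rw [F7.arr 15 rfl]; exact ha 15 (by omega) (by omega))).frame ?_
  rintro s8 T8 ⟨f8, hB8, hC8, hT8⟩
  have F8 := F7.seq f8
  have hs8 : HasSid S s8 := hs7.congr (f8.arr 6 rfl)
  have hp8 : HasParent S s8 := hp7.congr (f8.arr 7 rfl)
  refine Runs.mono (runs_blockGraph H (h.frame F8) hs8 hp8 hB8 (HasGraph.nil
    (fun i => by rw [F8.arr 31 rfl]; exact ha 31 (by omega) (by omega) _ _)
    (fun i => by rw [F8.arr 32 rfl]; exact ha 32 (by omega) (by omega) _ _))).frame ?_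
  rintro s9 T9 ⟨f9, hg9, hT9⟩
  have F9 := F8.seq f9
  have hB9 : HasBlocks S S.blkList s9 := hB8.congr (f9.reg 5 rfl) (f9.arr 11 rfl) (f9.arr 12 rfl)
    (f9.arr 13 rfl) (f9.arr 14 rfl) (f9.arr 16 rfl)
  have F10 := F9.seq ((Op.copy 43 5).frame s9)
  have hg10 : HasGraph 30 (S.arcs S.blkList) ((Op.copy 43 5).run s9) :=
    HasGraph.congr (s := s9) hg9 rfl rfl rfl
  refine Runs.mono (runs_kahn (n := S.blkList.length) hg10 (h.frame F10).zero (by simp [hB9.len]) ?_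
    H.arcs_acyclic).frame ?_
  · rintro ⟨u, v⟩ hm
    obtain ⟨hu, hv, -⟩ := H.mem_arcs hm
    exact ⟨hu, hv⟩
  rintro s11 T11 ⟨f11, q', hnd', hq', hq33, hord', hT11⟩
  have hlen2 := WF.length_arcs_le (S := S) S.blkList
  have F11 := F10.seq f11
  have a11 : ∀ A, blockGraph.setsArr A = false → (kahn 30).setsArr A = false →
      s11.arr A = s8.arr A := by
    intro A h1 h2
    rw [f11.arr A h2]
    exact f9.arr A h1
  have hB11 : HasBlocks S S.blkList s11 := hB9.congr (by rw [f11.reg 5 rfl]; rfl)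
    (by rw [f11.arr 11 rfl]; rfl) (by rw [f11.arr 12 rfl]; rfl) (by rw [f11.arr 13 rfl]; rfl)
    (by rw [f11.arr 14 rfl]; rfl) (by rw [f11.arr 16 rfl]; rfl)
  refine Runs.mono (runs_emitBlocks H (h.frame F11) (hs8.congr (a11 6 rfl rfl))
    (hp8.congr (a11 7 rfl rfl)) hB11 (hC8.congr (a11 15 rfl rfl)) hnd' hq' hq33 hord'
    (by rw [F11.arr 17 rfl]; exact ha 17 (by omega) (by omega))
    (by rw [F11.arr 19 rfl]; exact ha 19 (by omega) (by omega))).frame ?_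
  rintro s12 T12 ⟨f12, hE, hT12⟩
  have F12 := F11.seq f12
  have hO := H.isOrder_of_order hnd' hq' hord'
  refine Runs.mono (runs_writeBuffers hE (h.frame F12).zero ((F12.out rfl).trans ho)) ?_
  rintro s13 T13 ⟨hout, hT13⟩
  have hcost := H.blkCost_le hO.nodup fun k hk => (hO.mem k).1 hk
  have htext := H.length_codeOf_le fun k hk => (hO.mem k).1 hk
  have hlab := H.length_labelsOf_eq hO
  exact ⟨⟨_, hO, hout⟩, by omega⟩

end Ram

/-! ### Consequences of perfect recall, and the information structure of a game -/

namespace EFG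

variable {G : EFG.{u}}

/-- The record is defined by recursion from the root, whereas parent sequences concern its last
entry; this allows induction along the path from its end. -/
theorem playedFrom_append (i : Fin 2) (p t : List G.Act) (a : G.Act) :
    G.playedFrom i p (t ++ [a]) = G.playedFrom i p t ++
      if G.owner (p ++ t) = some i then [((G.info i).part (p ++ t), a)] else [] := by
  induction t generalizing p with
  | nil => simp [playedFrom]
  | cons b t ih =>
    have h : p ++ b :: t = p ++ [b] ++ t := by simp
    simp only [List.cons_append, playedFrom, ih (p ++ [b]), h]
    split_ifs <;> rfl

theorem played_append (i : Fin 2) (h : List G.Act) (a : G.Act) :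
    G.played i (h ++ [a]) = G.played i h ++
      if G.owner h = some i then [((G.info i).part h, a)] else [] := by
  exact playedFrom_append i [] h a

/-- The last pair of a player on the path to a node. -/
theorem exists_of_getLast?_played (i : Fin 2) (u : List G.Act) (x : G.Infoset × G.Act)
    (hx : (G.played i u).getLast? = some x) : ∃ p, p ++ [x.2] <+: u ∧ G.owner p = some i ∧
      x.1 = (G.info i).part p ∧ G.played i u = G.played i p ++ [x] := by
  induction u using List.reverseRecOn with
  | nil => simp [played, playedFrom] at hx
  | append_singleton u a ih =>
    rw [played_append] at hx ⊢
    split_ifs at hx ⊢ with ho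
    · simp only [List.getLast?_append, List.getLast?_singleton, Option.some_or,
        Option.some.injEq] at hx
      subst hx
      exact ⟨u, List.prefix_rfl, ho, rfl, rfl⟩
    · rw [List.append_nil] at hx ⊢
      obtain ⟨p, h1, h2⟩ := ih hx
      exact ⟨p, h1.trans (List.prefix_append _ _), h2⟩

theorem mem_nodes_of_prefix {p u : List G.Act} (h : p <+: u) (hu : u ∈ G.nodes) : p ∈ G.nodes := by
  induction u using List.reverseRecOn with
  | nil => rwa [List.prefix_nil.1 h]
  | append_singleton u a ih =>
    rcases List.prefix_concat_iff.1 h with rfl | h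
    · exact hu
    · exact ih h ((G.mem_append u a).1 hu).1

theorem mem_part {p : List G.Act} {i : Fin 2} (hp : p ∈ G.nodes) (ho : G.owner p = some i)
    (ha : (G.acts p).Nonempty) : p ∈ (G.info i).part p ∧ (G.info i).part p ∈ (G.info i).parts := by
  have h : p ∈ G.nodes.filter fun h => G.owner h = some i ∧ (G.acts h).Nonempty :=
    Finset.mem_filter.2 ⟨hp, ho, ha⟩
  exact ⟨(G.info i).mem_part h, (G.info i).part_mem.2 h⟩

theorem mem_of_mem_parts {i : Fin 2} {I : G.Infoset} (hI : I ∈ (G.info i).parts) {u : List G.Act}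
    (hu : u ∈ I) : u ∈ G.nodes ∧ G.owner u = some i ∧ (G.acts u).Nonempty :=
  Finset.mem_filter.1 ((G.info i).le hI hu)

theorem nonempty_of_mem_parts {i : Fin 2} {I : G.Infoset} (hI : I ∈ (G.info i).parts) :
    I.Nonempty := (G.info i).nonempty_of_mem_parts hI

theorem part_eq {i : Fin 2} {I : G.Infoset} (hI : I ∈ (G.info i).parts) {u : List G.Act}
    (hu : u ∈ I) : (G.info i).part u = I := (G.info i).part_eq_of_mem hI hu

theorem acts_eq_actions {i : Fin 2} {I : G.Infoset} (hI : I ∈ (G.info i).parts) {u : List G.Act}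
    (hu : u ∈ I) : G.acts u = G.actions I := by
  ext a
  simp only [actions, Finset.mem_biUnion]
  exact ⟨fun h => ⟨u, hu, h⟩, fun ⟨v, hv, h⟩ => by rwa [G.acts_eq i I hI u hu v hv]⟩

theorem actions_nonempty {i : Fin 2} {I : G.Infoset} (hI : I ∈ (G.info i).parts) :
    (G.actions I).Nonempty := by
  obtain ⟨u, hu⟩ := nonempty_of_mem_parts hI
  rw [← acts_eq_actions hI hu]
  exact (mem_of_mem_parts hI hu).2.2

theorem parentSeq_eq (hG : G.PerfectRecall) {i : Fin 2} {I : G.Infoset}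
    (hI : I ∈ (G.info i).parts) {u : List G.Act} (hu : u ∈ I) :
    G.parentSeq i I = (G.played i u).getLast? := by
  have h : I.Nonempty := ⟨u, hu⟩
  rw [parentSeq, dif_pos h, hG i I hI _ h.choose_spec u hu]

/-- The parent sequence in terms of a node of the information set. -/
theorem exists_of_parentSeq (hG : G.PerfectRecall) {i : Fin 2} {I I' : G.Infoset} {a : G.Act}
    (hI : I ∈ (G.info i).parts) {u : List G.Act} (hu : u ∈ I)
    (h : G.parentSeq i I = some (I', a)) : ∃ p ∈ I', p ++ [a] <+: u ∧ a ∈ G.actions I' ∧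
      I' ∈ (G.info i).parts ∧ G.played i u = G.played i p ++ [(I', a)] := by
  rw [parentSeq_eq hG hI hu] at h
  obtain ⟨p, h1, h2, h3, h4⟩ := exists_of_getLast?_played i u _ h
  simp only at h1 h3
  have hpa := mem_nodes_of_prefix h1 (mem_of_mem_parts hI hu).1
  have hp := (G.mem_append p a).1 hpa
  have hm := mem_part hp.1 h2 ⟨a, hp.2⟩
  rw [← h3] at hm
  exact ⟨p, hm.1, h1, by rw [← acts_eq_actions hm.2 hm.1]; exact hp.2, hm.2, h4⟩

theorem Connected.symm {I J : G.Infoset} (h : Connected I J) : Connected J I := by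
  obtain ⟨u, hu, v, hv, h⟩ := h
  exact ⟨v, hv, u, hu, h.symm⟩

/-- The node `p` of the parent set lies above `u`. If `v` is below `u` it is below `p`; if `v` is
above `u`, both `p` and `v` are prefixes of `u` and thus comparable. -/
theorem Connected.parent (hG : G.PerfectRecall) {i : Fin 2} {I I' J : G.Infoset} {a : G.Act}
    (hI : I ∈ (G.info i).parts) (h : G.parentSeq i I = some (I', a)) (hc : Connected I J) :
    Connected I' J := by
  obtain ⟨u, hu, v, hv, huv⟩ := hc
  obtain ⟨p, hp, h1, -⟩ := exists_of_parentSeq hG hI hu h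
  have h2 : p <+: u := (List.prefix_append _ _).trans h1
  refine ⟨p, hp, v, hv, ?_⟩
  rcases huv with h3 | h3
  · exact Or.inl (h2.trans h3)
  · exact List.prefix_or_prefix_of_prefix h2 h3

theorem mem_seqs {i : Fin 2} {I : G.Infoset} {a : G.Act} :
    some (I, a) ∈ G.seqs i ↔ I ∈ (G.info i).parts ∧ a ∈ G.actions I := by
  simp only [seqs, Finset.some_mem_insertNone, Finset.mem_biUnion, Finset.mem_image,
    Prod.mk.injEq]
  constructor
  · rintro ⟨I', hI', a', ha', rfl, rfl⟩
    exact ⟨hI', ha'⟩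
  · rintro ⟨h1, h2⟩
    exact ⟨I, h1, a, h2, rfl, rfl⟩

theorem none_mem_seqs {i : Fin 2} : (none : G.Seq) ∈ G.seqs i := by simp [seqs]

theorem parentSeq_mem (hG : G.PerfectRecall) {i : Fin 2} {I : G.Infoset}
    (hI : I ∈ (G.info i).parts) : G.parentSeq i I ∈ G.seqs i := by
  obtain ⟨u, hu⟩ := nonempty_of_mem_parts hI
  rcases h : G.parentSeq i I with _ | ⟨I', a⟩
  · exact none_mem_seqs
  · obtain ⟨p, -, -, h1, h2, -⟩ := exists_of_parentSeq hG hI hu h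
    exact mem_seqs.2 ⟨h2, h1⟩

theorem player_cases (i : Fin 2) : i = 0 ∨ i = 1 := by
  fin_cases i <;> simp

namespace Numbering

variable (ν : G.Numbering)

/-- The number of an information set, the information sets of the first player coming first. -/
def num (i : Fin 2) (I : G.Infoset) : ℕ :=
  (if i = 0 then 0 else (ν.infos 0).length) + (ν.infos i).idxOf I + 1

/-- The pair of numbers of a sequence. -/
def seqNum (i : Fin 2) : G.Seq → ℕ × ℕ
  | none => (0, 0)
  | some (I, a) => (ν.num i I, (ν.acts I).idxOf a)

/-- The player whose information set has the given number. -/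
def side (X : ℕ) : Fin 2 := if X ≤ (ν.infos 0).length then 0 else 1

/-- The information set with the given number. -/
def infoAt (X : ℕ) : G.Infoset :=
  if X ≤ (ν.infos 0).length then (ν.infos 0).getD (X - 1) ∅
  else (ν.infos 1).getD (X - (ν.infos 0).length - 1) ∅

open Classical in
/-- The information structure of the game in numbers. -/
noncomputable def skel (es : List (ℕ × ℕ)) : Skel where
  n0 := (ν.infos 0).length
  n := (ν.infos 0).length + (ν.infos 1).length
  na X := if X = 0 then 1 else (G.actions (ν.infoAt X)).card
  pi X := if X = 0 then 0 else (ν.seqNum (ν.side X) (G.parentSeq (ν.side X) (ν.infoAt X))).1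
  pa X := if X = 0 then 0 else (ν.seqNum (ν.side X) (G.parentSeq (ν.side X) (ν.infoAt X))).2
  dep X := if X = 0 then 0 else
    if h : (ν.infoAt X).Nonempty then (G.played (ν.side X) h.choose).length + 1 else 0
  edges := es

theorem mem_infos' {i : Fin 2} {I : G.Infoset} (hI : I ∈ (G.info i).parts) : I ∈ ν.infos i :=
  (ν.mem_infos i I).2 hI

theorem idxOf_lt {i : Fin 2} {I : G.Infoset} (hI : I ∈ (G.info i).parts) :
    (ν.infos i).idxOf I < (ν.infos i).length := List.idxOf_lt_length_iff.2 (ν.mem_infos' hI)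

theorem num_zero (I : G.Infoset) : ν.num 0 I = (ν.infos 0).idxOf I + 1 := by simp [num]

theorem num_one (I : G.Infoset) :
    ν.num 1 I = (ν.infos 0).length + (ν.infos 1).idxOf I + 1 := by simp [num]

theorem num_le_left {I : G.Infoset} (hI : I ∈ (G.info 0).parts) :
    ν.num 0 I ≤ (ν.infos 0).length := by
  rw [num_zero]
  exact ν.idxOf_lt hI

theorem lt_num_right (I : G.Infoset) : (ν.infos 0).length < ν.num 1 I := by
  rw [num_one]; omega

theorem num_pos (i : Fin 2) (I : G.Infoset) : 1 ≤ ν.num i I := by unfold num; omega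

theorem num_le {i : Fin 2} {I : G.Infoset} (hI : I ∈ (G.info i).parts) :
    ν.num i I ≤ (ν.infos 0).length + (ν.infos 1).length := by
  have h := ν.idxOf_lt hI
  rcases player_cases i with rfl | rfl
  · rw [num_zero]; omega
  · rw [num_one]; omega

theorem side_num {i : Fin 2} {I : G.Infoset} (hI : I ∈ (G.info i).parts) :
    ν.side (ν.num i I) = i := by
  fin_cases i
  · exact if_pos (ν.num_le_left hI)
  · exact if_neg (by have := ν.lt_num_right I; simp only [Fin.mk_one]; omega)

theorem infoAt_num {i : Fin 2} {I : G.Infoset} (hI : I ∈ (G.info i).parts) :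
    ν.infoAt (ν.num i I) = I := by
  have h := ν.idxOf_lt hI
  unfold infoAt
  fin_cases i
  · simp only [Fin.zero_eta] at *
    rw [if_pos (ν.num_le_left hI), num_zero, Nat.add_sub_cancel, List.getD_eq_getElem _ _ h]
    exact List.getElem_idxOf h
  · simp only [Fin.mk_one] at *
    rw [if_neg (by have := ν.lt_num_right I; omega), num_one,
      show (ν.infos 0).length + (ν.infos 1).idxOf I + 1 - (ν.infos 0).length - 1 =
        (ν.infos 1).idxOf I by omega, List.getD_eq_getElem _ _ h]
    exact List.getElem_idxOf h

theorem exists_num {X : ℕ} (h1 : 1 ≤ X) (h2 : X ≤ (ν.infos 0).length + (ν.infos 1).length) :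
    ∃ i, ∃ I ∈ (G.info i).parts, X = ν.num i I := by
  by_cases h : X ≤ (ν.infos 0).length
  · have hl : X - 1 < (ν.infos 0).length := by omega
    refine ⟨0, _, (ν.mem_infos 0 _).1 (List.getElem_mem hl), ?_⟩
    rw [num_zero, (ν.infos_nodup 0).idxOf_getElem]
    omega
  · have hl : X - (ν.infos 0).length - 1 < (ν.infos 1).length := by omega
    refine ⟨1, _, (ν.mem_infos 1 _).1 (List.getElem_mem hl), ?_⟩
    rw [num_one, (ν.infos_nodup 1).idxOf_getElem]
    omega

theorem num_inj {i i' : Fin 2} {I I' : G.Infoset} (hI : I ∈ (G.info i).parts)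
    (hI' : I' ∈ (G.info i').parts) (h : ν.num i I = ν.num i' I') : i = i' ∧ I = I' := by
  constructor
  · rw [← ν.side_num hI, h, ν.side_num hI']
  · rw [← ν.infoAt_num hI, h, ν.infoAt_num hI']

theorem length_acts (I : G.Infoset) : (ν.acts I).length = (G.actions I).card := by
  rw [← List.toFinset_card_of_nodup (ν.acts_nodup I)]
  congr 1
  ext a
  rw [List.mem_toFinset, ν.mem_acts]

theorem idxOf_acts_lt {I : G.Infoset} {a : G.Act} (ha : a ∈ G.actions I) :
    (ν.acts I).idxOf a < (G.actions I).card := by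
  rw [← ν.length_acts]
  exact List.idxOf_lt_length_iff.2 ((ν.mem_acts I a).2 ha)

theorem seqNum_inj {i : Fin 2} {σ τ : G.Seq} (hσ : σ ∈ G.seqs i) (hτ : τ ∈ G.seqs i)
    (h : ν.seqNum i σ = ν.seqNum i τ) : σ = τ := by
  rcases σ with _ | ⟨I, a⟩ <;> rcases τ with _ | ⟨J, b⟩
  · rfl
  · have := ν.num_pos i J
    simp only [seqNum, Prod.mk.injEq] at h
    omega
  · have := ν.num_pos i I
    simp only [seqNum, Prod.mk.injEq] at h
    omega
  · obtain ⟨h1, h2⟩ := mem_seqs.1 hσ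
    obtain ⟨h3, h4⟩ := mem_seqs.1 hτ
    simp only [seqNum, Prod.mk.injEq] at h
    obtain ⟨-, rfl⟩ := ν.num_inj h1 h3 h.1
    have := (List.idxOf_inj ((ν.mem_acts I a).2 h2)).1 h.2
    rw [this]

variable {es : List (ℕ × ℕ)}

theorem na_num {i : Fin 2} {I : G.Infoset} (hI : I ∈ (G.info i).parts) :
    (ν.skel es).na (ν.num i I) = (G.actions I).card := by
  have := ν.num_pos i I
  simp only [skel]
  rw [if_neg (by omega), ν.infoAt_num hI]

theorem sg_num {i : Fin 2} {I : G.Infoset} (hI : I ∈ (G.info i).parts) :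
    (ν.skel es).sg (ν.num i I) = ν.seqNum i (G.parentSeq i I) := by
  have := ν.num_pos i I
  simp only [skel, Skel.sg]
  rw [if_neg (by omega), if_neg (by omega), ν.infoAt_num hI, ν.side_num hI]

theorem dep_num (hG : G.PerfectRecall) {i : Fin 2} {I : G.Infoset} (hI : I ∈ (G.info i).parts)
    {u : List G.Act} (hu : u ∈ I) :
    (ν.skel es).dep (ν.num i I) = (G.played i u).length + 1 := by
  have := ν.num_pos i I
  have hne : I.Nonempty := ⟨u, hu⟩
  simp only [skel]
  rw [if_neg (by omega)]
  simp only [ν.infoAt_num hI, ν.side_num hI]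
  rw [dif_pos hne, hG i I hI _ hne.choose_spec u hu]

/-- The list consists of the pairs of numbers of connected information sets. -/
def ListsEdges (es : List (ℕ × ℕ)) : Prop :=
  es.Nodup ∧ ∀ X Y, (X, Y) ∈ es ↔ ∃ I ∈ (G.info 0).parts, ∃ J ∈ (G.info 1).parts,
    Connected I J ∧ X = ν.num 0 I ∧ Y = ν.num 1 J

variable {ν}

theorem ListsEdges.mem (hes : ν.ListsEdges es) {I J : G.Infoset} (hI : I ∈ (G.info 0).parts)
    (hJ : J ∈ (G.info 1).parts) : (ν.num 0 I, ν.num 1 J) ∈ es ↔ Connected I J := by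
  rw [hes.2]
  constructor
  · rintro ⟨I', hI', J', hJ', h1, h2, h3⟩
    rwa [(ν.num_inj hI hI' h2).2, (ν.num_inj hJ hJ' h3).2]
  · exact fun h => ⟨I, hI, J, hJ, h, rfl, rfl⟩

/-- Perfect recall makes the parent sequence and the depth independent of the node chosen in an
information set. Depth is the length of the player's record plus one, and the record at a node of
the parent set is shorter by one entry. -/
theorem skel_wf (hG : G.PerfectRecall) (hT : G.TriangleFree) (hes : ν.ListsEdges es) :
    (ν.skel es).WF := by
  have hpi : ∀ {i : Fin 2} {I : G.Infoset}, I ∈ (G.info i).parts →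
      (ν.skel es).pi (ν.num i I) = (ν.seqNum i (G.parentSeq i I)).1 := fun hI =>
    congrArg Prod.fst (ν.sg_num (es := es) hI)
  have hpa : ∀ {i : Fin 2} {I : G.Infoset}, I ∈ (G.info i).parts →
      (ν.skel es).pa (ν.num i I) = (ν.seqNum i (G.parentSeq i I)).2 := fun hI =>
    congrArg Prod.snd (ν.sg_num (es := es) hI)
  refine ⟨?_, ?_, ?_, ?_, ?_, ?_, ?_, ?_, ?_, ?_, ?_, ?_, ?_⟩
  · simp [skel]
  · simp [skel]
  · intro X hX
    rcases Nat.eq_zero_or_pos X with rfl | h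
    · simp [skel]
    · obtain ⟨i, I, hI, rfl⟩ := ν.exists_num h hX
      rw [ν.na_num hI]
      exact (actions_nonempty hI).card_pos
  · simp [skel]
  · intro X hX
    rcases Nat.eq_zero_or_pos X with rfl | h
    · simp [skel]
    · obtain ⟨i, I, hI, rfl⟩ := ν.exists_num h (hX.trans (Nat.le_add_right _ _))
      rw [hpi hI]
      have hi : i = 0 := by rw [← ν.side_num hI]; exact if_pos hX
      subst hi
      have hm := parentSeq_mem hG hI
      rcases h : G.parentSeq 0 I with _ | ⟨I', a⟩
      · simp [seqNum]
      · rw [h, mem_seqs] at hm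
        exact ν.num_le_left hm.1
  · intro X h0 hX
    obtain ⟨i, I, hI, rfl⟩ := ν.exists_num (by omega) hX
    rw [hpi hI]
    have hi : i = 1 := by
      rw [← ν.side_num hI]
      exact if_neg (by change (ν.infos 0).length < _ at h0; omega)
    subst hi
    have hm := parentSeq_mem hG hI
    rcases h : G.parentSeq 1 I with _ | ⟨I', a⟩
    · simp [seqNum]
    · rw [h, mem_seqs] at hm
      exact Or.inr ⟨ν.lt_num_right I', ν.num_le hm.1⟩
  · intro X hX
    rcases Nat.eq_zero_or_pos X with rfl | h
    · simp [skel]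
    · obtain ⟨i, I, hI, rfl⟩ := ν.exists_num h hX
      rw [hpi hI, hpa hI]
      have hm := parentSeq_mem hG hI
      rcases h : G.parentSeq i I with _ | ⟨I', a⟩
      · simp [seqNum, skel]
      · rw [h, mem_seqs] at hm
        simp only [seqNum]
        rw [ν.na_num hm.1]
        exact ν.idxOf_acts_lt hm.2
  · intro X h1 hX
    obtain ⟨i, I, hI, rfl⟩ := ν.exists_num h1 hX
    obtain ⟨u, hu⟩ := nonempty_of_mem_parts hI
    rw [hpi hI, ν.dep_num hG hI hu]
    rcases h : G.parentSeq i I with _ | ⟨I', a⟩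
    · simp [seqNum, skel]
    · obtain ⟨p, hp, -, -, h2, h3⟩ := exists_of_parentSeq hG hI hu h
      simp only [seqNum]
      rw [ν.dep_num hG h2 hp, h3]
      simp
  · exact hes.1
  · intro X Y h
    obtain ⟨I, hI, J, hJ, -, rfl, rfl⟩ := (hes.2 X Y).1 h
    exact ⟨ν.num_pos _ _, ν.num_le_left hI, ν.lt_num_right J, ν.num_le hJ⟩
  · intro X Y h h0
    obtain ⟨I, hI, J, hJ, hc, rfl, rfl⟩ := (hes.2 X Y).1 h
    rw [hpi hI] at h0 ⊢
    have hm := parentSeq_mem hG hI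
    rcases hp : G.parentSeq 0 I with _ | ⟨I', a⟩
    · rw [hp] at h0; exact absurd rfl h0
    · rw [hp, mem_seqs] at hm
      exact (hes.mem hm.1 hJ).2 (hc.parent hG hI hp)
  · intro X Y h h0
    obtain ⟨I, hI, J, hJ, hc, rfl, rfl⟩ := (hes.2 X Y).1 h
    rw [hpi hJ] at h0 ⊢
    have hm := parentSeq_mem hG hJ
    rcases hp : G.parentSeq 1 J with _ | ⟨J', a⟩
    · rw [hp] at h0; exact absurd rfl h0
    · rw [hp, mem_seqs] at hm
      exact (hes.mem hI hm.1).2 (hc.symm.parent hG hJ hp).symm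
  -- The three edges share `J` and share `I`. They match the triangle in the game when `J'` is taken
  -- as its first and `J` as its second set of the second player.
  · intro X X' Y Y' hX hY hsX hsY h1 h2 h3
    obtain ⟨I, hI, J, hJ, c1, rfl, rfl⟩ := (hes.2 X Y).1 h1
    obtain ⟨I', hI', J1, hJ1, c2, rfl, hJJ⟩ := (hes.2 _ _).1 h2
    obtain ⟨I1, hI1, J', hJ', c3, hII, rfl⟩ := (hes.2 _ _).1 h3
    obtain ⟨-, rfl⟩ := ν.num_inj hJ hJ1 hJJ
    obtain ⟨-, rfl⟩ := ν.num_inj hI hI1 hII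
    rw [ν.sg_num hI, ν.sg_num hI'] at hsX
    rw [ν.sg_num hJ, ν.sg_num hJ'] at hsY
    refine hT I hI I' hI' (fun h => hX (by rw [h]))
      (ν.seqNum_inj (parentSeq_mem hG hI) (parentSeq_mem hG hI') hsX) J' hJ' J hJ
      (fun h => hY (by rw [h]))
      (ν.seqNum_inj (parentSeq_mem hG hJ') (parentSeq_mem hG hJ) hsY.symm) ⟨c3, c2, c1⟩

end Numbering

end EFG

/-! ### The block equations are equivalent to the constraints -/

namespace Skel

variable {S : Skel}

theorem sum_map_range (f : ℕ → ℝ) (n : ℕ) :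
    ((List.range n).map f).sum = ∑ i ∈ Finset.range n, f i := by
  induction n with
  | zero => simp
  | succ n ih => simp [List.range_succ, Finset.sum_range_succ, ih]

namespace WF

variable (H : S.WF)
include H

/-- Every relevant pair other than the pair of empty sequences lies in a block, by totality of
precedence. -/
theorem mem_labelsOf_iff {Q : List Blk} (hQ : S.IsOrder Q) {s t : ℕ × ℕ} :
    (s, t) ∈ S.labelsOf Q ↔ S.IsSeq s ∧ S.IsSeq t ∧ s.1 ≤ S.n0 ∧ (t.1 = 0 ∨ S.n0 < t.1) ∧
      S.Con s.1 t.1 := by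
  have hn := H.n0_le
  constructor
  · intro h
    obtain ⟨h1, h2⟩ := H.isSeq_labelsOf (fun k hk => (hQ.mem k).1 hk) h
    refine ⟨h1, h2, ?_⟩
    rcases List.mem_cons.1 h with h | h
    · simp only [Prod.mk.injEq] at h
      rw [h.1, h.2]
      exact ⟨Nat.zero_le _, Or.inl rfl, Or.inl ⟨rfl, Nat.zero_le _⟩⟩
    · obtain ⟨⟨X, Y, b⟩, hk, h⟩ := List.mem_flatMap.1 h
      have hk := (hQ.mem _).1 hk
      have hbef : S.Bef Y X := hk.1
      obtain ⟨a, -, h⟩ := List.mem_map.1 h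
      have hX := H.bef_pos hbef
      have hside : Y ≠ 0 → (X ≤ S.n0 ↔ ¬ Y ≤ S.n0) := H.side_of_bef hbef
      simp only [ord] at h
      split_ifs at h with hx
      · simp only [Prod.mk.injEq] at h
        rw [← h.1, ← h.2]
        exact ⟨hx, by simp only; omega, bef_con hbef⟩
      · simp only [Prod.mk.injEq] at h
        rw [← h.1, ← h.2]
        exact ⟨by simp only; omega, Or.inr (by simp only; omega), (bef_con hbef).symm⟩
  · rintro ⟨h1, h2, h3, h4, h5⟩
    by_cases h0 : s.1 = 0 ∧ t.1 = 0
    · have hz := H.na_zero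
      have hs : s = (0, 0) := by
        unfold IsSeq at h1
        rw [h0.1, hz] at h1
        exact Prod.ext h0.1 (by simp only; omega)
      have ht : t = (0, 0) := by
        unfold IsSeq at h2
        rw [h0.2, hz] at h2
        exact Prod.ext h0.2 (by simp only; omega)
      rw [hs, ht]
      exact List.mem_cons_self
    · refine List.mem_cons_of_mem _ (List.mem_flatMap.2 ?_)
      rcases H.bef_total h5 (by omega) with h | h
      · refine ⟨(t.1, s), (hQ.mem _).2 ⟨h, h1⟩, List.mem_map.2 ⟨t.2, List.mem_range.2 h2, ?_⟩⟩
        have := H.bef_pos h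
        simp only [ord]
        rw [if_neg (by omega)]
      · refine ⟨(s.1, t), (hQ.mem _).2 ⟨h, h2⟩, List.mem_map.2 ⟨s.2, List.mem_range.2 h1, ?_⟩⟩
        simp only [ord]
        rw [if_pos h3]

/-- The equations of all blocks are equivalent to the constraints of the polytope. -/
theorem blkEq_iff {Q : List Blk} (hQ : S.IsOrder Q) (w : (ℕ × ℕ) × (ℕ × ℕ) → ℝ) :
    (∀ k ∈ Q, S.BlkEq w k) ↔ ∀ X t, X ≠ 0 → S.Con X t.1 → S.IsSeq t →
      ∑ a ∈ Finset.range (S.na X), w (S.ord X (X, a) t) = w (S.ord X (S.sg X) t) := by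
  have hn := H.n0_le
  have hz := H.na_zero
  constructor
  · intro hB
    -- Labels carry the first player's sequence in front, while `WF.constraint` treats the players
    -- alike. `V` reads `w` at either order of a pair and is symmetric on connected pairs.
    let V : ℕ × ℕ → ℕ × ℕ → ℝ := fun s t =>
      if s.1 = 0 ∧ t.1 = 0 then w ((0, 0), (0, 0)) else
        if (s.1 ≠ 0 ∧ s.1 ≤ S.n0) ∨ (s.1 = 0 ∧ S.n0 < t.1) then w (s, t) else w (t, s)
    have hside : ∀ {X Y : ℕ}, S.Con X Y → X ≠ 0 → Y ≠ 0 → (X ≤ S.n0 ↔ S.n0 < Y) := by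
      intro X Y h h1 h2
      rcases h with h | h | h | h
      · omega
      · omega
      · have := H.edges_mem _ _ h; omega
      · have := H.edges_mem _ _ h; omega
    have hV : ∀ s t, S.Con s.1 t.1 → V s t = V t s := by
      intro s t hc
      have h1 := hside hc
      by_cases hs : s.1 = 0 <;> by_cases ht : t.1 = 0
      · simp [V, hs, ht]
      · by_cases h2 : S.n0 < t.1
        · simp [V, hs, ht, h2]
        · simp [V, hs, ht, h2, Nat.le_of_not_lt h2]
      · by_cases h2 : S.n0 < s.1
        · simp [V, hs, ht, h2]
        · simp [V, hs, ht, h2, Nat.le_of_not_lt h2]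
      · have h2 := h1 hs ht
        by_cases h3 : s.1 ≤ S.n0
        · have h4 := h2.1 h3
          simp [V, hs, ht, h3, h4]
        · have h4 : t.1 ≤ S.n0 := by omega
          have h5 : S.n0 < s.1 := by omega
          simp [V, hs, ht, h4, h5]
    have hV1 : ∀ X t a, X ≠ 0 → V (X, a) t = w (S.ord X (X, a) t) := by
      intro X t a hX
      by_cases hx : X ≤ S.n0
      · simp [V, hX, hx, ord]
      · simp [V, hX, hx, ord]
    have hV2 : ∀ X t, X ≠ 0 → S.Con X t.1 → S.IsSeq t →
        V (S.sg X) t = w (S.ord X (S.sg X) t) := by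
      intro X t hX hc ht
      have hXn := (H.con_le hc).1
      by_cases h0 : S.pi X = 0
      · have h1 := H.pa_lt X hXn
        rw [h0, hz] at h1
        have hsg : S.sg X = (0, 0) := Prod.ext h0 (by simp only [sg]; omega)
        rw [hsg]
        by_cases ht0 : t.1 = 0
        · unfold IsSeq at ht
          rw [ht0, hz] at ht
          have ht' : t = (0, 0) := Prod.ext ht0 (by simp only; omega)
          simp [V, ht', ord]
        · have h2 := hside hc hX ht0
          by_cases hx : X ≤ S.n0
          · simp [V, ht0, ord, hx, h2.1 hx]
          · have h3 : ¬ S.n0 < t.1 := fun h => hx (h2.2 h)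
            simp [V, ht0, ord, hx, h3]
      · have h1 := H.side_pi hXn h0
        have h2 : (S.sg X).1 ≠ 0 := h0
        by_cases hx : X ≤ S.n0
        · have h3 : (S.sg X).1 ≤ S.n0 := h1.2 hx
          simp [V, h2, h3, ord, hx]
        · have h3 : ¬ (S.sg X).1 ≤ S.n0 := fun h => hx (h1.1 h)
          simp [V, h2, h3, ord, hx]
    intro X t hX hc ht
    -- The equation of a block without preceding child is the first hypothesis; the second, for `Y`
    -- at `(X, a)`, is the equation of the block `(X, S.sg Y)`, whose preceding child is `Y`.
    have key := H.constraint (V := V) hV ?_ ?_ hX (Y := t.1) (b := t.2) hc ht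
    · unfold Constraint at key
      simp only [Prod.mk.eta, hV1 X t _ hX] at key
      rw [key, hV2 X t hX hc ht]
    · intro X Y b hbef hb h0
      have h1 := hB (X, Y, b) ((hQ.mem _).2 ⟨hbef, hb⟩)
      have hX : X ≠ 0 := by have := H.bef_pos hbef; omega
      unfold BlkEq at h1
      rw [if_pos h0, labels, List.map_map, sum_map_range] at h1
      unfold Constraint
      simp only [hV1 X _ _ hX]
      rw [hV2 X (Y, b) hX (bef_con hbef) hb, ← h1]
      rfl
    · intro X Y a hY hbef ha
      have hXp := H.bef_pos hbef
      have hX : X ≠ 0 := by omega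
      have hc : S.chd X (S.sg Y) = Y := H.chd_eq ⟨hY, rfl, hbef⟩
      have hpi := H.bef_pi hbef
      have h1 := hB (X, S.sg Y) ((hQ.mem _).2 ⟨hpi, H.pa_lt Y hXp.2.2⟩)
      unfold BlkEq at h1
      rw [if_neg (by simpa only [hc] using hY)] at h1
      have h2 := h1 a ha
      simp only [hc, List.map_map, sum_map_range] at h2
      unfold Constraint
      rw [hV _ _ (bef_con hpi).symm, hV1 X _ a hX, h2]
      refine Finset.sum_congr rfl fun b _ => ?_
      rw [hV _ _ (bef_con hbef).symm, hV1 X _ a hX]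
      rfl
  · intro hC k hk
    have hk := (hQ.mem _).1 hk
    obtain ⟨X, Y, b⟩ := k
    have hbef : S.Bef Y X := hk.1
    have hX := H.bef_pos hbef
    unfold BlkEq
    split_ifs with h0
    · rw [labels, List.map_map, sum_map_range]
      exact hC X (Y, b) (by omega) (bef_con hbef) hk.2
    · intro a ha
      -- Conversely, the equation for the action `a` of a block with preceding child is the
      -- constraint of that child at `(X, a)`.
      obtain ⟨h1, h2, h3⟩ := isChd_chd h0
      have h4 := hC (S.chd X (Y, b)) (X, a) h1 (bef_con h3).symm ha
      have h5 := H.side_of_bef h3 h1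
      have h6 : ∀ u, S.ord (S.chd X (Y, b)) u (X, a) = S.ord X (X, a) u := by
        intro u
        unfold ord
        by_cases hx : X ≤ S.n0
        · rw [if_pos hx, if_neg (h5.1 hx)]
        · rw [if_neg hx, if_pos (by by_contra h; exact hx (h5.2 h))]
      simp only [h6, h2] at h4
      rw [List.map_map, sum_map_range]
      exact h4.symm

end WF

end Skel

/-! ### The polytope in terms of numbers -/

namespace EFG.Numbering

variable {G : EFG.{u}} {ν : G.Numbering} {es : List (ℕ × ℕ)}

theorem isSeq_seqNum {i : Fin 2} {σ : G.Seq} (hσ : σ ∈ G.seqs i) :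
    (ν.skel es).IsSeq (ν.seqNum i σ) := by
  unfold Skel.IsSeq
  rcases σ with _ | ⟨I, a⟩
  · simp [seqNum, skel]
  · obtain ⟨h1, h2⟩ := mem_seqs.1 hσ
    simp only [seqNum, ν.na_num h1]
    exact ν.idxOf_acts_lt h2

theorem exists_seqNum_some {i : Fin 2} {I : G.Infoset} (hI : I ∈ (G.info i).parts) {b : ℕ}
    (hb : b < (ν.skel es).na (ν.num i I)) :
    ∃ a ∈ G.actions I, b = (ν.acts I).idxOf a := by
  rw [ν.na_num hI, ← ν.length_acts] at hb
  exact ⟨_, (ν.mem_acts I _).1 (List.getElem_mem hb), ((ν.acts_nodup I).idxOf_getElem _ _).symm⟩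

theorem exists_seqNum {i : Fin 2} {t : ℕ × ℕ} (ht : (ν.skel es).IsSeq t)
    (h : t.1 = 0 ∨ ∃ I ∈ (G.info i).parts, t.1 = ν.num i I) : ∃ σ ∈ G.seqs i, t = ν.seqNum i σ := by
  rcases h with h | ⟨I, hI, h⟩
  · unfold Skel.IsSeq at ht
    rw [h] at ht
    simp only [skel, if_true] at ht
    exact ⟨none, none_mem_seqs, Prod.ext h (by simp only [seqNum]; omega)⟩
  · unfold Skel.IsSeq at ht
    rw [h] at ht
    obtain ⟨a, ha, hb⟩ := exists_seqNum_some hI ht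
    exact ⟨some (I, a), mem_seqs.2 ⟨hI, ha⟩, Prod.ext h hb⟩

theorem relevant_of_relInfo_left {I : G.Infoset} {a : G.Act} {τ : G.Seq} :
    Relevant (some (I, a)) τ ↔ RelInfo I τ := by
  rcases τ with _ | ⟨J, b⟩ <;> rfl

theorem relevant_of_relInfo_right {J : G.Infoset} {b : G.Act} {σ : G.Seq} :
    Relevant σ (some (J, b)) ↔ RelInfo J σ := by
  rcases σ with _ | ⟨I, a⟩
  · rfl
  · exact ⟨Connected.symm, Connected.symm⟩

theorem mem_relPairs {σ τ : G.Seq} :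
    (σ, τ) ∈ G.relPairs ↔ σ ∈ G.seqs 0 ∧ τ ∈ G.seqs 1 ∧ Relevant σ τ := by
  simp [relPairs, and_assoc]

theorem con_iff (hes : ν.ListsEdges es) {σ τ : G.Seq} (hσ : σ ∈ G.seqs 0) (hτ : τ ∈ G.seqs 1) :
    (ν.skel es).Con (ν.seqNum 0 σ).1 (ν.seqNum 1 τ).1 ↔ Relevant σ τ := by
  have hle : ∀ {i : Fin 2} {σ : G.Seq}, σ ∈ G.seqs i → (ν.seqNum i σ).1 ≤ (ν.skel es).n := by
    intro i σ hσ
    rcases σ with _ | ⟨I, a⟩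
    · exact Nat.zero_le _
    · exact ν.num_le (mem_seqs.1 hσ).1
  rcases σ with _ | ⟨I, a⟩
  · exact ⟨fun _ => trivial, fun _ => Or.inl ⟨rfl, hle hτ⟩⟩
  rcases τ with _ | ⟨J, b⟩
  · exact ⟨fun _ => trivial, fun _ => Or.inr (Or.inl ⟨rfl, hle hσ⟩)⟩
  have hI := (mem_seqs.1 hσ).1
  have hJ := (mem_seqs.1 hτ).1
  have h1 := ν.num_pos 0 I
  have h2 := ν.num_pos 1 J
  have h3 := ν.num_le_left hI
  have h4 := ν.lt_num_right J
  change _ ↔ Connected I J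
  rw [← hes.mem hI hJ]
  simp only [Skel.Con, seqNum]
  constructor
  · rintro (h | h | h | h)
    · omega
    · omega
    · exact h
    · obtain ⟨I', hI', J', -, -, h5, -⟩ := (hes.2 _ _).1 h
      have := ν.num_le_left hI'
      omega
  · exact fun h => Or.inr (Or.inr (Or.inl h))

theorem sum_actions {I : G.Infoset} {i : Fin 2} (hI : I ∈ (G.info i).parts) (g : ℕ → ℝ) :
    ∑ a ∈ G.actions I, g ((ν.acts I).idxOf a) =
      ∑ k ∈ Finset.range ((ν.skel es).na (ν.num i I)), g k := by
  refine Finset.sum_nbij (fun a => (ν.acts I).idxOf a) ?_ ?_ ?_ fun _ _ => rfl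
  · intro a ha
    rw [Finset.mem_range, ν.na_num hI]
    exact ν.idxOf_acts_lt ha
  · intro a ha b hb h
    exact (List.idxOf_inj ((ν.mem_acts I a).2 ha)).1 h
  · intro k hk
    obtain ⟨a, ha, h⟩ := exists_seqNum_some hI (Finset.mem_range.1 hk)
    exact ⟨a, ha, h.symm⟩

/-- The numbers of a pair of sequences. -/
def pairNum (ν : G.Numbering) (p : G.Seq × G.Seq) : (ℕ × ℕ) × (ℕ × ℕ) :=
  (ν.seqNum 0 p.1, ν.seqNum 1 p.2)

theorem parentSeq_relevant (hG : G.PerfectRecall) {I : G.Infoset} (hI : I ∈ (G.info 0).parts)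
    {τ : G.Seq} (h : RelInfo I τ) : Relevant (G.parentSeq 0 I) τ := by
  rcases hp : G.parentSeq 0 I with _ | ⟨I', a⟩
  · trivial
  · rw [relevant_of_relInfo_left]
    rcases τ with _ | ⟨J, b⟩
    · trivial
    · exact Connected.parent hG hI hp h

theorem relevant_parentSeq (hG : G.PerfectRecall) {J : G.Infoset} (hJ : J ∈ (G.info 1).parts)
    {σ : G.Seq} (h : RelInfo J σ) : Relevant σ (G.parentSeq 1 J) := by
  rcases hp : G.parentSeq 1 J with _ | ⟨J', a⟩
  · rcases σ with _ | _ <;> trivial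
  · rw [relevant_of_relInfo_right]
    rcases σ with _ | ⟨I, b⟩
    · trivial
    · exact Connected.parent hG hJ hp h

/-- The vector `w` may be anything outside the numbers of relevant pairs: all entries that a
constraint mentions are relevant, because relevance passes to parent sequences. -/
theorem mem_vsf_iff (hG : G.PerfectRecall) (hes : ν.ListsEdges es) {v : G.relPairs → ℝ}
    {w : (ℕ × ℕ) × (ℕ × ℕ) → ℝ} (hw : ∀ p : G.relPairs, w (ν.pairNum p.1) = v p) :
    v ∈ G.vsf ↔ (∀ p, 0 ≤ v p) ∧ w ((0, 0), (0, 0)) = 1 ∧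
      ∀ X t, X ≠ 0 → (ν.skel es).Con X t.1 → (ν.skel es).IsSeq t →
        ∑ a ∈ Finset.range ((ν.skel es).na X), w ((ν.skel es).ord X (X, a) t) =
          w ((ν.skel es).ord X ((ν.skel es).sg X) t) := by
  have hE : ∀ {σ τ : G.Seq}, σ ∈ G.seqs 0 → τ ∈ G.seqs 1 → Relevant σ τ →
      entry v σ τ = w (ν.seqNum 0 σ, ν.seqNum 1 τ) := by
    intro σ τ h1 h2 h3
    have h4 := mem_relPairs.2 ⟨h1, h2, h3⟩
    rw [entry, dif_pos h4]
    exact (hw ⟨(σ, τ), h4⟩).symm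
  have hleft : ∀ {I : G.Infoset}, I ∈ (G.info 0).parts → ∀ {τ : G.Seq}, τ ∈ G.seqs 1 →
      RelInfo I τ → ((∑ a ∈ G.actions I, entry v (some (I, a)) τ = entry v (G.parentSeq 0 I) τ) ↔
        ∑ a ∈ Finset.range ((ν.skel es).na (ν.num 0 I)),
          w ((ν.skel es).ord (ν.num 0 I) (ν.num 0 I, a) (ν.seqNum 1 τ)) =
          w ((ν.skel es).ord (ν.num 0 I) ((ν.skel es).sg (ν.num 0 I)) (ν.seqNum 1 τ))) := by
    intro I hI τ hτ hr
    have ho : ∀ s t, (ν.skel es).ord (ν.num 0 I) s t = (s, t) := fun s t =>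
      if_pos (ν.num_le_left hI)
    simp only [ho, ν.sg_num hI]
    rw [hE (parentSeq_mem hG hI) hτ (parentSeq_relevant hG hI hr),
      ← sum_actions hI (fun k => w ((ν.num 0 I, k), ν.seqNum 1 τ)),
      Finset.sum_congr rfl fun a ha => hE (mem_seqs.2 ⟨hI, ha⟩) hτ (relevant_of_relInfo_left.2 hr)]
    rfl
  have hright : ∀ {J : G.Infoset}, J ∈ (G.info 1).parts → ∀ {σ : G.Seq}, σ ∈ G.seqs 0 →
      RelInfo J σ → ((∑ a ∈ G.actions J, entry v σ (some (J, a)) = entry v σ (G.parentSeq 1 J)) ↔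
        ∑ a ∈ Finset.range ((ν.skel es).na (ν.num 1 J)),
          w ((ν.skel es).ord (ν.num 1 J) (ν.num 1 J, a) (ν.seqNum 0 σ)) =
          w ((ν.skel es).ord (ν.num 1 J) ((ν.skel es).sg (ν.num 1 J)) (ν.seqNum 0 σ))) := by
    intro J hJ σ hσ hr
    have ho : ∀ s t, (ν.skel es).ord (ν.num 1 J) s t = (t, s) := fun s t =>
      if_neg (Nat.not_le.2 (ν.lt_num_right J))
    simp only [ho, ν.sg_num hJ]
    rw [hE hσ (parentSeq_mem hG hJ) (relevant_parentSeq hG hJ hr),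
      ← sum_actions hJ (fun k => w (ν.seqNum 0 σ, (ν.num 1 J, k))),
      Finset.sum_congr rfl fun a ha => hE hσ (mem_seqs.2 ⟨hJ, ha⟩) (relevant_of_relInfo_right.2 hr)]
    rfl
  have hroot : entry v none none = w ((0, 0), (0, 0)) :=
    hE none_mem_seqs none_mem_seqs trivial
  unfold vsf
  simp only [Set.mem_ofPred_eq, hroot]
  refine and_congr_right fun _ => and_congr_right fun _ => ⟨?_, fun h => ⟨?_, ?_⟩⟩
  · rintro ⟨h1, h2⟩ X t hX hc ht
    have hle : X ≤ (ν.skel es).n ∧ t.1 ≤ (ν.skel es).n := by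
      rcases hc with h | h | h | h
      · omega
      · exact ⟨h.2, by omega⟩
      · obtain ⟨I, hI, J, hJ, -, h3, h4⟩ := (hes.2 _ _).1 h
        rw [h3, h4]
        exact ⟨ν.num_le hI, ν.num_le hJ⟩
      · obtain ⟨I, hI, J, hJ, -, h3, h4⟩ := (hes.2 _ _).1 h
        rw [h3, h4]
        exact ⟨ν.num_le hJ, ν.num_le hI⟩
    obtain ⟨i, I, hI, rfl⟩ := ν.exists_num (Nat.pos_of_ne_zero hX) hle.1
    have hopp : t.1 = 0 ∨ ∃ j ≠ i, ∃ J ∈ (G.info j).parts, t.1 = ν.num j J := by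
      rcases hc with h | h | h | h
      · omega
      · exact Or.inl h.1
      · obtain ⟨I', hI', J, hJ, -, h3, h4⟩ := (hes.2 _ _).1 h
        obtain ⟨rfl, -⟩ := ν.num_inj hI hI' h3
        exact Or.inr ⟨1, by decide, J, hJ, h4⟩
      · obtain ⟨I', hI', J, hJ, -, h3, h4⟩ := (hes.2 _ _).1 h
        obtain ⟨rfl, -⟩ := ν.num_inj hI hJ h4
        exact Or.inr ⟨0, by decide, I', hI', h3⟩
    obtain ⟨a0, ha0⟩ := actions_nonempty hI
    rcases player_cases i with rfl | rfl
    · obtain ⟨τ, hτ, rfl⟩ := exists_seqNum (i := 1) ht (by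
        rcases hopp with h | ⟨j, hj, h⟩
        · exact Or.inl h
        · rcases player_cases j with rfl | rfl
          · exact absurd rfl hj
          · exact Or.inr h)
      have hr := (con_iff hes (σ := some (I, a0)) (mem_seqs.2 ⟨hI, ha0⟩) hτ).1 hc
      rw [relevant_of_relInfo_left] at hr
      exact (hleft hI hτ hr).1 (h1 I hI τ hτ hr)
    · obtain ⟨σ, hσ, rfl⟩ := exists_seqNum (i := 0) ht (by
        rcases hopp with h | ⟨j, hj, h⟩
        · exact Or.inl h
        · rcases player_cases j with rfl | rfl
          · exact Or.inr h
          · exact absurd rfl hj)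
      have hr := (con_iff hes (τ := some (I, a0)) hσ (mem_seqs.2 ⟨hI, ha0⟩)).1 hc.symm
      rw [relevant_of_relInfo_right] at hr
      exact (hright hI hσ hr).1 (h2 I hI σ hσ hr)
  · intro I hI τ hτ hr
    obtain ⟨a0, ha0⟩ := actions_nonempty hI
    have := ν.num_pos 0 I
    exact (hleft hI hτ hr).2 (h _ _ (by omega) ((con_iff hes (σ := some (I, a0))
      (mem_seqs.2 ⟨hI, ha0⟩) hτ).2 (relevant_of_relInfo_left.2 hr)) (isSeq_seqNum hτ))
  · intro J hJ σ hσ hr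
    obtain ⟨a0, ha0⟩ := actions_nonempty hJ
    have := ν.num_pos 1 J
    exact (hright hJ hσ hr).2 (h _ _ (by omega) ((con_iff hes (τ := some (J, a0)) hσ
      (mem_seqs.2 ⟨hJ, ha0⟩)).2 (relevant_of_relInfo_right.2 hr)).symm (isSeq_seqNum hσ))

theorem mem_labelsOf_pairNum (hG : G.PerfectRecall) (hT : G.TriangleFree) (hes : ν.ListsEdges es)
    {Q : List Skel.Blk} (hQ : (ν.skel es).IsOrder Q) {x : (ℕ × ℕ) × (ℕ × ℕ)} :
    x ∈ (ν.skel es).labelsOf Q ↔ ∃ p ∈ G.relPairs, x = ν.pairNum p := by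
  have H := skel_wf hG hT hes
  obtain ⟨s, t⟩ := x
  rw [H.mem_labelsOf_iff hQ]
  constructor
  · rintro ⟨h1, h2, h3, h4, h5⟩
    have hle := H.con_le h5
    obtain ⟨σ, hσ, rfl⟩ := exists_seqNum (i := 0) h1 (by
      rcases Nat.eq_zero_or_pos s.1 with h | h
      · exact Or.inl h
      · obtain ⟨i, I, hI, hs⟩ := ν.exists_num h hle.1
        rcases player_cases i with rfl | rfl
        · exact Or.inr ⟨I, hI, hs⟩
        · have := ν.lt_num_right I
          rw [← hs] at this
          exact absurd h3 (Nat.not_le.2 this))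
    obtain ⟨τ, hτ, rfl⟩ := exists_seqNum (i := 1) h2 (by
      rcases h4 with h | h
      · exact Or.inl h
      · obtain ⟨i, J, hJ, ht⟩ := ν.exists_num (Nat.zero_lt_of_lt h) hle.2
        rcases player_cases i with rfl | rfl
        · have := ν.num_le_left hJ
          rw [← ht] at this
          exact absurd h (Nat.not_lt.2 this)
        · exact Or.inr ⟨J, hJ, ht⟩)
    exact ⟨(σ, τ), mem_relPairs.2 ⟨hσ, hτ, (con_iff hes hσ hτ).1 h5⟩, rfl⟩
  · rintro ⟨⟨σ, τ⟩, hp, h⟩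
    obtain ⟨hσ, hτ, hr⟩ := mem_relPairs.1 hp
    simp only [pairNum, Prod.mk.injEq] at h
    obtain ⟨rfl, rfl⟩ := h
    refine ⟨isSeq_seqNum hσ, isSeq_seqNum hτ, ?_, ?_, (con_iff hes hσ hτ).2 hr⟩
    · rcases σ with _ | ⟨I, a⟩
      · exact Nat.zero_le _
      · exact ν.num_le_left (mem_seqs.1 hσ).1
    · rcases τ with _ | ⟨J, b⟩
      · exact Or.inl rfl
      · exact Or.inr (ν.lt_num_right J)

theorem pairNum_inj {p q : G.Seq × G.Seq} (hp : p ∈ G.relPairs) (hq : q ∈ G.relPairs)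
    (h : ν.pairNum p = ν.pairNum q) : p = q := by
  obtain ⟨h1, h2, -⟩ := mem_relPairs.1 (show (p.1, p.2) ∈ G.relPairs from hp)
  obtain ⟨h3, h4, -⟩ := mem_relPairs.1 (show (q.1, q.2) ∈ G.relPairs from hq)
  simp only [pairNum, Prod.mk.injEq] at h
  exact Prod.ext (ν.seqNum_inj h1 h3 h.1) (ν.seqNum_inj h2 h4 h.2)

theorem labelCode_pairNum {p : G.Seq × G.Seq} (hp : p ∈ G.relPairs) :
    (ν.skel es).labelCode (ν.pairNum p) = ν.seqCode 0 p.1 ++ ν.seqCode 1 p.2 := by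
  obtain ⟨σ, τ⟩ := p
  obtain ⟨h1, h2, -⟩ := mem_relPairs.1 hp
  have hloc0 : (ν.skel es).loc 0 = 0 := by simp [Skel.loc]
  have h3 : [(ν.skel es).loc (ν.seqNum 0 σ).1, (ν.seqNum 0 σ).2] = ν.seqCode 0 σ := by
    rcases σ with _ | ⟨I, a⟩
    · simp [seqNum, seqCode, hloc0]
    · have hI := ν.num_le_left (mem_seqs.1 h1).1
      have : (ν.skel es).loc (ν.num 0 I) = ν.num 0 I := if_pos hI
      simp only [seqNum, seqCode, this]
      rw [num_zero]
  have h4 : [(ν.skel es).loc (ν.seqNum 1 τ).1, (ν.seqNum 1 τ).2] = ν.seqCode 1 τ := by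
    rcases τ with _ | ⟨J, b⟩
    · simp [seqNum, seqCode, hloc0]
    · have hJ := ν.lt_num_right J
      have : (ν.skel es).loc (ν.num 1 J) = ν.num 1 J - (ν.infos 0).length :=
        if_neg (Nat.not_le.2 hJ)
      simp only [seqNum, seqCode, this]
      rw [num_one]
      simp only [List.cons.injEq, and_true]
      omega
  rw [← h3, ← h4]
  rfl

/-- The text for an ordering of the blocks writes out a decomposition. -/
theorem writesDecomposition (hG : G.PerfectRecall) (hT : G.TriangleFree) (hes : ν.ListsEdges es)
    {Q : List Skel.Blk} (hQ : (ν.skel es).IsOrder Q) :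
    ν.WritesDecomposition ((ν.skel es).output Q) ∧ G.dim = (ν.skel es).weight := by
  have H := skel_wf hG hT hes
  have hlen := H.length_labelsOf_eq hQ
  obtain ⟨hnd, -, d, D, hd, hP, hc, hm, hset⟩ :=
    H.realizes Q hQ.nodup (fun k hk => (hQ.mem k).1 hk) hQ.ready
  set lab := (ν.skel es).labelsOf Q with hlab
  have hmem : ∀ x, x ∈ lab ↔ ∃ p ∈ G.relPairs, x = ν.pairNum p := fun x =>
    mem_labelsOf_pairNum hG hT hes hQ
  have hlt : ∀ p : G.relPairs, lab.idxOf (ν.pairNum p.1) < d := fun p => by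
    rw [← hd]
    exact List.idxOf_lt_length_iff.2 ((hmem _).2 ⟨p.1, p.2, rfl⟩)
  -- The position of a pair among the labels. It is a bijection because the labels are without
  -- repetition and are exactly the numbers of relevant pairs; its inverse is the labelling `e` of
  -- the coordinates.
  let f : G.relPairs → Fin d := fun p => ⟨lab.idxOf (ν.pairNum p.1), hlt p⟩
  have hf : Function.Bijective f := by
    constructor
    · intro p q h
      have h1 : lab.idxOf (ν.pairNum p.1) = lab.idxOf (ν.pairNum q.1) := congrArg Fin.val h
      exact Subtype.ext (pairNum_inj p.2 q.2
        ((List.idxOf_inj ((hmem _).2 ⟨p.1, p.2, rfl⟩)).1 h1))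
    · intro k
      have hk : k.1 < lab.length := by rw [hd]; exact k.2
      obtain ⟨p, hp, h⟩ := (hmem _).1 (List.getElem_mem hk)
      refine ⟨⟨p, hp⟩, Fin.ext ?_⟩
      change lab.idxOf (ν.pairNum p) = k.1
      rw [← h]
      exact hnd.idxOf_getElem k.1 hk
  let e : Fin d ≃ G.relPairs := (Equiv.ofBijective f hf).symm
  have hfe : ∀ k, f (e k) = k := fun k => (Equiv.ofBijective f hf).apply_symm_apply k
  have hef : ∀ p, e (f p) = p := fun p => (Equiv.ofBijective f hf).symm_apply_apply p
  have hval : ∀ (x : Fin d → ℝ) (p : G.relPairs), Chain.valAt lab x (ν.pairNum p.1) = x (f p) :=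
    fun x p => by
      -- `Chain.valAt` compares labels by decidable equality, `f` by the product instance.
      have hb : (instBEqOfDecidableEq : BEq ((ℕ × ℕ) × (ℕ × ℕ))) = instBEqProd :=
        lawful_beq_subsingleton _ _
      unfold Chain.valAt
      rw [hb]
      exact dif_pos (hlt p)
  refine ⟨⟨d, D, e, _, ⟨hP, ?_⟩, hc, ?_⟩, ?_⟩
  · rw [hset]
    ext x
    simp only [Set.mem_ofPred_eq, Set.mem_image]
    have hiff : ∀ v : G.relPairs → ℝ, (∀ p, x (f p) = v p) → (v ∈ G.vsf ↔ (∀ i, 0 ≤ x i) ∧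
        Chain.valAt lab x ((0, 0), 0, 0) = 1 ∧
          ∀ k ∈ Q, (ν.skel es).BlkEq (Chain.valAt lab x) k) := by
      intro v hv
      rw [mem_vsf_iff (w := Chain.valAt lab x) hG hes fun p => by rw [hval, hv],
        H.blkEq_iff hQ]
      refine and_congr_left fun _ => ⟨fun h i => ?_, fun h p => ?_⟩
      · rw [← hfe i, hv]; exact h _
      · rw [← hv]; exact h _
    constructor
    · intro h
      exact ⟨fun p => x (f p), (hiff _ fun _ => rfl).2 h, funext fun k => by
        simp only [Function.comp_apply, hfe]⟩
    · rintro ⟨v, hv, rfl⟩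
      exact (hiff v fun p => by simp only [Function.comp_apply, hef]).1 hv
  · rw [Skel.output, hm]
    congr 1
    have hget : ∀ k : Fin d, ν.pairNum (e k).1 = lab[k.1]'(by rw [hd]; exact k.2) := by
      intro k
      have h1 : lab.idxOf (ν.pairNum (e k).1) = k.1 := congrArg Fin.val (hfe k)
      have h2 : lab.idxOf (ν.pairNum (e k).1) < lab.length := by rw [hd]; exact hlt _
      have h3 := List.getElem_idxOf h2
      simp only [h1] at h3
      exact h3.symm
    have hl : lab = (List.finRange d).map fun k => ν.pairNum (e k).1 := by
      refine List.ext_getElem (by simp [hd]) fun i h1 h2 => ?_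
      rw [List.getElem_map, hget]
      simp
    rw [← hlab, hl, List.flatMap_map]
    congr 1
    funext k
    exact labelCode_pairNum (e k).2
  · have := Fintype.card_congr e
    rw [Fintype.card_fin, Fintype.card_coe] at this
    rw [dim, ← this, ← hd, hlen]

end EFG.Numbering

/-! ### Reading the information structure -/

namespace Ram

/-- Sets up the numbers of the information sets, given how many each player has: array 5 for the
output, and array 40, which gives the number of an information set in terms of the player and the
number among the information sets of that player. -/
def layout : Prog :=
  .op (.const 14 1) ;; .op (.const 16 2) ;; .op (.store 0 0 0 14) ;; .op (.const 15 0) ;;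
  .for 12 1 (.op (.inc 15) ;; .op (.store 5 15 0 15) ;; .op (.store 40 14 15 15)) ;;
  .op (.const 17 0) ;;
  .for 12 11 (.op (.inc 15) ;; .op (.inc 17) ;; .op (.store 5 15 0 17) ;;
    .op (.store 40 16 17 15)) ;;
  .op (.copy 2 15) ;; .op (.inc 2)

/-- The numbers of the information sets are set up. -/
structure LaidOut (n0 n1 : ℕ) (s : State) : Prop where
  zero : s.reg 0 = 0
  left : s.reg 1 = n0
  right : s.reg 11 = n1
  one : s.reg 14 = 1
  two : s.reg 16 = 2
  n : s.reg 2 = n0 + n1 + 1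
  loc : ∀ X, X ≤ n0 + n1 → s.arr 5 X 0 = if X ≤ n0 then X else X - n0
  num_none : ∀ j, s.arr 40 0 j = 0
  num_left : ∀ j, j ≤ n0 → s.arr 40 1 j = j
  num_right : ∀ j, j ≤ n1 → s.arr 40 2 j = if j = 0 then 0 else n0 + j

theorem LaidOut.frame {n0 n1 : ℕ} {s s' : State} {p : Prog} (h : LaidOut n0 n1 s)
    (hf : Frame p s s') (h0 : p.setsReg 0 = false := by rfl) (h1 : p.setsReg 1 = false := by rfl)
    (h2 : p.setsReg 2 = false := by rfl) (h11 : p.setsReg 11 = false := by rfl)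
    (h14 : p.setsReg 14 = false := by rfl) (h16 : p.setsReg 16 = false := by rfl)
    (a5 : p.setsArr 5 = false := by rfl) (a40 : p.setsArr 40 = false := by rfl) :
    LaidOut n0 n1 s' where
  zero := (hf.reg 0 h0).trans h.zero
  left := (hf.reg 1 h1).trans h.left
  right := (hf.reg 11 h11).trans h.right
  one := (hf.reg 14 h14).trans h.one
  two := (hf.reg 16 h16).trans h.two
  n := (hf.reg 2 h2).trans h.n
  loc := by rw [hf.arr 5 a5]; exact h.loc
  num_none := by rw [hf.arr 40 a40]; exact h.num_none
  num_left := by rw [hf.arr 40 a40]; exact h.num_left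
  num_right := by rw [hf.arr 40 a40]; exact h.num_right

theorem runs_layout {n0 n1 : ℕ} {s : State} {T : ℕ} (h0 : s.reg 0 = 0) (h1 : s.reg 1 = n0)
    (h11 : s.reg 11 = n1) (ha : ∀ A i j, s.arr A i j = 0) :
    Runs layout s T fun s' T' => LaidOut n0 n1 s' ∧
      (∀ X j, s'.arr 0 X j = if X = 0 ∧ j = 0 then 1 else 0) ∧ T' ≤ T + 11 + 6 * (n0 + n1) := by
  unfold layout
  simp only [runs_seq, runs_op, Op.run, State.setReg_reg, State.setArr_reg, h0,
    Nat.reduceEqDiff, OfNat.zero_ne_ofNat, ↓reduceIte]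
  refine runs_for (fun k s' T' => s'.reg 15 = k ∧
    (∀ X, X ≤ k → s'.arr 5 X 0 = X) ∧ (∀ X, X ≤ k → s'.arr 40 1 X = X) ∧
    (∀ i, i ≠ 1 → ∀ j, s'.arr 40 i j = 0) ∧ T' ≤ T + 5 + 5 * k) rfl rfl (by decide) ?_ ?_ ?_
  · refine ⟨by simp, ?_, ?_, ?_, by omega⟩
    · intro X hX; simp [ha]; omega
    · intro X hX; simp [ha]; omega
    · intro i _ j; simp [ha]
  · rintro k s1 T1 hk hi hf ⟨g15, g5, g40, gz, gT⟩
    have e0 : s1.reg 0 = 0 := (hf.reg 0 rfl).trans (by simpa using h0)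
    have e14 : s1.reg 14 = 1 := (hf.reg 14 rfl).trans (by simp)
    simp only [runs_seq, runs_op, Op.run, State.setReg_reg, State.setArr_reg, g15, e0, e14,
      Nat.reduceEqDiff, OfNat.zero_ne_ofNat, ↓reduceIte]
    refine ⟨by simp [g15], fun X hX => ?_, fun X hX => ?_, fun i hne j => ?_, by omega⟩
    · by_cases hXk : X = k + 1
      · simp [hXk]
      · simp [hXk, g5 X (by omega)]
    · by_cases hXk : X = k + 1
      · simp [hXk]
      · simp [hXk, g40 X (by omega)]
    · simp [hne, gz i hne j]
  · rintro s1 T1 hf ⟨g15, g5, g40, gz, gT⟩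
    have en : ((((s.setReg 14 1).setReg 16 2).setArr 0 0 0 1).setReg 15 0).reg 1 = n0 := by
      simp [h1]
    rw [en] at g15 g5 g40 gT
    have e0 : s1.reg 0 = 0 := (hf.reg 0 rfl).trans (by simpa using h0)
    have e1 : s1.reg 1 = n0 := (hf.reg 1 rfl).trans (by simpa using h1)
    have e11 : s1.reg 11 = n1 := (hf.reg 11 rfl).trans (by simpa using h11)
    have e14 : s1.reg 14 = 1 := (hf.reg 14 rfl).trans (by simp)
    have e16 : s1.reg 16 = 2 := (hf.reg 16 rfl).trans (by simp)
    have a0 : ∀ X j, s1.arr 0 X j = if X = 0 ∧ j = 0 then 1 else 0 := by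
      rw [hf.arr 0 rfl]
      intro X j
      simp [ha]
    refine runs_for (fun k s' T' => s'.reg 15 = n0 + k ∧ s'.reg 17 = k ∧
      (∀ X, X ≤ n0 + k → s'.arr 5 X 0 = if X ≤ n0 then X else X - n0) ∧
      (∀ X, X ≤ n0 → s'.arr 40 1 X = X) ∧ (∀ j, s'.arr 40 0 j = 0) ∧
      (∀ X, X ≤ k → s'.arr 40 2 X = if X = 0 then 0 else n0 + X) ∧ T' ≤ T + 8 + 5 * n0 + 6 * k)
      rfl rfl (by decide) ?_ ?_ ?_
    · refine ⟨by simpa using g15, by simp, fun X hX => ?_, by simpa using g40,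
        by simpa using gz 0 (by decide), fun X hX => ?_, by omega⟩
      · rw [if_pos (by omega)]
        simpa using g5 X (by omega)
      · obtain rfl : X = 0 := by omega
        simpa using gz 2 (by decide) 0
    · rintro k s2 T2 hk hi hf2 ⟨k15, k17, k5, k401, k400, k402, kT⟩
      have d0 : s2.reg 0 = 0 := (hf2.reg 0 rfl).trans (by simpa using e0)
      have d16 : s2.reg 16 = 2 := (hf2.reg 16 rfl).trans (by simpa using e16)
      simp only [runs_seq, runs_op, Op.run, State.setReg_reg, State.setArr_reg, k15, k17, d0, d16,
        Nat.reduceEqDiff, OfNat.zero_ne_ofNat, ↓reduceIte]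
      refine ⟨by omega, by simp [k17], fun X hX => ?_, fun X hX => ?_, fun j => ?_,
        fun X hX => ?_, by omega⟩
      · by_cases hXk : X = n0 + k + 1
        · subst hXk
          have : ¬ n0 + k + 1 ≤ n0 := by omega
          simp [this]
          omega
        · simp [hXk, k5 X (by omega)]
      · simpa using k401 X hX
      · simpa using k400 j
      · by_cases hXk : X = k + 1
        · subst hXk
          simp
          omega
        · simp [hXk, k402 X (by omega)]
    · rintro s2 T2 hf2 ⟨k15, k17, k5, k401, k400, k402, kT⟩
      have en : (s1.setReg 17 0).reg 11 = n1 := by simp [e11]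
      rw [en] at k15 k17 k5 k402 kT
      have d0 : s2.reg 0 = 0 := (hf2.reg 0 rfl).trans (by simpa using e0)
      have d1 : s2.reg 1 = n0 := (hf2.reg 1 rfl).trans (by simpa using e1)
      have d11 : s2.reg 11 = n1 := (hf2.reg 11 rfl).trans (by simpa using e11)
      have d14 : s2.reg 14 = 1 := (hf2.reg 14 rfl).trans (by simpa using e14)
      have d16 : s2.reg 16 = 2 := (hf2.reg 16 rfl).trans (by simpa using e16)
      refine ⟨⟨by simp [d0], by simp [d1], by simp [d11], by simp [d14], by simp [d16],
        by simp [k15], by simpa using k5, by simpa using k400, by simpa using k401,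
        by simpa using k402⟩, ?_, by omega⟩
      simp only [State.setReg_arr]
      rw [hf2.arr 0 rfl]
      simpa using a0

/-- Reads the records of the information sets of one player, the number of the player being in
register `p`, the number of information sets in register `n`, and the number of the information set
before the first one in register 15. -/
def readRecords (p n : ℕ) : Prog :=
  .for 12 n (.op (.inc 15) ;; .op (.read 13) ;; .op (.store 0 15 0 13) ;; .op (.read 13) ;;
    .op (.load 13 40 p 13) ;; .op (.store 1 15 0 13) ;; .op (.read 13) ;; .op (.store 2 15 0 13))

/-- A record may refer to an information set that is listed later, so parents are translated by
array 40, which was set up in advance from the numbers of information sets alone. Column `0` of that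
array stands for the empty sequence. -/
theorem runs_readRecords {p n b : ℕ} {s : State} {T : ℕ} (hp : p ≠ 12 ∧ p ≠ 13 ∧ p ≠ 15)
    (hn : n ≠ 12 ∧ n ≠ 13 ∧ n ≠ 15) (l : List (ℕ × ℕ × ℕ)) (rest : List ℕ)
    (h0 : s.reg 0 = 0) (hb : s.reg 15 = b) (hl : s.reg n = l.length)
    (hi : s.inp = (l.flatMap fun r => [r.1, r.2.1, r.2.2]) ++ rest) :
    Runs (readRecords p n) s T fun s' T' => s'.reg 15 = b + l.length ∧ s'.inp = rest ∧
      (∀ k (h : k < l.length), s'.arr 0 (b + k + 1) 0 = l[k].1 ∧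
        s'.arr 1 (b + k + 1) 0 = s.arr 40 (s.reg p) l[k].2.1 ∧
        s'.arr 2 (b + k + 1) 0 = l[k].2.2) ∧
      (∀ X, X ≤ b → s'.arr 0 X 0 = s.arr 0 X 0 ∧ s'.arr 1 X 0 = s.arr 1 X 0 ∧
        s'.arr 2 X 0 = s.arr 2 X 0) ∧ T' ≤ T + 2 + 10 * l.length := by
  unfold readRecords
  have hreg : ∀ m, m ≠ 12 ∧ m ≠ 13 ∧ m ≠ 15 → (readRecords p n).setsReg m = false := by
    rintro m ⟨h1, h2, h3⟩
    have hb : ∀ c, m ≠ c → Nat.beq c m = false := fun c hc => by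
      cases h' : Nat.beq c m
      · rfl
      · exact absurd (Nat.eq_of_beq_eq_true h').symm hc
    simp [readRecords, Prog.for, Prog.setsReg, Op.setsReg, hb _ h1, hb _ h2, hb _ h3]
  refine runs_for (fun k s' T' => s'.reg 15 = b + k ∧
    s'.inp = ((l.drop k).flatMap fun r => [r.1, r.2.1, r.2.2]) ++ rest ∧
    (∀ j (h : j < l.length), j < k → s'.arr 0 (b + j + 1) 0 = l[j].1 ∧
        s'.arr 1 (b + j + 1) 0 = s.arr 40 (s.reg p) l[j].2.1 ∧
        s'.arr 2 (b + j + 1) 0 = l[j].2.2) ∧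
      (∀ X, X ≤ b → s'.arr 0 X 0 = s.arr 0 X 0 ∧ s'.arr 1 X 0 = s.arr 1 X 0 ∧
        s'.arr 2 X 0 = s.arr 2 X 0) ∧ T' ≤ T + 1 + 10 * k) rfl ?_ (by omega) ?_ ?_ ?_
  · have := hreg n hn
    simp only [readRecords, Prog.for, Prog.setsReg, Bool.or_eq_false_iff] at this ⊢
    exact this.2.1
  · refine ⟨by simpa using hb, by simpa using hi, by simp, by simp, by omega⟩
  · rintro k s1 T1 hk h12 hf ⟨g15, gi, gj, gX, gT⟩
    rw [hl] at hk
    have e0 : s1.reg 0 = 0 := (hf.reg 0 rfl).trans h0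
    have ep : s1.reg p = s.reg p := hf.reg p (hreg p hp)
    have e40 : s1.arr 40 = s.arr 40 := hf.arr 40 rfl
    rw [List.drop_eq_getElem_cons hk, List.flatMap_cons] at gi
    simp only [runs_seq, runs_op, Op.run, State.setReg_reg, State.setArr_reg, State.setReg_arr,
      State.setReg_inp, State.setArr_inp, g15, e0, gi, List.cons_append, List.nil_append,
      List.headD_cons, List.tail_cons, ep, hp.1, hp.2.1, hp.2.2, State.setArr_arr_ne, e40,
      Nat.reduceEqDiff, OfNat.zero_ne_ofNat, ↓reduceIte, ne_eq, not_false_eq_true]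
    refine ⟨by omega, trivial, fun j hj hjk => ?_, fun X hX => ?_, by omega⟩
    · by_cases h : j = k
      · subst h
        simp
      · simp [h, gj j hj (by omega)]
    · have h : X ≠ b + k + 1 := by omega
      simp [h, gX X hX]
  · rintro s1 T1 hf ⟨g15, gi, gj, gX, gT⟩
    rw [hl] at g15 gi gj gT
    refine ⟨g15, by simpa using gi, fun k h => gj k h h, gX, by omega⟩

/-- Reads the connected pairs. -/
def readEdges : Prog :=
  .for 12 3 (.op (.read 13) ;; .op (.inc 13) ;; .op (.load 13 40 14 13) ;; .op (.store 3 12 0 13) ;;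
    .op (.read 13) ;; .op (.inc 13) ;; .op (.load 13 40 16 13) ;; .op (.store 4 12 0 13))

theorem runs_readEdges {n0 n1 : ℕ} {s : State} {T : ℕ} (h : LaidOut n0 n1 s) (l : List (ℕ × ℕ))
    (hl : s.reg 3 = l.length) (hi : s.inp = l.flatMap fun r => [r.1, r.2]) :
    Runs readEdges s T fun s' T' =>
      (∀ k (h : k < l.length), s'.arr 3 k 0 = s.arr 40 1 (l[k].1 + 1) ∧
        s'.arr 4 k 0 = s.arr 40 2 (l[k].2 + 1)) ∧ T' ≤ T + 2 + 10 * l.length := by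
  unfold readEdges
  refine runs_for (fun k s' T' => s'.inp = ((l.drop k).flatMap fun r => [r.1, r.2]) ∧
    (∀ j (h : j < l.length), j < k → s'.arr 3 j 0 = s.arr 40 1 (l[j].1 + 1) ∧
        s'.arr 4 j 0 = s.arr 40 2 (l[j].2 + 1)) ∧ T' ≤ T + 1 + 10 * k)
    rfl rfl (by decide) ?_ ?_ ?_
  · refine ⟨by simpa using hi, by simp, by omega⟩
  · rintro k s1 T1 hk h12 hf ⟨gi, gj, gT⟩
    rw [hl] at hk
    have h1 := h.frame hf
    have e40 : s1.arr 40 = s.arr 40 := hf.arr 40 rfl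
    rw [List.drop_eq_getElem_cons hk, List.flatMap_cons] at gi
    simp only [runs_seq, runs_op, Op.run, State.setReg_reg, State.setArr_reg, State.setReg_arr,
      State.setReg_inp, State.setArr_inp, h12, h1.zero, h1.one, h1.two, gi, List.cons_append,
      List.nil_append, List.headD_cons, List.tail_cons, State.setArr_arr_ne, e40,
      Nat.reduceEqDiff, OfNat.zero_ne_ofNat, ↓reduceIte, ne_eq, not_false_eq_true]
    refine ⟨trivial, fun j hj hjk => ?_, by omega⟩
    by_cases h : j = k
    · subst h
      simp
    · simp [h, gj j hj (by omega)]
  · rintro s1 T1 hf ⟨gi, gj, gT⟩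
    rw [hl] at gj gT
    exact ⟨fun k h => gj k h h, by omega⟩

/-- Reads the information structure. -/
def readInfo : Prog :=
  .op (.read 1) ;; .op (.read 11) ;; .op (.read 3) ;; layout ;; .op (.const 15 0) ;;
  readRecords 14 1 ;; readRecords 16 11 ;; readEdges

/-- The array of numbers of information sets contains the number of the information set of a
sequence. -/
theorem LaidOut.num {G : EFG.{u}} {ν : G.Numbering} {s : State}
    (h : LaidOut (ν.infos 0).length (ν.infos 1).length s) {i : Fin 2} {I : G.Infoset}
    (hI : I ∈ (G.info i).parts) :
    s.arr 40 (i + 1) ((ν.infos i).idxOf I + 1) = ν.num i I := by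
  have hlt := ν.idxOf_lt hI
  rcases EFG.player_cases i with rfl | rfl
  · rw [ν.num_zero]
    exact h.num_left _ hlt
  · rw [ν.num_one]
    exact (h.num_right _ hlt).trans (by simp; omega)

end Ram

namespace EFG.Numbering

open Ram

variable {G : EFG.{u}} {ν : G.Numbering}

/-- The record of an information set. -/
noncomputable def record (ν : G.Numbering) (i : Fin 2) (I : G.Infoset) : ℕ × ℕ × ℕ :=
  ((G.actions I).card, (ν.seqCode i (G.parentSeq i I)).headD 0,
    ((ν.seqCode i (G.parentSeq i I)).getD 1 0))

theorem infoCode_eq (ν : G.Numbering) (i : Fin 2) :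
    ν.infoCode i = ((ν.infos i).map (ν.record i)).flatMap fun r => [r.1, r.2.1, r.2.2] := by
  rw [infoCode, List.flatMap_map]
  congr 1
  funext I
  unfold record
  rcases G.parentSeq i I with _ | ⟨I', a⟩ <;> rfl

theorem seqNum_eq {s : State} (h : LaidOut (ν.infos 0).length (ν.infos 1).length s) {i : Fin 2}
    {σ : G.Seq} (hσ : σ ∈ G.seqs i) :
    ν.seqNum i σ = (s.arr 40 (i + 1) ((ν.seqCode i σ).headD 0), (ν.seqCode i σ).getD 1 0) := by
  rcases σ with _ | ⟨I, a⟩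
  · rcases player_cases i with rfl | rfl
    · exact Prod.ext (h.num_left 0 (Nat.zero_le _)).symm rfl
    · exact Prod.ext (h.num_right 0 (Nat.zero_le _)).symm rfl
  · exact Prod.ext (h.num (mem_seqs.1 hσ).1).symm rfl

/-- The connected pairs as pairs of numbers. -/
def edgeNums (ν : G.Numbering) (edges : List (G.Infoset × G.Infoset)) : List (ℕ × ℕ) :=
  edges.map fun p => (ν.num 0 p.1, ν.num 1 p.2)

theorem listsEdges_edgeNums {edges : List (G.Infoset × G.Infoset)} (he : ListsConnected edges) :
    ν.ListsEdges (ν.edgeNums edges) := by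
  constructor
  · refine List.Nodup.map_on ?_ he.1
    rintro ⟨I, J⟩ h1 ⟨I', J'⟩ h2 h
    obtain ⟨hI, hJ, -⟩ := (he.2 _ _).1 h1
    obtain ⟨hI', hJ', -⟩ := (he.2 _ _).1 h2
    simp only [Prod.mk.injEq] at h
    rw [(ν.num_inj hI hI' h.1).2, (ν.num_inj hJ hJ' h.2).2]
  · intro X Y
    simp only [edgeNums, List.mem_map, Prod.exists, Prod.mk.injEq]
    constructor
    · rintro ⟨I, J, h, rfl, rfl⟩
      obtain ⟨hI, hJ, hc⟩ := (he.2 _ _).1 h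
      exact ⟨I, hI, J, hJ, hc, rfl, rfl⟩
    · rintro ⟨I, hI, J, hJ, hc, rfl, rfl⟩
      exact ⟨I, J, (he.2 _ _).2 ⟨hI, hJ, hc⟩, rfl, rfl⟩

theorem runs_readInfo (hG : G.PerfectRecall) {edges : List (G.Infoset × G.Infoset)}
    (he : ListsConnected edges) :
    Runs readInfo (State.start (ν.infoInput edges)) 0 fun s' T' =>
      Loaded (ν.skel (ν.edgeNums edges)) s' ∧
      T' ≤ 22 + 16 * ((ν.infos 0).length + (ν.infos 1).length + edges.length) := by
  set n0 := (ν.infos 0).length with hn0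
  set n1 := (ν.infos 1).length with hn1
  have hin : ν.infoInput edges = n0 :: n1 :: edges.length ::
      ((((ν.infos 0).map (ν.record 0)).flatMap fun r => [r.1, r.2.1, r.2.2]) ++
      ((((ν.infos 1).map (ν.record 1)).flatMap fun r => [r.1, r.2.1, r.2.2]) ++
      ((edges.map fun p => ((ν.infos 0).idxOf p.1, (ν.infos 1).idxOf p.2)).flatMap
        fun r => [r.1, r.2]))) := by
    simp only [infoInput, infoCode_eq, List.flatMap_map, List.append_assoc, List.cons_append,
      List.nil_append, hn0, hn1]
  unfold readInfo
  simp only [runs_seq, runs_op, Op.run, State.start, State.setReg_inp, hin, List.headD_cons,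
    List.tail_cons]
  refine Runs.mono (runs_layout (n0 := n0) (n1 := n1) (by simp) (by simp) (by simp)
    (by simp)).frame ?_
  rintro s1 T1 ⟨f1, L1, z1, hT1⟩
  have i1 := f1.inp rfl
  have r1 := f1.reg 3 rfl
  have a1 := f1.arr 1 rfl
  have a2 := f1.arr 2 rfl
  simp only [State.setReg_inp, State.setReg_reg, State.setReg_arr, ↓reduceIte] at i1 r1 a1 a2
  have f2 := (Op.const 15 0).frame s1
  have L2 := L1.frame f2
  refine Runs.mono (runs_readRecords (b := 0) (by decide) (by decide)
    ((ν.infos 0).map (ν.record 0)) _ L2.zero (by simp) (by rw [List.length_map]; exact L2.left)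
    i1).frame ?_
  rintro s3 T3 ⟨f3, b3, i3, g3, o3, hT3⟩
  have L3 := L2.frame f3
  refine Runs.mono (runs_readRecords (by decide) (by decide)
    ((ν.infos 1).map (ν.record 1)) _ L3.zero b3 (by rw [List.length_map]; exact L3.right)
    i3).frame ?_
  rintro s4 T4 ⟨f4, b4, i4, g4, o4, hT4⟩
  have L4 := L3.frame f4
  have r4 : s4.reg 3 = edges.length := by
    rw [f4.reg 3 rfl, f3.reg 3 rfl, f2.reg 3 rfl, r1]
  refine Runs.mono (runs_readEdges L4
    (edges.map fun p => ((ν.infos 0).idxOf p.1, (ν.infos 1).idxOf p.2))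
    (by rw [List.length_map]; exact r4) i4).frame ?_
  rintro s5 T5 ⟨f5, g5, hT5⟩
  have L5 := L4.frame f5
  simp only [List.length_map, Nat.zero_add, ← hn0, ← hn1] at *
  have hrec : ∀ X, X ≤ n0 + n1 → s4.arr 0 X 0 = (ν.skel (ν.edgeNums edges)).na X ∧
      s4.arr 1 X 0 = (ν.skel (ν.edgeNums edges)).pi X ∧
      s4.arr 2 X 0 = (ν.skel (ν.edgeNums edges)).pa X := by
    intro X hX
    rcases Nat.eq_zero_or_pos X with rfl | hX0
    · obtain ⟨p1, p2, p3⟩ := o4 0 (Nat.zero_le _)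
      obtain ⟨q1, q2, q3⟩ := o3 0 (Nat.zero_le _)
      refine ⟨?_, ?_, ?_⟩
      · rw [p1, q1]; simpa [Op.run, skel] using z1 0 0
      · rw [p2, q2]; simp [Op.run, skel, a1]
      · rw [p3, q3]; simp [Op.run, skel, a2]
    obtain ⟨i, I, hI, rfl⟩ := ν.exists_num hX0 hX
    have hsg := ν.sg_num (es := ν.edgeNums edges) hI
    have hpi := congrArg Prod.fst hsg
    have hpa := congrArg Prod.snd hsg
    have hlt := ν.idxOf_lt hI
    simp only [Skel.sg] at hpi hpa
    rw [ν.na_num hI, hpi, hpa]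
    have hm := parentSeq_mem hG hI
    rcases player_cases i with rfl | rfl
    · obtain ⟨p1, p2, p3⟩ := o4 _ (ν.num_le_left hI)
      obtain ⟨q1, q2, q3⟩ := g3 _ hlt
      rw [p1, p2, p3, ν.seqNum_eq L2 hm, ν.num_zero, q1, q2, q3, L2.one]
      simp [record]
    · obtain ⟨q1, q2, q3⟩ := g4 _ hlt
      rw [ν.seqNum_eq L3 hm, ν.num_one, q1, q2, q3, L3.two]
      simp [record]
  refine ⟨⟨L5.zero, L5.left, L5.n, ?_, ?_, ?_, ?_, ?_, ?_, ?_⟩, by omega⟩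
  · rw [f5.reg 3 rfl, r4]; simp [skel, edgeNums]
  · rw [f5.arr 0 rfl]; exact fun X hX => (hrec X hX).1
  · rw [f5.arr 1 rfl]; exact fun X hX => (hrec X hX).2.1
  · rw [f5.arr 2 rfl]; exact fun X hX => (hrec X hX).2.2
  · intro k hk
    have hk' : k < edges.length := by simpa [skel, edgeNums] using hk
    have hI := ((he.2 _ _).1 (List.getElem_mem hk')).1
    rw [(g5 k hk').1]
    simpa [skel, edgeNums] using L4.num hI
  · intro k hk
    have hk' : k < edges.length := by simpa [skel, edgeNums] using hk
    have hJ := ((he.2 _ _).1 (List.getElem_mem hk')).2.1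
    rw [(g5 k hk').2]
    simpa [skel, edgeNums] using L4.num hJ
  · exact L5.loc

end EFG.Numbering

/-! ### The running time given the information structure -/

namespace EFG.Numbering

open Ram

variable {G : EFG.{u}} {ν : G.Numbering}

/-- Common to both kinds of input: any program that loads the information structure, leaves arrays 6
to 39 blank and writes nothing can be followed by `decompose`. -/
theorem outputs_decompose (hG : G.PerfectRecall) (hT : G.TriangleFree) {es : List (ℕ × ℕ)}
    (hes : ν.ListsEdges es) {p : Prog} {input : List ℕ} {c : ℕ}
    (h : Runs p (State.start input) 0 fun s' T' => Loaded (ν.skel es) s' ∧ T' ≤ c)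
    (ha : ∀ A, 6 ≤ A → A < 40 → p.setsArr A = false) (hp : p.writes = false) :
    ∃ (out : List ℕ) (t : ℕ), (p ;; decompose).Outputs input out t ∧ ν.WritesDecomposition out ∧
      t ≤ c + 1000 * G.dim ∧ G.dim = (ν.skel es).weight := by
  have H := skel_wf hG hT hes
  obtain ⟨s1, t1, h1, f, L, hT1⟩ := h.frame
  obtain ⟨s2, t2, h2, ⟨Q, hQ, hout⟩, hT2⟩ := runs_decompose (T := 0 + t1) H L
    (fun A h6 h40 i j => by rw [f.arr A (ha A h6 h40)]; rfl) ((f.out hp).trans rfl)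
  obtain ⟨hw, hd⟩ := writesDecomposition hG hT hes hQ
  exact ⟨_, t1 + t2, ⟨s2, Exec.seq h1 h2, hout⟩, hw, by omega, hd⟩

/-- The decomposition is computed from the information structure in linear time. -/
theorem outputs_readInfo_decompose (hG : G.PerfectRecall) (hT : G.TriangleFree)
    {edges : List (G.Infoset × G.Infoset)} (he : ListsConnected edges) :
    ∃ (out : List ℕ) (t : ℕ), (readInfo ;; decompose).Outputs (ν.infoInput edges) out t ∧
      ν.WritesDecomposition out ∧ t ≤ 1022 * G.dim := by
  have hes := listsEdges_edgeNums (ν := ν) he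
  obtain ⟨out, t, h1, h2, h3, hd⟩ := outputs_decompose hG hT hes (runs_readInfo hG he)
    (fun A h6 h40 => by interval_cases A <;> rfl) rfl
  refine ⟨out, t, h1, h2, h3.trans ?_⟩
  -- Reading takes at most `22` steps per information set (with set `0`) and edge, and these are
  -- bounded by the dimensionality: `1022 = 22 + 1000`.
  have hw := (skel_wf hG hT hes).card_add_edges_le_weight
  have : (ν.skel (ν.edgeNums edges)).n = (ν.infos 0).length + (ν.infos 1).length := rfl
  have h4 : (ν.skel (ν.edgeNums edges)).edges.length = edges.length := by simp [skel, edgeNums]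
  omega

/-- Some numbering. -/
noncomputable def default (G : EFG.{u}) : G.Numbering where
  infos i := (G.info i).parts.toList
  infos_nodup _ := Finset.nodup_toList _
  mem_infos _ _ := Finset.mem_toList
  acts I := (G.actions I).toList
  acts_nodup _ := Finset.nodup_toList _
  mem_acts _ _ := Finset.mem_toList

end EFG.Numbering

/-! ### Existence of the decomposition, and the number of relevant pairs -/

namespace EFG

variable {G : EFG.{u}}

theorem exists_listsConnected (G : EFG.{u}) :
    ∃ edges : List (G.Infoset × G.Infoset), ListsConnected edges := by
  classical
  refine ⟨(((G.info 0).parts ×ˢ (G.info 1).parts).filter fun p => Connected p.1 p.2).toList,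
    Finset.nodup_toList _, fun I J => ?_⟩
  rw [Finset.mem_toList, Finset.mem_filter, Finset.mem_product, and_assoc]

/-- Existence is read off from a run of the program on some numbering. -/
theorem exists_isDecomposition (hG : G.PerfectRecall) (hT : G.TriangleFree) :
    ∃ (d : ℕ) (D : Chain d) (e : Fin d ≃ G.relPairs), G.IsDecomposition D e := by
  obtain ⟨edges, he⟩ := exists_listsConnected G
  obtain ⟨-, -, -, ⟨d, D, e, -, h, -⟩, -⟩ :=
    Numbering.outputs_readInfo_decompose (ν := Numbering.default G) hG hT he
  exact ⟨d, D, e, h⟩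

/-- Different sequences of a player end in different nodes. -/
theorem card_seqs_le (G : EFG.{u}) (i : Fin 2) : (G.seqs i).card ≤ G.size := by
  classical
  -- A sequence `(I, a)` goes to the node reached by `a` from a chosen node of `I`, the empty
  -- sequence to the root. The node determines `a` as its last action and `I` as the information set
  -- of its parent.
  let f : G.Seq → List G.Act := fun σ => match σ with
    | none => []
    | some (I, a) => if h : I.Nonempty then h.choose ++ [a] else []
  refine Finset.card_le_card_of_injOn f ?_ ?_
  · rintro (_ | ⟨I, a⟩) hσ
    · exact G.root_mem
    · obtain ⟨hI, ha⟩ := mem_seqs.1 hσ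
      have hne := nonempty_of_mem_parts hI
      have hu := hne.choose_spec
      simp only [f, dif_pos hne, Finset.mem_coe]
      rw [G.mem_append]
      refine ⟨(mem_of_mem_parts hI hu).1, ?_⟩
      rw [acts_eq_actions hI hu]
      exact ha
  · rintro (_ | ⟨I, a⟩) hσ (_ | ⟨J, b⟩) hτ h
    · rfl
    · have hne := nonempty_of_mem_parts (mem_seqs.1 hτ).1
      simp [f, dif_pos hne] at h
    · have hne := nonempty_of_mem_parts (mem_seqs.1 hσ).1
      simp [f, dif_pos hne] at h
    · have hI := (mem_seqs.1 hσ).1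
      have hJ := (mem_seqs.1 hτ).1
      have hne := nonempty_of_mem_parts hI
      have hne' := nonempty_of_mem_parts hJ
      simp only [f, dif_pos hne, dif_pos hne'] at h
      have h1 := List.append_inj' h rfl
      have hu := hne.choose_spec
      have hv := hne'.choose_spec
      rw [← h1.1] at hv
      have h2 := part_eq hI hu
      have h3 := part_eq hJ hv
      simp only [List.cons.injEq, and_true] at h1
      rw [h1.2, ← h2, h3]

theorem dim_le (G : EFG.{u}) : G.dim ≤ G.size ^ 2 := by
  classical
  unfold dim relPairs
  refine (Finset.card_filter_le _ _).trans ?_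
  rw [Finset.card_product, sq]
  exact Nat.mul_le_mul (card_seqs_le G 0) (card_seqs_le G 1)

end EFG

/-! ### The information structure from the game tree -/

namespace Ram

/-- A tree is in the memory: the number of nodes in register 18, and for each node the parent, the
action leading to it, the player and the information set in arrays 41, …, 44. -/
structure HasTree (N : ℕ) (par act plr u : ℕ → ℕ) (s : State) : Prop where
  zero : s.reg 0 = 0
  one : s.reg 14 = 1
  size : s.reg 18 = N
  par : ∀ x, s.arr 41 x 0 = par x
  act : ∀ x, s.arr 42 x 0 = act x
  plr : ∀ x, s.arr 43 x 0 = plr x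
  u : ∀ x, s.arr 44 x 0 = u x

theorem HasTree.frame {N : ℕ} {par act plr u : ℕ → ℕ} {s s' : State} {p : Prog}
    (h : HasTree N par act plr u s) (hf : Frame p s s') (h0 : p.setsReg 0 = false := by rfl)
    (h14 : p.setsReg 14 = false := by rfl) (h18 : p.setsReg 18 = false := by rfl)
    (a41 : p.setsArr 41 = false := by rfl) (a42 : p.setsArr 42 = false := by rfl)
    (a43 : p.setsArr 43 = false := by rfl) (a44 : p.setsArr 44 = false := by rfl) :
    HasTree N par act plr u s' where
  zero := (hf.reg 0 h0).trans h.zero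
  one := (hf.reg 14 h14).trans h.one
  size := (hf.reg 18 h18).trans h.size
  par := by rw [hf.arr 41 a41]; exact h.par
  act := by rw [hf.arr 42 a42]; exact h.act
  plr := by rw [hf.arr 43 a43]; exact h.plr
  u := by rw [hf.arr 44 a44]; exact h.u

theorem HasTree.setReg {N : ℕ} {par act plr u : ℕ → ℕ} {s : State}
    (h : HasTree N par act plr u s) (r v : ℕ) (h0 : 0 ≠ r := by decide) (h14 : 14 ≠ r := by decide)
    (h18 : 18 ≠ r := by decide) : HasTree N par act plr u (s.setReg r v) where
  zero := by simpa [h0] using h.zero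
  one := by simpa [h14] using h.one
  size := by simpa [h18] using h.size
  par := h.par
  act := h.act
  plr := h.plr
  u := h.u

/-- Reads the nodes of the tree. -/
def readNodes : Prog :=
  .for 12 18 (.op (.copy 19 12) ;; .op (.inc 19) ;; .op (.read 13) ;; .op (.store 41 19 0 13) ;;
    .op (.read 13) ;; .op (.store 42 19 0 13) ;; .op (.read 13) ;; .op (.store 43 19 0 13) ;;
    .op (.read 20) ;; .op (.inc 20) ;; .op (.load 20 40 13 20) ;; .op (.store 44 19 0 20))

theorem runs_readNodes {s : State} {T : ℕ} (l : List (ℕ × ℕ × ℕ × ℕ)) (h0 : s.reg 0 = 0)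
    (hl : s.reg 18 = l.length) (hi : s.inp = l.flatMap fun r => [r.1, r.2.1, r.2.2.1, r.2.2.2]) :
    Runs readNodes s T fun s' T' =>
      (∀ k (h : k < l.length), s'.arr 41 (k + 1) 0 = l[k].1 ∧ s'.arr 42 (k + 1) 0 = l[k].2.1 ∧
        s'.arr 43 (k + 1) 0 = l[k].2.2.1 ∧
        s'.arr 44 (k + 1) 0 = s.arr 40 l[k].2.2.1 (l[k].2.2.2 + 1)) ∧
      s'.arr 41 0 0 = s.arr 41 0 0 ∧ s'.arr 42 0 0 = s.arr 42 0 0 ∧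
      s'.arr 43 0 0 = s.arr 43 0 0 ∧ s'.arr 44 0 0 = s.arr 44 0 0 ∧
      T' ≤ T + 2 + 14 * l.length := by
  unfold readNodes
  refine runs_for (fun k s' T' =>
    s'.inp = ((l.drop k).flatMap fun r => [r.1, r.2.1, r.2.2.1, r.2.2.2]) ∧
    (∀ j (h : j < l.length), j < k → s'.arr 41 (j + 1) 0 = l[j].1 ∧
      s'.arr 42 (j + 1) 0 = l[j].2.1 ∧ s'.arr 43 (j + 1) 0 = l[j].2.2.1 ∧
      s'.arr 44 (j + 1) 0 = s.arr 40 l[j].2.2.1 (l[j].2.2.2 + 1)) ∧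
    s'.arr 41 0 0 = s.arr 41 0 0 ∧ s'.arr 42 0 0 = s.arr 42 0 0 ∧
    s'.arr 43 0 0 = s.arr 43 0 0 ∧ s'.arr 44 0 0 = s.arr 44 0 0 ∧
    T' ≤ T + 1 + 14 * k) rfl rfl (by decide) ?_ ?_ ?_
  · exact ⟨by simpa using hi, by simp, rfl, rfl, rfl, rfl, by omega⟩
  · rintro k s1 T1 hk h12 hf ⟨gi, gj, z1, z2, z3, z4, gT⟩
    rw [hl] at hk
    have e0 : s1.reg 0 = 0 := (hf.reg 0 rfl).trans h0
    have e40 : s1.arr 40 = s.arr 40 := hf.arr 40 rfl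
    rw [List.drop_eq_getElem_cons hk, List.flatMap_cons] at gi
    simp only [runs_seq, runs_op, Op.run, State.setReg_reg, State.setArr_reg, State.setReg_arr,
      State.setReg_inp, State.setArr_inp, h12, e0, gi, List.cons_append,
      List.nil_append, List.headD_cons, List.tail_cons, State.setArr_arr_ne, e40,
      Nat.reduceEqDiff, OfNat.zero_ne_ofNat, ↓reduceIte, ne_eq, not_false_eq_true]
    refine ⟨trivial, fun j hj hjk => ?_, by simp [z1], by simp [z2], by simp [z3], by simp [z4],
      by omega⟩
    by_cases h : j = k
    · subst h
      simp
    · simp [h, gj j hj (by omega)]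
  · rintro s1 T1 hf ⟨gi, gj, z1, z2, z3, z4, gT⟩
    rw [hl] at gj gT
    exact ⟨fun k h => gj k h h, z1, z2, z3, z4, by omega⟩

variable {N : ℕ} {par act plr u : ℕ → ℕ}

/-- Counts the actions at each information set. -/
def countActions : Prog :=
  .for 12 18 (.op (.copy 19 12) ;; .op (.inc 19) ;; .op (.load 20 41 19 0) ;;
    .op (.load 20 44 20 0) ;; .op (.load 21 42 19 0) ;; .op (.inc 21) ;; .op (.load 22 0 20 0) ;;
    .ite 22 21 (.op (.store 0 20 0 21)) .skip)

/-- The number of actions is found as the maximum of the action numbers plus one. Children of chance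
nodes and the root are booked under set `0` with action number `0`, which agrees with its single
action. -/
theorem runs_countActions {s : State} {T : ℕ} (h : HasTree N par act plr u s) :
    Runs countActions s T fun s' T' =>
      (∀ x, 1 ≤ x → x ≤ N → act x + 1 ≤ s'.arr 0 (u (par x)) 0) ∧
      (∀ X, s'.arr 0 X 0 = s.arr 0 X 0 ∨
        ∃ x, 1 ≤ x ∧ x ≤ N ∧ u (par x) = X ∧ s'.arr 0 X 0 = act x + 1) ∧
      T' ≤ T + 2 + 12 * N := by
  unfold countActions
  refine runs_for (fun k s' T' =>
      (∀ x, 1 ≤ x → x ≤ k → act x + 1 ≤ s'.arr 0 (u (par x)) 0) ∧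
      (∀ X, s'.arr 0 X 0 = s.arr 0 X 0 ∨
        ∃ x, 1 ≤ x ∧ x ≤ k ∧ u (par x) = X ∧ s'.arr 0 X 0 = act x + 1) ∧
      T' ≤ T + 1 + 12 * k) rfl rfl (by decide) ?_ ?_ ?_
  · exact ⟨fun x h1 h2 => by omega, fun X => Or.inl rfl, by omega⟩
  · rintro k s1 T1 hk h12 hf ⟨g1, g2, gT⟩
    have h1 := h.frame hf
    simp only [runs_seq, runs_op, runs_ite, runs_skip, Op.run, State.setReg_reg, State.setArr_reg,
      State.setReg_arr, h12, h1.zero, h1.par, h1.u, h1.act,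
      Nat.reduceEqDiff, OfNat.zero_ne_ofNat, ↓reduceIte]
    split_ifs with hlt
    · refine ⟨fun x hx1 hx2 => ?_, fun X => ?_, by omega⟩
      · by_cases hx : u (par x) = u (par (k + 1))
        · by_cases hxk : x = k + 1
          · subst hxk; simp
          · have := g1 x hx1 (by omega)
            rw [hx] at this
            simp [hx]
            omega
        · have hxk : x ≠ k + 1 := by rintro rfl; exact hx rfl
          have := g1 x hx1 (by omega)
          simpa [hx] using this
      · by_cases hX : X = u (par (k + 1))
        · exact Or.inr ⟨k + 1, by omega, le_rfl, hX.symm, by simp [hX]⟩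
        · rcases g2 X with g | ⟨x, x1, x2, x3, x4⟩
          · exact Or.inl (by simpa [hX] using g)
          · exact Or.inr ⟨x, x1, by omega, x3, by simpa [hX] using x4⟩
    · refine ⟨fun x hx1 hx2 => ?_, fun X => ?_, by omega⟩
      · by_cases hxk : x = k + 1
        · subst hxk
          simpa using hlt
        · simpa using g1 x hx1 (by omega)
      · rcases g2 X with g | ⟨x, x1, x2, x3, x4⟩
        · exact Or.inl (by simpa using g)
        · exact Or.inr ⟨x, x1, by omega, x3, by simpa using x4⟩
  · rintro s1 T1 hf ⟨g1, g2, gT⟩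
    rw [h.size] at g1 g2 gT
    exact ⟨g1, g2, by omega⟩

/-- Finds the parent sequences of the information sets. -/
def findParents : Prog :=
  .for 12 18 (.op (.copy 19 12) ;; .op (.inc 19) ;; .op (.load 23 43 19 0) ;;
    .op (.load 21 44 19 0) ;; .op (.copy 22 19) ;;
    .for 24 18 (.op (.load 25 41 22 0) ;; .op (.load 26 43 25 0) ;;
      .ite 0 23 (.ite 26 23 .skip (.ite 23 26 .skip (.op (.load 27 44 25 0) ;;
        .op (.store 1 21 0 27) ;; .op (.load 27 42 22 0) ;; .op (.store 2 21 0 27) ;;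
        .op (.const 23 0)))) .skip ;;
      .op (.copy 22 25)))

/-- From every decision node the path is climbed until the same player is met again. Different nodes
of an information set write the same values: the hypotheses express them by functions of `u x`, as
perfect recall permits. -/
theorem runs_findParents {s : State} {T : ℕ} (h : HasTree N par act plr u s) {pi pa : ℕ → ℕ}
    (hsome : ∀ x, 1 ≤ x → x ≤ N → 0 < plr x → ∀ k, k < N → plr (par^[k + 1] x) = plr x →
      (∀ j, j < k → plr (par^[j + 1] x) ≠ plr x) →
      pi (u x) = u (par^[k + 1] x) ∧ pa (u x) = act (par^[k] x))
    (hnone : ∀ x, 1 ≤ x → x ≤ N → 0 < plr x → (∀ k, k < N → plr (par^[k + 1] x) ≠ plr x) →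
      pi (u x) = 0 ∧ pa (u x) = 0)
    (h1 : ∀ X, s.arr 1 X 0 = 0) (h2 : ∀ X, s.arr 2 X 0 = 0) :
    Runs findParents s T fun s' T' =>
      (∀ x, 1 ≤ x → x ≤ N → 0 < plr x →
        s'.arr 1 (u x) 0 = pi (u x) ∧ s'.arr 2 (u x) 0 = pa (u x)) ∧
      (∀ X, (∀ x, 1 ≤ x → x ≤ N → 0 < plr x → u x ≠ X) →
        s'.arr 1 X 0 = 0 ∧ s'.arr 2 X 0 = 0) ∧
      T' ≤ T + 2 + (9 + 14 * N) * N := by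
  unfold findParents
  refine runs_for (fun m s' T' =>
      (∀ x, 1 ≤ x → x ≤ m → 0 < plr x →
        s'.arr 1 (u x) 0 = pi (u x) ∧ s'.arr 2 (u x) 0 = pa (u x)) ∧
      (∀ X, s'.arr 1 X 0 = 0 ∧ s'.arr 2 X 0 = 0 ∨
        (∃ x, 1 ≤ x ∧ x ≤ N ∧ 0 < plr x ∧ u x = X) ∧ s'.arr 1 X 0 = pi X ∧ s'.arr 2 X 0 = pa X) ∧
      T' ≤ T + 1 + (9 + 14 * N) * m) rfl rfl (by decide) ?_ ?_ ?_
  · exact ⟨fun x h1 h2 => by omega, fun X => Or.inl ⟨h1 X, h2 X⟩, by omega⟩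
  · rintro m s1 T1 hm h12 hf ⟨g1, g2, gT⟩
    rw [h.size] at hm
    have H1 := h.frame hf
    simp only [runs_seq, runs_op, Op.run, State.setReg_reg, State.setArr_reg,
      State.setReg_arr, h12, H1.zero, H1.plr, H1.u,
      Nat.reduceEqDiff, OfNat.zero_ne_ofNat, ↓reduceIte]
    -- Register 23 holds the player searched for, and is set to zero once the parent sequence has
    -- been stored, so that further climbing has no effect.
    refine runs_for (fun k s' T' => s'.reg 22 = par^[k] (m + 1) ∧
      (s'.reg 23 = plr (m + 1) ∧ (∀ j, j < k → 0 < plr (m + 1) →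
          plr (par^[j + 1] (m + 1)) ≠ plr (m + 1)) ∨
        s'.reg 23 = 0 ∧ s'.arr 1 (u (m + 1)) 0 = pi (u (m + 1)) ∧
          s'.arr 2 (u (m + 1)) 0 = pa (u (m + 1))) ∧
      (∀ x, 1 ≤ x → x ≤ m → 0 < plr x →
        s'.arr 1 (u x) 0 = pi (u x) ∧ s'.arr 2 (u x) 0 = pa (u x)) ∧
      (∀ X, s'.arr 1 X 0 = 0 ∧ s'.arr 2 X 0 = 0 ∨
        (∃ x, 1 ≤ x ∧ x ≤ N ∧ 0 < plr x ∧ u x = X) ∧ s'.arr 1 X 0 = pi X ∧ s'.arr 2 X 0 = pa X) ∧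
      T' ≤ T1 + 7 + 14 * k) rfl rfl (by decide) ?_ ?_ ?_
    · exact ⟨by simp, Or.inl ⟨by simp, by simp⟩, by simpa using g1, by simpa using g2, by omega⟩
    · rintro k s2 T2 hk h24 hf2 ⟨k22, k23, k1, k2, kT⟩
      have hk' : k < N := by
        have := H1.size
        simp at hk
        omega
      have H2 := (((((H1.setReg 19 m).setReg 19 (m + 1)).setReg 23 (plr (m + 1))).setReg 21
        (u (m + 1))).setReg 22 (m + 1)).frame hf2
      have e21 : s2.reg 21 = u (m + 1) := (hf2.reg 21 rfl).trans (by simp)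
      simp only [runs_seq, runs_op, runs_ite, runs_skip, Op.run, State.setReg_reg,
        State.setArr_reg, State.setReg_arr, k22, e21, H2.zero, H2.plr, H2.par, H2.u, H2.act,
        State.setArr_arr_ne, Nat.reduceEqDiff, OfNat.zero_ne_ofNat, ↓reduceIte, ne_eq,
        not_false_eq_true, ← Function.iterate_succ_apply' par, Nat.succ_eq_add_one]
      rcases k23 with ⟨e23, hn⟩ | ⟨e23, ep1, ep2⟩
      · rw [e23]
        split_ifs with c0 c1 c2
        · refine ⟨by simp, Or.inl ⟨by simp [e23], fun j hj hp => ?_⟩, by simpa using k1,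
            by simpa using k2, by omega⟩
          rcases Nat.lt_succ_iff_lt_or_eq.1 hj with hj | rfl
          · exact hn j hj hp
          · exact c1.ne
        · refine ⟨by simp, Or.inl ⟨by simp [e23], fun j hj hp => ?_⟩, by simpa using k1,
            by simpa using k2, by omega⟩
          rcases Nat.lt_succ_iff_lt_or_eq.1 hj with hj | rfl
          · exact hn j hj hp
          · exact c2.ne'
        · obtain ⟨p1, p2⟩ := hsome (m + 1) (by omega) (by omega) c0 k hk' (by omega)
            fun j hj => hn j hj c0
          refine ⟨by simp, Or.inr ⟨by simp, by simp [p1], by simp [p2]⟩,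
            fun x hx1 hx2 hp => ?_, fun X => ?_, by omega⟩
          · by_cases hx : u x = u (m + 1)
            · simp [hx, p1, p2]
            · simpa [hx] using k1 x hx1 hx2 hp
          · by_cases hX : X = u (m + 1)
            · exact Or.inr ⟨⟨m + 1, by omega, by omega, c0, hX.symm⟩, by simp [hX, p1, p2]⟩
            · simpa [hX] using k2 X
        · refine ⟨by simp, Or.inl ⟨by simp [e23], fun j hj hp => absurd hp c0⟩,
            by simpa using k1, by simpa using k2, by omega⟩
      · rw [e23]
        simp only [lt_irrefl, ↓reduceIte]
        exact ⟨by simp, Or.inr ⟨by simp [e23], by simpa using ep1, by simpa using ep2⟩,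
          by simpa using k1, by simpa using k2, by omega⟩
    · rintro s2 T2 hf2 ⟨k22, k23, k1, k2, kT⟩
      have en := H1.size
      simp only [State.setReg_reg, Nat.reduceEqDiff, ↓reduceIte, en] at k22 k23 k1 k2 kT
      refine ⟨fun x hx1 hx2 hp => ?_, k2, by rw [Nat.mul_succ]; omega⟩
      by_cases hx : x = m + 1
      · subst hx
        rcases k23 with ⟨-, hn⟩ | ⟨-, h⟩
        · obtain ⟨p1, p2⟩ := hnone _ hx1 hm hp fun j hj => hn j hj hp
          rcases k2 (u (m + 1)) with ⟨q1, q2⟩ | ⟨-, q⟩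
          · rw [q1, q2, p1, p2]; exact ⟨rfl, rfl⟩
          · exact q
        · exact h
      · exact k1 x hx1 (by omega) hp
  · rintro s1 T1 hf ⟨g1, g2, gT⟩
    rw [h.size] at g1 gT
    refine ⟨g1, fun X hX => ?_, by omega⟩
    rcases g2 X with g | ⟨⟨x, x1, x2, x3, x4⟩, -⟩
    · exact g
    · exact absurd x4 (hX x x1 x2 x3)

end Ram

/-! ### The connected pairs from the game tree -/

namespace Ram

/-- The listed pairs are in arrays 3 and 4, and marked in array 45. -/
structure Marked (L : List (ℕ × ℕ)) (s : State) : Prop where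
  len : s.reg 3 = L.length
  nodup : L.Nodup
  mark : ∀ X Y, s.arr 45 X Y = if (X, Y) ∈ L then 1 else 0
  left : ∀ k (h : k < L.length), s.arr 3 k 0 = L[k].1
  right : ∀ k (h : k < L.length), s.arr 4 k 0 = L[k].2

theorem Marked.congr {L : List (ℕ × ℕ)} {s s' : State} (h : Marked L s) (h3 : s'.reg 3 = s.reg 3)
    (a45 : s'.arr 45 = s.arr 45) (a3 : s'.arr 3 = s.arr 3) (a4 : s'.arr 4 = s.arr 4) :
    Marked L s' :=
  ⟨h3.trans h.len, h.nodup, by rw [a45]; exact h.mark, by rw [a3]; exact h.left,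
    by rw [a4]; exact h.right⟩

/-- Adds a pair to the list unless it is there. -/
def mark (a b : ℕ) : Prog :=
  .op (.load 28 45 a b) ;;
  .ite 28 14 (.op (.store 45 a b 14) ;; .op (.store 3 3 0 a) ;; .op (.store 4 3 0 b) ;;
    .op (.inc 3)) .skip

/-- A pair of information sets is met at many pairs of nodes; the mark in array 45 lets it be listed
once. -/
theorem runs_mark {a b : ℕ} {s : State} {T : ℕ} {L : List (ℕ × ℕ)} (h : Marked L s)
    (h0 : s.reg 0 = 0) (h14 : s.reg 14 = 1) (ha : a ≠ 28) (hb : b ≠ 28) :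
    Runs (mark a b) s T fun s' T' =>
      (∃ L', Marked L' s' ∧ ∀ e, e ∈ L' ↔ e ∈ L ∨ e = (s.reg a, s.reg b)) ∧ T' ≤ T + 6 := by
  unfold mark
  simp only [runs_seq, runs_op, runs_ite, runs_skip, Op.run, State.setReg_reg,
    State.setArr_reg, State.setReg_arr, State.setArr_arr_ne, ha, hb, h.mark, h0, h14, h.len,
    Nat.reduceEqDiff, OfNat.zero_ne_ofNat, ↓reduceIte]
  by_cases hm : (s.reg a, s.reg b) ∈ L
  · simp only [hm, ↓reduceIte, lt_irrefl]
    refine ⟨⟨L, h.congr (by simp) rfl rfl rfl, fun e => ⟨Or.inl, ?_⟩⟩, by omega⟩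
    rintro (h | rfl)
    · exact h
    · exact hm
  · simp only [hm, ↓reduceIte, Nat.zero_lt_one]
    refine ⟨⟨L ++ [(s.reg a, s.reg b)], ⟨by simp [h.len], ?_, fun X Y => ?_, fun k hk => ?_,
      fun k hk => ?_⟩, fun e => by simp⟩, by omega⟩
    · exact List.nodup_append.2 ⟨h.nodup, by simp, by
        rintro x hx y hy rfl
        rw [List.mem_singleton] at hy
        exact hm (hy ▸ hx)⟩
    · by_cases e : X = s.reg a ∧ Y = s.reg b
      · simp [e.1, e.2]
      · have := h.mark X Y
        simp only [State.setReg_arr, State.setArr_arr, Nat.reduceEqDiff, false_and, true_and,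
          ↓reduceIte, List.mem_append, List.mem_singleton, Prod.mk.injEq, e, or_false, this]
    · by_cases e : k = L.length
      · subst e
        simp
      · have hk' : k < L.length := by
          rw [List.length_append, List.length_singleton] at hk
          omega
        simp [e, List.getElem_append_left hk', h.left k hk']
    · by_cases e : k = L.length
      · subst e
        simp
      · have hk' : k < L.length := by
          rw [List.length_append, List.length_singleton] at hk
          omega
        simp [e, List.getElem_append_left hk', h.right k hk']

variable {N : ℕ} {par act plr u : ℕ → ℕ}

/-- The pair of information sets of two nodes of different players, that of the first player
first. -/
def IsLink (plr u : ℕ → ℕ) (x y : ℕ) (e : ℕ × ℕ) : Prop :=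
  (0 < plr x ∧ plr x < plr y ∧ e = (u x, u y)) ∨ (0 < plr y ∧ plr y < plr x ∧ e = (u y, u x))

/-- Lists the connected pairs of information sets. -/
def findEdges : Prog :=
  .op (.const 3 0) ;;
  .for 12 18 (.op (.copy 19 12) ;; .op (.inc 19) ;; .op (.load 20 43 19 0) ;;
    .op (.load 21 44 19 0) ;; .op (.copy 22 19) ;;
    .for 24 18 (.op (.load 22 41 22 0) ;; .op (.load 26 43 22 0) ;; .op (.load 27 44 22 0) ;;
      .ite 20 26 (.ite 0 20 (mark 21 27) .skip)
        (.ite 26 20 (.ite 0 26 (mark 27 21) .skip) .skip)))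

/-- Each node is compared with all its proper ancestors. The number of climbing steps may exceed the
depth of the node; beyond the root the climb stays at number `0`, which has no player. -/
theorem runs_findEdges {s : State} {T : ℕ} (h : HasTree N par act plr u s)
    (h45 : ∀ X Y, s.arr 45 X Y = 0) :
    Runs findEdges s T fun s' T' =>
      (∃ L, Marked L s' ∧ ∀ e, e ∈ L ↔
        ∃ x, 1 ≤ x ∧ x ≤ N ∧ ∃ k, k < N ∧ IsLink plr u x (par^[k + 1] x) e) ∧
      T' ≤ T + 3 + (9 + 14 * N) * N := by
  unfold findEdges
  rw [runs_seq, runs_op]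
  have h' := h.setReg 3 0
  refine runs_for (fun m s' T' =>
    (∃ L, Marked L s' ∧ ∀ e, e ∈ L ↔
      ∃ x, 1 ≤ x ∧ x ≤ m ∧ ∃ k, k < N ∧ IsLink plr u x (par^[k + 1] x) e) ∧
    T' ≤ T + 2 + (9 + 14 * N) * m) rfl rfl (by decide) ?_ ?_ ?_
  · refine ⟨⟨[], ⟨by simp [Op.run], by simp, by simpa [Op.run] using h45, by simp, by simp⟩,
      fun e => ?_⟩, by omega⟩
    simp only [List.not_mem_nil, false_iff]
    rintro ⟨x, h1, h2, -⟩
    omega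
  · rintro m s1 T1 hm h12 hf ⟨⟨L, hL, g1⟩, gT⟩
    have H1 := h'.frame hf
    simp only [runs_seq, runs_op, Op.run, State.setReg_reg, State.setArr_reg,
      State.setReg_arr, h12, H1.zero, H1.plr, H1.u,
      Nat.reduceEqDiff, OfNat.zero_ne_ofNat, ↓reduceIte]
    refine runs_for (fun k s' T' => s'.reg 22 = par^[k] (m + 1) ∧
      (∃ L', Marked L' s' ∧ ∀ e, e ∈ L' ↔ e ∈ L ∨
        ∃ j, j < k ∧ IsLink plr u (m + 1) (par^[j + 1] (m + 1)) e) ∧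
      T' ≤ T1 + 7 + 14 * k) rfl rfl (by decide) ?_ ?_ ?_
    · exact ⟨by simp, ⟨L, hL.congr (by simp) rfl rfl rfl, fun e => by simp⟩, by omega⟩
    · rintro k s2 T2 hk h24 hf2 ⟨k22, ⟨L', hL', k1⟩, kT⟩
      have H2 := (((((H1.setReg 19 m).setReg 19 (m + 1)).setReg 20 (plr (m + 1))).setReg 21
        (u (m + 1))).setReg 22 (m + 1)).frame hf2
      have e21 : s2.reg 21 = u (m + 1) := (hf2.reg 21 rfl).trans (by simp)
      have e20 : s2.reg 20 = plr (m + 1) := (hf2.reg 20 rfl).trans (by simp)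
      simp only [runs_seq, runs_op, runs_ite, runs_skip, Op.run, State.setReg_reg,
        State.setReg_arr, k22, e21, e20, H2.zero, H2.plr, H2.par, H2.u,
        Nat.reduceEqDiff, OfNat.zero_ne_ofNat, ↓reduceIte,
        ← Function.iterate_succ_apply' par, Nat.succ_eq_add_one]
      set y := par^[k + 1] (m + 1) with hy
      set s3 := ((s2.setReg 22 y).setReg 26 (plr y)).setReg 27 (u y) with hs3
      have H3 : HasTree N par act plr u s3 := ((H2.setReg 22 y).setReg 26 (plr y)).setReg 27 (u y)
      have hL3 : Marked L' s3 := hL'.congr (by simp [hs3]) rfl rfl rfl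
      have e3 : s3.reg 22 = y ∧ s3.reg 21 = u (m + 1) ∧ s3.reg 27 = u y := by
        simp [hs3, e21]
      have hstep : ∀ e, (∃ j, j < k + 1 ∧ IsLink plr u (m + 1) (par^[j + 1] (m + 1)) e) ↔
          (∃ j, j < k ∧ IsLink plr u (m + 1) (par^[j + 1] (m + 1)) e) ∨
            IsLink plr u (m + 1) y e := by
        intro e
        constructor
        · rintro ⟨j, hj, hl⟩
          rcases Nat.lt_succ_iff_lt_or_eq.1 hj with hj | rfl
          · exact Or.inl ⟨j, hj, hl⟩
          · exact Or.inr hl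
        · rintro (⟨j, hj, hl⟩ | hl)
          · exact ⟨j, by omega, hl⟩
          · exact ⟨k, by omega, hl⟩
      have hskip : (∀ e, ¬ IsLink plr u (m + 1) y e) → ∀ T', T' ≤ T2 + 12 →
          True ∧ (∃ L', Marked L' (s3.setReg 24 (k + 1)) ∧
            ∀ e, e ∈ L' ↔ e ∈ L ∨
              ∃ j, j < k + 1 ∧ IsLink plr u (m + 1) (par^[j + 1] (m + 1)) e) ∧
          T' + 1 ≤ T1 + 7 + 14 * (k + 1) := fun hn T' hT' =>
        ⟨trivial, ⟨L', hL3.congr (by simp) rfl rfl rfl, fun e => by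
          rw [hstep, k1]; simp [hn e]⟩, by omega⟩
      have hmark : ∀ a b, (mark a b).setsReg 22 = false → a ≠ 28 → b ≠ 28 →
          (∀ e, IsLink plr u (m + 1) y e ↔ e = (s3.reg a, s3.reg b)) →
          ∀ T', T' ≤ T2 + 7 → Runs (mark a b) s3 T' fun s'' T'' =>
            s''.reg 22 = y ∧ (∃ L', Marked L' (s''.setReg 24 (k + 1)) ∧
            ∀ e, e ∈ L' ↔ e ∈ L ∨
              ∃ j, j < k + 1 ∧ IsLink plr u (m + 1) (par^[j + 1] (m + 1)) e) ∧
          T'' + 1 ≤ T1 + 7 + 14 * (k + 1) := by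
        intro a b h22 ha hb hl T' hT'
        refine Runs.mono (runs_mark hL3 H3.zero H3.one ha hb).frame ?_
        rintro s4 T4 ⟨f4, ⟨L4, hL4, hm4⟩, hT4⟩
        refine ⟨by rw [f4.reg 22 h22, e3.1], ⟨L4, hL4.congr (by simp) rfl rfl rfl,
          fun e => ?_⟩, by omega⟩
        rw [hm4, hstep, k1, hl, or_assoc]
      split_ifs with c1 c2 c3 c4
      · refine hmark 21 27 rfl (by decide) (by decide) (fun e => ?_) _ (by omega)
        rw [e3.2.1, e3.2.2, IsLink]
        exact ⟨fun h => h.elim (fun h => h.2.2) fun h => absurd h.2.1 (by omega),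
          fun h => Or.inl ⟨c2, c1, h⟩⟩
      · refine hskip (fun e h => ?_) _ (by omega)
        rcases h with h | h
        · exact c2 h.1
        · have := h.2.1
          omega
      · refine hmark 27 21 rfl (by decide) (by decide) (fun e => ?_) _ (by omega)
        rw [e3.2.1, e3.2.2, IsLink]
        exact ⟨fun h => h.elim (fun h => absurd h.2.1 c1) fun h => h.2.2,
          fun h => Or.inr ⟨c4, c3, h⟩⟩
      · refine hskip (fun e h => ?_) _ (by omega)
        rcases h with h | h
        · exact c1 h.2.1
        · exact c4 h.1
      · refine hskip (fun e h => ?_) _ (by omega)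
        rcases h with h | h
        · exact c1 h.2.1
        · exact c3 h.2.1
    · rintro s2 T2 hf2 ⟨k22, ⟨L', hL', k1⟩, kT⟩
      have en := H1.size
      simp only [State.setReg_reg, Nat.reduceEqDiff, ↓reduceIte, en] at k1 kT
      refine ⟨⟨L', hL'.congr (by simp) rfl rfl rfl, fun e => ?_⟩, by rw [Nat.mul_succ]; omega⟩
      rw [k1, g1]
      constructor
      · rintro (⟨x, h1, h2, h3⟩ | h3)
        · exact ⟨x, h1, by omega, h3⟩
        · exact ⟨m + 1, by omega, le_rfl, h3⟩
      · rintro ⟨x, h1, h2, h3⟩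
        rcases Nat.lt_succ_iff_lt_or_eq.1 (Nat.lt_succ_of_le h2) with h2 | rfl
        · exact Or.inl ⟨x, h1, by omega, h3⟩
        · exact Or.inr h3
  · rintro s1 T1 hf ⟨g1, gT⟩
    have en : ((Op.const 3 0).run s).reg 18 = N := h'.size
    rw [en] at g1 gT
    exact ⟨g1, by omega⟩

end Ram

/-! ### The game tree in terms of parent pointers -/

namespace EFG

open Ram

variable {G : EFG.{u}}

theorem played_append_of_not {i : Fin 2} (p t : List G.Act)
    (h : ∀ t', t' <+: t → t' ≠ t → G.owner (p ++ t') ≠ some i) :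
    G.played i (p ++ t) = G.played i p := by
  induction t using List.reverseRecOn with
  | nil => rw [List.append_nil]
  | append_singleton t a ih =>
    rw [← List.append_assoc, played_append, if_neg (h t (List.prefix_append _ _) (by simp)),
      List.append_nil]
    refine ih fun t' h1 h2 => h t' (h1.trans (List.prefix_append _ _)) ?_
    rintro rfl
    have := h1.length_le
    simp at this

/-- The prefixes of `h` are distinct nodes. Hence as many climbing steps as there are nodes suffice
to reach the root from anywhere. -/
theorem length_lt_size {h : List G.Act} (hh : h ∈ G.nodes) : h.length < G.size := by
  have : (Finset.range (h.length + 1)).card ≤ G.nodes.card := by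
    refine Finset.card_le_card_of_injOn (fun k => h.take k) ?_ ?_
    · intro k _
      exact mem_nodes_of_prefix (List.take_prefix _ _) hh
    · intro k hk l hl hkl
      have h1 := congrArg List.length hkl
      simp only [Finset.coe_range, Set.mem_Iio] at hk hl
      simp only [List.length_take] at h1
      omega
  rw [Finset.card_range] at this
  exact this

theorem length_nodes {nodes : List (List G.Act)} (hn : ListsNodes nodes) :
    nodes.length = G.size := by
  rw [← List.toFinset_card_of_nodup hn.1, size]
  congr 1
  ext h
  rw [List.mem_toFinset, hn.2]

namespace Numbering

/-- The number of a node. -/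
def nodeNum (nodes : List (List G.Act)) (h : List G.Act) : ℕ := nodes.idxOf h + 1

/-- The functions describe the tree in terms of the numbers of the nodes. -/
structure IsTree (ν : G.Numbering) (nodes : List (List G.Act)) (par act plr u : ℕ → ℕ) : Prop where
  par_zero : par 0 = 0
  plr_zero : plr 0 = 0
  u_zero : u 0 = 0
  par_root : par (nodeNum nodes []) = 0
  act_root : act (nodeNum nodes []) = 0
  par_append : ∀ h a, h ++ [a] ∈ G.nodes → par (nodeNum nodes (h ++ [a])) = nodeNum nodes h
  act_chance : ∀ h a, h ++ [a] ∈ G.nodes → G.owner h = none → act (nodeNum nodes (h ++ [a])) = 0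
  act_append : ∀ i h a, h ++ [a] ∈ G.nodes → G.owner h = some i →
    act (nodeNum nodes (h ++ [a])) = (ν.acts ((G.info i).part h)).idxOf a
  decision : ∀ i, ∀ h ∈ G.nodes, G.owner h = some i → (G.acts h).Nonempty →
    plr (nodeNum nodes h) = i + 1 ∧ u (nodeNum nodes h) = ν.num i ((G.info i).part h)
  other : ∀ h ∈ G.nodes, (∀ i, G.owner h = some i → ¬ (G.acts h).Nonempty) →
    plr (nodeNum nodes h) = 0 ∧ u (nodeNum nodes h) = 0

variable {ν : G.Numbering} {nodes : List (List G.Act)}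

theorem exists_nodeNum (hn : ListsNodes nodes) {x : ℕ} (h1 : 1 ≤ x) (h2 : x ≤ nodes.length) :
    ∃ h ∈ G.nodes, x = nodeNum nodes h := by
  have hl : x - 1 < nodes.length := by omega
  refine ⟨nodes[x - 1], (hn.2 _).1 (List.getElem_mem hl), ?_⟩
  rw [nodeNum, hn.1.idxOf_getElem]
  omega

theorem nodeNum_le (hn : ListsNodes nodes) {h : List G.Act} (hh : h ∈ G.nodes) :
    nodeNum nodes h ≤ nodes.length := List.idxOf_lt_length_iff.2 ((hn.2 h).2 hh)

namespace IsTree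

variable {par act plr u : ℕ → ℕ} (H : ν.IsTree nodes par act plr u)
include H

theorem plr_eq_iff {h : List G.Act} (hh : h ∈ G.nodes) (i : Fin 2) :
    plr (nodeNum nodes h) = i + 1 ↔ G.owner h = some i ∧ (G.acts h).Nonempty := by
  constructor
  · intro hp
    by_cases hd : ∃ j, G.owner h = some j ∧ (G.acts h).Nonempty
    · obtain ⟨j, h1, h2⟩ := hd
      have := (H.decision j h hh h1 h2).1
      have hij : i = j := Fin.ext (by omega)
      exact hij ▸ ⟨h1, h2⟩
    · have := (H.other h hh fun j h1 h2 => hd ⟨j, h1, h2⟩).1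
      omega
  · exact fun h1 => (H.decision i h hh h1.1 h1.2).1

theorem exists_of_plr_pos {h : List G.Act} (hh : h ∈ G.nodes) (hp : 0 < plr (nodeNum nodes h)) :
    ∃ i, G.owner h = some i ∧ (G.acts h).Nonempty := by
  by_contra hd
  have := (H.other h hh fun j h1 h2 => hd ⟨j, h1, h2⟩).1
  omega

theorem iterate_append (p t : List G.Act) (h : p ++ t ∈ G.nodes) :
    par^[t.length] (nodeNum nodes (p ++ t)) = nodeNum nodes p := by
  induction t using List.reverseRecOn with
  | nil => simp
  | append_singleton t a ih =>
    rw [← List.append_assoc] at h ⊢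
    rw [List.length_append, List.length_singleton, Function.iterate_succ_apply, H.par_append _ _ h]
    exact ih ((G.mem_append _ _).1 h).1

theorem iterate_of_length_lt {h : List G.Act} (hh : h ∈ G.nodes) {k : ℕ} (hk : h.length < k) :
    par^[k] (nodeNum nodes h) = 0 := by
  obtain ⟨j, rfl⟩ := Nat.exists_eq_add_of_lt hk
  rw [show h.length + j + 1 = j + 1 + h.length by omega, Function.iterate_add_apply]
  have := H.iterate_append [] h hh
  rw [List.nil_append] at this
  rw [this, Function.iterate_succ_apply, H.par_root]
  exact Function.iterate_fixed H.par_zero j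

/-- The ancestors that are decision nodes. -/
theorem exists_of_plr_iterate {h : List G.Act} (hh : h ∈ G.nodes) {k : ℕ}
    (hk : 0 < plr (par^[k + 1] (nodeNum nodes h))) :
    ∃ p a t, h = p ++ a :: t ∧ t.length = k ∧ p ∈ G.nodes ∧
      par^[k + 1] (nodeNum nodes h) = nodeNum nodes p ∧
      par^[k] (nodeNum nodes h) = nodeNum nodes (p ++ [a]) := by
  have hle : k + 1 ≤ h.length := by
    by_contra hlt
    rw [H.iterate_of_length_lt hh (by omega), H.plr_zero] at hk
    omega
  have hlt : h.length - (k + 1) < h.length := by omega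
  have he : h = h.take (h.length - (k + 1)) ++ h[h.length - (k + 1)] ::
      h.drop (h.length - (k + 1) + 1) := by
    rw [← List.drop_eq_getElem_cons, List.take_append_drop]
  have hlen : (h.drop (h.length - (k + 1) + 1)).length = k := by
    rw [List.length_drop]; omega
  generalize h.take (h.length - (k + 1)) = p at he
  generalize h[h.length - (k + 1)] = a at he
  generalize h.drop (h.length - (k + 1) + 1) = t at he hlen
  subst he
  refine ⟨p, a, t, rfl, hlen, mem_nodes_of_prefix (List.prefix_append _ _) hh, ?_, ?_⟩
  · have := H.iterate_append p (a :: t) hh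
    rwa [List.length_cons, hlen] at this
  · have := H.iterate_append (p ++ [a]) t (by simpa using hh)
    rw [hlen] at this
    simpa using this

/-- The nearest proper ancestor of the same player ends the record of that player: none of the nodes
in between belongs to the player, so the record grows by just that pair (`played_append_of_not`). -/
theorem sg_of_iterate (hG : G.PerfectRecall) {es : List (ℕ × ℕ)} {i : Fin 2} {h : List G.Act}
    (hh : h ∈ G.nodes) (ho : G.owner h = some i) (ha : (G.acts h).Nonempty) {k : ℕ}
    (hk : plr (par^[k + 1] (nodeNum nodes h)) = i + 1)
    (hlt : ∀ j, j < k → plr (par^[j + 1] (nodeNum nodes h)) ≠ i + 1) :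
    (ν.skel es).sg (u (nodeNum nodes h)) =
      (u (par^[k + 1] (nodeNum nodes h)), act (par^[k] (nodeNum nodes h))) := by
  obtain ⟨p, a, t, rfl, ht, hp, h1, h2⟩ := H.exists_of_plr_iterate hh (k := k) (by omega)
  rw [h1] at hk
  obtain ⟨hpo, hpa⟩ := (H.plr_eq_iff hp i).1 hk
  have hpa' : p ++ [a] ∈ G.nodes := mem_nodes_of_prefix (by simp) hh
  obtain ⟨hm, hI⟩ := mem_part hh ho ha
  have hpl : G.played i (p ++ a :: t) = G.played i p ++ [((G.info i).part p, a)] := by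
    have h3 := played_append_of_not (i := i) (p ++ [a]) t ?_
    · rw [played_append, if_pos hpo] at h3
      simpa using h3
    · rintro t' ⟨t'', rfl⟩ hne ho'
      have hne : t'' ≠ [] := by rintro rfl; simp at hne
      obtain ⟨b, t3, rfl⟩ := List.exists_cons_of_ne_nil hne
      have hmem : p ++ [a] ++ t' ++ [b] ∈ G.nodes := mem_nodes_of_prefix ⟨t3, by simp⟩ hh
      obtain ⟨hq, hb⟩ := (G.mem_append _ _).1 hmem
      have h4 := H.iterate_append (p ++ [a] ++ t') (b :: t3) (by simpa using hh)
      refine hlt t3.length (by simp only [List.length_append, List.length_cons] at ht; omega) ?_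
      rw [List.length_cons, show p ++ [a] ++ t' ++ b :: t3 = p ++ a :: (t' ++ b :: t3) by simp]
        at h4
      rw [h4]
      exact (H.plr_eq_iff hq i).2 ⟨ho', b, hb⟩
  rw [(H.decision i _ hh ho ha).2, ν.sg_num hI, parentSeq_eq hG hI hm, hpl, h1, h2,
    (H.decision i p hp hpo hpa).2, H.act_append i p a hpa' hpo]
  simp [seqNum]

theorem sg_of_not (hG : G.PerfectRecall) {es : List (ℕ × ℕ)} {i : Fin 2} {h : List G.Act}
    (hh : h ∈ G.nodes) (ho : G.owner h = some i) (ha : (G.acts h).Nonempty)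
    (hlt : ∀ j, j < G.size → plr (par^[j + 1] (nodeNum nodes h)) ≠ i + 1) :
    (ν.skel es).sg (u (nodeNum nodes h)) = (0, 0) := by
  obtain ⟨hm, hI⟩ := mem_part hh ho ha
  have hpl : G.played i h = [] := by
    have h3 := played_append_of_not (i := i) [] h ?_
    · simpa [played, playedFrom] using h3
    · rintro t' ⟨t'', rfl⟩ hne ho'
      have hne : t'' ≠ [] := by rintro rfl; simp at hne
      obtain ⟨b, t3, rfl⟩ := List.exists_cons_of_ne_nil hne
      have hmem : t' ++ [b] ∈ G.nodes := mem_nodes_of_prefix ⟨t3, by simp⟩ hh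
      obtain ⟨hq, hb⟩ := (G.mem_append _ _).1 hmem
      have h4 := H.iterate_append t' (b :: t3) hh
      have h5 := length_lt_size hh
      refine hlt t3.length (by simp only [List.length_append, List.length_cons] at h5; omega) ?_
      rw [List.length_cons] at h4
      rw [h4]
      exact (H.plr_eq_iff hq i).2 ⟨ho', b, hb⟩
  rw [(H.decision i _ hh ho ha).2, ν.sg_num hI, parentSeq_eq hG hI hm, hpl]
  rfl

theorem isLink_iff (hn : ListsNodes nodes) {X Y : ℕ} :
    (∃ x, 1 ≤ x ∧ x ≤ nodes.length ∧ ∃ k, k < nodes.length ∧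
      IsLink plr u x (par^[k + 1] x) (X, Y)) ↔
    ∃ I ∈ (G.info 0).parts, ∃ J ∈ (G.info 1).parts,
      Connected I J ∧ X = ν.num 0 I ∧ Y = ν.num 1 J := by
  have hpair : ∀ {h p : List G.Act}, h ∈ G.nodes → p ∈ G.nodes → 0 < plr (nodeNum nodes h) →
      plr (nodeNum nodes h) < plr (nodeNum nodes p) → (h <+: p ∨ p <+: h) →
      ∃ I ∈ (G.info 0).parts, ∃ J ∈ (G.info 1).parts, Connected I J ∧
        u (nodeNum nodes h) = ν.num 0 I ∧ u (nodeNum nodes p) = ν.num 1 J := by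
    intro h p hh hp h1 h2 hc
    obtain ⟨i, ho, ha⟩ := H.exists_of_plr_pos hh h1
    obtain ⟨j, ho', ha'⟩ := H.exists_of_plr_pos hp (by omega)
    obtain ⟨d1, d2⟩ := H.decision i h hh ho ha
    obtain ⟨d3, d4⟩ := H.decision j p hp ho' ha'
    rcases player_cases i with rfl | rfl <;> rcases player_cases j with rfl | rfl
    · omega
    · obtain ⟨m1, m2⟩ := mem_part hh ho ha
      obtain ⟨m3, m4⟩ := mem_part hp ho' ha'
      exact ⟨_, m2, _, m4, ⟨_, m1, _, m3, hc⟩, d2, d4⟩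
    · simp at d1 d3; omega
    · omega
  constructor
  · rintro ⟨x, h1, h2, k, hk, hl⟩
    obtain ⟨h, hh, rfl⟩ := exists_nodeNum hn h1 h2
    have hpos : 0 < plr (par^[k + 1] (nodeNum nodes h)) := by
      rcases hl with hl | hl <;> omega
    obtain ⟨p, a, t, rfl, ht, hp, h3, -⟩ := H.exists_of_plr_iterate hh hpos
    rw [h3] at hl
    rcases hl with ⟨l1, l2, l3⟩ | ⟨l1, l2, l3⟩
    · obtain ⟨I, hI, J, hJ, hc, e1, e2⟩ := hpair hh hp l1 l2 (Or.inr (List.prefix_append _ _))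
      simp only [Prod.mk.injEq] at l3
      exact ⟨I, hI, J, hJ, hc, l3.1.trans e1, l3.2.trans e2⟩
    · obtain ⟨I, hI, J, hJ, hc, e1, e2⟩ := hpair hp hh l1 l2 (Or.inl (List.prefix_append _ _))
      simp only [Prod.mk.injEq] at l3
      exact ⟨I, hI, J, hJ, hc, l3.1.trans e1, l3.2.trans e2⟩
  · rintro ⟨I, hI, J, hJ, ⟨v, hv, w, hw, hvw⟩, rfl, rfl⟩
    obtain ⟨v1, v2, v3⟩ := mem_of_mem_parts hI hv
    obtain ⟨w1, w2, w3⟩ := mem_of_mem_parts hJ hw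
    obtain ⟨d1, d2⟩ := H.decision 0 v v1 v2 v3
    obtain ⟨d3, d4⟩ := H.decision 1 w w1 w2 w3
    rw [part_eq hI hv] at d2
    rw [part_eq hJ hw] at d4
    -- The nodes have different owners, so the prefix is proper and at least one climbing step leads
    -- from the lower to the upper one.
    have hne : v ≠ w := by
      rintro rfl
      rw [v2] at w2
      simp at w2
    rw [length_nodes hn]
    rcases hvw with ⟨t, rfl⟩ | ⟨t, rfl⟩
    · have ht : t ≠ [] := by rintro rfl; simp at hne
      obtain ⟨b, t, rfl⟩ := List.exists_cons_of_ne_nil ht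
      have h5 := length_lt_size w1
      have h6 := H.iterate_append v (b :: t) w1
      rw [List.length_append, List.length_cons] at h5
      rw [List.length_cons] at h6
      refine ⟨nodeNum nodes _, Nat.le_add_left _ _, (nodeNum_le hn w1).trans_eq (length_nodes hn), t.length,
        by omega, Or.inr ?_⟩
      rw [h6, d1, d2, d3, d4]
      simp
    · have ht : t ≠ [] := by rintro rfl; simp at hne
      obtain ⟨b, t, rfl⟩ := List.exists_cons_of_ne_nil ht
      have h5 := length_lt_size v1
      have h6 := H.iterate_append w (b :: t) v1
      rw [List.length_append, List.length_cons] at h5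
      rw [List.length_cons] at h6
      refine ⟨nodeNum nodes _, Nat.le_add_left _ _, (nodeNum_le hn v1).trans_eq (length_nodes hn), t.length,
        by omega, Or.inl ?_⟩
      rw [h6, d1, d2, d3, d4]
      simp

theorem u_parent_lt (hn : ListsNodes nodes) {es : List (ℕ × ℕ)} {x : ℕ} (h1 : 1 ≤ x)
    (h2 : x ≤ nodes.length) : act x + 1 ≤ (ν.skel es).na (u (par x)) := by
  obtain ⟨h, hh, rfl⟩ := exists_nodeNum hn h1 h2
  rcases List.eq_nil_or_concat h with rfl | ⟨p, a, rfl⟩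
  · rw [H.par_root, H.act_root, H.u_zero]
    simp [skel]
  · rw [List.concat_eq_append] at *
    obtain ⟨hp, ha⟩ := (G.mem_append p a).1 hh
    rw [H.par_append p a hh]
    rcases ho : G.owner p with _ | i
    · rw [H.act_chance p a hh ho, (H.other p hp (by simp [ho])).2]
      simp [skel]
    · obtain ⟨m1, m2⟩ := mem_part hp ho ⟨a, ha⟩
      rw [H.act_append i p a hh ho, (H.decision i p hp ho ⟨a, ha⟩).2, ν.na_num m2]
      exact ν.idxOf_acts_lt (by rwa [← acts_eq_actions m2 m1])

/-- The action with the last number is available at every node of the information set, so the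
maximum of action numbers is attained. -/
theorem exists_na_le (hn : ListsNodes nodes) {es : List (ℕ × ℕ)} {i : Fin 2} {I : G.Infoset}
    (hI : I ∈ (G.info i).parts) : ∃ x, 1 ≤ x ∧ x ≤ nodes.length ∧ u (par x) = ν.num i I ∧
      (ν.skel es).na (ν.num i I) ≤ act x + 1 := by
  have hpos := (actions_nonempty hI).card_pos
  have hlen := ν.length_acts I
  obtain ⟨h, hh⟩ := nonempty_of_mem_parts hI
  obtain ⟨h1, h2, h3⟩ := mem_of_mem_parts hI hh
  have hlt : (ν.acts I).length - 1 < (ν.acts I).length := by omega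
  have ha := List.getElem_mem hlt
  have hidx := (ν.acts_nodup I).idxOf_getElem _ hlt
  generalize (ν.acts I)[(ν.acts I).length - 1] = a at ha hidx
  have hm : h ++ [a] ∈ G.nodes :=
    (G.mem_append h a).2 ⟨h1, by rw [acts_eq_actions hI hh]; exact (ν.mem_acts I a).1 ha⟩
  refine ⟨nodeNum nodes (h ++ [a]), Nat.le_add_left _ _, nodeNum_le hn hm, ?_, ?_⟩
  · rw [H.par_append h a hm, (H.decision i h h1 h2 h3).2, part_eq hI hh]
  · rw [ν.na_num hI, H.act_append i h a hm h2, part_eq hI hh, hidx]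
    omega

end IsTree

end Numbering

end EFG

/-! ### The running time given the game tree -/

namespace Ram

/-- Reads the game tree and finds the information structure. -/
def readTree : Prog :=
  .op (.read 18) ;; .op (.read 1) ;; .op (.read 11) ;; layout ;; readNodes ;; countActions ;;
  findParents ;; findEdges

end Ram

namespace EFG.Numbering

open Ram

variable {G : EFG.{u}} {ν : G.Numbering} {nodes : List (List G.Act)}

/-- The record of a node. -/
def nodeRecord (ν : G.Numbering) (nodes : List (List G.Act)) (h : List G.Act) : ℕ × ℕ × ℕ × ℕ :=
  ((ν.edgeCode nodes h).headD 0, (ν.edgeCode nodes h).getD 1 0, (ν.nodeCode h).headD 0,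
    (ν.nodeCode h).getD 1 0)

theorem treeInput_eq : ν.treeInput nodes = nodes.length :: (ν.infos 0).length ::
    (ν.infos 1).length ::
    (nodes.map (ν.nodeRecord nodes)).flatMap fun r => [r.1, r.2.1, r.2.2.1, r.2.2.2] := by
  simp only [treeInput, List.flatMap_map, List.cons_append, List.nil_append]
  congr 4
  funext h
  unfold nodeRecord edgeCode nodeCode
  rcases h.getLast? with _ | a <;> (split_ifs <;> [rcases G.owner h with _ | i; skip]) <;> rfl

/-- Row `0` of the table is zero, so that chance nodes and terminal nodes, coded as `0, 0`, belong
to set `0`. -/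
theorem isTree_of_records {par act plr u : ℕ → ℕ} {tab : ℕ → ℕ → ℕ}
    (hzero : ∀ j, tab 0 j = 0)
    (htab : ∀ i, ∀ I ∈ (G.info i).parts, tab (i + 1) ((ν.infos i).idxOf I + 1) = ν.num i I)
    (h0 : par 0 = 0 ∧ act 0 = 0 ∧ plr 0 = 0 ∧ u 0 = 0)
    (h : ∀ h ∈ G.nodes, par (nodeNum nodes h) = (ν.nodeRecord nodes h).1 ∧
      act (nodeNum nodes h) = (ν.nodeRecord nodes h).2.1 ∧
      plr (nodeNum nodes h) = (ν.nodeRecord nodes h).2.2.1 ∧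
      u (nodeNum nodes h) = tab (ν.nodeRecord nodes h).2.2.1 ((ν.nodeRecord nodes h).2.2.2 + 1)) :
    ν.IsTree nodes par act plr u where
  par_zero := h0.1
  plr_zero := h0.2.2.1
  u_zero := h0.2.2.2
  par_root := (h [] G.root_mem).1
  act_root := (h [] G.root_mem).2.1
  par_append p a hp := by
    rw [(h _ hp).1]
    simp [nodeRecord, edgeCode, nodeNum]
  act_chance p a hp ho := by
    rw [(h _ hp).2.1]
    simp [nodeRecord, edgeCode, ho]
  act_append i p a hp ho := by
    rw [(h _ hp).2.1]
    simp [nodeRecord, edgeCode, ho]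
  decision i p hp ho ha := by
    obtain ⟨-, -, h1, h2⟩ := h p hp
    have hI := (mem_part hp ho ha).2
    have hc : ν.nodeCode p = [(i : ℕ) + 1, (ν.infos i).idxOf ((G.info i).part p)] := by
      rw [nodeCode, if_pos ha, ho]
    rw [h1, h2, ← htab i _ hI]
    simp [nodeRecord, hc]
  other p hp hd := by
    obtain ⟨-, -, h1, h2⟩ := h p hp
    have hc : ν.nodeCode p = [0, 0] := by
      rw [nodeCode]
      split_ifs with ha
      · rcases ho : G.owner p with _ | i
        · rfl
        · exact absurd ha (hd i ho)
      · rfl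
    rw [h1, h2]
    simp [nodeRecord, hc, hzero]

theorem runs_readTree (hG : G.PerfectRecall) (hn : ListsNodes nodes) :
    Runs readTree (State.start (ν.treeInput nodes)) 0 fun s' T' =>
      ∃ es, ν.ListsEdges es ∧ Loaded (ν.skel es) s' ∧
      T' ≤ 23 + 6 * ((ν.infos 0).length + (ν.infos 1).length) + 72 * G.size ^ 2 := by
  have hN := length_nodes hn
  have hN1 : 1 ≤ G.size := Finset.card_pos.2 ⟨[], G.root_mem⟩
  set n0 := (ν.infos 0).length with hn0
  set n1 := (ν.infos 1).length with hn1
  unfold readTree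
  simp only [runs_seq, runs_op, Op.run, State.start, State.setReg_inp, treeInput_eq,
    List.headD_cons, List.tail_cons]
  refine Runs.mono (runs_layout (n0 := n0) (n1 := n1) (by simp) (by simp [hn0]) (by simp [hn1])
    (by simp)).frame ?_
  rintro s1 T1 ⟨f1, L1, z1, hT1⟩
  have i1 := f1.inp rfl
  have r1 := f1.reg 18 rfl
  have a1 : ∀ A, layout.setsArr A = false → ∀ i j, s1.arr A i j = 0 := fun A hA i j => by
    rw [f1.arr A hA]; rfl
  simp only [State.setReg_reg, ↓reduceIte, Nat.reduceEqDiff] at i1 r1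
  refine Runs.mono (runs_readNodes (nodes.map (ν.nodeRecord nodes)) L1.zero
    (by rw [List.length_map]; exact r1) i1).frame ?_
  rintro s2 T2 ⟨f2, g2, z41, z42, z43, z44, hT2⟩
  rw [List.length_map, hN] at hT2
  have L2 := L1.frame f2
  have H2 : HasTree G.size (fun x => s2.arr 41 x 0) (fun x => s2.arr 42 x 0)
      (fun x => s2.arr 43 x 0) (fun x => s2.arr 44 x 0) s2 :=
    ⟨L2.zero, L2.one, by rw [f2.reg 18 rfl, r1, hN], fun _ => rfl, fun _ => rfl, fun _ => rfl,
      fun _ => rfl⟩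
  have I2 : ν.IsTree nodes (fun x => s2.arr 41 x 0) (fun x => s2.arr 42 x 0)
      (fun x => s2.arr 43 x 0) (fun x => s2.arr 44 x 0) := by
    refine isTree_of_records (tab := s1.arr 40) L1.num_none (fun i I hI => L1.num hI)
      ⟨z41.trans (a1 41 rfl _ _), z42.trans (a1 42 rfl _ _), z43.trans (a1 43 rfl _ _),
        z44.trans (a1 44 rfl _ _)⟩ fun h hh => ?_
    have hlt : nodes.idxOf h < nodes.length := List.idxOf_lt_length_iff.2 ((hn.2 h).2 hh)
    have := g2 (nodes.idxOf h) (by rwa [List.length_map])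
    rwa [List.getElem_map, List.getElem_idxOf] at this
  generalize (fun x => s2.arr 41 x 0) = par at H2 I2
  generalize (fun x => s2.arr 42 x 0) = act at H2 I2
  generalize (fun x => s2.arr 43 x 0) = plr at H2 I2
  generalize (fun x => s2.arr 44 x 0) = u at H2 I2
  have hdec : ∀ x, 1 ≤ x → x ≤ G.size → 0 < plr x → ∃ h ∈ G.nodes, x = nodeNum nodes h ∧
      ∃ i : Fin 2, plr x = i + 1 ∧ G.owner h = some i ∧ (G.acts h).Nonempty := by
    intro x h1 h2 h3
    obtain ⟨h, hh, rfl⟩ := exists_nodeNum hn h1 (h2.trans_eq hN.symm)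
    obtain ⟨i, ho, ha⟩ := I2.exists_of_plr_pos hh h3
    exact ⟨h, hh, rfl, i, (I2.decision i h hh ho ha).1, ho, ha⟩
  refine Runs.mono (runs_countActions H2).frame ?_
  rintro s3 T3 ⟨f3, c1, c2, hT3⟩
  have H3 := H2.frame f3
  -- Parent sequences do not depend on the list of edges, which has not been found at this point;
  -- the empty list is used instead.
  refine Runs.mono (runs_findParents H3 (pi := (ν.skel []).pi) (pa := (ν.skel []).pa) ?_ ?_
    (fun X => by rw [f3.arr 1 rfl, f2.arr 1 rfl]; exact a1 1 rfl _ _)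
    (fun X => by rw [f3.arr 2 rfl, f2.arr 2 rfl]; exact a1 2 rfl _ _)).frame ?_
  · intro x h1 h2 h3 k hk hp hlt
    obtain ⟨h, hh, rfl, i, hpi, ho, ha⟩ := hdec x h1 h2 h3
    rw [hpi] at hp hlt
    have := I2.sg_of_iterate hG (es := []) hh ho ha hp hlt
    exact ⟨congrArg Prod.fst this, congrArg Prod.snd this⟩
  · intro x h1 h2 h3 hlt
    obtain ⟨h, hh, rfl, i, hpi, ho, ha⟩ := hdec x h1 h2 h3
    rw [hpi] at hlt
    have := I2.sg_of_not hG (es := []) hh ho ha hlt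
    exact ⟨congrArg Prod.fst this, congrArg Prod.snd this⟩
  rintro s4 T4 ⟨f4, p1, p2, hT4⟩
  have H4 := H3.frame f4
  refine Runs.mono (runs_findEdges H4 (fun X Y => by
    rw [f4.arr 45 rfl, f3.arr 45 rfl, f2.arr 45 rfl]; exact a1 45 rfl _ _)).frame ?_
  rintro s5 T5 ⟨f5, ⟨es, M5, hmem⟩, hT5⟩
  have F := ((f2.seq f3).seq f4).seq f5
  have L5 := L1.frame F
  have hrec : ∀ X, X ≤ n0 + n1 → s4.arr 0 X 0 = (ν.skel es).na X ∧
      s4.arr 1 X 0 = (ν.skel es).pi X ∧ s4.arr 2 X 0 = (ν.skel es).pa X := by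
    intro X hX
    have hinit : s2.arr 0 X 0 = if X = 0 then 1 else 0 := by
      rw [f2.arr 0 rfl, z1]
      simp
    rw [f4.arr 0 rfl]
    refine ⟨?_, ?_⟩
    · have hle : s3.arr 0 X 0 ≤ (ν.skel es).na X := by
        rcases c2 X with h | ⟨x, h1, h2, rfl, h3⟩
        · rw [h, hinit]
          split_ifs with h0
          · rw [h0]; exact ge_of_eq rfl
          · exact Nat.zero_le _
        · rw [h3]
          exact I2.u_parent_lt hn h1 (h2.trans_eq hN.symm)
      refine le_antisymm hle ?_
      rcases Nat.eq_zero_or_pos X with rfl | hX0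
      · change 1 ≤ _
        rcases c2 0 with h | ⟨x, h1, h2, -, h3⟩
        · rw [h, hinit, if_pos rfl]
        · omega
      · obtain ⟨i, I, hI, rfl⟩ := ν.exists_num hX0 hX
        obtain ⟨x, h1, h2, h3, h4⟩ := I2.exists_na_le hn (es := es) hI
        have := c1 x h1 (h2.trans_eq hN)
        rw [h3] at this
        exact h4.trans this
    · rcases Nat.eq_zero_or_pos X with rfl | hX0
      · refine p2 0 fun x h1 h2 h3 h4 => ?_
        obtain ⟨h, hh, rfl, i, hpi, ho, ha⟩ := hdec x h1 h2 h3
        rw [(I2.decision i h hh ho ha).2] at h4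
        have := ν.num_pos i ((G.info i).part h)
        omega
      · obtain ⟨i, I, hI, rfl⟩ := ν.exists_num hX0 hX
        obtain ⟨h, hh⟩ := nonempty_of_mem_parts hI
        obtain ⟨h1, h2, h3⟩ := mem_of_mem_parts hI hh
        obtain ⟨d1, d2⟩ := I2.decision i h h1 h2 h3
        have := p1 (nodeNum nodes h) (Nat.le_add_left _ _) ((nodeNum_le hn h1).trans_eq hN)
          (by omega)
        rwa [d2, part_eq hI hh] at this
  refine ⟨es, ⟨M5.nodup, fun X Y => ?_⟩, ⟨L5.zero, L5.left, L5.n, M5.len, ?_, ?_, ?_, M5.left,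
    M5.right, L5.loc⟩, ?_⟩
  · rw [hmem, ← hN]
    exact I2.isLink_iff hn
  · rw [f5.arr 0 rfl]; exact fun X hX => (hrec X hX).1
  · rw [f5.arr 1 rfl]; exact fun X hX => (hrec X hX).2.1
  · rw [f5.arr 2 rfl]; exact fun X hX => (hrec X hX).2.2
  -- The linear terms `14 + 12 + 9 + 9` and the quadratic ones `14 + 14` add up to `72`, as the tree
  -- has at least one node.
  · nlinarith

/-- The decomposition is computed from the game tree in quadratic time. -/
theorem outputs_readTree_decompose (hG : G.PerfectRecall) (hT : G.TriangleFree)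
    (hn : ListsNodes nodes) :
    ∃ (out : List ℕ) (t : ℕ), (readTree ;; decompose).Outputs (ν.treeInput nodes) out t ∧
      ν.WritesDecomposition out ∧ t ≤ 1101 * G.size ^ 2 := by
  obtain ⟨s, t, h1, es, hes, h2⟩ := runs_readTree (ν := ν) hG hn
  obtain ⟨out, t, h1, h2, h3, hd⟩ := outputs_decompose hG hT hes ⟨s, t, h1, h2⟩
    (fun A h6 h40 => by interval_cases A <;> rfl) rfl
  refine ⟨out, t, h1, h2, h3.trans ?_⟩
  -- Since information sets and dimensionality are bounded by the square of the size, the constant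
  -- is `1101 = 23 + 6 + 72 + 1000`.
  have hw := (skel_wf hG hT hes).card_add_edges_le_weight
  have hs := dim_le G
  have : (ν.skel es).n = (ν.infos 0).length + (ν.infos 1).length := rfl
  omega

end EFG.Numbering

theorem mainTheorem4 :
    -- existence of the decomposition
    (∀ G : EFG.{u}, G.PerfectRecall → G.TriangleFree →
      ∃ (d : ℕ) (D : Chain d) (e : Fin d ≃ G.relPairs), G.IsDecomposition D e) ∧
    -- computation from the information structure, in time linear in the dimensionality
    (∃ (P : Ram.Prog) (C : ℕ), ∀ G : EFG.{u}, G.PerfectRecall → G.TriangleFree →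
      ∀ (ν : G.Numbering) (edges : List (G.Infoset × G.Infoset)), EFG.ListsConnected edges →
        ∃ (out : List ℕ) (t : ℕ), P.Outputs (ν.infoInput edges) out t ∧
          ν.WritesDecomposition out ∧ t ≤ C * G.dim) ∧
    -- the dimensionality is at most quadratic in the size of the game
    (∀ G : EFG.{u}, G.PerfectRecall → G.TriangleFree → G.dim ≤ G.size ^ 2) ∧
    -- computation from the game tree, in time quadratic in the size of the game
    (∃ (P : Ram.Prog) (C : ℕ), ∀ G : EFG.{u}, G.PerfectRecall → G.TriangleFree →
      ∀ (ν : G.Numbering) (nodes : List (List G.Act)), EFG.ListsNodes nodes →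
        ∃ (out : List ℕ) (t : ℕ), P.Outputs (ν.treeInput nodes) out t ∧
          ν.WritesDecomposition out ∧ t ≤ C * G.size ^ 2) := by
  exact ⟨fun G hG hT => EFG.exists_isDecomposition hG hT,
    ⟨_, 1022, fun G hG hT ν edges he => EFG.Numbering.outputs_readInfo_decompose hG hT he⟩,
    fun G _ _ => EFG.dim_le G,
    ⟨_, 1101, fun G hG hT ν nodes hn => EFG.Numbering.outputs_readTree_decompose hG hT hn⟩⟩
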